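/- Let $r\in\mathbb N$, let $M_r$ be the algebra of complex $r\times r$ matrices with the operator norm, $I$ its unit, and let $\mathfrak a=((\lambda_j,\alpha_j))_{j\in\mathbb Z}$, where $(\lambda_j)_{j\in\mathbb Z}$ is a strictly increasing sequence of real numbers with $\lambda_0\le 0<\lambda_1$ and the $\alpha_j\in M_r$ are non-zero positive semidefinite matrices. Put $\Delta_n:=(\pi n-\frac{\pi}{2},\pi n+\frac{\pi}{2}]$, $n\in\mathbb Z$, and suppose that $(A_1)$ $\sup_{n\in\mathbb Z}\sum_{\lambda_j\in\Delta_n}1<\infty$, $\ \sum_{n\in\mathbb Z}\sum_{\lambda_j\in\Delta_n}|\lambda_j-\pi n|^2<\infty$, $\ \sum_{n\in\mathbb Z}\|I-\sum_{\lambda_j\in\Delta_n}\alpha_j\|^2<\infty$; $(A_2)$ there is $N_0\in\mathbb N$ such that $\sum_{n=-N}^{N}\sum_{\lambda_j\in\Delta_n}\operatorname{rank}\alpha_j=(2N+1)r$ for all $N\ge N_0$; $(A_3)$ the system of functions $\{d\,e^{i\lambda_jt} : j\in\mathbb Z,\ d\in\operatorname{Ran}\alpha_j\}$ is complete in $L_2((-1,1),\mathbb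 C^r)$. Let $\mu:=\sum_{j}\alpha_j\delta_{\lambda_j}$ and $\mu_0:=\sum_{n}I\,\delta_{\pi n}$. Then: (a) the limit $$H(x)=H_\mu(x):=\lim_{n\to\infty}\int_{-\pi(n-1/2)}^{\pi(n+1/2)}e^{2i\lambda x}\,d(\mu-\mu_0)(\lambda)$$ exists in $L_2((-1,1),M_r)$; $H(x)^*=H(-x)$ for almost all $x\in(-1,1)$; and $H$ is an accelerant, i.e. for every $b\in[0,1]$ the equation $f(x)+\int_0^bH(x-t)f(t)\,dt=0$ has only the trivial solution in $L_2((0,1),\mathbb C^r)$; (b) the potential $q=\Theta(H):=iR_H(\cdot,0)\in L_2((0,1),M_r)$ is well defined, where $R_H$ is the solution of the Krein equation $$R(x,t)+H(x-t)+\int_0^xR(x,s)H(s-t)\,ds=0,\qquad 0\le t\le x\le 1,$$ which, extended by zero to $0\le x<t\le1$, is a measurable kernel on $[0,1]^2$ such that $x\mapsto R(x,\cdot)$ and $t\mapsto R(\cdot,t)$ are continuous maps from $[0,1]$ to $L_2((0,1),M_r)$; (c) $\mathfrak a=\mathfrak a_q$, i.e. $\mathfrak a$ is the spectral data of the Dirac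 operator $T_q$. Here, with $\vartheta:=\frac1i\begin{pmatrix}I&0\\0&-I\end{pmatrix}$ and $\mathbf q:=\begin{pmatrix}0&q\\q^*&0\end{pmatrix}$, $T_q$ acts by $T_qy=\vartheta y'+\mathbf q y$ on the functions $y=(y_1,y_2)^\top$, $y_1,y_2\in W_2^1((0,1),\mathbb C^r)$, with $y_1(0)=y_2(0)$ and $y_1(1)=y_2(1)$. The equality $\mathfrak a=\mathfrak a_q$ means that the $\lambda_j$, $j\in\mathbb Z$, are precisely the pairwise distinct eigenvalues of $T_q$ (labelled in increasing order with $\lambda_0\le0<\lambda_1$) and that $\alpha_j=-\operatorname{res}_{\lambda=\lambda_j}m_q(\lambda)$ for all $j\in\mathbb Z$, where $m_q(\lambda):=-s(\lambda)^{-1}c(\lambda)$ is the Weyl–Titchmarsh function of $T_q$: $s(\lambda):=a\,u_q(1,\lambda)\,\vartheta a^*$, $c(\lambda):=a\,u_q(1,\lambda)\,a^*$, $a:=\frac1{\sqrt2}(I,\,-I)$, and $u_q(\cdot,\lambda)\in W_2^1((0,1),M_{2r})$ is the solution of $\vartheta u'+\mathbf q u=\lambda u$, $u(0,\lambda)=I_{2r}$.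 -/

import Mathlib

open MeasureTheory Filter Topology Set
open scoped Matrix Matrix.Norms.L2Operator ComplexOrder

noncomputable section

namespace Dirac

/-- The Banach algebra `M_r` of complex `r × r` matrices (with the operator norm). -/
abbrev Mat (r : ℕ) : Type := Matrix (Fin r) (Fin r) ℂ

/-- The complex `2r × 2r` matrices, written in `r × r` blocks. -/
abbrev Mat2 (r : ℕ) : Type := Matrix (Fin r ⊕ Fin r) (Fin r ⊕ Fin r) ℂ

/-- Lebesgue measure on `(0, 1)`. -/
def vol01 : Measure ℝ := volume.restrict (Ioo 0 1)

/-- Lebesgue measure on `(-1, 1)`. -/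
def vol11 : Measure ℝ := volume.restrict (Ioo (-1) 1)

/-! ### Collections of prospective spectral data -/

/-- A sequence `((λ_j, α_j))_{j ∈ ℤ}` in which `(λ_j)` is a strictly increasing sequence of real
numbers with `λ_0 ≤ 0 < λ_1` and the `α_j` are non-zero positive semidefinite matrices. -/
structure Collection (r : ℕ) where
  lam : ℤ → ℝ
  alpha : ℤ → Mat r
  strictMono_lam : StrictMono lam
  lam_zero_nonpos : lam 0 ≤ 0
  lam_one_pos : 0 < lam 1
  alpha_posSemidef : ∀ j, (alpha j).PosSemidef
  alpha_ne_zero : ∀ j, alpha j ≠ 0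

/-- The interval `Δ_n = (π n - π / 2, π n + π / 2]`. -/
def Delta (n : ℤ) : Set ℝ :=
  Ioc (Real.pi * n - Real.pi / 2) (Real.pi * n + Real.pi / 2)

/-- The integral over `S` of a scalar function `f` with respect to the matrix-valued measure
`∑_j mass j • δ_{pt j}`. It is used only for bounded `S` that contain finitely many
of the points. -/
def atomicIntegral {r : ℕ} (pt : ℤ → ℝ) (mass : ℤ → Mat r) (S : Set ℝ) (f : ℝ → ℂ) : Mat r :=
  ∑ᶠ (j : ℤ) (_ : pt j ∈ S), f (pt j) • mass j

namespace Collection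

variable {r : ℕ} (a : Collection r)

/-- The indices `j` with `λ_j ∈ Δ_n`. -/
def idx (n : ℤ) : Set ℤ := {j | a.lam j ∈ Delta n}

/-- Condition `(A₁)`. The first clause makes all the index sets `a.idx n` finite. -/
def A1 : Prop :=
  (∃ C : ℕ, ∀ n : ℤ, (a.idx n).encard ≤ C) ∧
  (Summable fun n : ℤ => ∑ᶠ j ∈ a.idx n, |a.lam j - Real.pi * n| ^ 2) ∧
  (Summable fun n : ℤ => ‖(1 : Mat r) - ∑ᶠ j ∈ a.idx n, a.alpha j‖ ^ 2)

/-- Condition `(A₂)`; it is used only together with `(A₁)`, so the inner sums are finite. -/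
def A2 : Prop :=
  ∃ N₀ : ℕ, ∀ N : ℕ, N₀ ≤ N →
    ∑ n ∈ Finset.Icc (-(N : ℤ)) (N : ℤ), ∑ᶠ j ∈ a.idx n, (a.alpha j).rank = (2 * N + 1) * r

/-- Condition `(A₃)`: the functions `t ↦ e^{i λ_j t} d` with `j ∈ ℤ` and `d` in the range of `α_j`
form a complete system in `L₂((-1, 1), ℂ^r)`, i.e. their linear span is dense. -/
def A3 : Prop :=
  Dense (Submodule.span ℂ
    {f : Lp (EuclideanSpace ℂ (Fin r)) 2 vol11 | ∃ (j : ℤ) (c : Fin r → ℂ),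
      f =ᵐ[vol11] fun t : ℝ =>
        Complex.exp (Complex.I * a.lam j * t) • WithLp.toLp 2 (a.alpha j *ᵥ c)} :
    Set (Lp (EuclideanSpace ℂ (Fin r)) 2 vol11))

/-- The integral of `e^{2 i λ x}` against `μ - μ_0` from `-π (n - 1/2)` to `π (n + 1/2)`, where
`μ = ∑_j α_j δ_{λ_j}` and `μ_0 = ∑_m I δ_{π m}`. -/
def truncH (n : ℕ) (x : ℝ) : Mat r :=
  atomicIntegral a.lam a.alpha
      (Ioc (-(Real.pi * ((n : ℝ) - 1 / 2))) (Real.pi * ((n : ℝ) + 1 / 2)))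
      (fun l => Complex.exp (2 * Complex.I * l * x)) -
    atomicIntegral (fun m : ℤ => Real.pi * m) (fun _ => (1 : Mat r))
      (Ioc (-(Real.pi * ((n : ℝ) - 1 / 2))) (Real.pi * ((n : ℝ) + 1 / 2)))
      (fun l => Complex.exp (2 * Complex.I * l * x))

/-- `H` is (a representative of) the function `H_μ`, the limit in `L₂((-1, 1), M_r)` of the
truncated integrals. -/
def IsHmu (H : ℝ → Mat r) : Prop :=
  MemLp H 2 vol11 ∧
    Tendsto (fun n : ℕ => eLpNorm (fun x => a.truncH n x - H x) 2 vol11) atTop (𝓝 0)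

end Collection

/-! ### Accelerants and the Krein equation -/

/-- `H ∈ L₂((-1, 1), M_r)` is an accelerant: for each `b ∈ [0, 1]` the equation
`f(x) + ∫_0^b H(x - t) f(t) dt = 0` has only the trivial solution in `L₂((0, 1), ℂ^r)`. -/
def IsAccelerant {r : ℕ} (H : ℝ → Mat r) : Prop :=
  MemLp H 2 vol11 ∧
    ∀ b ∈ Icc (0 : ℝ) 1, ∀ f : ℝ → (Fin r → ℂ), MemLp f 2 vol01 →
      (∀ᵐ x ∂vol01, f x + ∫ t in (0 : ℝ)..b, H (x - t) *ᵥ f t = 0) → f =ᵐ[vol01] 0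

/-- The accelerants with `H(x)^* = H(-x)` for almost all `x ∈ (-1, 1)`. -/
def IsSymmAccelerant {r : ℕ} (H : ℝ → Mat r) : Prop :=
  IsAccelerant H ∧ ∀ᵐ x ∂vol11, (H x)ᴴ = H (-x)

/-- The class `G₂(M_r)`: measurable kernels on `[0, 1]²` whose sections are in `L₂(0, 1)` and
depend continuously, in `L₂(0, 1)`, on the remaining variable. -/
def IsG2 {r : ℕ} (K : ℝ → ℝ → Mat r) : Prop :=
  AEStronglyMeasurable (fun p : ℝ × ℝ => K p.1 p.2)
      (volume.restrict (Icc (0 : ℝ) 1 ×ˢ Icc (0 : ℝ) 1)) ∧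
  (∀ x ∈ Icc (0 : ℝ) 1, MemLp (fun t => K x t) 2 vol01) ∧
  (∀ t ∈ Icc (0 : ℝ) 1, MemLp (fun x => K x t) 2 vol01) ∧
  (∀ x₀ ∈ Icc (0 : ℝ) 1,
    Tendsto (fun x => eLpNorm (fun t => K x t - K x₀ t) 2 vol01) (𝓝[Icc 0 1] x₀) (𝓝 0)) ∧
  (∀ t₀ ∈ Icc (0 : ℝ) 1,
    Tendsto (fun t => eLpNorm (fun x => K x t - K x t₀) 2 vol01) (𝓝[Icc 0 1] t₀) (𝓝 0))

/-- The triangle `Ω⁺ = {0 ≤ t ≤ x ≤ 1}`. -/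
def OmegaPlus : Set (ℝ × ℝ) := {p | 0 ≤ p.2 ∧ p.2 ≤ p.1 ∧ p.1 ≤ 1}

/-- The triangle `Ω⁻ = {0 ≤ x < t ≤ 1}`. -/
def OmegaMinus : Set (ℝ × ℝ) := {p | 0 ≤ p.1 ∧ p.1 < p.2 ∧ p.2 ≤ 1}

/-- `R` is the solution `R_H` of the Krein equation
`R(x,t) + H(x-t) + ∫_0^x R(x,s) H(s-t) ds = 0` on `Ω⁺`, extended by zero to `Ω⁻`; the extension
belongs to `G₂(M_r)`, which is what gives a meaning to the trace `R(·, 0)`. -/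
def IsKreinSolution {r : ℕ} (H : ℝ → Mat r) (R : ℝ → ℝ → Mat r) : Prop :=
  IsG2 R ∧
  (∀ᵐ p ∂(volume.restrict OmegaMinus), R p.1 p.2 = 0) ∧
  (∀ᵐ p ∂(volume.restrict OmegaPlus),
    R p.1 p.2 + H (p.1 - p.2) + ∫ s in (0 : ℝ)..p.1, R p.1 s * H (s - p.2) = 0)

/-- `q = Θ(H) := i R_H(·, 0)`, as an equality of classes of functions on `(0, 1)`. -/
def IsTheta {r : ℕ} (H q : ℝ → Mat r) : Prop :=
  ∃ R : ℝ → ℝ → Mat r, IsKreinSolution H R ∧ q =ᵐ[vol01] fun x => Complex.I • R x 0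

/-! ### The Dirac operator and its spectral data -/

/-- `q ∈ L₂((0, 1), M_r)`. -/
def IsPotential {r : ℕ} (q : ℝ → Mat r) : Prop := MemLp q 2 vol01

/-- `y` is (the continuous representative of) an element of the Sobolev space `W₂¹((0, 1), E)`
and `y'` is its derivative: `y' ∈ L₂` and `y` is a primitive of `y'` on `[0, 1]`. -/
def IsW12 {E : Type*} [NormedAddCommGroup E] [NormedSpace ℝ E] (y y' : ℝ → E) : Prop :=
  MemLp y' 2 vol01 ∧ ∀ x ∈ Icc (0 : ℝ) 1, y x = y 0 + ∫ t in (0 : ℝ)..x, y' t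

/-- `ϑ = (1 / i) diag(I, -I)`. -/
def theta (r : ℕ) : Mat2 r := (1 / Complex.I) • Matrix.fromBlocks 1 0 0 (-1)

/-- The matrix-valued function with zero diagonal blocks and off-diagonal blocks `q`, `q^*`. -/
def bq {r : ℕ} (q : ℝ → Mat r) (x : ℝ) : Mat2 r := Matrix.fromBlocks 0 (q x) (q x)ᴴ 0

/-- `y ∈ D(T_q)` and `T_q y = f`: `y = (y₁, y₂)` is in `W₂¹`, `y₁(0) = y₂(0)`, `y₁(1) = y₂(1)`, and
`f = ϑ y' + 𝐪 y`. -/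
def DiracGraph {r : ℕ} (q : ℝ → Mat r) (y f : ℝ → (Fin r ⊕ Fin r → ℂ)) : Prop :=
  ∃ y' : ℝ → (Fin r ⊕ Fin r → ℂ), IsW12 y y' ∧
    (∀ i : Fin r, y 0 (Sum.inl i) = y 0 (Sum.inr i)) ∧
    (∀ i : Fin r, y 1 (Sum.inl i) = y 1 (Sum.inr i)) ∧
    ∀ᵐ x ∂vol01, f x = theta r *ᵥ y' x + bq q x *ᵥ y x

/-- `z` is an eigenvalue of `T_q`. -/
def IsDiracEigenvalue {r : ℕ} (q : ℝ → Mat r) (z : ℂ) : Prop :=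
  ∃ y : ℝ → (Fin r ⊕ Fin r → ℂ), ¬ (y =ᵐ[vol01] 0) ∧ DiracGraph q y (fun x => z • y x)

/-- `u = u_q(·, z) ∈ W₂¹((0, 1), M_{2r})` solves `ϑ u' + 𝐪 u = z u`, `u(0) = I_{2r}`. -/
def IsFundamentalSolution {r : ℕ} (q : ℝ → Mat r) (z : ℂ) (u : ℝ → Mat2 r) : Prop :=
  ∃ u' : ℝ → Mat2 r, IsW12 u u' ∧ u 0 = 1 ∧
    ∀ᵐ x ∂vol01, theta r * u' x + bq q x * u x = z • u x

/-- The `r × 2r` matrix `a = (1 / √2) (I, -I)` of the boundary conditions. -/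
def bdry (r : ℕ) : Matrix (Fin r) (Fin r ⊕ Fin r) ℂ :=
  ((1 / Real.sqrt 2 : ℝ) : ℂ) • Matrix.fromCols 1 (-1)

/-- `m` is the Weyl-Titchmarsh function `m_q(z) = -s(z)⁻¹ c(z)` of `T_q`, where
`s(z) = a u_q(1, z) ϑ a^*` and `c(z) = a u_q(1, z) a^*`. The values at the points where `s(z)` is
singular play no role. -/
def IsWeylTitchmarsh {r : ℕ} (q : ℝ → Mat r) (m : ℂ → Mat r) : Prop :=
  ∃ u : ℂ → ℝ → Mat2 r, (∀ z, IsFundamentalSolution q z (u z)) ∧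
    ∀ z, m z = -((bdry r * (u z 1 * (theta r * (bdry r)ᴴ)))⁻¹ * (bdry r * (u z 1 * (bdry r)ᴴ)))

/-- `z₀` is an isolated singularity of `m` (or a point of holomorphy) and `A` is the residue of `m`
at `z₀`. -/
def HasResidueAt {r : ℕ} (m : ℂ → Mat r) (z₀ : ℂ) (A : Mat r) : Prop :=
  ∃ ρ : ℝ, 0 < ρ ∧ DifferentiableOn ℂ m (Metric.ball z₀ ρ \ {z₀}) ∧
    ∀ ε ∈ Ioo 0 ρ, (∮ z in C(z₀, ε), m z) = (2 * Real.pi * Complex.I) • A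

/-- `𝔞 = 𝔞_q`: the `λ_j` are precisely the pairwise distinct eigenvalues of `T_q`, in increasing
order with `λ_0 ≤ 0 < λ_1`, and `α_j = -res_{λ_j} m_q` for all `j`. -/
def IsSpectralData {r : ℕ} (q : ℝ → Mat r) (a : Collection r) : Prop :=
  {z : ℂ | IsDiracEigenvalue q z} = range (fun j : ℤ => (a.lam j : ℂ)) ∧
  ∃ m : ℂ → Mat r, IsWeylTitchmarsh q m ∧ ∀ j : ℤ, HasResidueAt m (a.lam j) (-(a.alpha j))

end Dirac

end

noncomputable section

set_option linter.unusedSectionVars false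

namespace Dirac

open scoped InnerProductSpace ENNReal

section

/-! Write V for ℂ^r and e_λ v for the function e^{iλt} v in L₂((-1,1), V) (`expCol`). Everything is
extracted from one positive operator I + 𝓚, where 𝓚 has the hermitian difference kernel k(s - t)
with k(s) = ½ H(s/2). Formally k is half of Σ_j e^{iλ_j s} α_j - Σ_n e^{iπns} I; condition (A₁)
makes this series converge in L₂ (`summable_block`). The functions e^{iπnt}/√2 form an orthonormal
basis, so the subtracted sum represents the identity, and 2(I + 𝓚) = Σ_j e_{λ_j} α_j e_{λ_j}^* in
the weak sense (`tendsto_form`). Hence I + 𝓚 ≥ 0; it is injective by (A₃), 𝓚 is compact, and so I +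
𝓚 is coercive (`Represents.coercive`). Coercivity passes to the compressions to (-x, x). After the
substitution s = 2t - x these compressions are the operators of the accelerant condition and of the
Krein equation, which gives (a) and (b).

The inverses of the compressions supply the rows σ_y of a transformation operator X = I + 𝓝. It is
triangular with respect to the cutoffs and satisfies X(I + 𝓚)X^* = I (`trafo_big_adjoint`). The rows
obey an integrated evolution equation (`sigma_eq_evol`) whose coefficient is p = R_H(·, 0). No
smoothness of H is available to differentiate anything. Instead the error in the equation is written
as an integral of a function `defect`, which is itself such an error, so Gronwall's inequality makes
it vanish. Applied to exponentials, the equation says that φ(x, λ) and φ(-x, λ), where φ(·, λ) is X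
e_λ, solve the Dirac system with q = ip, with the common value I at x = 0.

It remains to identify the spectral data. The functions ψ_j = X e_{λ_j} satisfy Σ_j ψ_j α_j ψ_j^* =
2I. Here (A₂) enters as a dimension count: `exists_submodule` produces at least rank α_j independent
functions annihilated by all the other terms, and this forces the ranges of the ψ_j α_j to be
mutually orthogonal (`al_adjoint_eigCol`). Green's formula turns orthogonality into equality of the
Gram matrices of the φ(1, λ_j) α_j and of the φ(-1, λ_j) α_j. The asymptotics over the blocks Δ_n
upgrade this to φ(1, λ_j) α_j = φ(-1, λ_j) α_j, the boundary condition at the right end (`phi_one`).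
The Parseval relation then excludes further eigenvalues. Combined with Green's formula for two Weyl
solutions it gives a Mittag-Leffler expansion of m_q (`weyl_eq`), from which the residues -α_j are
read off. -/

instance : IsFiniteMeasure vol11 := ⟨by simp [vol11]⟩

instance : IsFiniteMeasure vol01 := ⟨by simp [vol01]⟩

/-! ### Continuity of translations in L₂. -/

section Translation

variable {W : Type*} [NormedAddCommGroup W]

theorem memLp_comp_sub_right {F : ℝ → W} (hF : MemLp F 2 volume) (t : ℝ) :
    MemLp (fun s => F (s - t)) 2 volume :=
  hF.comp_measurePreserving (measurePreserving_sub_right volume t)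

/-- Since H is only square integrable, this is the sole source of continuity in the construction: it
makes the columns of a difference kernel depend continuously on their index. -/
theorem tendsto_eLpNorm_translate {F : ℝ → W} (hF : MemLp F 2 volume) (t₀ : ℝ) :
    Tendsto (fun t => eLpNorm (fun s => F (s - t) - F (s - t₀)) 2 volume) (𝓝 t₀) (𝓝 0) := by
  have hg : Continuous fun t : ℝ => (⟨fun s => s - t, by fun_prop⟩ : C(ℝ, ℝ)) :=
    ContinuousMap.continuous_of_continuous_uncurry _ (by simp [Function.uncurry_def]; fun_prop)
  have hm : ∀ t : ℝ, MeasurePreserving (⟨fun s => s - t, by fun_prop⟩ : C(ℝ, ℝ)) volume volume :=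
    fun t => measurePreserving_sub_right volume t
  have key := Continuous.compMeasurePreservingLp (p := 2) (continuous_const (y := hF.toLp F)) hg hm
    (by simp)
  have h1 := key.tendsto t₀
  have h2 : ∀ t, Lp.compMeasurePreserving _ (hm t) (hF.toLp F) =
      (memLp_comp_sub_right hF t).toLp _ := by
    intro t
    exact Lp.toLp_compMeasurePreserving hF (hm t)
  simp only [h2] at h1
  rw [Lp.tendsto_Lp_iff_tendsto_eLpNorm''] at h1
  exact h1

end Translation

theorem ae_vol11_mem : ∀ᵐ y ∂vol11, y ∈ Ioo (-1 : ℝ) 1 := ae_restrict_mem measurableSet_Ioo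

variable {V : Type*} [NormedAddCommGroup V] [InnerProductSpace ℂ V] [FiniteDimensional ℂ V]
  [CompleteSpace V]

/-- The Hilbert space `L₂((-1, 1), V)`. -/
abbrev L2V (V : Type*) [NormedAddCommGroup V] : Type _ := Lp V 2 vol11

/-! ### Operators built from columns and from continuous families of rows. -/

section ColOp

variable {μ : Measure ℝ}

theorem norm_apply_le (v : V) :
    ‖(ContinuousLinearMap.apply ℂ V v : (V →L[ℂ] V) →L[ℂ] V)‖ ≤ ‖v‖ := by
  refine ContinuousLinearMap.opNorm_le_bound _ (norm_nonneg _) fun f => ?_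
  rw [mul_comm]
  exact f.le_opNorm v

theorem norm_apply_compLp_le (F : Lp (V →L[ℂ] V) 2 μ) (v : V) :
    ‖(ContinuousLinearMap.apply ℂ V v : (V →L[ℂ] V) →L[ℂ] V).compLp F‖ ≤ ‖F‖ * ‖v‖ := by
  rw [mul_comm]
  refine (ContinuousLinearMap.norm_compLp_le _ _).trans ?_
  gcongr
  exact norm_apply_le v

/-- The operator `v ↦ F(·) v` of an operator valued square integrable function `F`. -/
def colOp : Lp (V →L[ℂ] V) 2 μ →L[ℂ] V →L[ℂ] Lp V 2 μ :=
  LinearMap.mkContinuous₂ (LinearMap.mk₂ ℂ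
    (fun F v => (ContinuousLinearMap.apply ℂ V v : (V →L[ℂ] V) →L[ℂ] V).compLpL 2 μ F)
    (fun F G v => map_add _ F G)
    (fun c F v => map_smul _ c F)
    (fun F v w => by
      rw [map_add, ContinuousLinearMap.add_compLpL]; rfl)
    (fun c F v => by rw [map_smul, ContinuousLinearMap.smul_compLpL]; rfl)) 1
    (fun F v => by
      rw [one_mul]
      exact norm_apply_compLp_le F v)

theorem coeFn_colOp (F : Lp (V →L[ℂ] V) 2 μ) (v : V) : colOp F v =ᵐ[μ] fun s => F s v :=
  ContinuousLinearMap.coeFn_compLpL _ F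

theorem norm_colOp_le (F : Lp (V →L[ℂ] V) 2 μ) : ‖colOp F‖ ≤ ‖F‖ :=
  ContinuousLinearMap.opNorm_le_bound _ (norm_nonneg _) fun v => norm_apply_compLp_le F v

theorem integrable_adjoint_apply {F : ℝ → V →L[ℂ] V} (hF : MemLp F 2 μ) {g : ℝ → V}
    (hg : MemLp g 2 μ) : Integrable (fun s => ContinuousLinearMap.adjoint (F s) (g s)) μ := by
  have h1 : MemLp (fun s => ContinuousLinearMap.adjoint (F s)) 2 μ := by
    refine hF.of_le ?_ (ae_of_all _ fun s => by simp)
    exact (ContinuousLinearMap.adjoint (𝕜 := ℂ) (E := V) (F :=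
        V)).continuous.comp_aestronglyMeasurable
      hF.1
  have := (MemLp.integrable_mul (p := 2) (q := 2) h1.norm hg.norm)
  refine this.mono ?_ (ae_of_all _ fun s => ?_)
  · exact (ContinuousLinearMap.apply ℂ V).flip.aestronglyMeasurable_comp₂ h1.1 hg.1
  · simpa using (ContinuousLinearMap.adjoint (F s)).le_opNorm (g s)

theorem adjoint_colOp_apply (F : Lp (V →L[ℂ] V) 2 μ) (g : Lp V 2 μ) :
    ContinuousLinearMap.adjoint (colOp F) g = ∫ s, ContinuousLinearMap.adjoint (F s) (g s) ∂μ := by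
  refine ext_inner_left ℂ fun v => ?_
  rw [ContinuousLinearMap.adjoint_inner_right, L2.inner_def,
    ← integral_inner (integrable_adjoint_apply (Lp.memLp F) (Lp.memLp g))]
  refine integral_congr_ae ?_
  filter_upwards [coeFn_colOp F v] with s hs
  rw [hs, ContinuousLinearMap.adjoint_inner_right]

end ColOp

section FamOp

theorem exists_bound_of_continuous {W : Type*} [NormedAddCommGroup W] {σ : ℝ → W}
    (hσ : Continuous σ) : ∃ C, 0 ≤ C ∧ ∀ y ∈ Icc (-1 : ℝ) 1, ‖σ y‖ ≤ C := by
  obtain ⟨C, hC⟩ := isCompact_Icc.exists_bound_of_continuousOn (hσ.continuousOn (s := Icc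
      (-1 : ℝ) 1))
  exact ⟨C, (norm_nonneg _).trans (hC 0 (by simp)), hC⟩

theorem memLp_of_continuous {W : Type*} [NormedAddCommGroup W] {σ : ℝ → W}
    (hσ : Continuous σ) : MemLp σ 2 vol11 := by
  obtain ⟨C, -, hC⟩ := exists_bound_of_continuous hσ
  refine MemLp.of_bound (hσ.aestronglyMeasurable) C ?_
  filter_upwards [ae_vol11_mem] with y hy
  exact hC y (Ioo_subset_Icc_self hy)

theorem memLp_fam {σ : ℝ → L2V V →L[ℂ] V} (hσ : Continuous σ) (g : L2V V) :
    MemLp (fun y => σ y g) 2 vol11 :=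
  memLp_of_continuous (hσ.clm_apply continuous_const)

/-- The operator `g ↦ (y ↦ σ_y g)` of a continuous family of operators. -/
def famOp (σ : ℝ → L2V V →L[ℂ] V) (hσ : Continuous σ) : L2V V →L[ℂ] L2V V :=
  LinearMap.mkContinuousOfExistsBound
    { toFun := fun g => (memLp_fam hσ g).toLp _
      map_add' := fun f g => by
        refine Lp.ext ?_
        filter_upwards [(memLp_fam hσ f).coeFn_toLp, (memLp_fam hσ g).coeFn_toLp,
          (memLp_fam hσ (f + g)).coeFn_toLp, Lp.coeFn_add ((memLp_fam hσ f).toLp _)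
          ((memLp_fam hσ g).toLp _)] with y h1 h2 h3 h4
        rw [h3, h4, Pi.add_apply, h1, h2, map_add]
      map_smul' := fun c g => by
        refine Lp.ext ?_
        filter_upwards [(memLp_fam hσ g).coeFn_toLp,
          (memLp_fam hσ (c • g)).coeFn_toLp, Lp.coeFn_smul c ((memLp_fam hσ g).toLp _)]
          with y h1 h2 h3
        rw [RingHom.id_apply, h2, h3, Pi.smul_apply, h1, map_smul] }
    (by
      obtain ⟨C, hC0, hC⟩ := exists_bound_of_continuous (W := L2V V →L[ℂ] V) hσ
      refine ⟨(measureUnivNNReal vol11 : ℝ) ^ (2 : ℝ≥0∞).toReal⁻¹ * C, fun g => ?_⟩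
      rw [mul_assoc]
      refine Lp.norm_le_of_ae_bound (by positivity) ?_
      filter_upwards [ae_vol11_mem, (memLp_fam hσ g).coeFn_toLp] with y hy h
      simp only [LinearMap.coe_mk, AddHom.coe_mk]
      rw [h]
      exact (σ y).le_of_opNorm_le (hC y (Ioo_subset_Icc_self hy)) g)

theorem coeFn_famOp (σ : ℝ → L2V V →L[ℂ] V) (hσ : Continuous σ) (g : L2V V) :
    famOp σ hσ g =ᵐ[vol11] fun y => σ y g :=
  (memLp_fam hσ g).coeFn_toLp

end FamOp

/-! ### Cutoffs to symmetric intervals. -/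

section Cut

theorem memLp_indicator_Ioo (x : ℝ) (g : L2V V) : MemLp ((Ioo (-x) x).indicator g) 2 vol11 :=
  (Lp.memLp g).indicator measurableSet_Ioo

variable (V) in
/-- The cutoff to the interval `(-x, x)`. -/
def cut (x : ℝ) : L2V V →L[ℂ] L2V V :=
  LinearMap.mkContinuous
    { toFun := fun g => (memLp_indicator_Ioo x g).toLp _
      map_add' := fun f g => by
        refine Lp.ext ?_
        filter_upwards [(memLp_indicator_Ioo x f).coeFn_toLp, (memLp_indicator_Ioo x g).coeFn_toLp,
          (memLp_indicator_Ioo x (f + g)).coeFn_toLp, Lp.coeFn_add f g,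
          Lp.coeFn_add ((memLp_indicator_Ioo x f).toLp _)
          ((memLp_indicator_Ioo x g).toLp _)] with y h1 h2 h3 h4 h5
        rw [h3, h5, Pi.add_apply, h1, h2]
        by_cases h : y ∈ Ioo (-x) x
        · rw [indicator_of_mem h, indicator_of_mem h, indicator_of_mem h, h4, Pi.add_apply]
        · rw [indicator_of_notMem h, indicator_of_notMem h, indicator_of_notMem h, add_zero]
      map_smul' := fun c g => by
        refine Lp.ext ?_
        filter_upwards [(memLp_indicator_Ioo x g).coeFn_toLp,
          (memLp_indicator_Ioo x (c • g)).coeFn_toLp, Lp.coeFn_smul c g,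
          Lp.coeFn_smul c ((memLp_indicator_Ioo x g).toLp _)] with y h1 h2 h3 h4
        rw [RingHom.id_apply, h2, h4, Pi.smul_apply, h1]
        by_cases h : y ∈ Ioo (-x) x
        · rw [indicator_of_mem h, indicator_of_mem h, h3, Pi.smul_apply]
        · rw [indicator_of_notMem h, indicator_of_notMem h, smul_zero] } 1
    (fun g => by
      rw [one_mul]
      refine Lp.norm_le_norm_of_ae_le ?_
      filter_upwards [(memLp_indicator_Ioo x g).coeFn_toLp] with y hy
      simp only [LinearMap.coe_mk, AddHom.coe_mk]
      rw [hy]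
      exact norm_indicator_le_norm_self _ _)

theorem coeFn_cut (x : ℝ) (g : L2V V) : cut V x g =ᵐ[vol11] (Ioo (-x) x).indicator g :=
  (memLp_indicator_Ioo x g).coeFn_toLp

theorem norm_cut_le (x : ℝ) : ‖cut V x‖ ≤ 1 := LinearMap.mkContinuous_norm_le _ zero_le_one _

theorem cut_apply_cut (x y : ℝ) (g : L2V V) : cut V x (cut V y g) = cut V (min x y) g := by
  refine Lp.ext ?_
  filter_upwards [coeFn_cut x (cut V y g), coeFn_cut y g, coeFn_cut (min x y) g] with s h1 h2 h3
  rw [h1, h3, indicator_apply, h2, indicator_apply, indicator_apply]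
  by_cases h : s ∈ Ioo (-x) x <;> by_cases h' : s ∈ Ioo (-y) y <;>
  simp only [h, h', if_true, if_false] <;> simp only [mem_Ioo] at h h' ⊢ <;> grind

theorem cut_mul_cut (x y : ℝ) : cut V x * cut V y = cut V (min x y) :=
  ContinuousLinearMap.ext (cut_apply_cut x y)

theorem cut_cut (x : ℝ) (g : L2V V) : cut V x (cut V x g) = cut V x g := by
  rw [cut_apply_cut, min_self]

theorem cut_of_nonpos {x : ℝ} (hx : x ≤ 0) : cut V x = 0 := by
  ext1 g
  refine Lp.ext ?_
  filter_upwards [coeFn_cut x g, Lp.coeFn_zero V 2 vol11] with s h1 h2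
  simp only [zero_apply, h1, h2]
  rw [Ioo_eq_empty (by linarith)]; simp

theorem cut_of_one_le {x : ℝ} (hx : 1 ≤ x) : cut V x = 1 := by
  ext1 g
  refine Lp.ext ?_
  filter_upwards [coeFn_cut x g, ae_vol11_mem] with s h1 h2
  rw [one_apply_eq_self, h1, indicator_of_mem]
  exact ⟨by linarith [h2.1], by linarith [h2.2]⟩

theorem inner_cut_left (x : ℝ) (f g : L2V V) : ⟪cut V x f, g⟫_ℂ = ⟪f, cut V x g⟫_ℂ := by
  rw [L2.inner_def, L2.inner_def]
  refine integral_congr_ae ?_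
  filter_upwards [coeFn_cut x f, coeFn_cut x g] with s h1 h2
  rw [h1, h2]
  by_cases h : s ∈ Ioo (-x) x <;> simp [h]

theorem adjoint_cut (x : ℝ) : ContinuousLinearMap.adjoint (cut V x) = cut V x := by
  symm
  rw [ContinuousLinearMap.eq_adjoint_iff]
  exact inner_cut_left x

theorem norm_sq_cut (x : ℝ) (g : L2V V) :
    ‖cut V x g‖ ^ 2 = ∫ s, (Ioo (-x) x).indicator (fun s => ‖g s‖ ^ 2) s ∂vol11 := by
  have h : ((‖cut V x g‖ ^ 2 : ℝ) : ℂ) = ⟪cut V x g, cut V x g⟫_ℂ := by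
    rw [inner_self_eq_norm_sq_to_K]; norm_cast
  rw [L2.inner_def] at h
  have h2 : ∫ s, ⟪cut V x g s, cut V x g s⟫_ℂ ∂vol11 =
      ∫ s, (((Ioo (-x) x).indicator (fun s => ‖g s‖ ^ 2) s : ℝ) : ℂ) ∂vol11 := by
    refine integral_congr_ae ?_
    filter_upwards [coeFn_cut x g] with s h1
    rw [h1, inner_self_eq_norm_sq_to_K]
    by_cases h : s ∈ Ioo (-x) x <;> simp [h]
  rw [h2, integral_complex_ofReal] at h
  exact_mod_cast h

theorem integrable_norm_sq (g : L2V V) : Integrable (fun s => ‖g s‖ ^ 2) vol11 :=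
  (memLp_two_iff_integrable_sq_norm (Lp.memLp g).1).1 (Lp.memLp g)

/-- Pythagoras for the nested orthogonal projections `cut V x` and `cut V y`. -/
theorem norm_sq_cut_sub {x y : ℝ} (hxy : x ≤ y) (g : L2V V) :
    ‖cut V y g - cut V x g‖ ^ 2 = ‖cut V y g‖ ^ 2 - ‖cut V x g‖ ^ 2 := by
  have h0 : ⟪cut V y g, cut V x g⟫_ℂ = ⟪cut V x g, cut V x g⟫_ℂ := by
    rw [inner_cut_left, cut_apply_cut, min_eq_right hxy, inner_cut_left, cut_cut]
  have h1 : RCLike.re ⟪cut V y g, cut V x g⟫_ℂ = ‖cut V x g‖ ^ 2 := by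
    rw [h0, inner_self_eq_norm_sq]
  rw [@norm_sub_sq ℂ, h1]
  ring

/-- The squared norm is continuous in x by dominated convergence, because the endpoints ±x are null,
and `norm_sq_cut_sub` converts this into continuity of the vectors. Continuity holds only strongly,
not in operator norm. -/
theorem continuous_cut_apply (g : L2V V) : Continuous fun x => cut V x g := by
  have hF : Continuous fun x => ‖cut V x g‖ ^ 2 := by
    simp only [norm_sq_cut]
    rw [continuous_iff_continuousAt]
    intro x₀
    refine continuousAt_of_dominated (bound := fun s => ‖g s‖ ^ 2) ?_ ?_ (integrable_norm_sq g) ?_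
    · exact Eventually.of_forall fun x =>
        (integrable_norm_sq g).aestronglyMeasurable.indicator measurableSet_Ioo
    · refine Eventually.of_forall fun x => ae_of_all _ fun s => ?_
      refine (norm_indicator_le_norm_self _ _).trans ?_
      simp
    · have hne : ∀ᵐ s ∂vol11, s ≠ x₀ ∧ s ≠ -x₀ := by
        have h1 := (Measure.ae_ne (volume : Measure ℝ) x₀)
        have h2 := (Measure.ae_ne (volume : Measure ℝ) (-x₀))
        exact ae_restrict_of_ae (h1.and h2)
      filter_upwards [hne] with s hs
      by_cases h : |s| < x₀
      · have : ∀ᶠ x in 𝓝 x₀, |s| < x := lt_mem_nhds h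
        refine (continuousAt_const (y := ‖g s‖ ^ 2)).congr ?_
        filter_upwards [this] with x hx
        rw [indicator_of_mem]
        exact abs_lt.1 hx
      · have h' : x₀ < |s| := by
          refine lt_of_le_of_ne (not_lt.1 h) fun h2 => ?_
          rcases abs_choice s with h3 | h3 <;> rw [h3] at h2
          · exact hs.1 h2.symm
          · exact hs.2 (by linarith)
        have : ∀ᶠ x in 𝓝 x₀, x < |s| := gt_mem_nhds h'
        refine (continuousAt_const (y := (0 : ℝ))).congr ?_
        filter_upwards [this] with x hx
        rw [indicator_of_notMem]
        exact fun hm => absurd (abs_lt.2 hm) (not_lt.2 hx.le)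
  rw [continuous_iff_continuousAt]
  intro x₀
  rw [ContinuousAt, tendsto_iff_norm_sub_tendsto_zero]
  have h1 : ∀ x, ‖cut V x g - cut V x₀ g‖ = Real.sqrt |‖cut V x g‖ ^ 2 - ‖cut V x₀ g‖ ^ 2| := by
    intro x
    rcases le_total x x₀ with h | h
    · rw [norm_sub_rev, abs_sub_comm, ← norm_sq_cut_sub h, abs_of_nonneg (by positivity),
        Real.sqrt_sq (norm_nonneg _)]
    · rw [← norm_sq_cut_sub h, abs_of_nonneg (by positivity), Real.sqrt_sq (norm_nonneg _)]
  simp only [h1]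
  have : Continuous fun x => Real.sqrt |‖cut V x g‖ ^ 2 - ‖cut V x₀ g‖ ^ 2| := by fun_prop
  simpa using this.tendsto x₀

/-- The shell between (-x, x) and (-y, y) has measure at most 2(y - x). This square root gain for
bounded functions is the smallness used in all the shell arguments below. -/
theorem norm_cut_sub_le_of_bound {x y : ℝ} (hxy : x ≤ y) (g : L2V V) {C : ℝ} (hC : 0 ≤ C)
    (hg : ∀ᵐ s ∂vol11, ‖g s‖ ≤ C) :
    ‖cut V y g - cut V x g‖ ≤ C * Real.sqrt (2 * (y - x)) := by
  refine le_of_sq_le_sq ?_ (by positivity)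
  rw [norm_sq_cut_sub hxy, norm_sq_cut, norm_sq_cut, mul_pow, Real.sq_sqrt (by linarith),
    ← integral_sub ((integrable_norm_sq g).indicator measurableSet_Ioo)
    ((integrable_norm_sq g).indicator measurableSet_Ioo)]
  set D : Set ℝ := Ioc (-y) (-x) ∪ Ico x y
  have hD : MeasurableSet D := measurableSet_Ioc.union measurableSet_Ico
  have hvol : volume.real D ≤ 2 * (y - x) := by
    refine (measureReal_union_le _ _).trans ?_
    simp only [Real.volume_real_Ioc, Real.volume_real_Ico]
    rw [max_eq_left (by linarith), max_eq_left (by linarith)]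
    linarith
  have hvfin : volume D ≠ ⊤ := by
    refine ((measure_union_le _ _).trans_lt ?_).ne
    simp [ENNReal.add_lt_top]
  calc _ ≤ ∫ s, D.indicator (fun _ => C ^ 2) s ∂vol11 := by
        refine integral_mono_ae (((integrable_norm_sq g).indicator measurableSet_Ioo).sub
          ((integrable_norm_sq g).indicator measurableSet_Ioo))
          ((integrable_const _).indicator hD) ?_
        filter_upwards [hg] with s hs
        have h1 : ‖g s‖ ^ 2 ≤ C ^ 2 := by gcongr
        by_cases h2 : s ∈ Ioo (-y) y <;> by_cases h3 : s ∈ Ioo (-x) x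
        · simp only [h2, h3, indicator_of_mem, sub_self]
          exact indicator_nonneg (fun _ _ => by positivity) _
        · have : s ∈ D := by
            simp only [D, mem_union, mem_Ioc, mem_Ico, mem_Ioo] at h2 h3 ⊢
            grind
          simpa only [h2, h3, this, indicator_of_mem, not_false_eq_true, indicator_of_notMem,
            sub_zero] using h1
        · exact absurd ⟨by linarith [h3.1], by linarith [h3.2]⟩ h2
        · simp only [h2, h3, not_false_eq_true, indicator_of_notMem, sub_self]
          exact indicator_nonneg (fun _ _ => by positivity) _
    _ = C ^ 2 * vol11.real D := by
        rw [integral_indicator_const _ hD, smul_eq_mul, mul_comm]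
    _ ≤ C ^ 2 * (2 * (y - x)) := by
        refine mul_le_mul_of_nonneg_left (le_trans ?_ hvol) (by positivity)
        exact ENNReal.toReal_mono hvfin (Measure.restrict_apply_le _ _)

end Cut

end

/-! ### Coercive operators and smallness on thin shells. -/

section

section Coercive

variable {H : Type*} [NormedAddCommGroup H] [InnerProductSpace ℂ H] [CompleteSpace H]

/-- Coercivity of a symmetric operator is the inequality T ≥ δ in a C⋆-algebra, and an element above
a strictly positive one is invertible. -/
theorem isUnit_of_coercive {T : H →L[ℂ] H} (hT : ∀ f g, ⟪T f, g⟫_ℂ = ⟪f, T g⟫_ℂ) {δ : ℝ}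
    (hδ : 0 < δ) (h : ∀ g, δ * ‖g‖ ^ 2 ≤ RCLike.re ⟪g, T g⟫_ℂ) : IsUnit T := by
  have h1 : IsStrictlyPositive (algebraMap ℝ (H →L[ℂ] H) δ) :=
    isStrictlyPositive_algebraMap hδ
  refine CStarAlgebra.isUnit_of_le (algebraMap ℝ (H →L[ℂ] H) δ) ?_ h1
  rw [ContinuousLinearMap.le_def, ContinuousLinearMap.isPositive_iff]
  have e : ∀ x, (T - algebraMap ℝ (H →L[ℂ] H) δ) x = T x - (δ : ℂ) • x := by
    intro x
    rw [Algebra.algebraMap_eq_smul_one]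
    simp
  refine ⟨?_, ?_⟩
  · intro x y
    simp only [ContinuousLinearMap.coe_coe, e, inner_sub_left, inner_sub_right, hT, inner_smul_left,
      inner_smul_right, Complex.conj_ofReal]
  · intro x
    have hs : ⟪T x, x⟫_ℂ = (RCLike.re ⟪x, T x⟫_ℂ : ℂ) := by
      rw [hT]
      refine (RCLike.conj_eq_iff_re.1 ?_).symm
      rw [inner_conj_symm, hT]
    rw [e, inner_sub_left, inner_smul_left, Complex.conj_ofReal, hs, inner_self_eq_norm_sq_to_K]
    have := h x
    have h2 : ((RCLike.re ⟪x, T x⟫_ℂ : ℂ) - δ * (‖x‖ : ℂ) ^ 2) =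
      ((RCLike.re ⟪x, T x⟫_ℂ - δ * ‖x‖ ^ 2 : ℝ) : ℂ) := by push_cast; rfl
    refine le_of_le_of_eq ?_ h2.symm
    exact_mod_cast sub_nonneg.2 this

theorem norm_le_of_coercive {T : H →L[ℂ] H} {δ : ℝ} (h : ∀ g, δ * ‖g‖ ^ 2 ≤ RCLike.re ⟪g, T g⟫_ℂ)
    (g : H) : δ * ‖g‖ ≤ ‖T g‖ := by
  rcases (norm_nonneg g).eq_or_lt with h0 | h0
  · rw [← h0, mul_zero]; exact norm_nonneg _
  · have h1 := (h g).trans ((RCLike.re_le_norm _).trans (norm_inner_le_norm g (T g)))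
    nlinarith

end Coercive

variable {V : Type*} [NormedAddCommGroup V] [InnerProductSpace ℂ V] [FiniteDimensional ℂ V]
  [CompleteSpace V]

section Cut

theorem continuous_cut_comp {x : ℝ → ℝ} {g : ℝ → L2V V} (hx : Continuous x) (hg : Continuous g) :
    Continuous fun y => cut V (x y) (g y) := by
  rw [continuous_iff_continuousAt]
  intro y₀
  rw [ContinuousAt, tendsto_iff_norm_sub_tendsto_zero]
  have h1 : Tendsto (fun y => ‖g y - g y₀‖ + ‖cut V (x y) (g y₀) - cut V (x y₀) (g y₀)‖) (𝓝 y₀)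
      (𝓝 0) := by
    have : Continuous fun y => ‖g y - g y₀‖ + ‖cut V (x y) (g y₀) - cut V (x y₀) (g y₀)‖ :=
      (hg.sub continuous_const).norm.add
        (((continuous_cut_apply (g y₀)).comp hx).sub continuous_const).norm
    simpa using this.tendsto y₀
  refine squeeze_zero (fun _ => norm_nonneg _) (fun y => ?_) h1
  have h2 : cut V (x y) (g y) - cut V (x y₀) (g y₀) =
      cut V (x y) (g y - g y₀) + (cut V (x y) (g y₀) - cut V (x y₀) (g y₀)) := by
    rw [map_sub]; abel
  rw [h2]
  refine (norm_add_le _ _).trans ?_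
  gcongr
  simpa using (cut V (x y)).le_of_opNorm_le (norm_cut_le _) (g y - g y₀)

/-- A continuous family of rows is bounded on [-1, 1], so the images are bounded functions with
bound C‖g‖, and `norm_cut_sub_le_of_bound` applies. -/
theorem exists_norm_cut_sub_famOp_le (σ : ℝ → L2V V →L[ℂ] V) (hσ : Continuous σ) :
    ∃ C, 0 ≤ C ∧ ∀ x y, x ≤ y → ‖(cut V y - cut V x) * famOp σ hσ‖ ≤ C * √(2 * (y - x)) := by
  obtain ⟨C, hC0, hC⟩ := exists_bound_of_continuous (W := L2V V →L[ℂ] V) hσ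
  refine ⟨C, hC0, fun x y hxy => ContinuousLinearMap.opNorm_le_bound _ (by positivity) fun g => ?_⟩
  have h := norm_cut_sub_le_of_bound hxy (famOp σ hσ g) (C := C * ‖g‖) (by positivity) (by
    filter_upwards [coeFn_famOp σ hσ g, ae_vol11_mem] with s h1 h2
    rw [h1]
    exact (σ s).le_of_opNorm_le (hC s (Ioo_subset_Icc_self h2)) g)
  calc _ ≤ C * ‖g‖ * √(2 * (y - x)) := h
    _ = _ := by ring

/-- An operator that commutes with all cutoffs and has small diagonal blocks vanishes. -/
theorem eq_zero_of_commute_cut {Y : L2V V →L[ℂ] L2V V}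
    (hY : ∀ a, Y * cut V a = cut V a * Y) {C : ℝ}
    (hC : ∀ a b, a ≤ b → ‖(cut V b - cut V a) * Y * (cut V b - cut V a)‖ ≤ C * √(2 * (b - a))) :
    Y = 0 := by
  ext1 f
  -- Slice (0, 1) into N + 1 shells of width h = 1/(N + 1). Commutation makes Y block diagonal, so
  -- squared norms add up over the shells and each contributes a factor C² · 2h. Letting N → ∞ kills
  -- Y f.
  have key : ∀ N : ℕ, ∀ n : ℕ, ‖cut V (n * (1 / (N + 1 : ℝ))) (Y f)‖ ^ 2 ≤
      C ^ 2 * (2 * (1 / (N + 1 : ℝ))) * ‖cut V (n * (1 / (N + 1 : ℝ))) f‖ ^ 2 := by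
    intro N n
    set h := 1 / (N + 1 : ℝ) with hh
    have hpos : 0 < h := by positivity
    induction n with
    | zero => simp [cut_of_nonpos]
    | succ n ih =>
      have hle : (n : ℝ) * h ≤ ((n + 1 : ℕ) : ℝ) * h := by push_cast; nlinarith
      have h1 := norm_sq_cut_sub hle (Y f)
      have h2 := norm_sq_cut_sub hle f
      set b := ((n + 1 : ℕ) : ℝ) * h
      set a := (n : ℝ) * h
      have hba : b - a = h := by simp only [a, b]; push_cast; ring
      have h3 : cut V b (Y f) - cut V a (Y f) =
          ((cut V b - cut V a) * Y * (cut V b - cut V a)) (cut V b f - cut V a f) := by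
        have e1 : (cut V b - cut V a) * Y = Y * (cut V b - cut V a) := by
          rw [sub_mul, mul_sub, hY, hY]
        have e2 : (cut V b - cut V a) * (cut V b - cut V a) = cut V b - cut V a := by
          rw [sub_mul, mul_sub, mul_sub, cut_mul_cut, cut_mul_cut, cut_mul_cut, cut_mul_cut,
            min_self, min_self, min_eq_right hle, min_eq_left hle]; abel
        have e4 : (cut V b - cut V a) * Y =
            (cut V b - cut V a) * Y * (cut V b - cut V a) * (cut V b - cut V a) := by
          rw [mul_assoc ((cut V b - cut V a) * Y), e2, mul_assoc, ← e1, ← mul_assoc, e2]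
        exact DFunLike.congr_fun e4 f
      have h4 : ‖cut V b (Y f) - cut V a (Y f)‖ ≤ C * √(2 * h) * ‖cut V b f - cut V a f‖ := by
        rw [h3, ← hba]
        exact ContinuousLinearMap.le_of_opNorm_le _ (hC a b hle) _
      have h5 : ‖cut V b (Y f) - cut V a (Y f)‖ ^ 2 ≤
          C ^ 2 * (2 * h) * ‖cut V b f - cut V a f‖ ^ 2 := by
        calc _ ≤ (C * √(2 * h) * ‖cut V b f - cut V a f‖) ^ 2 := by gcongr
          _ = _ := by rw [mul_pow, mul_pow, Real.sq_sqrt (by positivity)]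
      rw [h1, h2] at h5
      linarith
  have key2 : ∀ N : ℕ, ‖Y f‖ ^ 2 ≤ C ^ 2 * (2 * (1 / (N + 1 : ℝ))) * ‖f‖ ^ 2 := by
    intro N
    have := key N (N + 1)
    have e : ((N + 1 : ℕ) : ℝ) * (1 / (N + 1 : ℝ)) = 1 := by push_cast; field_simp
    rw [e, cut_of_one_le le_rfl] at this
    simpa using this
  have hlim : Tendsto (fun N : ℕ => C ^ 2 * (2 * (1 / (N + 1 : ℝ))) * ‖f‖ ^ 2) atTop (𝓝 0) := by
    have := ((tendsto_one_div_add_atTop_nhds_zero_nat (𝕜 := ℝ)).const_mul 2).const_mul (C ^ 2)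
    simpa using this.mul_const (‖f‖ ^ 2)
  have h0 : ‖Y f‖ ^ 2 ≤ 0 := ge_of_tendsto' hlim key2
  simpa using h0

end Cut

section PairIntegrable

variable {μ ν : Measure ℝ} [IsFiniteMeasure μ] [SFinite ν]

/-- Fubini is justified by the bound |⟨k f, g⟩| ≤ ‖k‖²‖f‖² + ‖g‖²; the first term is integrable
because ∫ ‖k(t - s)‖² dt does not depend on s. -/
theorem integrable_kernel_pair {S : Set ℝ} {k : ℝ → V →L[ℂ] V} (hk : StronglyMeasurable k)
    (hk2 : MemLp k 2 volume) {f g : ℝ → V} (hf : MemLp f 2 μ) (hg : MemLp g 2 (volume.restrict S)) :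
    Integrable (fun p : ℝ × ℝ => ⟪k (p.2 - p.1) (f p.1), g p.2⟫_ℂ) (μ.prod (volume.restrict S)) :=
        by
  have hkm : StronglyMeasurable fun p : ℝ × ℝ => k (p.2 - p.1) :=
    hk.comp_measurable (measurable_snd.sub measurable_fst)
  have hfm : AEStronglyMeasurable (fun p : ℝ × ℝ => f p.1) (μ.prod (volume.restrict S)) :=
    hf.1.comp_fst
  have hfm' : AEStronglyMeasurable (fun p : ℝ × ℝ => f p.1) (μ.prod volume) :=
    hf.1.comp_fst
  have hgm : AEStronglyMeasurable (fun p : ℝ × ℝ => g p.2) (μ.prod (volume.restrict S)) :=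
    hg.1.comp_snd
  have hmeas : AEStronglyMeasurable (fun p : ℝ × ℝ => ⟪k (p.2 - p.1) (f p.1), g p.2⟫_ℂ)
      (μ.prod (volume.restrict S)) := by
    refine AEStronglyMeasurable.inner ?_ hgm
    exact (ContinuousLinearMap.apply ℂ V).flip.aestronglyMeasurable_comp₂
      hkm.aestronglyMeasurable hfm
  have h1 : Integrable (fun p : ℝ × ℝ => ‖f p.1‖ ^ 2 * ‖k (p.2 - p.1)‖ ^ 2) (μ.prod volume) := by
    have hk3 : Integrable (fun t => ‖k t‖ ^ 2) volume :=
      (memLp_two_iff_integrable_sq_norm hk2.1).1 hk2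
    rw [integrable_prod_iff]
    · refine ⟨ae_of_all _ fun s => ?_, ?_⟩
      · exact (hk3.comp_sub_right s).const_mul (‖f s‖ ^ 2)
      · have : ∀ s, ∫ t, ‖‖f s‖ ^ 2 * ‖k (t - s)‖ ^ 2‖ = ‖f s‖ ^ 2 * ∫ t, ‖k t‖ ^ 2 := by
          intro s
          rw [← integral_sub_right_eq_self (fun t => ‖k t‖ ^ 2) s, ← integral_const_mul]
          exact integral_congr_ae (ae_of_all _ fun t => by
            simp only; rw [Real.norm_of_nonneg (by positivity)])
        simp only [this]
        exact ((memLp_two_iff_integrable_sq_norm hf.1).1 hf).mul_const _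
    · exact (hfm'.norm.pow 2).mul (hkm.aestronglyMeasurable.norm.pow 2)
  have h2 : Integrable (fun p : ℝ × ℝ => ‖f p.1‖ ^ 2 * ‖k (p.2 - p.1)‖ ^ 2)
      (μ.prod (volume.restrict S)) :=
    h1.mono_measure (Measure.prod_mono le_rfl Measure.restrict_le_self)
  have h3 : Integrable (fun p : ℝ × ℝ => ‖g p.2‖ ^ 2) (μ.prod (volume.restrict S)) :=
    ((memLp_two_iff_integrable_sq_norm hg.1).1 hg).comp_snd μ
  refine (h2.add h3).mono' hmeas (ae_of_all _ fun p => ?_)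
  have := norm_inner_le_norm (𝕜 := ℂ) (k (p.2 - p.1) (f p.1)) (g p.2)
  have h5 := (k (p.2 - p.1)).le_opNorm (f p.1)
  simp only [Pi.add_apply]
  have h6 : ‖k (p.2 - p.1) (f p.1)‖ * ‖g p.2‖ ≤ ‖k (p.2 - p.1)‖ * ‖f p.1‖ * ‖g p.2‖ := by gcongr
  nlinarith [sq_nonneg (‖k (p.2 - p.1)‖ * ‖f p.1‖ - ‖g p.2‖), sq_nonneg (‖k (p.2 - p.1)‖ * ‖f p.1‖),
    sq_nonneg (‖g p.2‖)]

end PairIntegrable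

end

/-! ### Difference kernels, their compressions and the triangular factorization. -/

section

variable {V : Type*} [NormedAddCommGroup V] [InnerProductSpace ℂ V] [FiniteDimensional ℂ V]
  [CompleteSpace V]

open ContinuousLinearMap (adjoint)

/-- A hermitian difference kernel `k(s - t)` with `k ∈ L₂(ℝ)`. -/
structure DiffKernel (V : Type*) [NormedAddCommGroup V] [InnerProductSpace ℂ V]
    [FiniteDimensional ℂ V] [CompleteSpace V] where
  k : ℝ → V →L[ℂ] V
  meas : StronglyMeasurable k
  memLp : MemLp k 2 volume
  symm : ∀ s, k (-s) = adjoint (k s)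

namespace DiffKernel

variable (κ : DiffKernel V)

theorem memLp_col (t : ℝ) : MemLp (fun s => κ.k (s - t)) 2 vol11 :=
  (memLp_comp_sub_right κ.memLp t).restrict _

/-- The columns `v ↦ k(· - t) v` of the kernel. -/
def tau (t : ℝ) : V →L[ℂ] L2V V := colOp ((κ.memLp_col t).toLp _)

theorem coeFn_tau (t : ℝ) (v : V) : κ.tau t v =ᵐ[vol11] fun s => κ.k (s - t) v := by
  filter_upwards [coeFn_colOp ((κ.memLp_col t).toLp _) v, (κ.memLp_col t).coeFn_toLp] with s h1 h2
  rw [tau, h1, h2]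

theorem continuous_tau : Continuous κ.tau := by
  refine colOp.continuous.comp ?_
  rw [continuous_iff_continuousAt]
  intro t₀
  rw [ContinuousAt, Lp.tendsto_Lp_iff_tendsto_eLpNorm'']
  refine tendsto_of_tendsto_of_tendsto_of_le_of_le tendsto_const_nhds
    (tendsto_eLpNorm_translate κ.memLp t₀) (fun _ => zero_le) fun t => ?_
  exact eLpNorm_mono_measure _ Measure.restrict_le_self

theorem adjoint_tau_apply (s : ℝ) (g : L2V V) :
    adjoint (κ.tau s) g = ∫ t, κ.k (s - t) (g t) ∂vol11 := by
  rw [tau, adjoint_colOp_apply]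
  refine integral_congr_ae ?_
  filter_upwards [(κ.memLp_col s).coeFn_toLp] with t h
  rw [h, ← κ.symm, neg_sub]

theorem continuous_adjoint_tau : Continuous fun s => adjoint (κ.tau s) :=
  (LinearIsometryEquiv.continuous _).comp κ.continuous_tau

/-- The integral operator with the kernel `k(s - t)` in `L₂((-1, 1), V)`. -/
def conv : L2V V →L[ℂ] L2V V := famOp (fun s => adjoint (κ.tau s)) κ.continuous_adjoint_tau

theorem coeFn_conv (g : L2V V) : κ.conv g =ᵐ[vol11] fun s => adjoint (κ.tau s) g :=
  coeFn_famOp _ _ g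

theorem inner_conv_right (f g : L2V V) :
    ⟪f, κ.conv g⟫_ℂ = ∫ s, ∫ t, ⟪κ.k (t - s) (f s), g t⟫_ℂ ∂vol11 ∂vol11 := by
  rw [L2.inner_def]
  refine integral_congr_ae ?_
  filter_upwards [κ.coeFn_conv g] with s h
  rw [h, adjoint_tau_apply, ← integral_inner]
  · refine integral_congr_ae (ae_of_all _ fun t => ?_)
    simp only
    rw [← neg_sub t s, κ.symm, ContinuousLinearMap.adjoint_inner_right]
  · have := integrable_adjoint_apply (κ.memLp_col s) (Lp.memLp g)
    refine this.congr (ae_of_all _ fun t => ?_)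
    simp only
    rw [← κ.symm, neg_sub]

theorem inner_conv_left (f g : L2V V) : ⟪κ.conv f, g⟫_ℂ = ⟪f, κ.conv g⟫_ℂ := by
  rw [inner_conv_right, ← inner_conj_symm, inner_conv_right, ← integral_conj]
  simp only [← integral_conj]
  rw [integral_integral_swap]
  · refine integral_congr_ae (ae_of_all _ fun s => integral_congr_ae (ae_of_all _ fun t => ?_))
    simp only
    rw [inner_conj_symm, ← neg_sub t s, κ.symm, ContinuousLinearMap.adjoint_inner_right]
  · have := integrable_kernel_pair (μ := vol11) (S := Ioo (-1) 1) κ.meas κ.memLp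
      (Lp.memLp g) (Lp.memLp f)
    exact (Complex.conjLIE.integrable_comp_iff (φ := fun p : ℝ × ℝ =>
      ⟪κ.k (p.2 - p.1) (g p.1), f p.2⟫_ℂ)).2 this

/-- The operator `I + 𝓚`. -/
def big : L2V V →L[ℂ] L2V V := 1 + κ.conv

/-- `I + 𝓚` is bounded below. -/
def Coercive : Prop :=
  ∃ δ : ℝ, 0 < δ ∧ δ ≤ 1 ∧ ∀ g : L2V V, δ * ‖g‖ ^ 2 ≤ RCLike.re ⟪g, κ.big g⟫_ℂ

/-- The compression of `I + 𝓚` to the interval `(-x, x)`, extended by the identity. -/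
def trunc (x : ℝ) : L2V V →L[ℂ] L2V V := 1 + cut V x * κ.conv * cut V x

theorem trunc_apply (x : ℝ) (g : L2V V) :
    κ.trunc x g = g + cut V x (κ.conv (cut V x g)) := rfl

theorem big_apply (g : L2V V) : κ.big g = g + κ.conv g := rfl

theorem inner_big_left (f g : L2V V) : ⟪κ.big f, g⟫_ℂ = ⟪f, κ.big g⟫_ℂ := by
  rw [big_apply, big_apply, inner_add_left, inner_add_right, inner_conv_left]

theorem inner_trunc_left (x : ℝ) (f g : L2V V) : ⟪κ.trunc x f, g⟫_ℂ = ⟪f, κ.trunc x g⟫_ℂ := by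
  rw [trunc_apply, trunc_apply, inner_add_left, inner_add_right, inner_cut_left, inner_conv_left,
    inner_cut_left]

theorem adjoint_conv : adjoint κ.conv = κ.conv := by
  symm
  rw [ContinuousLinearMap.eq_adjoint_iff]
  exact κ.inner_conv_left

/-- On functions supported outside (-x, x) the compression acts as the identity. This is why
`Coercive` asks for δ ≤ 1. -/
theorem trunc_coercive {δ : ℝ} (hδ1 : δ ≤ 1)
    (h : ∀ g : L2V V, δ * ‖g‖ ^ 2 ≤ RCLike.re ⟪g, κ.big g⟫_ℂ) (x : ℝ) (g : L2V V) :
    δ * ‖g‖ ^ 2 ≤ RCLike.re ⟪g, κ.trunc x g⟫_ℂ := by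
  have h1 := h (cut V x g)
  have h2 : ‖g - cut V x g‖ ^ 2 = ‖g‖ ^ 2 - ‖cut V x g‖ ^ 2 := by
    have e : RCLike.re ⟪g, cut V x g⟫_ℂ = ‖cut V x g‖ ^ 2 := by
      rw [← cut_cut x g, ← inner_cut_left, cut_cut, inner_self_eq_norm_sq]
    rw [@norm_sub_sq ℂ, e]; ring
  have h3 : RCLike.re ⟪g, κ.trunc x g⟫_ℂ =
      ‖g‖ ^ 2 - ‖cut V x g‖ ^ 2 + RCLike.re ⟪cut V x g, κ.big (cut V x g)⟫_ℂ := by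
    rw [trunc_apply, big_apply, inner_add_right, inner_add_right, map_add, map_add,
      inner_self_eq_norm_sq, inner_self_eq_norm_sq, inner_cut_left]
    ring
  rw [h3]
  nlinarith [sq_nonneg ‖g - cut V x g‖]

theorem Coercive.isUnit_trunc {κ : DiffKernel V} (h : κ.Coercive) (x : ℝ) : IsUnit (κ.trunc x) := by
  obtain ⟨δ, h0, h1, h2⟩ := h
  exact isUnit_of_coercive (κ.inner_trunc_left x) h0 (κ.trunc_coercive h1 h2 x)

/-- The cutoffs are only strongly continuous, but composed with 𝓚 they become norm continuous: on
the left by the shell estimate, on the right by taking adjoints. Norm continuity is what passes to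
the inverses. -/
theorem continuous_trunc : Continuous κ.trunc := by
  obtain ⟨C, hC0, hC⟩ := exists_norm_cut_sub_famOp_le _ κ.continuous_adjoint_tau
  change ∀ x y, x ≤ y → ‖(cut V y - cut V x) * κ.conv‖ ≤ _ at hC
  have hC1 : ∀ x y, ‖(cut V y - cut V x) * κ.conv‖ ≤ C * √(2 * |y - x|) := by
    intro x y
    rcases le_total x y with h | h
    · rw [abs_of_nonneg (by linarith)]; exact hC x y h
    · rw [abs_of_nonpos (by linarith), neg_sub, ← neg_sub, neg_mul, norm_neg]; exact hC y x h
  have hC2 : ∀ x y, ‖κ.conv * (cut V y - cut V x)‖ ≤ C * √(2 * |y - x|) := by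
    intro x y
    rw [← LinearIsometryEquiv.norm_map adjoint]
    change ‖adjoint (κ.conv ∘L (cut V y - cut V x))‖ ≤ _
    rw [ContinuousLinearMap.adjoint_comp, map_sub, adjoint_cut, adjoint_cut, adjoint_conv]
    exact hC1 x y
  rw [continuous_iff_continuousAt]
  intro x₀
  rw [ContinuousAt, tendsto_iff_norm_sub_tendsto_zero]
  have hlim : Tendsto (fun x => C * √(2 * |x - x₀|) + C * √(2 * |x - x₀|)) (𝓝 x₀) (𝓝 0) := by
    have : Continuous fun x => C * √(2 * |x - x₀|) + C * √(2 * |x - x₀|) := by fun_prop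
    simpa using this.tendsto x₀
  refine squeeze_zero (fun _ => norm_nonneg _) (fun x => ?_) hlim
  have e : κ.trunc x - κ.trunc x₀ = (cut V x - cut V x₀) * κ.conv * cut V x +
      cut V x₀ * (κ.conv * (cut V x - cut V x₀)) := by
    simp only [trunc]
    noncomm_ring
  rw [e]
  refine (norm_add_le _ _).trans (add_le_add ?_ ?_)
  · refine (norm_mul_le _ _).trans ?_
    refine (mul_le_of_le_one_right (norm_nonneg _) (norm_cut_le x)).trans (hC1 _ _)
  · refine (norm_mul_le _ _).trans ?_
    refine (mul_le_of_le_one_left (norm_nonneg _) (norm_cut_le _)).trans (hC2 _ _)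

/-- The inverse of the compression of `I + 𝓚`. -/
def tinv (x : ℝ) : L2V V →L[ℂ] L2V V := Ring.inverse (κ.trunc x)

theorem cut_mul_trunc (x : ℝ) : cut V x * κ.trunc x = κ.trunc x * cut V x := by
  rw [trunc, mul_add, add_mul, mul_one, one_mul, mul_assoc, mul_assoc, ← mul_assoc (cut V x)
      (cut V x),
    cut_mul_cut, min_self, mul_assoc, cut_mul_cut, min_self]

variable {κ} (hκ : κ.Coercive)
include hκ

namespace Coercive

theorem continuous_tinv : Continuous κ.tinv := by
  rw [continuous_iff_continuousAt]
  intro x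
  have h := NormedRing.inverse_continuousAt (hκ.isUnit_trunc x).unit
  rw [IsUnit.unit_spec] at h
  exact ContinuousAt.comp (f := κ.trunc) h κ.continuous_trunc.continuousAt

theorem tinv_mul_trunc (x : ℝ) : κ.tinv x * κ.trunc x = 1 :=
  Ring.inverse_mul_cancel _ (hκ.isUnit_trunc x)

theorem trunc_mul_tinv (x : ℝ) : κ.trunc x * κ.tinv x = 1 :=
  Ring.mul_inverse_cancel _ (hκ.isUnit_trunc x)

theorem cut_mul_tinv (x : ℝ) : cut V x * κ.tinv x = κ.tinv x * cut V x := by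
  calc cut V x * κ.tinv x = (κ.tinv x * κ.trunc x) * cut V x * κ.tinv x := by
        rw [hκ.tinv_mul_trunc, one_mul]
    _ = κ.tinv x * (cut V x * κ.trunc x) * κ.tinv x := by rw [κ.cut_mul_trunc, mul_assoc (κ.tinv x)]
    _ = _ := by rw [mul_assoc, mul_assoc, hκ.trunc_mul_tinv, mul_one]

theorem adjoint_tinv (x : ℝ) : adjoint (κ.tinv x) = κ.tinv x := by
  symm
  rw [ContinuousLinearMap.eq_adjoint_iff]
  intro f g
  have e : ∀ h, κ.trunc x (κ.tinv x h) = h := fun h => DFunLike.congr_fun (hκ.trunc_mul_tinv x) h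
  nth_rw 1 [← e g]
  rw [← κ.inner_trunc_left, e]

end Coercive

omit hκ
variable (κ)

/-- The columns of the kernel, cut off to `(-|y|, |y|)`. -/
def wcol (y : ℝ) : V →L[ℂ] L2V V := cut V |y| ∘L κ.tau y

theorem continuous_wcol : Continuous κ.wcol := by
  -- V is finite-dimensional, so strong continuity of the cutoffs suffices here.
  rw [continuous_clm_apply]
  intro v
  exact continuous_cut_comp continuous_abs (κ.continuous_tau.clm_apply continuous_const)

/-- The rows `σ_y` of the transformation operator. -/
def sigma (y : ℝ) : L2V V →L[ℂ] V := -(adjoint (κ.wcol y) ∘L κ.tinv |y|)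

theorem adjoint_wcol (y : ℝ) : adjoint (κ.wcol y) = adjoint (κ.tau y) ∘L cut V |y| := by
  rw [wcol, ContinuousLinearMap.adjoint_comp, adjoint_cut]

theorem sigma_apply (y : ℝ) (g : L2V V) :
    κ.sigma y g = -adjoint (κ.tau y) (cut V |y| (κ.tinv |y| g)) := by
  rw [sigma, adjoint_wcol]; rfl

/-- The resolvent kernel `G(y, t)`. -/
def green (y t : ℝ) : V →L[ℂ] V := -(κ.sigma y ∘L κ.tau t)

variable {κ}

namespace Coercive

include hκ

theorem continuous_sigma : Continuous κ.sigma := by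
  refine Continuous.neg ?_
  refine Continuous.clm_comp ((LinearIsometryEquiv.continuous adjoint).comp κ.continuous_wcol) ?_
  exact hκ.continuous_tinv.comp continuous_abs

theorem continuous_green : Continuous fun p : ℝ × ℝ => κ.green p.1 p.2 :=
  ((hκ.continuous_sigma.comp continuous_fst).clm_comp
    (κ.continuous_tau.comp continuous_snd)).neg

theorem sigma_cut (y : ℝ) (g : L2V V) : κ.sigma y (cut V |y| g) = κ.sigma y g := by
  have := DFunLike.congr_fun (hκ.cut_mul_tinv |y|) g
  simp only [mul_apply_eq_comp] at this
  rw [sigma_apply, sigma_apply, ← this, cut_cut]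

theorem sigma_cut_of_le {y a : ℝ} (hy : |y| ≤ a) (g : L2V V) :
    κ.sigma y (cut V a g) = κ.sigma y g := by
  rw [← hκ.sigma_cut, cut_apply_cut, min_eq_left hy, hκ.sigma_cut]

/-- The defining property of the rows: on functions supported in (-|y|, |y|) one has σ_y (I + 𝓚) =
-τ_y^*, because there the compressed operator agrees with the cut-off of I + 𝓚 and `tinv` undoes it.
-/
theorem sigma_big {y : ℝ} {h : L2V V} (hh : cut V |y| h = h) :
    κ.sigma y (κ.big h) = -adjoint (κ.tau y) h := by
  rw [sigma_apply]
  have e1 : cut V |y| (κ.tinv |y| (κ.big h)) = κ.tinv |y| (cut V |y| (κ.big h)) :=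
    DFunLike.congr_fun (hκ.cut_mul_tinv |y|) _
  have e2 : cut V |y| (κ.big h) = κ.trunc |y| h := by
    rw [trunc_apply, big_apply, map_add, hh]
  have e3 : κ.tinv |y| (κ.trunc |y| h) = h := DFunLike.congr_fun (hκ.tinv_mul_trunc |y|) h
  rw [e1, e2, e3]

theorem adjoint_sigma (y : ℝ) : adjoint (κ.sigma y) = -(κ.tinv |y| ∘L κ.wcol y) := by
  rw [sigma, map_neg, ContinuousLinearMap.adjoint_comp, ContinuousLinearMap.adjoint_adjoint,
    hκ.adjoint_tinv]

/-- G(x, t) is -σ_x τ_t. The inverse of the compression is self-adjoint and commutes with the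
cutoff, so at t = -x, where both points have the same modulus, the expression is symmetric under
adjunction. It yields that the two Dirac equations have adjoint coefficients. -/
theorem adjoint_green (x : ℝ) : adjoint (κ.green x (-x)) = κ.green (-x) x := by
  rw [green, green, map_neg, ContinuousLinearMap.adjoint_comp, hκ.adjoint_sigma]
  ext v
  have := DFunLike.congr_fun (hκ.cut_mul_tinv |x|) (κ.tau x v)
  simp only [mul_apply_eq_comp] at this
  simp [sigma_apply, wcol, this]

variable (κ) in
omit hκ in
/-- The transformation operator `I + 𝓝`, `(𝓝 g)(y) = σ_y g`. -/
def lower (hκ : κ.Coercive) : L2V V →L[ℂ] L2V V := famOp κ.sigma hκ.continuous_sigma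

theorem coeFn_lower (g : L2V V) : hκ.lower κ g =ᵐ[vol11] fun y => κ.sigma y g := coeFn_famOp _ _ g

/-- Triangularity in one direction: σ_y sees only the restriction of its argument to (-|y|, |y|). -/
theorem cut_lower_cut (a : ℝ) :
    cut V a * hκ.lower κ * cut V a = cut V a * hκ.lower κ := by
  ext1 g
  refine Lp.ext ?_
  simp only [mul_apply_eq_comp]
  filter_upwards [coeFn_cut a (hκ.lower κ (cut V a g)), coeFn_cut a (hκ.lower κ g),
    hκ.coeFn_lower (cut V a g), hκ.coeFn_lower g] with y h1 h2 h3 h4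
  rw [h1, h2]
  by_cases hy : y ∈ Ioo (-a) a
  · rw [indicator_of_mem hy, indicator_of_mem hy, h3, h4, hκ.sigma_cut_of_le (abs_lt.2 hy).le]
  · rw [indicator_of_notMem hy, indicator_of_notMem hy]

variable (κ) in
omit hκ in
/-- The transformation operator `I + 𝓝`. -/
def trafo (hκ : κ.Coercive) : L2V V →L[ℂ] L2V V := 1 + hκ.lower κ

/-- Triangularity in the opposite direction: if h lives on (-a, a) and |y| ≥ a, then at y the term
(𝓚 h)(y) cancels against σ_y (I + 𝓚) h by `sigma_big`. -/
theorem cut_trafo_big (a : ℝ) :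
    cut V a * (hκ.trafo κ * κ.big * cut V a) = hκ.trafo κ * κ.big * cut V a := by
  ext1 g
  simp only [mul_apply_eq_comp]
  set h := cut V a g with hh
  have hc : cut V a h = h := cut_cut a g
  refine Lp.ext ?_
  have e : hκ.trafo κ (κ.big h) = h + κ.conv h + hκ.lower κ (κ.big h) := rfl
  rw [e]
  filter_upwards [coeFn_cut a (h + κ.conv h + hκ.lower κ (κ.big h)),
    Lp.coeFn_add (h + κ.conv h) (hκ.lower κ (κ.big h)), Lp.coeFn_add h (κ.conv h),
    κ.coeFn_conv h, hκ.coeFn_lower (κ.big h), coeFn_cut a h] with y h1 h2 h3 h4 h5 h6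
  rw [h1]
  by_cases hy : y ∈ Ioo (-a) a
  · rw [indicator_of_mem hy]
  · rw [indicator_of_notMem hy, h2, Pi.add_apply, h3, Pi.add_apply, h4, h5]
    have ha : a ≤ |y| := not_lt.1 fun hlt => hy (abs_lt.1 hlt)
    have h7 : cut V |y| h = h := by
      rw [hh, cut_apply_cut, min_eq_right ha]
    rw [hc, indicator_of_notMem hy] at h6
    rw [hκ.sigma_big h7, h6, zero_add, add_neg_cancel]

theorem cut_trafo_cut (a : ℝ) : cut V a * hκ.trafo κ * cut V a = cut V a * hκ.trafo κ := by
  rw [trafo, mul_add, add_mul, hκ.cut_lower_cut, mul_one, cut_mul_cut, min_self]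

theorem adjoint_big : adjoint κ.big = κ.big := by
  symm
  rw [ContinuousLinearMap.eq_adjoint_iff]
  exact κ.inner_big_left

/-- X(I + 𝓚) and X^* both preserve functions supported in (-a, a), hence so does their product. The
product is self-adjoint, so the cutoffs reduce it. -/
theorem trafo_big_adjoint_commute (a : ℝ) :
    (hκ.trafo κ * κ.big * adjoint (hκ.trafo κ)) * cut V a =
      cut V a * (hκ.trafo κ * κ.big * adjoint (hκ.trafo κ)) := by
  set X := hκ.trafo κ
  set Z := X * κ.big * adjoint X with hZ
  have hadj : star Z = Z := by
    have e1 : star (adjoint X) = X := ContinuousLinearMap.adjoint_adjoint X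
    have e2 : star κ.big = κ.big := hκ.adjoint_big
    have e3 : star X = adjoint X := rfl
    rw [hZ, star_mul, star_mul, e1, e2, e3, mul_assoc]
  have hP : star (cut V a) = cut V a := adjoint_cut a
  have h1 : adjoint X * cut V a = cut V a * adjoint X * cut V a := by
    have := congrArg star (hκ.cut_trafo_cut a)
    rw [star_mul, star_mul, hP] at this
    exact (this.symm).trans (by rw [mul_assoc]; rfl)
  have h2 : Z * cut V a = cut V a * Z * cut V a := by
    calc Z * cut V a = X * κ.big * (adjoint X * cut V a) := by rw [hZ, mul_assoc]
      _ = X * κ.big * cut V a * (adjoint X * cut V a) := by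
          rw [h1, mul_assoc (X * κ.big), ← mul_assoc (cut V a) (cut V a * adjoint X),
            ← mul_assoc (cut V a) (cut V a), cut_mul_cut, min_self]
      _ = cut V a * (X * κ.big * cut V a) * (adjoint X * cut V a) := by
          rw [hκ.cut_trafo_big]
      _ = cut V a * (X * κ.big * cut V a * (adjoint X * cut V a)) := by rw [mul_assoc]
      _ = cut V a * (X * κ.big * (adjoint X * cut V a)) := by
          rw [h1, mul_assoc (X * κ.big) (cut V a), ← mul_assoc (cut V a) (cut V a * adjoint X),
            ← mul_assoc (cut V a) (cut V a), cut_mul_cut, min_self]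
      _ = _ := by rw [hZ]; simp only [mul_assoc]
  have h3 := congrArg star h2
  rw [star_mul Z, star_mul (cut V a * Z), star_mul (cut V a) Z, hP, hadj] at h3
  exact h2.trans ((mul_assoc _ _ _).trans h3.symm)

/-- The factorization `(I + 𝓝)(I + 𝓚)(I + 𝓝)^* = I`. -/
theorem trafo_big_adjoint : hκ.trafo κ * κ.big * adjoint (hκ.trafo κ) = 1 := by
  set X := hκ.trafo κ with hX
  obtain ⟨C₁, hC₁0, hC₁⟩ := exists_norm_cut_sub_famOp_le _ κ.continuous_adjoint_tau
  obtain ⟨C₂, hC₂0, hC₂⟩ := exists_norm_cut_sub_famOp_le _ hκ.continuous_sigma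
  change ∀ x y, x ≤ y → ‖(cut V y - cut V x) * κ.conv‖ ≤ _ at hC₁
  change ∀ x y, x ≤ y → ‖(cut V y - cut V x) * hκ.lower κ‖ ≤ _ at hC₂
  rw [← sub_eq_zero]
  -- Every summand has 𝓝 or 𝓚 on the far left or 𝓝^* on the far right, where it meets a shell
  -- projection and becomes small. The operator also commutes with the cutoffs, so it vanishes.
  have hexp : X * κ.big * adjoint X - 1 =
      hκ.lower κ * (κ.big * adjoint X) + κ.conv * adjoint X + adjoint (hκ.lower κ) := by
    have e : adjoint X = 1 + adjoint (hκ.lower κ) := by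
      rw [hX, trafo, map_add]
      congr 1
      exact star_one _
    have e1 : X * κ.big * adjoint X = (1 + hκ.lower κ) * κ.big * adjoint X := rfl
    have e2 : κ.big * adjoint X = adjoint X + κ.conv * adjoint X := by
      rw [big, add_mul, one_mul]
    rw [e1, mul_assoc, add_mul, one_mul, e2]
    nth_rw 1 [e]
    abel
  refine eq_zero_of_commute_cut (C := C₂ * ‖κ.big * adjoint X‖ + C₁ * ‖adjoint X‖ + C₂) ?_ ?_
  · intro a
    rw [sub_mul, mul_sub, hκ.trafo_big_adjoint_commute, one_mul, mul_one]
  · intro a b hab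
    have hD : ‖cut V b - cut V a‖ ≤ 1 := by
      refine ContinuousLinearMap.opNorm_le_bound _ zero_le_one fun g => ?_
      rw [one_mul]
      have h1 := norm_sq_cut_sub hab g
      have h2 : ‖cut V b g‖ ≤ ‖g‖ := by
        simpa using (cut V b).le_of_opNorm_le (norm_cut_le b) g
      refine le_of_sq_le_sq ?_ (norm_nonneg _)
      have h3 : ‖(cut V b - cut V a) g‖ ^ 2 = ‖cut V b g‖ ^ 2 - ‖cut V a g‖ ^ 2 := h1
      rw [h3]
      nlinarith [norm_nonneg (cut V b g), norm_nonneg (cut V a g), sq_nonneg (‖cut V a g‖)]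
    set D := cut V b - cut V a with hDdef
    rw [hexp]
    have e : D * (hκ.lower κ * (κ.big * adjoint X) + κ.conv * adjoint X + adjoint (hκ.lower κ)) * D
        = D * hκ.lower κ * (κ.big * adjoint X) * D + D * κ.conv * adjoint X * D +
          D * (adjoint (hκ.lower κ) * D) := by
      noncomm_ring
    have h3 : ‖adjoint (hκ.lower κ) * D‖ ≤ C₂ * √(2 * (b - a)) := by
      refine le_of_eq_of_le ?_ (hC₂ a b hab)
      rw [← norm_star]
      have e5 : star D = D := by
        rw [hDdef, star_sub]
        exact congrArg₂ _ (adjoint_cut b) (adjoint_cut a)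
      have e6 : star (adjoint (hκ.lower κ)) = hκ.lower κ :=
        ContinuousLinearMap.adjoint_adjoint _
      rw [star_mul, e5, e6]
    rw [e]
    refine (norm_add₃_le).trans ?_
    have t1 : ‖D * hκ.lower κ * (κ.big * adjoint X) * D‖ ≤
        C₂ * √(2 * (b - a)) * ‖κ.big * adjoint X‖ := by
      refine (norm_mul_le _ _).trans ((mul_le_of_le_one_right (norm_nonneg _) hD).trans ?_)
      refine (norm_mul_le _ _).trans ?_
      gcongr
      exact hC₂ a b hab
    have t2 : ‖D * κ.conv * adjoint X * D‖ ≤ C₁ * √(2 * (b - a)) * ‖adjoint X‖ := by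
      refine (norm_mul_le _ _).trans ((mul_le_of_le_one_right (norm_nonneg _) hD).trans ?_)
      refine (norm_mul_le _ _).trans ?_
      gcongr
      exact hC₁ a b hab
    have t3 : ‖D * (adjoint (hκ.lower κ) * D)‖ ≤ C₂ * √(2 * (b - a)) :=
      (norm_mul_le _ _).trans ((mul_le_of_le_one_left (norm_nonneg _) hD).trans h3)
    calc _ ≤ C₂ * √(2 * (b - a)) * ‖κ.big * adjoint X‖ + C₁ * √(2 * (b - a)) * ‖adjoint X‖ +
          C₂ * √(2 * (b - a)) := add_le_add (add_le_add t1 t2) t3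
      _ = _ := by ring

/-- A Volterra argument: 𝓝 is a strict contraction on each sufficiently thin shell, so g = -𝓝 g
vanishes on one shell after another. -/
theorem trafo_injective {g : L2V V} (hg : hκ.trafo κ g = 0) : g = 0 := by
  obtain ⟨C, hC0, hC⟩ := exists_norm_cut_sub_famOp_le _ hκ.continuous_sigma
  change ∀ x y, x ≤ y → ‖(cut V y - cut V x) * hκ.lower κ‖ ≤ _ at hC
  have hg' : g = -hκ.lower κ g := eq_neg_of_add_eq_zero_left hg
  -- Chosen so that C√(2h) < 1 for h = 1/(N + 1).
  obtain ⟨N, hN⟩ := exists_nat_gt (2 * C ^ 2)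
  set h := 1 / (N + 1 : ℝ) with hh
  have hpos : 0 < h := by positivity
  have hsmall : C * √(2 * h) < 1 := by
    have : (C * √(2 * h)) ^ 2 < 1 := by
      rw [mul_pow, Real.sq_sqrt (by positivity), hh]
      field_simp
      linarith
    nlinarith [Real.sqrt_nonneg (2 * h), mul_nonneg hC0 (Real.sqrt_nonneg (2 * h))]
  have key : ∀ n : ℕ, cut V (n * h) g = 0 := by
    intro n
    induction n with
    | zero => simp [cut_of_nonpos]
    | succ n ih =>
      have hle : (n : ℝ) * h ≤ ((n + 1 : ℕ) : ℝ) * h := by push_cast; nlinarith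
      have hsub : ((n + 1 : ℕ) : ℝ) * h - (n : ℝ) * h = h := by push_cast; ring
      set b := ((n + 1 : ℕ) : ℝ) * h
      set a := (n : ℝ) * h
      have e1 : cut V b g = -((cut V b - cut V a) * hκ.lower κ) (cut V b g) := by
        have e2 : cut V b g = (cut V b - cut V a) g := by
          rw [sub_apply, ih, sub_zero]
        have e3 : (cut V b - cut V a) = (cut V b - cut V a) * cut V b := by
          rw [sub_mul, cut_mul_cut, cut_mul_cut, min_self, min_eq_left hle]
        have e4 : (cut V b - cut V a) * hκ.lower κ * cut V b =
            (cut V b - cut V a) * hκ.lower κ := by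
          rw [e3, mul_assoc (cut V b - cut V a), mul_assoc (cut V b - cut V a), hκ.cut_lower_cut]
        have e5 := DFunLike.congr_fun e4 g
        simp only [mul_apply_eq_comp] at e5 ⊢
        rw [e5]
        rw [e2]
        nth_rw 1 [hg']
        rw [map_neg]
      have e2 : ‖cut V b g‖ ≤ C * √(2 * h) * ‖cut V b g‖ := by
        conv_lhs => rw [e1]
        rw [norm_neg, ← hsub]
        exact ContinuousLinearMap.le_of_opNorm_le _ (hC a b hle) _
      have e3 : ‖cut V b g‖ ≤ 0 := by nlinarith [norm_nonneg (cut V b g)]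
      simpa using e3
  have := key (N + 1)
  have e : ((N + 1 : ℕ) : ℝ) * h = 1 := by rw [hh]; push_cast; field_simp
  rw [e, cut_of_one_le le_rfl] at this
  simpa using this

theorem big_injective {g : L2V V} (hg : κ.big g = 0) : g = 0 := by
  obtain ⟨δ, h0, -, h2⟩ := hκ
  have := norm_le_of_coercive h2 g
  rw [hg, norm_zero] at this
  have h3 : ‖g‖ ≤ 0 := by nlinarith [norm_nonneg g]
  simpa using h3

/-- The factorization gives only a right inverse of X(I + 𝓚); injectivity of X and of I + 𝓚 makes it
two-sided. -/
theorem adjoint_trafo_surjective (g : L2V V) :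
    adjoint (hκ.trafo κ) (hκ.trafo κ (κ.big g)) = g := by
  set X := hκ.trafo κ
  have h1 : ∀ f, X (κ.big (adjoint X f)) = f := DFunLike.congr_fun hκ.trafo_big_adjoint
  have h2 : κ.big (adjoint X (X (κ.big g)) - g) = 0 := by
    refine hκ.trafo_injective (?_ : X _ = 0)
    rw [map_sub, map_sub, h1, sub_self]
  exact sub_eq_zero.1 (hκ.big_injective h2)

theorem inner_big_adjoint (f g : L2V V) :
    ⟪adjoint (hκ.trafo κ) f, κ.big (adjoint (hκ.trafo κ) g)⟫_ℂ = ⟪f, g⟫_ℂ := by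
  rw [ContinuousLinearMap.adjoint_inner_left]
  congr 1
  exact DFunLike.congr_fun hκ.trafo_big_adjoint g

end Coercive
end DiffKernel

end

/-! ### Affine substitutions, Gronwall's inequality and convolution as a vector integral. -/

section

section Affine

theorem quasiMeasurePreserving_affine {a : ℝ} (ha : a ≠ 0) (b : ℝ) :
    Measure.QuasiMeasurePreserving (fun y : ℝ => a * y + b) volume volume := by
  have h1 : Measure.QuasiMeasurePreserving (fun y : ℝ => a * y) volume volume := by
    refine ⟨by fun_prop, ?_⟩
    rw [Real.map_volume_mul_left ha]
    exact Measure.smul_absolutelyContinuous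
  exact (measurePreserving_add_right volume b).quasiMeasurePreserving.comp h1

theorem integrable_comp_affine {W : Type*} [NormedAddCommGroup W] {F : ℝ → W}
    (hF : Integrable F volume) {a : ℝ} (ha : a ≠ 0) (b : ℝ) :
    Integrable (fun y => F (a * y + b)) volume :=
  (hF.comp_add_right b).comp_mul_left' ha

theorem memLp_comp_affine {W : Type*} [NormedAddCommGroup W] {F : ℝ → W}
    (hF : MemLp F 2 volume) {a : ℝ} (ha : a ≠ 0) (b : ℝ) :
    MemLp (fun y => F (a * y + b)) 2 volume := by
  have h1 : AEStronglyMeasurable (fun y => F (a * y + b)) volume :=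
    hF.1.comp_quasiMeasurePreserving (quasiMeasurePreserving_affine ha b)
  rw [memLp_two_iff_integrable_sq_norm h1]
  exact integrable_comp_affine ((memLp_two_iff_integrable_sq_norm hF.1).1 hF) ha b

theorem integral_comp_reflect {W : Type*} [NormedAddCommGroup W] [NormedSpace ℝ W] {ε : ℝ}
    (hε : ε = 1 ∨ ε = -1) (Φ : ℝ → W) (x : ℝ) :
    ∫ y in (0 : ℝ)..x, Φ (ε * (x - 2 * y)) = (1 / 2 : ℝ) • ∫ t in (-x)..x, Φ t := by
  rcases hε with rfl | rfl
  · have := intervalIntegral.integral_comp_sub_mul (a := 0) (b := x) Φ (c := 2) two_ne_zero x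
    simp only [one_mul]
    rw [this]
    norm_num
    ring_nf
  · have := intervalIntegral.integral_comp_mul_sub (a := 0) (b := x) Φ (c := 2) two_ne_zero x
    have e : ∀ y, -1 * (x - 2 * y) = 2 * y - x := fun y => by ring
    simp only [e]
    rw [this]
    norm_num
    ring_nf

end Affine

section Gronwall

/-- Iteration with the weight e^{2Cx}: each application of the hypothesis halves the constant. The a
priori bound B starts the iteration. -/
theorem eq_zero_of_le_integral {h : ℝ → ℝ} (hm : Measurable h) (h0 : ∀ x, 0 ≤ h x) {B C : ℝ}
    (hC : 0 < C) (hB : ∀ x ∈ Ioc (0 : ℝ) 1, h x ≤ B)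
    (hint : ∀ x ∈ Ioc (0 : ℝ) 1, h x ≤ C * ∫ t in (0 : ℝ)..x, h t) :
    ∀ x ∈ Ioc (0 : ℝ) 1, h x = 0 := by
  have hB0 : 0 ≤ B := (h0 1).trans (hB 1 (by simp))
  have key : ∀ n : ℕ, ∀ x ∈ Ioc (0 : ℝ) 1, h x ≤ B * (1 / 2) ^ n * Real.exp (2 * C * x) := by
    intro n
    induction n with
    | zero =>
      intro x hx
      rw [pow_zero, mul_one]
      refine (hB x hx).trans (le_mul_of_one_le_right hB0 (Real.one_le_exp ?_))
      have := hx.1; positivity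
    | succ n ih =>
      intro x hx
      have hii : IntervalIntegrable h volume 0 x := by
        rw [intervalIntegrable_iff_integrableOn_Ioc_of_le hx.1.le]
        refine Measure.integrableOn_of_bounded (M := B) (by simp) hm.aestronglyMeasurable ?_
        filter_upwards [ae_restrict_mem measurableSet_Ioc] with y hy
        rw [Real.norm_of_nonneg (h0 y)]
        exact hB y ⟨hy.1, hy.2.trans hx.2⟩
      have hcont : Continuous fun t => B * (1 / 2) ^ n * Real.exp (2 * C * t) := by fun_prop
      have h1 : ∫ t in (0 : ℝ)..x, h t ≤ ∫ t in (0 : ℝ)..x, B * (1 / 2) ^ n * Real.exp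
          (2 * C * t) := by
        refine intervalIntegral.integral_mono_on_of_le_Ioo hx.1.le hii
          (hcont.intervalIntegrable _ _) fun t ht => ih t ⟨ht.1, ht.2.le.trans hx.2⟩
      have h2 : ∫ t in (0 : ℝ)..x, B * (1 / 2) ^ n * Real.exp (2 * C * t) =
          B * (1 / 2) ^ n * ((2 * C)⁻¹ * (Real.exp (2 * C * x) - 1)) := by
        rw [intervalIntegral.integral_const_mul, intervalIntegral.integral_comp_mul_left _
            (by positivity)]
        simp
      calc h x ≤ C * ∫ t in (0 : ℝ)..x, h t := hint x hx
        _ ≤ C * (B * (1 / 2) ^ n * ((2 * C)⁻¹ * (Real.exp (2 * C * x) - 1))) := by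
            rw [← h2]; gcongr
        _ ≤ C * (B * (1 / 2) ^ n * ((2 * C)⁻¹ * (Real.exp (2 * C * x)))) := by
            gcongr; linarith
        _ = _ := by field_simp; ring
  intro x hx
  have hl : Tendsto (fun n : ℕ => B * (1 / 2) ^ n * Real.exp (2 * C * x)) atTop (𝓝 0) := by
    have := (tendsto_pow_atTop_nhds_zero_of_lt_one (r := (1 / 2 : ℝ)) (by norm_num)
      (by norm_num)).const_mul B
    simpa using this.mul_const (Real.exp (2 * C * x))
  exact le_antisymm (ge_of_tendsto' hl fun n => key n x hx) (h0 x)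

end Gronwall

section KernelMul

theorem integrable_kernel_mul {μ : Measure ℝ} [IsFiniteMeasure μ] {S : Set ℝ} {k a f : ℝ → ℝ}
    (hk : Measurable k) (hk2 : MemLp k 2 volume) (ha : MemLp a 2 μ)
    (hf : MemLp f 2 (volume.restrict S)) {φ : ℝ → ℝ} (hφ : Measurable φ) :
    Integrable (fun p : ℝ × ℝ => a p.1 * k (φ p.1 - p.2) * f p.2) (μ.prod (volume.restrict S)) := by
  have hkm : Measurable fun p : ℝ × ℝ => k (φ p.1 - p.2) :=
    hk.comp ((hφ.comp measurable_fst).sub measurable_snd)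
  have ham : AEStronglyMeasurable (fun p : ℝ × ℝ => a p.1) (μ.prod (volume.restrict S)) :=
    ha.1.comp_fst
  have hfm : AEStronglyMeasurable (fun p : ℝ × ℝ => f p.2) (μ.prod (volume.restrict S)) :=
    hf.1.comp_snd
  have ham' : AEStronglyMeasurable (fun p : ℝ × ℝ => a p.1) (μ.prod volume) := ha.1.comp_fst
  have h1 : Integrable (fun p : ℝ × ℝ => a p.1 ^ 2 * k (φ p.1 - p.2) ^ 2) (μ.prod volume) := by
    have hk3 : Integrable (fun t => k t ^ 2) volume := hk2.integrable_sq
    rw [integrable_prod_iff]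
    · refine ⟨ae_of_all _ fun s => ?_, ?_⟩
      · exact (hk3.comp_sub_left (φ s)).const_mul (a s ^ 2)
      · have : ∀ s, ∫ t, ‖a s ^ 2 * k (φ s - t) ^ 2‖ = a s ^ 2 * ∫ t, k t ^ 2 := by
          intro s
          rw [← integral_sub_left_eq_self (fun t => k t ^ 2) volume (φ s), ← integral_const_mul]
          exact integral_congr_ae (ae_of_all _ fun t => by
            simp only; rw [Real.norm_of_nonneg (by positivity)])
        simp only [this]
        exact ha.integrable_sq.mul_const _
    · exact (ham'.pow 2).mul (hkm.aestronglyMeasurable.pow 2)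
  have h2 : Integrable (fun p : ℝ × ℝ => a p.1 ^ 2 * k (φ p.1 - p.2) ^ 2)
      (μ.prod (volume.restrict S)) :=
    h1.mono_measure (Measure.prod_mono le_rfl Measure.restrict_le_self)
  have h3 : Integrable (fun p : ℝ × ℝ => f p.2 ^ 2) (μ.prod (volume.restrict S)) :=
    hf.integrable_sq.comp_snd μ
  refine (h2.add h3).mono' ((ham.mul hkm.aestronglyMeasurable).mul hfm) (ae_of_all _ fun p => ?_)
  simp only [Pi.add_apply, norm_mul, Real.norm_eq_abs]
  have h4 : |a p.1| ^ 2 = a p.1 ^ 2 := sq_abs _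
  have h5 : |k (φ p.1 - p.2)| ^ 2 = k (φ p.1 - p.2) ^ 2 := sq_abs _
  have h6 : |f p.2| ^ 2 = f p.2 ^ 2 := sq_abs _
  rw [← h4, ← h5, ← h6]
  nlinarith [sq_nonneg (|a p.1| * |k (φ p.1 - p.2)| - |f p.2|),
    sq_nonneg (|a p.1| * |k (φ p.1 - p.2)|), sq_nonneg (|f p.2|)]

end KernelMul

variable {V : Type*} [NormedAddCommGroup V] [InnerProductSpace ℂ V] [FiniteDimensional ℂ V]
  [CompleteSpace V]

open ContinuousLinearMap (adjoint)

theorem aestronglyMeasurable_clm_apply {W : Type*} [NormedAddCommGroup W] [NormedSpace ℂ W]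
    {T : ℝ → V →L[ℂ] W} (hT : Continuous T) {μ : Measure ℝ} {g : ℝ → V}
    (hg : AEStronglyMeasurable g μ) : AEStronglyMeasurable (fun t => T t (g t)) μ := by
  have h2 : Continuous fun p : ℝ × V => T p.1 p.2 :=
    (hT.comp continuous_fst).clm_apply continuous_snd
  have h3 : AEStronglyMeasurable (fun t : ℝ => t) μ := measurable_id.aestronglyMeasurable
  exact h2.comp_aestronglyMeasurable (h3.prodMk hg)

namespace DiffKernel

variable (κ : DiffKernel V)

theorem integrable_tau_apply (c : ℝ) (g : L2V V) :
    Integrable (fun t => κ.tau (t - c) (g t)) vol11 := by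
  have h1 : Continuous fun t => κ.tau (t - c) := κ.continuous_tau.comp (by fun_prop)
  obtain ⟨C, hC0, hC⟩ := exists_bound_of_continuous (W := V →L[ℂ] L2V V) h1
  have hg : Integrable g vol11 := (Lp.memLp g).integrable (by norm_num)
  refine (hg.norm.const_mul C).mono' ?_ ?_
  · exact aestronglyMeasurable_clm_apply (W := L2V V) h1 hg.1
  · filter_upwards [ae_vol11_mem] with t ht
    exact (κ.tau (t - c)).le_of_opNorm_le (hC t (Ioo_subset_Icc_self ht)) (g t)

/-- The shifted convolution as a vector valued integral. -/
theorem toLp_adjoint_tau_add (c : ℝ) (g : L2V V)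
    (h : MemLp (fun s => adjoint (κ.tau (s + c)) g) 2 vol11) :
    h.toLp _ = ∫ t, κ.tau (t - c) (g t) ∂vol11 := by
  refine ext_inner_left ℂ fun f => ?_
  rw [← integral_inner (κ.integrable_tau_apply c g)]
  have e1 : ∀ t, ⟪f, κ.tau (t - c) (g t)⟫_ℂ = ∫ s, ⟪f s, κ.k (s - t + c) (g t)⟫_ℂ ∂vol11 := by
    intro t
    rw [L2.inner_def]
    refine integral_congr_ae ?_
    filter_upwards [κ.coeFn_tau (t - c) (g t)] with s hs
    rw [hs]; congr 3; ring
  have e2 : ⟪f, h.toLp _⟫_ℂ = ∫ s, ∫ t, ⟪f s, κ.k (s - t + c) (g t)⟫_ℂ ∂vol11 ∂vol11 := by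
    rw [L2.inner_def]
    refine integral_congr_ae ?_
    filter_upwards [h.coeFn_toLp] with s hs
    rw [hs, adjoint_tau_apply, ← integral_inner]
    · refine integral_congr_ae (ae_of_all _ fun t => ?_)
      simp only
      congr 3; ring
    · have := integrable_adjoint_apply (κ.memLp_col (s + c)) (Lp.memLp g)
      refine this.congr (ae_of_all _ fun t => ?_)
      simp only
      rw [← κ.symm, neg_sub]
  simp only [e1, e2]
  rw [integral_integral_swap]
  have hk : StronglyMeasurable fun s => κ.k (s - (-c)) :=
    κ.meas.comp_measurable (by fun_prop)
  have := (integrable_kernel_pair (μ := vol11) (S := Ioo (-1) 1) hk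
      (memLp_comp_sub_right κ.memLp (-c)) (Lp.memLp g) (Lp.memLp f)).swap
  have h3 := (Complex.conjLIE.integrable_comp_iff).2 this
  refine h3.congr (ae_of_all _ fun p => ?_)
  simp only [Function.comp_def, Function.uncurry_def, Prod.snd_swap, Prod.fst_swap, sub_neg_eq_add]
  exact inner_conj_symm _ _

/-- Writing 𝓚 g as a Bochner integral of columns in L₂ allows the functionals σ_y to be moved under
the integral sign. -/
theorem conv_eq_integral (g : L2V V) : κ.conv g = ∫ t, κ.tau t (g t) ∂vol11 := by
  have h := κ.toLp_adjoint_tau_add 0 g (by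
    simpa only [add_zero] using memLp_fam κ.continuous_adjoint_tau g)
  simp only [sub_zero] at h
  rw [← h]
  refine Lp.ext ?_
  filter_upwards [κ.coeFn_conv g, MemLp.coeFn_toLp (by
    simpa only [add_zero] using memLp_fam κ.continuous_adjoint_tau g :
    MemLp (fun s => adjoint (κ.tau (s + 0)) g) 2 vol11)] with s h1 h2
  rw [h1, h2, add_zero]

end DiffKernel

end

/-! ### Trace of the transformation kernel and the effect of the rows on shifted functions. -/

section

variable {V : Type*} [NormedAddCommGroup V] [InnerProductSpace ℂ V] [FiniteDimensional ℂ V]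
  [CompleteSpace V]

open ContinuousLinearMap (adjoint)

theorem integral_vol11 {W : Type*} [NormedAddCommGroup W] [NormedSpace ℝ W] (f : ℝ → W) :
    ∫ t, f t ∂vol11 = ∫ t, (Ioo (-1 : ℝ) 1).indicator f t :=
  (integral_indicator measurableSet_Ioo).symm

theorem ae_vol11_iff {P : ℝ → Prop} :
    (∀ᵐ t ∂vol11, P t) ↔ ∀ᵐ t, t ∈ Ioo (-1 : ℝ) 1 → P t :=
  ae_restrict_iff' measurableSet_Ioo

theorem integrable_clm_apply {μ : Measure ℝ} {T : ℝ → V →L[ℂ] V} {g : ℝ → V} (hT : MemLp T 2 μ)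
    (hg : MemLp g 2 μ) : Integrable (fun t => T t (g t)) μ := by
  refine (MemLp.integrable_mul (p := 2) (q := 2) hT.norm hg.norm).mono ?_ (ae_of_all _ fun s => ?_)
  · exact (ContinuousLinearMap.apply ℂ V).flip.aestronglyMeasurable_comp₂ hT.1 hg.1
  · simpa using (T s).le_opNorm (g s)

theorem integrable_clm_mul {μ : Measure ℝ} {S T : ℝ → V →L[ℂ] V} (hS : MemLp S 2 μ)
    (hT : MemLp T 2 μ) : Integrable (fun t => S t * T t) μ := by
  refine (MemLp.integrable_mul (p := 2) (q := 2) hS.norm hT.norm).mono (hS.1.mul hT.1)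
    (ae_of_all _ fun s => ?_)
  simpa using norm_mul_le (S s) (T s)

/-- The class in `L₂((-1, 1), V)` of a function. -/
def res (F : ℝ → V) : L2V V :=
  open Classical in if h : MemLp F 2 vol11 then h.toLp F else 0

theorem res_of_memLp {F : ℝ → V} (h : MemLp F 2 vol11) : res F = h.toLp F := dif_pos h

theorem coeFn_res {F : ℝ → V} (h : MemLp F 2 vol11) : res F =ᵐ[vol11] F := by
  rw [res_of_memLp h]; exact h.coeFn_toLp

theorem res_add {F G : ℝ → V} (hF : MemLp F 2 vol11) (hG : MemLp G 2 vol11) :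
    res (fun s => F s + G s) = res F + res G := by
  rw [res_of_memLp hF, res_of_memLp hG, ← MemLp.toLp_add]
  exact res_of_memLp (hF.add hG)

namespace DiffKernel

variable (κ : DiffKernel V)

/-- The trace `p_ε(y) = 2 K(ε y, -ε y)` of the transformation kernel, on `(0, 1)`. -/
def pot (ε : ℝ) : ℝ → V →L[ℂ] V :=
  (Ioo (0 : ℝ) 1).indicator fun y => (2 : ℂ) • (κ.green (ε * y) (-(ε * y)) - κ.k (2 * (ε * y)))

/-- The kernel whose product with the trace is integrated in the defect function. -/
def defectKer (ε τ y : ℝ) : V →L[ℂ] V :=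
  κ.k (2 * ε * (τ - y)) - κ.green (-(ε * y)) (ε * (y - 2 * τ))

/-- The defect function; it vanishes identically. -/
def defect (ε τ : ℝ) : V →L[ℂ] V :=
  κ.green (ε * τ) (-(ε * τ)) + ∫ y in Ioo 0 τ, κ.pot ε y * κ.defectKer ε τ y

/-- The right-hand side of the integrated evolution equation of the rows `σ_{ε x}`. -/
def evol (ε x : ℝ) (F : ℝ → V) : V :=
  ∫ y in Ioo 0 x, κ.pot ε y (F (ε * (x - 2 * y)) +
    κ.sigma (-(ε * y)) (res fun s => F (s + ε * (x - y))))

variable {κ} {ε : ℝ}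

theorem sign_ne_zero (hε : ε = 1 ∨ ε = -1) : ε ≠ 0 := by rcases hε with rfl | rfl <;> norm_num

theorem sign_mul_self (hε : ε = 1 ∨ ε = -1) : ε * ε = 1 := by rcases hε with rfl | rfl <;> norm_num

theorem abs_sign_mul (hε : ε = 1 ∨ ε = -1) (y : ℝ) : |ε * y| = |y| := by
  rcases hε with rfl | rfl <;> simp

namespace Coercive

variable (hκ : κ.Coercive)
include hκ

theorem stronglyMeasurable_pot : StronglyMeasurable (κ.pot ε) := by
  refine StronglyMeasurable.indicator ?_ measurableSet_Ioo
  have hg : Continuous fun y : ℝ => κ.green (ε * y) (-(ε * y)) :=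
    hκ.continuous_green.comp (f := fun y : ℝ => (ε * y, -(ε * y))) (by fun_prop)
  have hk : StronglyMeasurable fun y : ℝ => κ.k (2 * (ε * y)) :=
    κ.meas.comp_measurable (by fun_prop)
  exact (hg.stronglyMeasurable.sub hk).const_smul (2 : ℂ)

theorem memLp_pot (hε : ε = 1 ∨ ε = -1) : MemLp (κ.pot ε) 2 volume := by
  have hg : Continuous fun y : ℝ => κ.green (ε * y) (-(ε * y)) :=
    hκ.continuous_green.comp (f := fun y : ℝ => (ε * y, -(ε * y))) (by fun_prop)
  rw [pot, memLp_indicator_iff_restrict measurableSet_Ioo]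
  have h1 := (memLp_of_continuous hg).mono_measure
      (Measure.restrict_mono (Ioo_subset_Ioo_left (by norm_num : (-1 : ℝ) ≤ 0)) le_rfl)
  have h2 := memLp_comp_affine κ.memLp (a := 2 * ε) (by simp [sign_ne_zero hε]) 0
  simp only [add_zero, mul_assoc] at h2
  exact (h1.sub (h2.restrict _)).const_smul (2 : ℂ)

theorem memLp_defectKer (hε : ε = 1 ∨ ε = -1) {τ : ℝ} (hτ1 : τ ≤ 1) :
    MemLp (κ.defectKer ε τ) 2 (volume.restrict (Ioo 0 τ)) := by
  have hg : Continuous fun y : ℝ => κ.green (-(ε * y)) (ε * (y - 2 * τ)) :=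
    hκ.continuous_green.comp (f := fun y : ℝ => (-(ε * y), ε * (y - 2 * τ))) (by fun_prop)
  refine MemLp.sub ?_ ?_
  · have := memLp_comp_affine κ.memLp (a := -(2 * ε)) (by simp [sign_ne_zero hε]) (2 * ε * τ)
    refine (this.restrict _).ae_eq (ae_of_all _ fun y => ?_)
    simp only
    congr 1; ring
  · exact (memLp_of_continuous hg).mono_measure
      (Measure.restrict_mono (Ioo_subset_Ioo (by norm_num) hτ1) le_rfl)

theorem integrable_defect (hε : ε = 1 ∨ ε = -1) {τ : ℝ} (hτ1 : τ ≤ 1) :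
    Integrable (fun y => κ.pot ε y * κ.defectKer ε τ y) (volume.restrict (Ioo 0 τ)) :=
  integrable_clm_mul ((hκ.memLp_pot hε).restrict _) (hκ.memLp_defectKer hε hτ1)

/-- The action of `σ_{-ε y}` on a shifted solution of `(I + 𝓚) g = F` on `(-x, x)`. -/
theorem sigma_shift (hε : ε = 1 ∨ ε = -1) {x y : ℝ} (hy : 0 < y) (hyx : y < x) (hx : x ≤ 1)
    {f : ℝ → V} (hf : MemLp f 2 volume) (hsupp : ∀ t, t ∉ Ioo (-x) x → f t = 0) {g : L2V V}
    (hg : g =ᵐ[vol11] f) :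
    (f (ε * (x - 2 * y)) + adjoint (κ.tau (ε * (x - 2 * y))) g) + κ.sigma (-(ε * y))
      (res fun s => f (s + ε * (x - y)) + adjoint (κ.tau (s + ε * (x - y))) g) =
    f (ε * (x - 2 * y)) + ∫ t, (if ε * t ≤ x - 2 * y then
      (κ.k (ε * (x - 2 * y) - t) - κ.green (-(ε * y)) (t - ε * (x - y))) (g t) else 0) ∂vol11 := by
  set c := ε * (x - y) with hc
  set b := ε * (x - 2 * y) with hb
  have hbc : b = c - ε * y := by rw [hb, hc]; ring
  have habs : |(-(ε * y))| = y := by rw [abs_neg, abs_sign_mul hε, abs_of_pos hy]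
  have m1 : MemLp (fun s => f (s + c)) 2 vol11 := by
    have := memLp_comp_affine hf (a := 1) one_ne_zero c
    simp only [one_mul] at this
    exact this.restrict _
  have m2 : MemLp (fun s => adjoint (κ.tau (s + c)) g) 2 vol11 :=
    memLp_of_continuous ((κ.continuous_adjoint_tau.comp (by fun_prop)).clm_apply continuous_const)
  set σ := κ.sigma (-(ε * y)) with hσ
  set f1 : L2V V := res fun s => f (s + c) with hf1
  set h := cut V y f1 with hh
  have hch : cut V |(-(ε * y))| h = h := by rw [habs, hh, cut_cut]
  have e1 : σ f1 = σ h := by rw [hh, hσ, hκ.sigma_cut_of_le habs.le]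
  have e2 : σ h + σ (κ.conv h) = -adjoint (κ.tau (-(ε * y))) h := by
    rw [← map_add, ← big_apply, hσ, hκ.sigma_big hch]
  have e3 : σ (κ.conv h) = ∫ t, σ (κ.tau t (h t)) ∂vol11 := by
    have hi := κ.integrable_tau_apply 0 h
    simp only [sub_zero] at hi
    rw [conv_eq_integral, ContinuousLinearMap.integral_comp_comm σ hi]
  have e4 : σ (res fun s => adjoint (κ.tau (s + c)) g) = ∫ t, σ (κ.tau (t - c) (g t)) ∂vol11 := by
    rw [res_of_memLp m2, toLp_adjoint_tau_add,
      ContinuousLinearMap.integral_comp_comm σ (κ.integrable_tau_apply c g)]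
  have i1 : ∀ (d : ℝ) (u : L2V V), Integrable (fun t => κ.k (d - t) (u t)) vol11 := by
    intro d u
    have := integrable_adjoint_apply (κ.memLp_col d) (Lp.memLp u)
    refine this.congr (ae_of_all _ fun t => ?_)
    simp only
    rw [← κ.symm, neg_sub]
  have i2 : ∀ (d : ℝ) (u : L2V V), Integrable (fun t => σ (κ.tau (t - d) (u t))) vol11 :=
    fun d u => σ.integrable_comp (κ.integrable_tau_apply d u)
  -- The nonlocal part of F gives the integral of Ψ over the whole interval. The local part,
  -- rewritten with `sigma_big`, gives minus the same integrand over |t - c| < y. Only the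
  -- complementary piece survives.
  set Ψ : ℝ → V → V := fun t v => κ.k (b - t) v + σ (κ.tau (t - c) v) with hΨ
  have hΨ0 : ∀ t, Ψ t 0 = 0 := fun t => by simp [hΨ]
  have e5 : adjoint (κ.tau b) g + ∫ t, σ (κ.tau (t - c) (g t)) ∂vol11 = ∫ t, Ψ t (g t) ∂vol11 := by
    rw [adjoint_tau_apply, ← integral_add (i1 b g) (i2 c g)]
  have e6 : adjoint (κ.tau (-(ε * y))) h + ∫ t, σ (κ.tau t (h t)) ∂vol11 =
      ∫ t, Ψ (t + c) (h t) ∂vol11 := by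
    have := i2 0 h
    simp only [sub_zero] at this
    rw [adjoint_tau_apply, ← integral_add (i1 _ h) this]
    refine integral_congr_ae (ae_of_all _ fun t => ?_)
    simp only [hΨ]
    rw [hbc, add_sub_cancel_right]
    congr 3; ring
  have e7 : ∫ t, Ψ (t + c) (h t) ∂vol11 =
      ∫ t, (if |t - c| < y then Ψ t (g t) else 0) ∂vol11 := by
    have l1 : ∫ t, Ψ (t + c) (h t) ∂vol11 = ∫ t, (if |t| < y then Ψ (t + c) (f (t + c)) else 0) :=
        by
      rw [integral_vol11]
      have := ae_vol11_iff.1 ((coeFn_cut y f1).and (coeFn_res m1))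
      refine integral_congr_ae ?_
      filter_upwards [this] with t ht
      by_cases h1 : t ∈ Ioo (-1 : ℝ) 1
      · obtain ⟨h2, h3⟩ := ht h1
        rw [indicator_of_mem h1, hh, h2]
        by_cases h4 : |t| < y
        · rw [if_pos h4, indicator_of_mem (show t ∈ Ioo (-y) y from abs_lt.1 h4), hf1, h3]
        · rw [if_neg h4, indicator_of_notMem (show t ∉ Ioo (-y) y from fun h5 => h4 (abs_lt.2 h5)),
              hΨ0]
      · rw [indicator_of_notMem h1, if_neg fun h4 => h1 ?_]
        have := abs_lt.1 h4
        exact ⟨by linarith [this.1], by linarith [this.2]⟩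
    have l2 : ∫ t, (if |t - c| < y then Ψ t (g t) else 0) ∂vol11 =
        ∫ t, (if |t - c| < y then Ψ t (f t) else 0) := by
      rw [integral_vol11]
      have := ae_vol11_iff.1 hg
      refine integral_congr_ae ?_
      filter_upwards [this] with t ht
      by_cases h1 : t ∈ Ioo (-1 : ℝ) 1
      · rw [indicator_of_mem h1, ht h1]
      · rw [indicator_of_notMem h1, hsupp t fun h2 => h1 ?_, hΨ0]
        · simp
        · exact ⟨by linarith [h2.1], by linarith [h2.2]⟩
    rw [l1, l2, ← integral_sub_right_eq_self (fun t =>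
      (if |t| < y then Ψ (t + c) (f (t + c)) else 0)) c]
    simp only [sub_add_cancel]
  have i3 : Integrable (fun t => Ψ t (g t)) vol11 := (i1 b g).add (i2 c g)
  have i4 : Integrable (fun t => if |t - c| < y then Ψ t (g t) else 0) vol11 := by
    have hm : MeasurableSet {t : ℝ | |t - c| < y} := by measurability
    refine (i3.indicator hm).congr (ae_of_all _ fun t => ?_)
    simp [indicator_apply]
  have e8 : ∫ t, Ψ t (g t) ∂vol11 - ∫ t, Ψ (t + c) (h t) ∂vol11 = ∫ t, (if ε * t ≤ x - 2 * y then
      (κ.k (b - t) - κ.green (-(ε * y)) (t - c)) (g t) else 0) ∂vol11 := by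
    rw [e7, ← integral_sub i3 i4]
    refine integral_congr_ae ?_
    filter_upwards [hg] with t ht
    by_cases hm : t ∈ Ioo (-x) x
    · have hiff : |t - c| < y ↔ ¬ (ε * t ≤ x - 2 * y) := by
        rw [hc, not_le, abs_lt]
        rcases hε with rfl | rfl
        · constructor
          · intro h; linarith [h.1]
          · intro h; constructor <;> linarith [hm.2]
        · constructor
          · intro h; linarith [h.2]
          · intro h; constructor <;> linarith [hm.1]
      by_cases h1 : ε * t ≤ x - 2 * y
      · rw [if_neg fun h2 => (hiff.1 h2) h1, if_pos h1, sub_zero]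
        simp [hΨ, green, hσ]
      · rw [if_pos (hiff.2 h1), if_neg h1, sub_self]
    · rw [ht, hsupp t hm, hΨ0]
      simp
  rw [res_add m1 m2, map_add, e4]
  have e9 : σ (res fun s => f (s + c)) = -(adjoint (κ.tau (-(ε * y))) h +
      ∫ t, σ (κ.tau t (h t)) ∂vol11) := by
    rw [← hf1, e1, eq_sub_of_add_eq e2, e3]; abel
  rw [e9, e6, ← e8, ← e5]
  abel

end Coercive

end DiffKernel

end

/-! ### The evolution equation up to a defect. -/

section

variable {V : Type*} [NormedAddCommGroup V] [InnerProductSpace ℂ V] [FiniteDimensional ℂ V]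
  [CompleteSpace V]

open ContinuousLinearMap (adjoint)

theorem integral_Ioo_eq_interval {W : Type*} [NormedAddCommGroup W] [NormedSpace ℝ W] {x : ℝ}
    (hx : 0 ≤ x) (f : ℝ → W) : ∫ y in Ioo 0 x, f y = ∫ y in (0 : ℝ)..x, f y := by
  rw [intervalIntegral.integral_of_le hx, integral_Ioc_eq_integral_Ioo]

theorem integral_vol11_of_support {W : Type*} [NormedAddCommGroup W] [NormedSpace ℝ W] {x : ℝ}
    (hx0 : 0 ≤ x) (hx : x ≤ 1) {f : ℝ → W} (hf : ∀ t, t ∉ Ioo (-x) x → f t = 0) :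
    ∫ t, f t ∂vol11 = ∫ t in (-x)..x, f t := by
  rw [intervalIntegral.integral_of_le (by linarith), integral_Ioc_eq_integral_Ioo, integral_vol11,
    ← integral_indicator measurableSet_Ioo]
  congr 1
  ext t
  by_cases h : t ∈ Ioo (-x) x
  · rw [indicator_of_mem h, indicator_of_mem]
    exact ⟨by linarith [h.1], by linarith [h.2]⟩
  · rw [indicator_of_notMem h]
    by_cases h' : t ∈ Ioo (-1 : ℝ) 1
    · rw [indicator_of_mem h', hf t h]
    · rw [indicator_of_notMem h']

namespace DiffKernel

variable {κ : DiffKernel V} {ε : ℝ}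

namespace Coercive

variable (hκ : κ.Coercive)
include hκ

theorem integrable_evol_kernel (hε : ε = 1 ∨ ε = -1) (x : ℝ) (g : L2V V) :
    Integrable (fun p : ℝ × ℝ => if ε * p.2 ≤ x - 2 * p.1 then
      κ.pot ε p.1 ((κ.k (ε * (x - 2 * p.1) - p.2) -
        κ.green (-(ε * p.1)) (p.2 - ε * (x - p.1))) (g p.2)) else 0)
      ((volume.restrict (Ioo 0 x)).prod vol11) := by
  have hgm : AEStronglyMeasurable (fun p : ℝ × ℝ => g p.2)
      ((volume.restrict (Ioo 0 x)).prod vol11) := (Lp.memLp g).1.comp_snd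
  have hpm : StronglyMeasurable fun p : ℝ × ℝ => κ.pot ε p.1 :=
    (hκ.stronglyMeasurable_pot (ε := ε)).comp_measurable measurable_fst
  have hkm : StronglyMeasurable fun p : ℝ × ℝ => κ.k (ε * (x - 2 * p.1) - p.2) :=
    κ.meas.comp_measurable (by fun_prop)
  have hGc : Continuous fun p : ℝ × ℝ => κ.green (-(ε * p.1)) (p.2 - ε * (x - p.1)) :=
    hκ.continuous_green.comp (f := fun p : ℝ × ℝ => (-(ε * p.1), p.2 - ε * (x - p.1)))
      (by fun_prop)
  have hset : MeasurableSet {p : ℝ × ℝ | ε * p.2 ≤ x - 2 * p.1} :=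
    measurableSet_le (by fun_prop) (by fun_prop)
  have happ : ∀ {T : ℝ × ℝ → V →L[ℂ] V} {f : ℝ × ℝ → V} {μ : Measure (ℝ × ℝ)},
      AEStronglyMeasurable T μ → AEStronglyMeasurable f μ →
      AEStronglyMeasurable (fun p => T p (f p)) μ := fun hT hf =>
    (ContinuousLinearMap.apply ℂ V).flip.aestronglyMeasurable_comp₂ hT hf
  have hmeas : AEStronglyMeasurable (fun p : ℝ × ℝ => κ.pot ε p.1 ((κ.k (ε * (x - 2 * p.1) - p.2) -
        κ.green (-(ε * p.1)) (p.2 - ε * (x - p.1))) (g p.2)))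
        ((volume.restrict (Ioo 0 x)).prod vol11) :=
    happ hpm.aestronglyMeasurable (happ (hkm.sub hGc.stronglyMeasurable).aestronglyMeasurable hgm)
  suffices h : Integrable (fun p : ℝ × ℝ => κ.pot ε p.1 ((κ.k (ε * (x - 2 * p.1) - p.2) -
        κ.green (-(ε * p.1)) (p.2 - ε * (x - p.1))) (g p.2)))
        ((volume.restrict (Ioo 0 x)).prod vol11) by
    refine (h.indicator hset).congr (ae_of_all _ fun p => ?_)
    simp [indicator_apply]
  obtain ⟨C, hC⟩ := (isCompact_Icc (a := ((0 : ℝ), (-1 : ℝ))) (b := (x,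
      (1 : ℝ)))).exists_bound_of_continuousOn
    hGc.continuousOn
  have hp := ((hκ.memLp_pot hε).restrict (Ioo 0 x)).norm
  have hg := (Lp.memLp g).norm
  have i1 := integrable_kernel_mul (S := Ioo (-1) 1) (κ.meas.norm.measurable) κ.memLp.norm hp hg
    (φ := fun y => ε * (x - 2 * y)) (by fun_prop)
  have i2 : Integrable (fun p : ℝ × ℝ => ‖κ.pot ε p.1‖ * ‖g p.2‖)
      ((volume.restrict (Ioo 0 x)).prod vol11) :=
    (hp.integrable (by norm_num)).mul_prod (hg.integrable (by norm_num))
  refine (i1.add (i2.const_mul C)).mono' hmeas ?_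
  have hmem : ∀ᵐ p ∂((volume.restrict (Ioo 0 x)).prod vol11), p ∈ Ioo 0 x ×ˢ Ioo (-1 : ℝ) 1 := by
    rw [vol11, Measure.prod_restrict]
    exact ae_restrict_mem (measurableSet_Ioo.prod measurableSet_Ioo)
  filter_upwards [hmem] with p hp
  have hGp : ‖κ.green (-(ε * p.1)) (p.2 - ε * (x - p.1))‖ ≤ C :=
    hC p ⟨⟨hp.1.1.le, hp.2.1.le⟩, ⟨hp.1.2.le, hp.2.2.le⟩⟩
  simp only [Pi.add_apply]
  calc _ ≤ ‖κ.pot ε p.1‖ * (‖κ.k (ε * (x - 2 * p.1) - p.2) -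
        κ.green (-(ε * p.1)) (p.2 - ε * (x - p.1))‖ * ‖g p.2‖) :=
        (ContinuousLinearMap.le_opNorm _ _).trans
          (mul_le_mul_of_nonneg_left (ContinuousLinearMap.le_opNorm _ _) (norm_nonneg _))
    _ ≤ ‖κ.pot ε p.1‖ * ((‖κ.k (ε * (x - 2 * p.1) - p.2)‖ + C) * ‖g p.2‖) := by
        gcongr
        exact (norm_sub_le _ _).trans (by gcongr)
    _ = _ := by ring

/-- By `sigma_shift` and Fubini the left side is one integral against g. With τ = (x - εt)/2, the
coefficient of g(t) collects half the trace, G(ετ, -ετ) - k(2ετ), the kernel k(εx - t) = k(2ετ), and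
an integral; k(2ετ) cancels and `defect` remains. By `sigma_big`, -τ_{εx}^* g is the value of σ_{εx}
on F = f + 𝓚g, so the identity measures the failure of the evolution equation. -/
theorem evol_solution (hε : ε = 1 ∨ ε = -1) {x : ℝ} (hx0 : 0 < x) (hx : x ≤ 1)
    {f : ℝ → V} (hf : MemLp f 2 volume) (hsupp : ∀ t, t ∉ Ioo (-x) x → f t = 0) {g : L2V V}
    (hg : g =ᵐ[vol11] f) :
    κ.evol ε x (fun s => f s + adjoint (κ.tau s) g) + adjoint (κ.tau (ε * x)) g =
      ∫ t, κ.defect ε ((x - ε * t) / 2) (g t) ∂vol11 := by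
  set Θ : ℝ × ℝ → V := fun p => if ε * p.2 ≤ x - 2 * p.1 then
      κ.pot ε p.1 ((κ.k (ε * (x - 2 * p.1) - p.2) -
        κ.green (-(ε * p.1)) (p.2 - ε * (x - p.1))) (g p.2)) else 0 with hΘ
  have hΘi : Integrable Θ ((volume.restrict (Ioo 0 x)).prod vol11) :=
    hκ.integrable_evol_kernel hε x g
  have hfr : MemLp (fun y => f (ε * (x - 2 * y))) 2 volume := by
    have := memLp_comp_affine hf (a := -(2 * ε)) (by simp [sign_ne_zero hε]) (ε * x)
    refine this.ae_eq (ae_of_all _ fun y => ?_)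
    simp only; congr 1; ring
  have e1 : κ.evol ε x (fun s => f s + adjoint (κ.tau s) g) =
      ∫ y in Ioo 0 x, (κ.pot ε y (f (ε * (x - 2 * y))) + ∫ t, Θ (y, t) ∂vol11) := by
    refine setIntegral_congr_fun measurableSet_Ioo fun y hy => ?_
    simp only
    rw [hκ.sigma_shift hε hy.1 hy.2 hx hf hsupp hg, map_add]
    congr 1
    rw [← ContinuousLinearMap.integral_comp_comm]
    · refine integral_congr_ae (ae_of_all _ fun t => ?_)
      simp only [hΘ]
      by_cases h : ε * t ≤ x - 2 * y
      · rw [if_pos h, if_pos h]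
      · rw [if_neg h, if_neg h, map_zero]
    · have hset : MeasurableSet {t : ℝ | ε * t ≤ x - 2 * y} :=
        measurableSet_le (by fun_prop) (by fun_prop)
      have hk : MemLp (fun t => κ.k (ε * (x - 2 * y) - t)) 2 vol11 := by
        have := memLp_comp_affine κ.memLp (a := -1) (by norm_num) (ε * (x - 2 * y))
        refine (this.restrict _).ae_eq (ae_of_all _ fun y => ?_)
        simp only; congr 1; ring
      have hG : MemLp (fun t => κ.green (-(ε * y)) (t - ε * (x - y))) 2 vol11 :=
        memLp_of_continuous (hκ.continuous_green.comp
          (f := fun t : ℝ => (-(ε * y), t - ε * (x - y))) (by fun_prop))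
      refine ((integrable_clm_apply (hk.sub hG) (Lp.memLp g)).indicator hset).congr
        (ae_of_all _ fun t => ?_)
      simp [indicator_apply]
  have i1 : Integrable (fun y => κ.pot ε y (f (ε * (x - 2 * y)))) (volume.restrict (Ioo 0 x)) :=
    integrable_clm_apply ((hκ.memLp_pot hε).restrict _) (hfr.restrict _)
  have i2 : Integrable (fun y => ∫ t, Θ (y, t) ∂vol11) (volume.restrict (Ioo 0 x)) :=
    hΘi.integral_prod_left
  have e2 : ∫ y in Ioo 0 x, κ.pot ε y (f (ε * (x - 2 * y))) =
      ∫ t, ((1 / 2 : ℂ) • κ.pot ε ((x - ε * t) / 2)) (g t) ∂vol11 := by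
    have h1 := integral_comp_reflect hε (fun t => κ.pot ε ((x - ε * t) / 2) (f t)) x
    rw [integral_Ioo_eq_interval hx0.le]
    have h2 : ∀ y, (x - ε * (ε * (x - 2 * y))) / 2 = y := fun y => by
      rw [← mul_assoc, sign_mul_self hε]; ring
    simp only [h2] at h1
    rw [h1, ← integral_vol11_of_support hx0.le hx fun t ht => by rw [hsupp t ht, map_zero],
      ← integral_smul]
    refine integral_congr_ae ?_
    filter_upwards [hg] with t ht
    rw [ht, smul_apply]
    exact (Complex.coe_smul (1 / 2 : ℝ) _).symm.trans (by norm_num)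
  have e0 : ∀ᵐ t ∂vol11, ∫ y in Ioo 0 x, Θ (y, t) =
      (∫ y in Ioo 0 ((x - ε * t) / 2), κ.pot ε y * κ.defectKer ε ((x - ε * t) / 2) y) (g t) := by
    filter_upwards [hg] with t ht
    by_cases hm : t ∈ Ioo (-x) x
    · set τ := (x - ε * t) / 2 with hτ
      have hτ01 : 0 < τ ∧ τ < x := by
        rw [hτ]
        rcases hε with rfl | rfl <;> constructor <;> linarith [hm.1, hm.2]
      rw [ContinuousLinearMap.integral_apply (hκ.integrable_defect hε (by linarith)),
        ← integral_Ioc_eq_integral_Ioo (x := (0 : ℝ)) (y := τ),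
        ← integral_indicator measurableSet_Ioo, ← integral_indicator measurableSet_Ioc]
      congr 1
      ext y
      by_cases hy : y ∈ Ioc 0 τ
      · have hy' : y ∈ Ioo 0 x := ⟨hy.1, hy.2.trans_lt hτ01.2⟩
        rw [indicator_of_mem hy, indicator_of_mem hy']
        have hle : ε * t ≤ x - 2 * y := by have := hy.2; rw [hτ] at this; linarith
        simp only [hΘ]
        rw [if_pos hle, mul_apply_eq_comp, defectKer]
        have a1 : ε * (x - 2 * y) - t = 2 * ε * (τ - y) := by
          rw [hτ]; linear_combination t * (sign_mul_self hε)
        have a2 : t - ε * (x - y) = ε * (y - 2 * τ) := by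
          rw [hτ]; linear_combination -t * (sign_mul_self hε)
        rw [a1, a2]
      · rw [indicator_of_notMem hy]
        by_cases hy' : y ∈ Ioo 0 x
        · rw [indicator_of_mem hy']
          simp only [hΘ]
          rw [if_neg]
          intro h
          refine hy ⟨hy'.1, ?_⟩
          rw [hτ]; linarith
        · rw [indicator_of_notMem hy']
    · rw [ht, hsupp t hm, map_zero]
      simp only [hΘ, ht, hsupp t hm, map_zero]
      simp
  have e3 : ∫ y in Ioo 0 x, ∫ t, Θ (y, t) ∂vol11 =
      ∫ t, (∫ y in Ioo 0 ((x - ε * t) / 2), κ.pot ε y * κ.defectKer ε ((x - ε * t) / 2) y) (g t)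
        ∂vol11 := by
    rw [integral_integral_swap hΘi]
    exact integral_congr_ae e0
  have hpm : MemLp (fun t => κ.pot ε ((x - ε * t) / 2)) 2 vol11 := by
    have := memLp_comp_affine (hκ.memLp_pot hε) (a := -(ε / 2)) (by simp [sign_ne_zero hε]) (x / 2)
    refine (this.restrict _).ae_eq (ae_of_all _ fun t => ?_)
    simp only; congr 1; ring
  have hpm' : MemLp (fun t => (1 / 2 : ℂ) • κ.pot ε ((x - ε * t) / 2)) 2 vol11 :=
    hpm.const_smul (1 / 2 : ℂ)
  have i3 : Integrable (fun t => ((1 / 2 : ℂ) • κ.pot ε ((x - ε * t) / 2)) (g t)) vol11 :=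
    integrable_clm_apply hpm' (Lp.memLp g)
  have i4 : Integrable (fun t => (∫ y in Ioo 0 ((x - ε * t) / 2),
      κ.pot ε y * κ.defectKer ε ((x - ε * t) / 2) y) (g t)) vol11 :=
    hΘi.integral_prod_right.congr e0
  have i34 : Integrable (fun t => ((1 / 2 : ℂ) • κ.pot ε ((x - ε * t) / 2)) (g t) +
      (∫ y in Ioo 0 ((x - ε * t) / 2),
        κ.pot ε y * κ.defectKer ε ((x - ε * t) / 2) y) (g t)) vol11 := i3.add i4
  have i5 : Integrable (fun t => κ.k (ε * x - t) (g t)) vol11 := by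
    have := integrable_adjoint_apply (κ.memLp_col (ε * x)) (Lp.memLp g)
    refine this.congr (ae_of_all _ fun t => ?_)
    simp only
    rw [← κ.symm, neg_sub]
  rw [e1, integral_add i1 i2, e2, e3, adjoint_tau_apply, ← integral_add i3 i4,
    ← integral_add i34 i5]
  refine integral_congr_ae ?_
  filter_upwards [hg] with t ht
  by_cases hm : t ∈ Ioo (-x) x
  · set τ := (x - ε * t) / 2 with hτ
    have hτ01 : 0 < τ ∧ τ < x := by
      rw [hτ]
      rcases hε with rfl | rfl <;> constructor <;> linarith [hm.1, hm.2]
    have hpot : κ.pot ε τ = (2 : ℂ) • (κ.green (ε * τ) (-(ε * τ)) - κ.k (2 * (ε * τ))) := by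
      rw [pot, indicator_of_mem]
      exact ⟨hτ01.1, by linarith⟩
    have a1 : ε * x - t = 2 * (ε * τ) := by
      rw [hτ]; linear_combination t * (sign_mul_self hε)
    rw [hpot, a1, defect, smul_smul]
    simp
    abel
  · rw [ht, hsupp t hm]; simp

end Coercive

end DiffKernel

end

/-! ### The defect vanishes. -/

section

variable {V : Type*} [NormedAddCommGroup V] [InnerProductSpace ℂ V] [FiniteDimensional ℂ V]
  [CompleteSpace V]

open ContinuousLinearMap (adjoint)

theorem sq_integral_mul_le {μ : Measure ℝ} {a b : ℝ → ℝ} (ha0 : ∀ t, 0 ≤ a t) (hb0 : ∀ t, 0 ≤ b t)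
    (ha : MemLp a 2 μ) (hb : MemLp b 2 μ) :
    (∫ t, a t * b t ∂μ) ^ 2 ≤ (∫ t, a t ^ 2 ∂μ) * ∫ t, b t ^ 2 ∂μ := by
  have h := integral_mul_le_Lp_mul_Lq_of_nonneg (μ := μ) (p := 2) (q := 2)
    (Real.HolderConjugate.two_two) (ae_of_all _ ha0) (ae_of_all _ hb0) (by simpa using ha)
    (by simpa using hb)
  have e : ∀ s : ℝ, s ^ (1 / 2 : ℝ) = √s := fun s => (Real.sqrt_eq_rpow s).symm
  simp only [Real.rpow_two, e] at h
  have h0 : 0 ≤ ∫ t, a t * b t ∂μ := integral_nonneg fun t => mul_nonneg (ha0 t) (hb0 t)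
  calc _ ≤ (√(∫ t, a t ^ 2 ∂μ) * √(∫ t, b t ^ 2 ∂μ)) ^ 2 := by gcongr
    _ = _ := by
      rw [mul_pow, Real.sq_sqrt (integral_nonneg fun t => sq_nonneg _),
        Real.sq_sqrt (integral_nonneg fun t => sq_nonneg _)]

theorem norm_integral_clm_apply_sq_le {μ : Measure ℝ} {T : ℝ → V →L[ℂ] V} {g : ℝ → V}
    (hT : MemLp T 2 μ) (hg : MemLp g 2 μ) :
    ‖∫ t, T t (g t) ∂μ‖ ^ 2 ≤ (∫ t, ‖T t‖ ^ 2 ∂μ) * ∫ t, ‖g t‖ ^ 2 ∂μ := by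
  refine le_trans ?_ (sq_integral_mul_le (fun _ => norm_nonneg _) (fun _ => norm_nonneg _)
    hT.norm hg.norm)
  gcongr
  refine norm_integral_le_of_norm_le (MemLp.integrable_mul (p := 2) (q := 2) hT.norm hg.norm)
    (ae_of_all _ fun t => ?_)
  exact (T t).le_opNorm (g t)

theorem integral_norm_sq (g : L2V V) : ∫ t, ‖g t‖ ^ 2 ∂vol11 = ‖g‖ ^ 2 := by
  have h := norm_sq_cut 1 g
  rw [cut_of_one_le le_rfl, one_apply_eq_self] at h
  rw [h]
  refine integral_congr_ae ?_
  filter_upwards [ae_vol11_mem] with t ht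
  rw [indicator_of_mem ht]

namespace DiffKernel

variable {κ : DiffKernel V} {ε : ℝ}

theorem tau_eq_res (t : ℝ) (v : V) : κ.tau t v = res fun s => κ.k (s - t) v := by
  refine Lp.ext ?_
  have h : MemLp (fun s => κ.k (s - t) v) 2 vol11 :=
    (memLp_congr_ae (κ.coeFn_tau t v)).1 (Lp.memLp _)
  filter_upwards [κ.coeFn_tau t v, coeFn_res h] with s h1 h2
  rw [h1, h2]

theorem memLp_comp_add {F : ℝ → V} (hF : MemLp F 2 volume) (c : ℝ) :
    MemLp (fun s => F (s + c)) 2 vol11 := by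
  have := memLp_comp_affine hF (a := 1) one_ne_zero c
  simp only [one_mul] at this
  exact this.restrict _

namespace Coercive

variable (hκ : κ.Coercive)
include hκ

theorem evol_congr (hε : ε = 1 ∨ ε = -1) {x : ℝ} {F F' : ℝ → V}
    (h : ∀ s ∈ Ioo (-x) x, F s = F' s) (hF : ∀ c, MemLp (fun s => F (s + c)) 2 vol11)
    (hF' : ∀ c, MemLp (fun s => F' (s + c)) 2 vol11) : κ.evol ε x F = κ.evol ε x F' := by
  refine setIntegral_congr_fun measurableSet_Ioo fun y hy => ?_
  have h1 : ε * (x - 2 * y) ∈ Ioo (-x) x := by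
    rcases hε with rfl | rfl <;> constructor <;> linarith [hy.1, hy.2]
  have habs : |(-(ε * y))| = y := by rw [abs_neg, abs_sign_mul hε, abs_of_pos hy.1]
  rw [h _ h1, ← hκ.sigma_cut, ← hκ.sigma_cut (-(ε * y)) (res fun s => F' (s + ε * (x - y))), habs]
  congr 3
  refine Lp.ext ?_
  filter_upwards [coeFn_cut y (res fun s => F (s + ε * (x - y))), coeFn_res (hF (ε * (x - y))),
    coeFn_cut y (res fun s => F' (s + ε * (x - y))), coeFn_res (hF' (ε *
        (x - y)))] with s a1 a2 a3 a4
  rw [a1, a3]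
  by_cases hs : s ∈ Ioo (-y) y
  · rw [indicator_of_mem hs, indicator_of_mem hs, a2, a4]
    apply h
    rcases hε with rfl | rfl <;> constructor <;> linarith [hy.1, hy.2, hs.1, hs.2]
  · rw [indicator_of_notMem hs, indicator_of_notMem hs]

/-- Solving the compressed equation on (-x, x) brings an arbitrary F into the form required by
`evol_solution`. The constant is uniform in x because the inverses depend continuously on x. -/
theorem exists_solution (hε : ε = 1 ∨ ε = -1) : ∃ C, 0 ≤ C ∧ ∀ x, 0 < x → x ≤ 1 → ∀ F : ℝ → V,
    MemLp F 2 volume → ∃ g : L2V V, cut V x g = g ∧ ‖g‖ ≤ C * ‖res F‖ ∧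
      κ.evol ε x F = κ.sigma (ε * x) (res F) + ∫ t, κ.defect ε ((x - ε * t) / 2) (g t) ∂vol11 := by
  obtain ⟨C, hC0, hC⟩ := exists_bound_of_continuous (W := L2V V →L[ℂ] L2V V) hκ.continuous_tinv
  refine ⟨C, hC0, fun x hx0 hx F hF => ⟨cut V x (κ.tinv x (res F)), cut_cut _ _, ?_, ?_⟩⟩
  · calc _ ≤ 1 * ‖κ.tinv x (res F)‖ := (cut V x).le_of_opNorm_le (norm_cut_le x) _
      _ ≤ _ := by
        rw [one_mul]
        exact (κ.tinv x).le_of_opNorm_le (hC x ⟨by linarith, hx⟩) _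
  set g := cut V x (κ.tinv x (res F)) with hg
  have hgc : cut V x g = g := cut_cut _ _
  have hsol : g + cut V x (κ.conv g) = cut V x (res F) := by
    have h1 : κ.trunc x g = cut V x (res F) := by
      have e1 : cut V x (κ.tinv x (res F)) = κ.tinv x (cut V x (res F)) :=
        DFunLike.congr_fun (hκ.cut_mul_tinv x) _
      rw [hg, e1]
      exact DFunLike.congr_fun (hκ.trunc_mul_tinv x) _
    rw [trunc_apply, hgc] at h1
    exact h1
  -- A representative of g chosen so that F = f + 𝓚g holds at every point of (-x, x), since `evol`
  -- evaluates F pointwise.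
  set f : ℝ → V := (Ioo (-x) x).indicator fun s => F s - adjoint (κ.tau s) g with hf
  have hcont : Continuous fun s => adjoint (κ.tau s) g :=
    κ.continuous_adjoint_tau.clm_apply continuous_const
  have hFr : MemLp F 2 vol11 := hF.restrict _
  have hfm : MemLp f 2 volume := by
    rw [hf, memLp_indicator_iff_restrict measurableSet_Ioo]
    exact (hF.restrict _).sub ((memLp_of_continuous hcont).mono_measure
      (Measure.restrict_mono (Ioo_subset_Ioo (by linarith) hx) le_rfl))
  have hsupp : ∀ t, t ∉ Ioo (-x) x → f t = 0 := fun t ht => indicator_of_notMem ht _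
  have hgf : g =ᵐ[vol11] f := by
    have e := congrArg (fun u : L2V V => (u : ℝ → V)) hsol
    have e' : (g + cut V x (κ.conv g) : L2V V) =ᵐ[vol11] cut V x (res F) := by rw [hsol]
    filter_upwards [e', Lp.coeFn_add g (cut V x (κ.conv g)), coeFn_cut x (κ.conv g),
      κ.coeFn_conv g, coeFn_cut x (res F), coeFn_res hFr] with s a1 a2 a3 a4 a5 a6
    rw [a2, Pi.add_apply, a3, a5] at a1
    by_cases hs : s ∈ Ioo (-x) x
    · rw [indicator_of_mem hs, indicator_of_mem hs, a4, a6] at a1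
      rw [hf, indicator_of_mem hs, ← a1]; abel
    · rw [indicator_of_notMem hs, indicator_of_notMem hs, add_zero] at a1
      rw [a1, hsupp s hs]
  have hs : κ.sigma (ε * x) (res F) = -adjoint (κ.tau (ε * x)) g := by
    rw [sigma_apply, abs_sign_mul hε, abs_of_pos hx0]
  have he : κ.evol ε x F = κ.evol ε x fun s => f s + adjoint (κ.tau s) g := by
    refine hκ.evol_congr hε (fun s hs => ?_) (memLp_comp_add hF) fun c => ?_
    · rw [hf, indicator_of_mem hs]; abel
    · exact (memLp_comp_add hfm c).add (memLp_of_continuous (hcont.comp (by fun_prop)))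
  rw [he, hs, ← hκ.evol_solution hε hx0 hx hfm hsupp hgf]
  abel

/-- The defect is the error of the evolution equation for the particular function F = k(· + εx) v.
Together with `exists_solution` this makes the defect satisfy a homogeneous Volterra relation. -/
theorem defect_eq (hε : ε = 1 ∨ ε = -1) {x : ℝ} (hx : x ≤ 1) (v : V) :
    κ.defect ε x v = κ.evol ε x (fun s => κ.k (s + ε * x) v) -
      κ.sigma (ε * x) (res fun s => κ.k (s + ε * x) v) := by
  have h1 : ∀ c, (res fun s => κ.k (s + c) v) = κ.tau (-c) v := fun c => by
    rw [tau_eq_res]; simp only [sub_neg_eq_add]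
  rw [defect, add_apply, h1, green, sub_eq_add_neg, add_comm]
  congr 1
  · rw [ContinuousLinearMap.integral_apply (hκ.integrable_defect hε hx)]
    refine setIntegral_congr_fun measurableSet_Ioo fun y hy => ?_
    simp only [mul_apply_eq_comp, defectKer, green, sub_neg_eq_add]
    have h2 : ∀ s, s + ε * (x - y) + ε * x = s + (ε * (x - y) + ε * x) := fun s => by ring
    simp only [h2]
    rw [h1]
    have a1 : 2 * ε * (x - y) = ε * (x - 2 * y) + ε * x := by ring
    have a2 : ε * (y - 2 * x) = -(ε * (x - y) + ε * x) := by ring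
    rw [a1, a2]
    rfl

theorem stronglyMeasurable_defect : StronglyMeasurable (κ.defect ε) := by
  have hG : Continuous fun p : ℝ × ℝ => κ.green (-(ε * p.2)) (ε * (p.2 - 2 * p.1)) :=
    hκ.continuous_green.comp (f := fun p : ℝ × ℝ => (-(ε * p.2), ε * (p.2 - 2 * p.1)))
      (by fun_prop)
  have hg : Continuous fun y : ℝ => κ.green (ε * y) (-(ε * y)) :=
    hκ.continuous_green.comp (f := fun y : ℝ => (ε * y, -(ε * y))) (by fun_prop)
  have hkm : StronglyMeasurable fun p : ℝ × ℝ => κ.k (2 * ε * (p.1 - p.2)) :=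
    κ.meas.comp_measurable (by fun_prop)
  have hpm : StronglyMeasurable fun p : ℝ × ℝ => κ.pot ε p.2 :=
    (hκ.stronglyMeasurable_pot (ε := ε)).comp_measurable measurable_snd
  have hset : MeasurableSet {p : ℝ × ℝ | p.2 ∈ Ioo 0 p.1} := by
    exact (measurableSet_lt measurable_const measurable_snd).inter
      (measurableSet_lt measurable_snd measurable_fst)
  have h1 : StronglyMeasurable (fun p : ℝ × ℝ => {p : ℝ × ℝ | p.2 ∈ Ioo 0 p.1}.indicator
      (fun p => κ.pot ε p.2 * κ.defectKer ε p.1 p.2) p) :=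
    (hpm.mul (hkm.sub hG.stronglyMeasurable)).indicator hset
  have h2 := h1.integral_prod_right' (ν := volume)
  have e : (fun τ => ∫ y in Ioo 0 τ, κ.pot ε y * κ.defectKer ε τ y) = fun τ =>
      ∫ y, {p : ℝ × ℝ | p.2 ∈ Ioo 0 p.1}.indicator
        (fun p => κ.pot ε p.2 * κ.defectKer ε p.1 p.2) (τ, y) := by
    funext τ
    rw [← integral_indicator measurableSet_Ioo]
    rfl
  rw [← e] at h2
  exact hg.stronglyMeasurable.add h2

theorem exists_bound_defect (hε : ε = 1 ∨ ε = -1) :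
    ∃ B, 0 ≤ B ∧ ∀ τ ∈ Ioc (0 : ℝ) 1, ‖κ.defect ε τ‖ ≤ B := by
  have hG : Continuous fun p : ℝ × ℝ => κ.green (-(ε * p.2)) (ε * (p.2 - 2 * p.1)) :=
    hκ.continuous_green.comp (f := fun p : ℝ × ℝ => (-(ε * p.2), ε * (p.2 - 2 * p.1)))
      (by fun_prop)
  have hg : Continuous fun y : ℝ => κ.green (ε * y) (-(ε * y)) :=
    hκ.continuous_green.comp (f := fun y : ℝ => (ε * y, -(ε * y))) (by fun_prop)
  obtain ⟨C, hC⟩ := (isCompact_Icc (a := ((0 : ℝ), (0 : ℝ)))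
    (b := ((1 : ℝ), (1 : ℝ)))).exists_bound_of_continuousOn hG.continuousOn
  obtain ⟨D, hD0, hD⟩ := exists_bound_of_continuous hg
  have hC0 : 0 ≤ C := (norm_nonneg _).trans (hC (0, 0) ⟨le_rfl, by simp⟩)
  have hp := hκ.memLp_pot hε
  have ip2 : Integrable (fun y => ‖κ.pot ε y‖ ^ 2) volume :=
    (memLp_two_iff_integrable_sq_norm hp.1).1 hp
  have ik2 : Integrable (fun y => ‖κ.k y‖ ^ 2) volume :=
    (memLp_two_iff_integrable_sq_norm κ.memLp.1).1 κ.memLp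
  set P := ∫ y, ‖κ.pot ε y‖ ^ 2
  set Q := ∫ y, ‖κ.k y‖ ^ 2
  refine ⟨D + (P + (Q + C ^ 2)), by positivity, fun τ hτ => ?_⟩
  refine (norm_add_le _ _).trans (add_le_add (hD τ ⟨by linarith [hτ.1], hτ.2⟩) ?_)
  have hkτ : Integrable (fun y => ‖κ.k (2 * ε * (τ - y))‖ ^ 2) volume := by
    have := integrable_comp_affine ik2 (a := -(2 * ε)) (by simp [sign_ne_zero hε]) (2 * ε * τ)
    refine this.congr (ae_of_all _ fun y => ?_)
    simp only; congr 3; ring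
  have hkQ : ∫ y, ‖κ.k (2 * ε * (τ - y))‖ ^ 2 ≤ Q := by
    have e1 := Measure.integral_comp_mul_left (fun y => ‖κ.k (y + 2 * ε * τ)‖ ^ 2) (-(2 * ε))
    have e2 : ∀ y, κ.k (-(2 * ε) * y + 2 * ε * τ) = κ.k (2 * ε * (τ - y)) := fun y => by
      congr 1; ring
    simp only [e2] at e1
    rw [e1, integral_add_right_eq_self (fun y => ‖κ.k y‖ ^ 2)]
    have e3 : |(-(2 * ε))⁻¹| = 1 / 2 := by rcases hε with rfl | rfl <;> norm_num
    rw [e3, smul_eq_mul]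
    have : 0 ≤ Q := integral_nonneg fun _ => by positivity
    linarith
  calc ‖∫ y in Ioo 0 τ, κ.pot ε y * κ.defectKer ε τ y‖
      ≤ ∫ y in Ioo 0 τ, (‖κ.pot ε y‖ ^ 2 + (‖κ.k (2 * ε * (τ - y))‖ ^ 2 + C ^ 2)) := by
        refine norm_integral_le_of_norm_le (ip2.restrict.add (hkτ.restrict.add
          (integrable_const_iff.2 (Or.inr (by simp [isFiniteMeasure_restrict]))))) ?_
        filter_upwards [ae_restrict_mem measurableSet_Ioo] with y hy
        have h1 : ‖κ.defectKer ε τ y‖ ≤ ‖κ.k (2 * ε * (τ - y))‖ + C :=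
          (norm_sub_le _ _).trans (by
            gcongr
            exact hC (τ, y) ⟨⟨hτ.1.le, hy.1.le⟩, ⟨hτ.2, by linarith [hy.2, hτ.2]⟩⟩)
        refine (norm_mul_le _ _).trans ?_
        nlinarith [mul_le_mul_of_nonneg_left h1 (norm_nonneg (κ.pot ε y)),
          sq_nonneg (‖κ.pot ε y‖ - (‖κ.k (2 * ε * (τ - y))‖ + C)),
          sq_nonneg (‖κ.k (2 * ε * (τ - y))‖ - C)]
    _ = (∫ y in Ioo 0 τ, ‖κ.pot ε y‖ ^ 2) + ((∫ y in Ioo 0 τ, ‖κ.k (2 * ε * (τ - y))‖ ^ 2) +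
          ∫ y in Ioo 0 τ, C ^ 2) := by
        have ic : Integrable (fun _ : ℝ => C ^ 2) (volume.restrict (Ioo 0 τ)) :=
          integrable_const_iff.2 (Or.inr (by simp [isFiniteMeasure_restrict]))
        have ikc : Integrable (fun y => ‖κ.k (2 * ε * (τ - y))‖ ^ 2 + C ^ 2)
          (volume.restrict (Ioo 0 τ)) := hkτ.restrict.add ic
        rw [integral_add ip2.restrict ikc, integral_add hkτ.restrict ic]
    _ ≤ _ := by
        refine add_le_add ?_ (add_le_add ?_ ?_)
        · exact setIntegral_le_integral ip2 (ae_of_all _ fun _ => by positivity)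
        · exact (setIntegral_le_integral hkτ (ae_of_all _ fun _ => by positivity)).trans hkQ
        · rw [setIntegral_const]
          simp only [Real.volume_real_Ioo_of_le hτ.1.le, sub_zero, smul_eq_mul]
          nlinarith [hτ.2, sq_nonneg C]

/-- Expressing the error for F = k(· + εx) v through `exists_solution` gives defect(x) v = ∫
defect((x - εt)/2) g(t) dt with ‖g‖ ≤ CT‖v‖. Cauchy–Schwarz yields ‖defect(x)‖² ≤ 2(CT)² ∫_0^x
‖defect‖², and Gronwall's inequality applies. -/
theorem defect_eq_zero (hε : ε = 1 ∨ ε = -1) : ∀ τ ∈ Ioc (0 : ℝ) 1, κ.defect ε τ = 0 := by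
  obtain ⟨C, hC0, hC⟩ := hκ.exists_solution hε
  obtain ⟨B, hB0, hB⟩ := hκ.exists_bound_defect hε
  obtain ⟨T, hT0, hT⟩ := exists_bound_of_continuous (W := V →L[ℂ] L2V V) κ.continuous_tau
  have hm := (hκ.stronglyMeasurable_defect (ε := ε))
  -- The summand 1 in the constant only secures strict positivity.
  have key := eq_zero_of_le_integral (h := fun x => ‖κ.defect ε x‖ ^ 2)
    (hm.norm.measurable.pow_const 2) (fun x => by positivity) (B := B ^ 2)
    (C := 2 * (C * T) ^ 2 + 1) (by positivity) (fun x hx => by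
      have := hB x hx
      gcongr) ?_
  · intro τ hτ
    simpa using key τ hτ
  intro x hx
  have hJ0 : 0 ≤ ∫ t in (0 : ℝ)..x, ‖κ.defect ε t‖ ^ 2 :=
    intervalIntegral.integral_nonneg hx.1.le fun _ _ => by positivity
  set J := ∫ t in (0 : ℝ)..x, ‖κ.defect ε t‖ ^ 2 with hJ
  suffices h : ‖κ.defect ε x‖ ≤ √(2 * J) * (C * T) by
    have h2 : ‖κ.defect ε x‖ ^ 2 ≤ (√(2 * J) * (C * T)) ^ 2 := by gcongr
    rw [mul_pow, Real.sq_sqrt (by positivity)] at h2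
    nlinarith
  refine ContinuousLinearMap.opNorm_le_bound _ (by positivity) fun v => ?_
  have hF : MemLp (fun s => κ.k (s + ε * x) v) 2 volume := by
    have := memLp_comp_affine κ.memLp (a := 1) one_ne_zero (ε * x)
    simp only [one_mul] at this
    exact (ContinuousLinearMap.apply ℂ V v : (V →L[ℂ] V) →L[ℂ] V).comp_memLp' this
  obtain ⟨g, hg1, hg2, hg3⟩ := hC x hx.1 hx.2 _ hF
  rw [hκ.defect_eq hε hx.2, hg3, add_sub_cancel_left]
  have hres : ‖res fun s => κ.k (s + ε * x) v‖ ≤ T * ‖v‖ := by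
    have e : (res fun s => κ.k (s + ε * x) v) = κ.tau (-(ε * x)) v := by
      rw [tau_eq_res]; simp only [sub_neg_eq_add]
    rw [e]
    refine (κ.tau _).le_of_opNorm_le (hT _ ?_) v
    rcases hε with rfl | rfl <;> constructor <;> linarith [hx.1, hx.2]
  -- The defect is controlled only for arguments in (0, 1]; outside (-x, x) the function g vanishes,
  -- so cutting off changes nothing.
  set S : ℝ → V →L[ℂ] V := (Ioo (-x) x).indicator fun t => κ.defect ε ((x - ε * t) / 2) with hS
  have hSm : StronglyMeasurable S :=
    (hm.comp_measurable (by fun_prop)).indicator measurableSet_Ioo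
  have hSb : ∀ t, ‖S t‖ ≤ B := by
    intro t
    by_cases ht : t ∈ Ioo (-x) x
    · rw [hS, indicator_of_mem ht]
      refine hB _ ?_
      rcases hε with rfl | rfl <;> constructor <;> linarith [ht.1, ht.2, hx.2]
    · rw [hS, indicator_of_notMem ht, norm_zero]; exact hB0
  have hSL : MemLp S 2 vol11 := MemLp.of_bound hSm.aestronglyMeasurable B (ae_of_all _ hSb)
  have e1 : ∫ t, κ.defect ε ((x - ε * t) / 2) (g t) ∂vol11 = ∫ t, S t (g t) ∂vol11 := by
    refine integral_congr_ae ?_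
    have h1 := coeFn_cut x g
    rw [hg1] at h1
    filter_upwards [h1] with t ht
    by_cases hm : t ∈ Ioo (-x) x
    · rw [hS, indicator_of_mem hm]
    · rw [ht, indicator_of_notMem hm, map_zero, map_zero]
  have e2 : ∫ t, ‖S t‖ ^ 2 ∂vol11 = 2 * J := by
    rw [integral_vol11_of_support hx.1.le hx.2 fun t ht => by
      rw [hS, indicator_of_notMem ht]; simp]
    have h1 := integral_comp_reflect hε (fun t => ‖S t‖ ^ 2) x
    have h2 : ∫ y in (0 : ℝ)..x, ‖S (ε * (x - 2 * y))‖ ^ 2 = J := by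
      rw [hJ, ← integral_Ioo_eq_interval hx.1.le, ← integral_Ioo_eq_interval hx.1.le]
      refine setIntegral_congr_fun measurableSet_Ioo fun y hy => ?_
      have hmem : ε * (x - 2 * y) ∈ Ioo (-x) x := by
        rcases hε with rfl | rfl <;> constructor <;> linarith [hy.1, hy.2]
      have h2 : (x - ε * (ε * (x - 2 * y))) / 2 = y := by
        rw [← mul_assoc, sign_mul_self hε]; ring
      simp only [hS, indicator_of_mem hmem, h2]
    rw [h2, smul_eq_mul] at h1
    linarith
  rw [e1]
  have h3 := norm_integral_clm_apply_sq_le hSL (Lp.memLp g)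
  rw [e2, integral_norm_sq] at h3
  have h4 : ‖∫ t, S t (g t) ∂vol11‖ ≤ √(2 * J) * ‖g‖ := by
    refine le_of_sq_le_sq ?_ (by positivity)
    rwa [mul_pow, Real.sq_sqrt (by positivity)]
  refine h4.trans ?_
  rw [mul_assoc]
  gcongr
  refine hg2.trans ?_
  rw [mul_assoc]
  gcongr

/-- The evolution equation of the rows `σ_{ε x}`. -/
theorem sigma_eq_evol (hε : ε = 1 ∨ ε = -1) {x : ℝ} (hx0 : 0 < x) (hx : x ≤ 1) {F : ℝ → V}
    (hF : MemLp F 2 volume) : κ.sigma (ε * x) (res F) = κ.evol ε x F := by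
  obtain ⟨C, -, hC⟩ := hκ.exists_solution hε
  obtain ⟨g, hg1, -, hg3⟩ := hC x hx0 hx F hF
  rw [hg3, left_eq_add]
  refine integral_eq_zero_of_ae ?_
  have h1 := coeFn_cut x g
  rw [hg1] at h1
  filter_upwards [h1] with t ht
  by_cases hm : t ∈ Ioo (-x) x
  · rw [hκ.defect_eq_zero hε, zero_apply, Pi.zero_apply]
    rcases hε with rfl | rfl <;> constructor <;> linarith [hm.1, hm.2]
  · rw [ht, indicator_of_notMem hm, map_zero, Pi.zero_apply]

end Coercive

end DiffKernel

end

/-! ### The product rule for primitives and the transformed exponentials. -/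

section

variable {V : Type*} [NormedAddCommGroup V] [InnerProductSpace ℂ V] [FiniteDimensional ℂ V]
  [CompleteSpace V]

open ContinuousLinearMap (adjoint)

section Primitive

variable {U W Z : Type*} [NormedAddCommGroup U] [NormedSpace ℝ U] [NormedAddCommGroup W]
  [NormedSpace ℝ W] [NormedAddCommGroup Z] [NormedSpace ℝ Z]
  [CompleteSpace U] [CompleteSpace W] [CompleteSpace Z]

omit [CompleteSpace U] in
theorem intervalIntegral_eq_indicator {x t : ℝ} (ht : t ∈ Ioc 0 x) (h : ℝ → U) :
    ∫ s in (0 : ℝ)..t, h s = ∫ s in Ioc 0 x, (Iic t).indicator h s := by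
  rw [intervalIntegral.integral_of_le ht.1.le, integral_indicator measurableSet_Iic,
    Measure.restrict_restrict measurableSet_Iic]
  congr 2
  ext s
  simp only [mem_Ioc, mem_inter_iff, mem_Iic]
  have := ht.2
  grind

omit [CompleteSpace U] in
theorem continuousOn_primitive_Icc {x : ℝ} {h : ℝ → U} (hh : IntegrableOn h (Ioc 0 x)) :
    ContinuousOn (fun t => ∫ s in (0 : ℝ)..t, h s) (Icc 0 x) := by
  have := intervalIntegral.continuousOn_primitive ((integrableOn_Icc_iff_integrableOn_Ioc
      (by simp)).2 hh)
  refine this.congr fun t ht => ?_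
  exact intervalIntegral.integral_of_le ht.1

/-- Both terms are integrals of B(f s)(g t) over the two triangles of a square, whose common
diagonal is null. Integrability is enough; no pointwise derivatives occur. -/
theorem integral_bilin_primitive (B : U →L[ℝ] W →L[ℝ] Z) {x : ℝ} (hx : 0 ≤ x) {f : ℝ → U}
    {g : ℝ → W} (hf : IntegrableOn f (Ioc 0 x)) (hg : IntegrableOn g (Ioc 0 x)) :
    (∫ t in (0 : ℝ)..x, B (f t) (∫ s in (0 : ℝ)..t, g s)) +
      ∫ t in (0 : ℝ)..x, B (∫ s in (0 : ℝ)..t, f s) (g t) =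
      B (∫ t in (0 : ℝ)..x, f t) (∫ t in (0 : ℝ)..x, g t) := by
  set ν := volume.restrict (Ioc 0 x) with hν
  have hf' : Integrable f ν := hf
  have hg' : Integrable g ν := hg
  have hΘ : Integrable (fun p : ℝ × ℝ => B (f p.1) (g p.2)) (ν.prod ν) := by
    refine ((hf'.norm.const_mul ‖B‖).mul_prod hg'.norm).mono'
      (B.aestronglyMeasurable_comp₂ hf'.1.comp_fst hg'.1.comp_snd) (ae_of_all _ fun p => ?_)
    exact B.le_opNorm₂ _ _
  have m1 : MeasurableSet {p : ℝ × ℝ | p.2 ≤ p.1} := measurableSet_le measurable_snd measurable_fst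
  have m2 : MeasurableSet {p : ℝ × ℝ | p.1 ≤ p.2} := measurableSet_le measurable_fst measurable_snd
  have i1 := hΘ.indicator m1
  have i2 := hΘ.indicator m2
  have e1 : ∫ t in (0 : ℝ)..x, B (f t) (∫ s in (0 : ℝ)..t, g s) =
      ∫ p, {p : ℝ × ℝ | p.2 ≤ p.1}.indicator (fun p => B (f p.1) (g p.2)) p ∂(ν.prod ν) := by
    rw [integral_prod _ i1, intervalIntegral.integral_of_le hx]
    refine setIntegral_congr_fun measurableSet_Ioc fun t ht => ?_
    rw [intervalIntegral_eq_indicator ht g, ← ContinuousLinearMap.integral_comp_comm _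
        (hg'.indicator measurableSet_Iic)]
    refine integral_congr_ae (ae_of_all _ fun s => ?_)
    by_cases h : s ≤ t <;> simp [indicator, h]
  have e2 : ∫ t in (0 : ℝ)..x, B (∫ s in (0 : ℝ)..t, f s) (g t) =
      ∫ p, {p : ℝ × ℝ | p.1 ≤ p.2}.indicator (fun p => B (f p.1) (g p.2)) p ∂(ν.prod ν) := by
    rw [integral_prod_symm _ i2, intervalIntegral.integral_of_le hx]
    refine setIntegral_congr_fun measurableSet_Ioc fun t ht => ?_
    rw [intervalIntegral_eq_indicator ht f, ← ContinuousLinearMap.flip_apply,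
      ← ContinuousLinearMap.integral_comp_comm _ (hf'.indicator measurableSet_Iic)]
    refine integral_congr_ae (ae_of_all _ fun s => ?_)
    by_cases h : s ≤ t <;> simp [indicator, h]
  rw [e1, e2, ← integral_add i1 i2,
    intervalIntegral.integral_of_le hx, intervalIntegral.integral_of_le hx,
    ← ContinuousLinearMap.integral_comp_comm _ hg']
  have e3 : ∫ t, B (∫ s, f s ∂ν) (g t) ∂ν = ∫ t, ∫ s, B (f s) (g t) ∂ν ∂ν := by
    refine integral_congr_ae (ae_of_all _ fun t => ?_)
    simp only
    rw [← ContinuousLinearMap.flip_apply, ← ContinuousLinearMap.integral_comp_comm _ hf']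
    rfl
  rw [e3, ← integral_prod_symm _ hΘ]
  refine integral_congr_ae ?_
  have hd : ∀ᵐ p ∂(ν.prod ν), p.1 ≠ p.2 := by
    have hm : MeasurableSet {p : ℝ × ℝ | p.1 ≠ p.2} :=
      (measurableSet_eq_fun measurable_fst measurable_snd).compl
    rw [Measure.ae_prod_iff_ae_ae hm]
    refine ae_of_all _ fun t => ?_
    have : ∀ᵐ s ∂ν, s ≠ t := ae_restrict_of_ae (Measure.ae_ne volume t)
    filter_upwards [this] with s hs
    exact hs.symm
  filter_upwards [hd] with p hp
  rcases lt_or_gt_of_ne hp with h | h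
  · simp [indicator, h.le, not_le.2 h]
  · simp [indicator, h.le, not_le.2 h]

/-- The product rule for primitives of integrable functions. -/
theorem bilin_primitive_eq (B : U →L[ℝ] W →L[ℝ] Z) {x : ℝ} (hx : 0 ≤ x) {F f : ℝ → U}
    {G g : ℝ → W} (hf : IntegrableOn f (Ioc 0 x)) (hg : IntegrableOn g (Ioc 0 x))
    (hF : ∀ t ∈ Icc 0 x, F t = F 0 + ∫ s in (0 : ℝ)..t, f s)
    (hG : ∀ t ∈ Icc 0 x, G t = G 0 + ∫ s in (0 : ℝ)..t, g s) :
    B (F x) (G x) = B (F 0) (G 0) + ∫ t in (0 : ℝ)..x, (B (f t) (G t) + B (F t) (g t)) := by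
  have hfi : IntervalIntegrable f volume 0 x := (intervalIntegrable_iff_integrableOn_Ioc_of_le hx).2 hf
  have hgi : IntervalIntegrable g volume 0 x := (intervalIntegrable_iff_integrableOn_Ioc_of_le hx).2 hg
  have i1 : IntervalIntegrable (fun t => B (f t) (∫ s in (0 : ℝ)..t, g s)) volume 0 x := by
    rw [intervalIntegrable_iff_integrableOn_Ioc_of_le hx]
    obtain ⟨C, hC⟩ := isCompact_Icc.exists_bound_of_continuousOn (continuousOn_primitive_Icc hg)
    refine (hf.norm.const_mul (‖B‖ * C)).mono' (B.aestronglyMeasurable_comp₂ hf.1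
      (((continuousOn_primitive_Icc hg).mono Ioc_subset_Icc_self).aestronglyMeasurable measurableSet_Ioc)) ?_
    filter_upwards [ae_restrict_mem measurableSet_Ioc] with t ht
    refine (B.le_opNorm₂ _ _).trans ?_
    have := hC t (Ioc_subset_Icc_self ht)
    calc _ ≤ ‖B‖ * ‖f t‖ * C := by gcongr
      _ = _ := by ring
  have i2 : IntervalIntegrable (fun t => B (∫ s in (0 : ℝ)..t, f s) (g t)) volume 0 x := by
    rw [intervalIntegrable_iff_integrableOn_Ioc_of_le hx]
    obtain ⟨C, hC⟩ := isCompact_Icc.exists_bound_of_continuousOn (continuousOn_primitive_Icc hf)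
    refine (hg.norm.const_mul (‖B‖ * C)).mono' (B.aestronglyMeasurable_comp₂
      (((continuousOn_primitive_Icc hf).mono Ioc_subset_Icc_self).aestronglyMeasurable measurableSet_Ioc) hg.1) ?_
    filter_upwards [ae_restrict_mem measurableSet_Ioc] with t ht
    refine (B.le_opNorm₂ _ _).trans ?_
    have := hC t (Ioc_subset_Icc_self ht)
    gcongr
  have i3 : IntervalIntegrable (fun t => B (f t) (G 0)) volume 0 x :=
    ⟨(B.flip (G 0)).integrable_comp hfi.1, (B.flip (G 0)).integrable_comp hfi.2⟩
  have i4 : IntervalIntegrable (fun t => B (F 0) (g t)) volume 0 x :=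
    ⟨(B (F 0)).integrable_comp hgi.1, (B (F 0)).integrable_comp hgi.2⟩
  have e : ∫ t in (0 : ℝ)..x, (B (f t) (G t) + B (F t) (g t)) = ∫ t in (0 : ℝ)..x,
      ((B (f t) (G 0) + B (f t) (∫ s in (0 : ℝ)..t, g s)) +
        (B (F 0) (g t) + B (∫ s in (0 : ℝ)..t, f s) (g t))) := by
    refine intervalIntegral.integral_congr fun t ht => ?_
    rw [uIcc_of_le hx] at ht
    rw [hF t ht, hG t ht, map_add, map_add, add_apply]
  have e1 : ∫ t in (0 : ℝ)..x, B (f t) (G 0) = B (∫ t in (0 : ℝ)..x, f t) (G 0) :=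
    ContinuousLinearMap.intervalIntegral_comp_comm (B.flip (G 0)) hfi
  have e2 : ∫ t in (0 : ℝ)..x, B (F 0) (g t) = B (F 0) (∫ t in (0 : ℝ)..x, g t) :=
    ContinuousLinearMap.intervalIntegral_comp_comm (B (F 0)) hgi
  rw [e, intervalIntegral.integral_add (i3.add i1) (i4.add i2), intervalIntegral.integral_add i3 i1,
    intervalIntegral.integral_add i4 i2, e1, e2, hF x (right_mem_Icc.2 hx), hG x
        (right_mem_Icc.2 hx),
    map_add, map_add, add_apply, add_apply, ← integral_bilin_primitive B hx hf hg]
  abel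

end Primitive

section Exponential

theorem memLp_exp (l : ℝ) :
    MemLp (fun t : ℝ => Complex.exp (Complex.I * l * t) • (1 : V →L[ℂ] V)) 2 vol11 :=
  memLp_of_continuous (by fun_prop)

/-- The columns `v ↦ e^{i l t} v`. -/
def expCol (l : ℝ) : V →L[ℂ] L2V V := colOp ((memLp_exp l).toLp _)

theorem coeFn_expCol (l : ℝ) (v : V) :
    expCol l v =ᵐ[vol11] fun t : ℝ => Complex.exp (Complex.I * l * t) • v := by
  filter_upwards [coeFn_colOp ((memLp_exp (V := V) l).toLp _) v, (memLp_exp (V := V) l).coeFn_toLp]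
    with s h1 h2
  rw [expCol, h1, h2]
  rfl

theorem adjoint_expCol_apply (l : ℝ) (g : L2V V) :
    adjoint (expCol l) g = ∫ t : ℝ, Complex.exp (-(Complex.I * l * t)) • g t ∂vol11 := by
  rw [expCol, adjoint_colOp_apply]
  refine integral_congr_ae ?_
  filter_upwards [(memLp_exp (V := V) l).coeFn_toLp] with t h
  rw [h, map_smulₛₗ]
  have : adjoint (1 : V →L[ℂ] V) = 1 := ContinuousLinearMap.adjoint_id
  rw [this, ← Complex.exp_conj, smul_apply, one_apply_eq_self]
  simp

end Exponential

namespace DiffKernel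

variable (κ : DiffKernel V) {ε : ℝ}

/-- The transformed exponentials `e^{i l y} + σ_y e^{i l ·}`. -/
def phi (y l : ℝ) : V →L[ℂ] V :=
  Complex.exp (Complex.I * l * y) • (1 : V →L[ℂ] V) + κ.sigma y ∘L expCol l

theorem phi_apply (y l : ℝ) (v : V) :
    κ.phi y l v = Complex.exp (Complex.I * l * y) • v + κ.sigma y (expCol l v) := rfl

theorem phi_zero (l : ℝ) (v : V) : κ.phi 0 l v = v := by
  rw [phi_apply, sigma_apply, abs_zero, cut_of_nonpos le_rfl]
  simp

variable {κ}

namespace Coercive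

variable (hκ : κ.Coercive)
include hκ

theorem continuous_phi (l : ℝ) : Continuous fun y => κ.phi y l :=
  ((by fun_prop : Continuous fun y : ℝ => Complex.exp (Complex.I * l * y)).smul
    continuous_const).add (hκ.continuous_sigma.clm_comp continuous_const)

theorem trafo_expCol (l : ℝ) (v : V) :
    hκ.trafo κ (expCol l v) =ᵐ[vol11] fun y => κ.phi y l v := by
  have e : hκ.trafo κ (expCol l v) = expCol l v + hκ.lower κ (expCol l v) := rfl
  rw [e]
  filter_upwards [Lp.coeFn_add (expCol l v) (hκ.lower κ (expCol l v)), coeFn_expCol l v,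
    hκ.coeFn_lower (expCol l v)] with y h1 h2 h3
  rw [h1, Pi.add_apply, h2, h3, phi_apply]

/-- Exponentials are eigenfunctions of translations, so the shifts in the evolution equation become
scalar factors and the equation takes variation-of-constants form. -/
theorem phi_evol (hε : ε = 1 ∨ ε = -1) {x : ℝ} (hx0 : 0 ≤ x) (hx : x ≤ 1) (l : ℝ) (v : V) :
    κ.phi (ε * x) l v = Complex.exp (Complex.I * (ε * l) * x) • (v + ∫ y in (0 : ℝ)..x,
      Complex.exp (-(Complex.I * (ε * l) * y)) • κ.pot ε y (κ.phi (-(ε * y)) l v)) := by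
  rcases hx0.eq_or_lt with rfl | hx0
  · simp [phi_zero]
  -- The evolution equation needs F in L₂(ℝ). The arguments s + c with |s| < 1 and |c| < 2 stay
  -- inside (-3, 3), so this cutoff is never noticed.
  set F : ℝ → V := (Ioo (-3) 3).indicator fun s => Complex.exp (Complex.I * l * s) • v with hF
  have hFm : MemLp F 2 volume := by
    rw [hF, memLp_indicator_iff_restrict measurableSet_Ioo]
    refine MemLp.of_bound (C := ‖v‖) (Continuous.aestronglyMeasurable (by fun_prop))
      (ae_of_all _ fun s => ?_)
    rw [norm_smul, show Complex.I * l * s = ((l * s : ℝ) : ℂ) * Complex.I by push_cast; ring,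
      Complex.norm_exp_ofReal_mul_I, one_mul]
  have hres : ∀ c : ℝ, |c| < 2 → (res fun s => F (s + c)) =
      Complex.exp (Complex.I * l * c) • expCol l v := by
    intro c hc
    rw [abs_lt] at hc
    refine Lp.ext ?_
    filter_upwards [coeFn_res (DiffKernel.memLp_comp_add hFm c), Lp.coeFn_smul
      (Complex.exp (Complex.I * l * c)) (expCol l v), coeFn_expCol l v,
          ae_vol11_mem] with s h1 h2 h3 h4
    rw [h1, h2, Pi.smul_apply, h3, hF, indicator_of_mem, smul_smul, ← Complex.exp_add]
    · congr 2; push_cast; ring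
    · constructor <;> linarith [h4.1, h4.2, hc.1, hc.2]
  have h0 : res F = expCol l v := by
    have := hres 0 (by simp)
    simpa using this
  have h := hκ.sigma_eq_evol hε hx0 hx hFm
  rw [phi_apply, ← h0, h, smul_add]
  congr 1
  · congr 2; push_cast; ring
  rw [evol, integral_Ioo_eq_interval hx0.le, ← intervalIntegral.integral_smul,
    ← integral_Ioo_eq_interval hx0.le, ← integral_Ioo_eq_interval hx0.le]
  refine setIntegral_congr_fun measurableSet_Ioo fun y hy => ?_
  rw [hres, smul_smul, ← Complex.exp_add]
  · rw [← map_smul (κ.pot ε y)]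
    congr 1
    have hm : ε * (x - 2 * y) ∈ Ioo (-3 : ℝ) 3 := by
      rcases hε with rfl | rfl <;> constructor <;> linarith [hy.1, hy.2]
    rw [hF, indicator_of_mem hm, phi_apply, smul_add, smul_smul, ← Complex.exp_add, map_smul]
    congr 3 <;> · push_cast; ring
  · rw [abs_sign_mul hε, abs_lt]
    constructor <;> linarith [hy.1, hy.2]

theorem integrable_pot_phi (hε : ε = 1 ∨ ε = -1) (l : ℝ) (v : V) :
    IntegrableOn (fun y => κ.pot ε y (κ.phi (-(ε * y)) l v)) (Ioc 0 1) := by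
  refine integrable_clm_apply ((hκ.memLp_pot hε).restrict _) ?_
  have hc : Continuous fun y => κ.phi (-(ε * y)) l v :=
    ((hκ.continuous_phi l).comp (by fun_prop : Continuous fun y : ℝ => -(ε * y))).clm_apply
      continuous_const
  have := (memLp_of_continuous hc).mono_measure
      (Measure.restrict_mono (Ioo_subset_Ioo_left (by norm_num : (-1 : ℝ) ≤ 0)) le_rfl)
  rwa [restrict_Ioo_eq_restrict_Ioc] at this

/-- The product rule removes the integrating factor. The cases ε = 1 and ε = -1 couple φ(x) with
φ(-x) and together form the Dirac system. -/
theorem phi_eq_integral (hε : ε = 1 ∨ ε = -1) {x : ℝ} (hx : x ∈ Icc (0 : ℝ) 1) (l : ℝ) (v : V) :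
    κ.phi (ε * x) l v = v + ∫ y in (0 : ℝ)..x, ((Complex.I * (ε * l)) • κ.phi (ε * y) l v +
      κ.pot ε y (κ.phi (-(ε * y)) l v)) := by
  set c : ℂ := Complex.I * (ε * l) with hc
  set E : ℝ → ℂ := fun t => Complex.exp (c * t) with hE
  set g : ℝ → V := fun y => Complex.exp (-(c * y)) • κ.pot ε y (κ.phi (-(ε * y)) l v) with hg
  set G : ℝ → V := fun t => v + ∫ y in (0 : ℝ)..t, g y with hG
  have hgi : IntegrableOn g (Ioc 0 1) := by
    have hcont : Continuous fun y : ℝ => Complex.exp (-(c * y)) := by fun_prop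
    obtain ⟨C, hC⟩ := (isCompact_Icc (a := (0 : ℝ)) (b := 1)).exists_bound_of_continuousOn
      hcont.continuousOn
    refine Integrable.bdd_smul (C := C) (hκ.integrable_pot_phi hε l v)
      hcont.aestronglyMeasurable ?_
    filter_upwards [ae_restrict_mem measurableSet_Ioc] with t ht
    exact hC t (Ioc_subset_Icc_self ht)
  have hEd : ∀ t : ℝ, HasDerivAt E (c * E t) t := by
    intro t
    have h1 : HasDerivAt (fun t : ℝ => c * (t : ℂ)) (c * 1) t :=
      (Complex.ofRealCLM.hasDerivAt (x := t)).const_mul c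
    have := h1.cexp
    simpa [hE, mul_comm] using this
  have hEc : Continuous E := by rw [hE]; fun_prop
  have hEF : ∀ t ∈ Icc 0 x, E t = E 0 + ∫ s in (0 : ℝ)..t, c * E s := by
    intro t _
    rw [intervalIntegral.integral_eq_sub_of_hasDerivAt (fun s _ => hEd s)
      ((continuous_const.mul hEc).intervalIntegrable _ _)]
    ring
  have key := bilin_primitive_eq (ContinuousLinearMap.lsmul ℝ ℂ : ℂ →L[ℝ] V →L[ℝ] V) hx.1 (F := E)
    (f := fun s => c * E s) (G := G) (g := g) ((continuous_const.mul hEc).integrableOn_Ioc)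
    (hgi.mono_set (Ioc_subset_Ioc_right hx.2)) hEF (fun t _ => by simp [hG])
  simp only [ContinuousLinearMap.lsmul_apply] at key
  have hphi : ∀ t ∈ Icc (0 : ℝ) 1, κ.phi (ε * t) l v = E t • G t := fun t ht =>
    hκ.phi_evol hε ht.1 ht.2 l v
  rw [hphi x hx, key]
  congr 1
  · simp [hE, hG]
  · refine intervalIntegral.integral_congr fun t ht => ?_
    rw [uIcc_of_le hx.1] at ht
    rw [hphi t ⟨ht.1, ht.2.trans hx.2⟩, hg, hE]
    simp only [smul_smul]
    rw [← Complex.exp_add, add_neg_cancel, Complex.exp_zero, one_smul]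

theorem adjoint_pot (x : ℝ) : adjoint (κ.pot 1 x) = κ.pot (-1) x := by
  by_cases h : x ∈ Ioo (0 : ℝ) 1
  · rw [pot, pot, indicator_of_mem h, indicator_of_mem h, map_smulₛₗ, map_sub, ← κ.symm]
    have h1 := hκ.adjoint_green x
    simp only [one_mul, neg_mul, neg_neg, mul_neg] at h1 ⊢
    rw [h1]
    have h2 : (starRingEnd ℂ) 2 = 2 := map_ofNat (starRingEnd ℂ) 2
    rw [h2]
  · rw [pot, pot, indicator_of_notMem h, indicator_of_notMem h, map_zero]

end Coercive

end DiffKernel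

end

/-! ### Vector valued Fourier series on (-1, 1). -/

section

variable {V : Type*} [NormedAddCommGroup V] [InnerProductSpace ℂ V] [FiniteDimensional ℂ V]
  [CompleteSpace V]

open ContinuousLinearMap (adjoint)

section Fourier

theorem adjoint_expCol_expCol (l l' : ℝ) (v : V) : adjoint (expCol l) (expCol l' v) =
    (∫ t in (-1 : ℝ)..1, Complex.exp (Complex.I * ((l' : ℂ) - l) * t)) • v := by
  rw [adjoint_expCol_apply, intervalIntegral.integral_of_le (by norm_num),
    integral_Ioc_eq_integral_Ioo, ← integral_smul_const]
  refine integral_congr_ae ?_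
  filter_upwards [coeFn_expCol l' v] with t ht
  rw [ht, smul_smul, ← Complex.exp_add]
  congr 2; ring

theorem adjoint_expCol_self (l : ℝ) (v : V) : adjoint (expCol l) (expCol l v) = (2 : ℂ) • v := by
  rw [adjoint_expCol_expCol]
  simp only [sub_self, mul_zero, zero_mul, Complex.exp_zero, intervalIntegral.integral_const]
  norm_num

theorem adjoint_expCol_expCol_of_ne {m n : ℤ} (h : m ≠ n) (v : V) :
    adjoint (expCol (Real.pi * m)) (expCol (Real.pi * n) v) = 0 := by
  rw [adjoint_expCol_expCol]
  have hne : Complex.I * (((Real.pi * n : ℝ) : ℂ) - (Real.pi * m : ℝ)) ≠ 0 := by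
    refine mul_ne_zero Complex.I_ne_zero ?_
    rw [sub_ne_zero]
    norm_cast
    intro h1
    exact h (by exact_mod_cast (mul_left_cancel₀ Real.pi_ne_zero h1).symm)
  rw [integral_exp_mul_complex hne]
  have : Complex.exp (Complex.I * (((Real.pi * n : ℝ) : ℂ) - (Real.pi * m : ℝ)) * ((1 : ℝ) : ℂ)) =
      Complex.exp (Complex.I * (((Real.pi * n : ℝ) : ℂ) - (Real.pi * m : ℝ)) * ((-1 : ℝ) : ℂ)) := by
    rw [Complex.exp_eq_exp_iff_exists_int]
    refine ⟨n - m, ?_⟩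
    push_cast; ring
  rw [this, sub_self, zero_div, zero_smul]

theorem norm_expCol_apply (l : ℝ) (v : V) : ‖expCol l v‖ ^ 2 = 2 * ‖v‖ ^ 2 := by
  have h : (‖expCol l v‖ : ℂ) ^ 2 = 2 * (‖v‖ : ℂ) ^ 2 := by
    have h1 := inner_self_eq_norm_sq_to_K (𝕜 := ℂ) (expCol l v)
    rw [← ContinuousLinearMap.adjoint_inner_right, adjoint_expCol_self, inner_smul_right,
      inner_self_eq_norm_sq_to_K] at h1
    exact h1.symm
  exact_mod_cast h

/-- The isometric embeddings `v ↦ e^{iπnt} v / √2`. -/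
def expIso (n : ℤ) : V →ₗᵢ[ℂ] L2V V where
  toLinearMap := (((√2)⁻¹ : ℝ) : ℂ) • (expCol (Real.pi * n) : V →L[ℂ] L2V V).toLinearMap
  norm_map' v := by
    change ‖(((√2)⁻¹ : ℝ) : ℂ) • expCol (Real.pi * n) v‖ = ‖v‖
    rw [← sq_eq_sq₀ (norm_nonneg _) (norm_nonneg _), norm_smul, mul_pow, norm_expCol_apply,
      Complex.norm_real, Real.norm_eq_abs, sq_abs, inv_pow, Real.sq_sqrt (by norm_num)]
    ring

theorem expIso_apply (n : ℤ) (v : V) :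
    expIso n v = (((√2)⁻¹ : ℝ) : ℂ) • expCol (Real.pi * n) v := rfl

theorem orthogonalFamily_expIso : OrthogonalFamily ℂ (fun _ : ℤ => V) expIso := by
  intro m n hmn v w
  rw [expIso_apply, expIso_apply, inner_smul_left, inner_smul_right,
    ← ContinuousLinearMap.adjoint_inner_right, adjoint_expCol_expCol_of_ne hmn, inner_zero_right,
    mul_zero, mul_zero]

/-- Pair with vectors v and use the scalar Parseval identity for ⟨v, g⟩, then let v run through an
orthonormal basis. -/
theorem eq_zero_of_adjoint_expCol {g : L2V V}
    (h : ∀ n : ℤ, adjoint (expCol (Real.pi * n)) g = 0) : g = 0 := by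
  have hg := Lp.memLp g
  have hlt : (-1 : ℝ) < 1 := by norm_num
  have key : ∀ v : V, (fun t => ⟪v, g t⟫_ℂ) =ᵐ[vol11] 0 := by
    intro v
    have hm : MemLp (fun t => ⟪v, g t⟫_ℂ) 2 vol11 := hg.const_inner v
    have hc : ∀ n, fourierCoeffOn hlt (fun t => ⟪v, g t⟫_ℂ) n = 0 := by
      intro n
      rw [fourierCoeffOn_eq_integral]
      have h2 : ∫ t in (-1 : ℝ)..1, fourier (-n) (t : AddCircle ((1 : ℝ) - -1)) • ⟪v, g t⟫_ℂ =
          ⟪v, adjoint (expCol (Real.pi * n)) g⟫_ℂ := by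
        have hi : Integrable (fun t : ℝ => Complex.exp (-(Complex.I *
            ((Real.pi * n : ℝ) : ℂ) * t)) •
            g t) vol11 := by
          refine Integrable.bdd_smul (C := 1) (hg.integrable (by norm_num))
            (Continuous.aestronglyMeasurable (by fun_prop)) (ae_of_all _ fun t => ?_)
          rw [show -(Complex.I * ((Real.pi * n : ℝ) : ℂ) * t) =
            ((-(Real.pi * n * t) : ℝ) : ℂ) * Complex.I by push_cast; ring,
            Complex.norm_exp_ofReal_mul_I]
        rw [adjoint_expCol_apply, ← integral_inner hi, intervalIntegral.integral_of_le hlt.le,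
          integral_Ioc_eq_integral_Ioo]
        refine integral_congr_ae (ae_of_all _ fun t => ?_)
        beta_reduce
        rw [fourier_coe_apply, inner_smul_right, smul_eq_mul]
        congr 2
        push_cast; ring
      rw [h2, h, inner_zero_right, smul_zero]
    have hs := hasSum_sq_fourierCoeffOn hlt (f := fun t => ⟪v, g t⟫_ℂ) (by
      rw [← restrict_Ioo_eq_restrict_Ioc]
      exact hm)
    simp only [hc, norm_zero, ne_eq, OfNat.ofNat_ne_zero, not_false_eq_true, zero_pow] at hs
    have h0 := hs.unique hasSum_zero
    rw [smul_eq_zero] at h0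
    have h0 := h0.resolve_left (by norm_num)
    rw [intervalIntegral.integral_of_le hlt.le, integral_Ioc_eq_integral_Ioo] at h0
    change ∫ t, ‖⟪v, g t⟫_ℂ‖ ^ 2 ∂vol11 = 0 at h0
    rw [integral_eq_zero_iff_of_nonneg (fun t => by positivity)
      ((memLp_two_iff_integrable_sq_norm hm.1).1 hm)] at h0
    filter_upwards [h0] with t ht
    simpa using ht
  refine Lp.ext ?_
  have hall : ∀ᵐ t ∂vol11, ∀ i, ⟪stdOrthonormalBasis ℂ V i, g t⟫_ℂ = 0 :=
    ae_all_iff.2 fun i => key _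
  filter_upwards [hall, Lp.coeFn_zero V 2 vol11] with t ht h0
  rw [h0, Pi.zero_apply]
  rw [← (stdOrthonormalBasis ℂ V).sum_repr' (g t)]
  exact Finset.sum_eq_zero fun i _ => by rw [ht i, zero_smul]

theorem isHilbertSum_expIso : IsHilbertSum ℂ (fun _ : ℤ => V) (expIso (V := V)) := by
  refine IsHilbertSum.mk orthogonalFamily_expIso ?_
  rw [top_le_iff, Submodule.topologicalClosure_eq_top_iff, Submodule.eq_bot_iff]
  intro g hg
  refine eq_zero_of_adjoint_expCol fun n => ext_inner_left ℂ fun v => ?_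
  rw [ContinuousLinearMap.adjoint_inner_right, inner_zero_right]
  have h1 : expIso n v ∈ ⨆ i, (expIso (V := V) i).range :=
    Submodule.mem_iSup_of_mem n ⟨v, rfl⟩
  have h2 := hg _ h1
  rw [expIso_apply, inner_smul_left, mul_eq_zero] at h2
  refine h2.resolve_left ?_
  simp

/-- The Fourier transform as a unitary map onto `ℓ₂(ℤ, V)`. -/
def fourierIso : L2V V ≃ₗᵢ[ℂ] lp (fun _ : ℤ => V) 2 := isHilbertSum_expIso.linearIsometryEquiv

theorem fourierIso_apply (g : L2V V) (n : ℤ) :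
    fourierIso g n = (((√2)⁻¹ : ℝ) : ℂ) • adjoint (expCol (Real.pi * n)) g := by
  refine ext_inner_left ℂ fun v => ?_
  refine (lp.inner_single_left (𝕜 := ℂ) n v (fourierIso g)).symm.trans ?_
  have h1 := fourierIso.symm.inner_map_map (lp.single (E := fun _ : ℤ => V) 2 n v) (fourierIso g)
  have h2 : fourierIso.symm (lp.single (E := fun _ : ℤ => V) 2 n v) = expIso n v :=
    isHilbertSum_expIso.linearIsometryEquiv_symm_apply_single v
  rw [← h1, h2, LinearIsometryEquiv.symm_apply_apply, expIso_apply, inner_smul_left,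
    inner_smul_right, Complex.conj_ofReal, ContinuousLinearMap.adjoint_inner_right]

/-- Parseval: 2I = Σ_n e_{πn} e_{πn}^*. This absorbs the terms subtracted in the definition of H. -/
theorem hasSum_inner_adjoint_expCol (f g : L2V V) :
    HasSum (fun n : ℤ => ⟪adjoint (expCol (Real.pi * n)) f, adjoint (expCol (Real.pi * n)) g⟫_ℂ)
      (2 * ⟪f, g⟫_ℂ) := by
  have h := (lp.hasSum_inner (𝕜 := ℂ) (fourierIso f) (fourierIso g)).mul_left 2
  have h1 := fourierIso.inner_map_map f g
  rw [h1] at h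
  refine h.congr_fun fun n => ?_
  rw [fourierIso_apply, fourierIso_apply, inner_smul_left, inner_smul_right, Complex.conj_ofReal,
    ← mul_assoc, ← mul_assoc, mul_assoc 2, ← Complex.ofReal_mul, ← mul_inv,
    Real.mul_self_sqrt (by norm_num)]
  norm_num

theorem norm_adjoint_expCol_le (l : ℝ) : ‖adjoint (expCol l : V →L[ℂ] L2V V)‖ ≤ 2 := by
  rw [LinearIsometryEquiv.norm_map]
  refine ContinuousLinearMap.opNorm_le_bound _ (by norm_num) fun v => ?_
  refine le_of_sq_le_sq ?_ (by positivity)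
  rw [norm_expCol_apply, mul_pow]
  nlinarith [sq_nonneg ‖v‖]

theorem norm_exp_sub_exp_le (a b t : ℝ) :
    ‖Complex.exp (-(Complex.I * a * t)) - Complex.exp (-(Complex.I * b * t))‖ ≤ |a - b| * |t| := by
  have e : Complex.exp (-(Complex.I * a * t)) - Complex.exp (-(Complex.I * b * t)) =
      Complex.exp (((-(b * t) : ℝ) : ℂ) * Complex.I) *
        (Complex.exp (Complex.I * ((-((a - b) * t) : ℝ) : ℂ)) - 1) := by
    rw [mul_sub, ← Complex.exp_add, mul_one]
    congr 2 <;> · push_cast; ring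
  rw [e, norm_mul, Complex.norm_exp_ofReal_mul_I, one_mul]
  refine (Real.norm_exp_I_mul_ofReal_sub_one_le).trans ?_
  rw [Real.norm_eq_abs, abs_neg, abs_mul]

theorem norm_Lp_vol11_le {W : Type*} [NormedAddCommGroup W] {F : Lp W 2 vol11} {C : ℝ} (hC : 0 ≤ C)
    (h : ∀ᵐ t ∂vol11, ‖F t‖ ≤ C) : ‖F‖ ≤ 2 * C := by
  refine (Lp.norm_le_of_ae_bound hC h).trans (mul_le_mul_of_nonneg_right ?_ hC)
  have h2 : (measureUnivNNReal vol11 : ℝ) = 2 := by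
    change (volume.restrict (Ioo (-1 : ℝ) 1) univ).toReal = 2
    rw [Measure.restrict_apply_univ, Real.volume_Ioo]
    norm_num
  rw [h2]
  refine (Real.rpow_le_rpow_of_exponent_le (by norm_num) (?_ : _ ≤ (1 : ℝ))).trans (by simp)
  norm_num

/-- Lipschitz dependence on the frequency turns the square summability of λ_j - πn into closeness of
functionals. -/
theorem norm_adjoint_expCol_sub_le (a b : ℝ) :
    ‖adjoint (expCol a : V →L[ℂ] L2V V) - adjoint (expCol b)‖ ≤ 2 * |a - b| := by
  rw [← map_sub, LinearIsometryEquiv.norm_map, expCol, expCol, ← map_sub]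
  refine (norm_colOp_le _).trans (norm_Lp_vol11_le (abs_nonneg _) ?_)
  filter_upwards [Lp.coeFn_sub ((memLp_exp (V := V) a).toLp _) ((memLp_exp (V := V) b).toLp _),
    (memLp_exp (V := V) a).coeFn_toLp, (memLp_exp (V := V) b).coeFn_toLp, ae_vol11_mem]
    with t h1 h2 h3 h4
  rw [h1, Pi.sub_apply, h2, h3, ← sub_smul, norm_smul]
  have h5 := norm_exp_sub_exp_le a b (-t)
  simp only [Complex.ofReal_neg, mul_neg, neg_neg, abs_neg] at h5
  calc _ ≤ |a - b| * |t| * 1 := mul_le_mul h5 ContinuousLinearMap.norm_id_le (norm_nonneg _)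
        (by positivity)
    _ ≤ _ := by
      rw [mul_one]
      exact mul_le_of_le_one_right (abs_nonneg _) (abs_le.2 ⟨h4.1.le, h4.2.le⟩)

end Fourier

end

/-! ### Spectral data with operator values and convergence of the series for H. -/

section

variable {V : Type*} [NormedAddCommGroup V] [InnerProductSpace ℂ V] [FiniteDimensional ℂ V]
  [CompleteSpace V]

open ContinuousLinearMap (adjoint)

/-- Prospective spectral data with operator values. -/
structure SpecData (V : Type*) [NormedAddCommGroup V] [InnerProductSpace ℂ V]
    [FiniteDimensional ℂ V] [CompleteSpace V] where
  lam : ℤ → ℝ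
  al : ℤ → V →L[ℂ] V
  idx : ℤ → Finset ℤ
  inj : Function.Injective lam
  mem_idx : ∀ j n, j ∈ idx n ↔ lam j ∈ Delta n
  pos : ∀ j, 0 ≤ al j
  card_le : ∃ C : ℕ, ∀ n, (idx n).card ≤ C
  summable_sq : Summable fun n : ℤ => ∑ j ∈ idx n, |lam j - Real.pi * n| ^ 2
  summable_norm : Summable fun n : ℤ => ‖1 - ∑ j ∈ idx n, al j‖ ^ 2
  rank_sum : ∃ N₀ : ℕ, ∀ N : ℕ, N₀ ≤ N → ∑ n ∈ Finset.Icc (-(N : ℤ)) N, ∑ j ∈ idx n,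
    Module.finrank ℂ (al j).range = (2 * N + 1) * Module.finrank ℂ V
  complete : ∀ g : L2V V, (∀ j, al j (adjoint (expCol (lam j)) g) = 0) → g = 0

/-- The class in `L₂((-1, 1), V →L V)` of an exponential with an operator coefficient and a
continuous weight. -/
def expLp (φ : ℝ → ℂ) (hφ : Continuous φ) (l : ℝ) (T : V →L[ℂ] V) : Lp (V →L[ℂ] V) 2 vol11 :=
  (memLp_of_continuous (σ := fun t : ℝ => φ t • Complex.exp (Complex.I * l * t) • T)
    (by fun_prop)).toLp _

theorem coeFn_expLp (φ : ℝ → ℂ) (hφ : Continuous φ) (l : ℝ) (T : V →L[ℂ] V) :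
    expLp φ hφ l T =ᵐ[vol11] fun t : ℝ => φ t • Complex.exp (Complex.I * l * t) • T :=
  MemLp.coeFn_toLp _

theorem norm_le_sum_norm_apply (T : V →L[ℂ] V) :
    ‖T‖ ≤ ∑ i, ‖T (stdOrthonormalBasis ℂ V i)‖ := by
  refine ContinuousLinearMap.opNorm_le_bound _ (Finset.sum_nonneg fun _ _ => norm_nonneg _)
    fun v => ?_
  conv_lhs => rw [← (stdOrthonormalBasis ℂ V).sum_repr' v, map_sum]
  refine (norm_sum_le _ _).trans ?_
  rw [Finset.sum_mul]
  refine Finset.sum_le_sum fun i _ => ?_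
  rw [map_smul, norm_smul, mul_comm]
  gcongr
  refine (norm_inner_le_norm _ _).trans ?_
  rw [(stdOrthonormalBasis ℂ V).orthonormal.1 i, one_mul]

/-- Orthogonality of exponentials is available for V-valued functions; this transfers it to operator
valued ones at the cost of a sum over a basis. -/
theorem norm_Lp_le_sum_norm_colOp (F : Lp (V →L[ℂ] V) 2 vol11) :
    ‖F‖ ≤ ∑ i, ‖colOp F (stdOrthonormalBasis ℂ V i)‖ := by
  set b := stdOrthonormalBasis ℂ V
  rw [Lp.norm_def]
  have h1 : eLpNorm F 2 vol11 ≤ ∑ i, eLpNorm (colOp F (b i)) 2 vol11 := by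
    calc eLpNorm F 2 vol11 ≤ eLpNorm (∑ i, fun t => ‖colOp F (b i) t‖) 2 vol11 := by
          refine eLpNorm_mono_ae ?_
          have hall : ∀ᵐ t ∂vol11, ∀ i, colOp F (b i) t = F t (b i) :=
            ae_all_iff.2 fun i => coeFn_colOp F (b i)
          filter_upwards [hall] with t ht
          rw [Finset.sum_apply, Real.norm_of_nonneg (Finset.sum_nonneg fun _ _ => norm_nonneg _)]
          simp only [ht]
          exact norm_le_sum_norm_apply _
      _ ≤ ∑ i, eLpNorm (fun t => ‖colOp F (b i) t‖) 2 vol11 :=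
          eLpNorm_sum_le (fun i _ => (Lp.memLp _).1.norm) (by norm_num)
      _ = _ := by simp only [eLpNorm_norm]
  have h2 : ∑ i, ‖colOp F (b i)‖ = (∑ i, eLpNorm (colOp F (b i)) 2 vol11).toReal := by
    rw [ENNReal.toReal_sum fun i _ => Lp.eLpNorm_ne_top _]
    rfl
  rw [h2]
  refine ENNReal.toReal_mono ?_ h1
  exact ENNReal.sum_ne_top.2 fun i _ => Lp.eLpNorm_ne_top _

theorem norm_sum_expCol_sq (t : Finset ℤ) (v : ℤ → V) :
    ‖∑ m ∈ t, expCol (Real.pi * m) (v m)‖ ^ 2 = 2 * ∑ m ∈ t, ‖v m‖ ^ 2 := by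
  have h := (orthogonalFamily_expIso (V := V)).norm_sum v t
  rw [← h]
  simp only [expIso_apply, ← Finset.smul_sum]
  rw [norm_smul, mul_pow, Complex.norm_real, Real.norm_eq_abs, sq_abs, inv_pow,
    Real.sq_sqrt (by norm_num)]
  ring

/-- Without the weight the terms are orthogonal column by column, and the weight costs a factor K.
The frequencies are 2πm because the blocks are evaluated at 2x. -/
theorem norm_sum_expLp_le {φ : ℝ → ℂ} (hφ : Continuous φ) {K : ℝ} (hK0 : 0 ≤ K)
    (hK : ∀ t ∈ Ioo (-1 : ℝ) 1, ‖φ t‖ ≤ K) (C : ℤ → V →L[ℂ] V) (t : Finset ℤ) :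
    ‖∑ m ∈ t, expLp φ hφ (Real.pi * (2 * m : ℤ)) (C m)‖ ≤
      Module.finrank ℂ V * (K * √(2 * ∑ m ∈ t, ‖C m‖ ^ 2)) := by
  refine (norm_Lp_le_sum_norm_colOp _).trans ?_
  have hb : ∀ i, ‖colOp (∑ m ∈ t, expLp φ hφ (Real.pi * (2 * m : ℤ)) (C m))
      (stdOrthonormalBasis ℂ V i)‖ ≤ K * √(2 * ∑ m ∈ t, ‖C m‖ ^ 2) := by
    intro i
    set b := stdOrthonormalBasis ℂ V i with hbdef
    have hb1 : ‖b‖ = 1 := (stdOrthonormalBasis ℂ V).orthonormal.1 i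
    set S : L2V V := ∑ m ∈ t, expCol (Real.pi * (2 * m : ℤ)) (C m b) with hS
    have h1 : ‖colOp (∑ m ∈ t, expLp φ hφ (Real.pi * (2 * m : ℤ)) (C m)) b‖ ≤ K * ‖S‖ := by
      refine Lp.norm_le_mul_norm_of_ae_le_mul ?_
      have a1 : ∀ᵐ s ∂vol11, ∀ m : ℤ, expLp φ hφ (Real.pi * (2 * m : ℤ)) (C m) s =
          φ s • Complex.exp (Complex.I * (Real.pi * (2 * m : ℤ) : ℝ) * s) • C m :=
        ae_all_iff.2 fun m => coeFn_expLp _ _ _ _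
      have a2 : ∀ᵐ s ∂vol11, ∀ m : ℤ, expCol (Real.pi * (2 * m : ℤ)) (C m b) s =
          Complex.exp (Complex.I * (Real.pi * (2 * m : ℤ) : ℝ) * s) • C m b :=
        ae_all_iff.2 fun m => coeFn_expCol _ _
      filter_upwards [coeFn_colOp (∑ m ∈ t, expLp φ hφ (Real.pi * (2 * m : ℤ)) (C m)) b, a1, a2,
        Lp.coeFn_finsetSum t fun m => expLp φ hφ (Real.pi * (2 * m : ℤ)) (C m),
        Lp.coeFn_finsetSum t fun m => expCol (Real.pi * (2 * m : ℤ)) (C m b), ae_vol11_mem]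
        with s h1 h2 h3 h4 h5 h6
      rw [h1, h4, hS, h5, Finset.sum_apply, Finset.sum_apply]
      have e : (∑ m ∈ t, expLp φ hφ (Real.pi * (2 * m : ℤ)) (C m) s) b =
          φ s • ∑ m ∈ t, expCol (Real.pi * (2 * m : ℤ)) (C m b) s := by
        rw [Finset.smul_sum, sum_apply]
        refine Finset.sum_congr rfl fun m _ => ?_
        rw [h2, h3]; rfl
      rw [e, norm_smul]
      gcongr
      exact hK s h6
    refine h1.trans (mul_le_mul_of_nonneg_left ?_ hK0)
    refine Real.le_sqrt_of_sq_le ?_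
    have h2 := norm_sum_expCol_sq (t.map ⟨fun m : ℤ => 2 * m, fun a b h => by simpa using h⟩)
      (fun k : ℤ => C (k / 2) b)
    rw [Finset.sum_map, Finset.sum_map] at h2
    have e : ∀ m : ℤ, 2 * m / 2 = m := fun m => Int.mul_ediv_cancel_left m two_ne_zero
    change ‖∑ m ∈ t, expCol (Real.pi * (2 * m : ℤ)) (C (2 * m / 2) b)‖ ^ 2 =
      2 * ∑ m ∈ t, ‖C (2 * m / 2) b‖ ^ 2 at h2
    simp_rw [e] at h2
    rw [hS, h2]
    gcongr with m
    exact (C m).le_of_opNorm_le_of_le le_rfl hb1.le |>.trans_eq (mul_one _)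
  refine (Finset.sum_le_sum fun i _ => hb i).trans_eq ?_
  rw [Finset.sum_const, Finset.card_univ, Fintype.card_fin, nsmul_eq_mul]

theorem summable_expLp {φ : ℝ → ℂ} (hφ : Continuous φ) {C : ℤ → V →L[ℂ] V}
    (hC : Summable fun m => ‖C m‖ ^ 2) :
    Summable fun m : ℤ => expLp φ hφ (Real.pi * (2 * m : ℤ)) (C m) := by
  obtain ⟨K, hK0, hK⟩ := exists_bound_of_continuous hφ
  rw [summable_iff_vanishing_norm]
  intro ε hε
  set A : ℝ := Module.finrank ℂ V * K with hA
  have hA0 : 0 ≤ A := by positivity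
  set η := (ε / (A + 1)) ^ 2 / 2 with hη
  have hη0 : 0 < η := by positivity
  obtain ⟨s, hs⟩ := summable_iff_vanishing_norm.1 hC η hη0
  refine ⟨s, fun t ht => ?_⟩
  have h1 := hs t ht
  rw [Real.norm_of_nonneg (Finset.sum_nonneg fun _ _ => by positivity)] at h1
  have h2 := norm_sum_expLp_le hφ hK0 (fun t ht => hK t (Ioo_subset_Icc_self ht)) C t
  refine h2.trans_lt ?_
  have h3 : √(2 * ∑ m ∈ t, ‖C m‖ ^ 2) ≤ ε / (A + 1) := by
    rw [Real.sqrt_le_left (by positivity)]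
    rw [hη] at h1
    linarith
  calc Module.finrank ℂ V * (K * √(2 * ∑ m ∈ t, ‖C m‖ ^ 2)) ≤ A * (ε / (A + 1)) := by
        rw [hA, ← mul_assoc]; gcongr
    _ < ε := by
        rw [mul_div_assoc', div_lt_iff₀ (by positivity)]
        nlinarith

/-- For |θ| ≤ 1 this is the Taylor estimate; for |θ| ≥ 1 the left side is at most 2 + |θ| ≤ 3θ². -/
theorem norm_exp_sub_one_sub_le (θ : ℝ) :
    ‖Complex.exp (Complex.I * θ) - 1 - Complex.I * θ‖ ≤ 3 * θ ^ 2 := by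
  have hn : ‖Complex.I * (θ : ℂ)‖ = |θ| := by simp
  rcases le_total |θ| 1 with h | h
  · refine (Complex.norm_exp_sub_one_sub_id_le (hn.trans_le h)).trans ?_
    rw [hn, sq_abs]
    nlinarith [sq_nonneg θ]
  · have h1 : ‖Complex.exp (Complex.I * θ)‖ = 1 := by rw [mul_comm, Complex.norm_exp_ofReal_mul_I]
    have h2 : ‖Complex.exp (Complex.I * θ) - 1 - Complex.I * θ‖ ≤ 1 + 1 + |θ| := by
      refine (norm_sub_le _ _).trans ?_
      rw [hn]
      gcongr
      refine (norm_sub_le _ _).trans ?_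
      rw [h1, norm_one]
    rw [← sq_abs θ]
    nlinarith

namespace SpecData

variable (D : SpecData V)

theorem exists_idx (j : ℤ) : ∃ n, j ∈ D.idx n := by
  refine ⟨⌈D.lam j / Real.pi - 1 / 2⌉, (D.mem_idx _ _).2 ?_⟩
  have h1 := Int.le_ceil (D.lam j / Real.pi - 1 / 2)
  have h2 := Int.ceil_lt_add_one (D.lam j / Real.pi - 1 / 2)
  have hpi := Real.pi_pos
  set n := ⌈D.lam j / Real.pi - 1 / 2⌉
  have e : D.lam j = Real.pi * (D.lam j / Real.pi) := by field_simp
  constructor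
  · rw [e]; nlinarith
  · rw [e]; nlinarith

theorem idx_unique {j m n : ℤ} (hm : j ∈ D.idx m) (hn : j ∈ D.idx n) : m = n := by
  rw [D.mem_idx, Delta, mem_Ioc] at hm hn
  have hpi := Real.pi_pos
  have h1 : Real.pi * ((m : ℝ) - n) < Real.pi * 1 := by linarith [hm.1, hn.2]
  have h2 : Real.pi * ((n : ℝ) - m) < Real.pi * 1 := by linarith [hn.1, hm.2]
  have h3 := lt_of_mul_lt_mul_left h1 hpi.le
  have h4 := lt_of_mul_lt_mul_left h2 hpi.le
  have h5 : m - n < 1 := by exact_mod_cast h3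
  have h6 : n - m < 1 := by exact_mod_cast h4
  omega

/-- The masses of the intervals `Δ_n`. -/
def beta (n : ℤ) : V →L[ℂ] V := ∑ j ∈ D.idx n, D.al j

/-- Positivity gives 0 ≤ α_j ≤ β_n for λ_j in Δ_n, and the β_n are bounded because they are close to
I. -/
theorem exists_norm_le : ∃ B, 0 ≤ B ∧ ∀ j, ‖D.al j‖ ≤ B := by
  set S := ∑' n, ‖1 - D.beta n‖ ^ 2 with hS
  have hS0 : 0 ≤ S := tsum_nonneg fun n => by positivity
  refine ⟨1 + (1 + S), by positivity, fun j => ?_⟩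
  obtain ⟨n, hn⟩ := D.exists_idx j
  have h1 : D.al j ≤ D.beta n := Finset.single_le_sum (fun i _ => D.pos i) hn
  refine (CStarAlgebra.norm_le_norm_of_nonneg_of_le (D.pos j) h1).trans ?_
  have h2 : ‖1 - D.beta n‖ ^ 2 ≤ S := D.summable_norm.le_tsum n fun _ _ => by positivity
  have h3 : ‖1 - D.beta n‖ ≤ 1 + S := by
    nlinarith [sq_nonneg (‖1 - D.beta n‖ - 1), norm_nonneg (1 - D.beta n)]
  calc ‖D.beta n‖ = ‖1 - (1 - D.beta n)‖ := by rw [sub_sub_cancel]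
    _ ≤ ‖(1 : V →L[ℂ] V)‖ + ‖1 - D.beta n‖ := norm_sub_le _ _
    _ ≤ _ := add_le_add ContinuousLinearMap.norm_id_le h3

theorem sq_sum_le {C : ℕ} (hC : ∀ n, (D.idx n).card ≤ C) (n : ℤ) :
    (∑ j ∈ D.idx n, |D.lam j - Real.pi * n|) ^ 2 ≤
      C * ∑ j ∈ D.idx n, |D.lam j - Real.pi * n| ^ 2 := by
  refine sq_sum_le_card_mul_sum_sq.trans ?_
  gcongr
  exact_mod_cast hC n

theorem summable_sq_sum : Summable fun n => (∑ j ∈ D.idx n, |D.lam j - Real.pi * n|) ^ 2 := by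
  obtain ⟨C, hC⟩ := D.card_le
  exact Summable.of_nonneg_of_le (fun _ => by positivity) (D.sq_sum_le hC)
      (D.summable_sq.mul_left _)

/-- The blocks of the formal Fourier series of the kernel. -/
def block (m : ℤ) (s : ℝ) : V →L[ℂ] V :=
  ∑ j ∈ D.idx m, Complex.exp (Complex.I * D.lam j * s) • D.al j -
    Complex.exp (Complex.I * (Real.pi * m : ℝ) * s) • 1

theorem continuous_block (m : ℤ) : Continuous (D.block m) := by
  unfold block
  fun_prop

theorem memLp_block (m : ℤ) : MemLp (fun x : ℝ => D.block m (2 * x)) 2 vol11 :=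
  memLp_of_continuous ((D.continuous_block m).comp (by fun_prop))

/-- Expand e^{2iλ_j x} around the frequency πm to second order. The zeroth and first order terms are
exponential series with square summable coefficients, β_m - I and Σ(λ_j - πm)α_j, the second
multiplied by the weight 2ix; both converge unconditionally by orthogonality. The remainder is
quadratic in λ_j - πm and absolutely summable. -/
theorem summable_block : Summable fun m => (D.memLp_block m).toLp _ := by
  obtain ⟨B, hB0, hB⟩ := D.exists_norm_le
  have s1 := summable_expLp (φ := fun _ => 1) continuous_const (C := fun m => D.beta m - 1) (by
    refine D.summable_norm.congr fun m => ?_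
    rw [← norm_neg, neg_sub]; rfl)
  have s2 := summable_expLp (φ := fun t => 2 * Complex.I * t) (by fun_prop)
    (C := fun m => ∑ j ∈ D.idx m, ((D.lam j - Real.pi * m : ℝ) : ℂ) • D.al j) (by
    refine Summable.of_nonneg_of_le (fun _ => by positivity) (fun m => ?_)
      (D.summable_sq_sum.mul_left (B ^ 2))
    rw [← mul_pow]
    gcongr
    refine (norm_sum_le _ _).trans ?_
    rw [Finset.mul_sum]
    refine Finset.sum_le_sum fun j _ => ?_
    rw [norm_smul, Complex.norm_real, Real.norm_eq_abs, mul_comm]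
    gcongr
    exact hB j)
  have s3 : Summable fun m => (D.memLp_block m).toLp _ -
      expLp (fun _ => 1) continuous_const (Real.pi * (2 * m : ℤ)) (D.beta m - 1) -
      expLp (fun t => 2 * Complex.I * t) (by fun_prop) (Real.pi * (2 * m : ℤ))
        (∑ j ∈ D.idx m, ((D.lam j - Real.pi * m : ℝ) : ℂ) • D.al j) := by
    -- The 12 is 3 · 2²: the remainder is at most 3θ² with |θ| ≤ 2|λ_j - πm|. The outer 2 comes from
    -- `norm_Lp_vol11_le`.
    refine Summable.of_norm_bounded (D.summable_sq.mul_left (2 * (B * 12))) fun m => ?_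
    rw [mul_assoc]
    refine norm_Lp_vol11_le (by positivity) ?_
    filter_upwards [Lp.coeFn_sub ((D.memLp_block m).toLp _ -
      expLp (fun _ => 1) continuous_const (Real.pi * (2 * m : ℤ)) (D.beta m - 1))
      (expLp (fun t => 2 * Complex.I * t) (by fun_prop) (Real.pi * (2 * m : ℤ))
        (∑ j ∈ D.idx m, ((D.lam j - Real.pi * m : ℝ) : ℂ) • D.al j)),
      Lp.coeFn_sub ((D.memLp_block m).toLp _)
        (expLp (fun _ => 1) continuous_const (Real.pi * (2 * m : ℤ)) (D.beta m - 1)),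
      (D.memLp_block m).coeFn_toLp, coeFn_expLp (fun _ => 1) continuous_const (Real.pi *
          (2 * m : ℤ))
        (D.beta m - 1), coeFn_expLp (fun t => 2 * Complex.I * t) (by fun_prop)
        (Real.pi * (2 * m : ℤ)) (∑ j ∈ D.idx m, ((D.lam j - Real.pi * m : ℝ) : ℂ) • D.al j),
      ae_vol11_mem] with t h1 h2 h3 h4 h5 h6
    rw [h1, Pi.sub_apply, h2, Pi.sub_apply, h3, h4, h5]
    set E := Complex.exp (Complex.I * (Real.pi * (2 * m : ℤ) : ℝ) * t) with hE
    have e : D.block m (2 * t) - (1 : ℂ) • E • (D.beta m - 1) - (2 * Complex.I * t) • E •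
        ∑ j ∈ D.idx m, ((D.lam j - Real.pi * m : ℝ) : ℂ) • D.al j =
        E • ∑ j ∈ D.idx m, (Complex.exp (Complex.I * ((2 * t *
            (D.lam j - Real.pi * m) : ℝ) : ℂ)) - 1 -
          Complex.I * ((2 * t * (D.lam j - Real.pi * m) : ℝ) : ℂ)) • D.al j := by
      have e1 : ∀ j, Complex.exp (Complex.I * D.lam j * (2 * t : ℝ)) =
          E * Complex.exp (Complex.I * ((2 * t * (D.lam j - Real.pi * m) : ℝ) : ℂ)) := by
        intro j
        rw [hE, ← Complex.exp_add]
        congr 1; push_cast; ring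
      have e2 : Complex.exp (Complex.I * (Real.pi * m : ℝ) * (2 * t : ℝ)) = E := by
        rw [hE]; congr 1; push_cast; ring
      rw [block, e2, beta]
      simp only [e1, sub_smul, Finset.sum_sub_distrib, smul_sub, one_smul, mul_smul,
        Finset.smul_sum]
      have e3 : ∀ j, (2 : ℂ) • Complex.I • (t : ℂ) • E • ((D.lam j - Real.pi * m : ℝ) : ℂ) • D.al j =
          E • Complex.I • ((2 * t * (D.lam j - Real.pi * m) : ℝ) : ℂ) • D.al j := by
        intro j
        simp only [smul_smul]
        congr 1; push_cast; ring
      simp only [e3]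
      abel
    rw [e, norm_smul]
    have hE1 : ‖E‖ = 1 := by
      rw [hE, show Complex.I * ((Real.pi * (2 * m : ℤ) : ℝ) : ℂ) * t =
        ((Real.pi * (2 * m : ℤ) * t : ℝ) : ℂ) * Complex.I by push_cast; ring,
        Complex.norm_exp_ofReal_mul_I]
    rw [hE1, one_mul, Finset.mul_sum]
    refine (norm_sum_le _ _).trans (Finset.sum_le_sum fun j _ => ?_)
    rw [norm_smul, sq_abs]
    have ht2 : t ^ 2 ≤ 1 := by nlinarith [h6.1, h6.2]
    calc _ ≤ (3 * (2 * t * (D.lam j - Real.pi * m)) ^ 2) * B :=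
          mul_le_mul (norm_exp_sub_one_sub_le _) (hB j) (norm_nonneg _) (by positivity)
      _ = (B * 12 * (D.lam j - Real.pi * m) ^ 2) * t ^ 2 := by ring
      _ ≤ (B * 12 * (D.lam j - Real.pi * m) ^ 2) * 1 := by gcongr
      _ = _ := by ring
  refine ((s3.add s2).add s1).congr fun m => ?_
  abel

/-- The limit of the formal Fourier series. -/
def hLim : Lp (V →L[ℂ] V) 2 vol11 := ∑' m, (D.memLp_block m).toLp _

theorem tendsto_block : Tendsto (fun n : ℕ => eLpNorm
    (fun x => ∑ m ∈ Finset.Ioc (-(n : ℤ)) n, D.block m (2 * x) - D.hLim x) 2 vol11) atTop (𝓝 0) :=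
        by
  have h := D.summable_block.hasSum.comp (Finset.tendsto_Ioc_neg (R := ℤ))
  change Tendsto _ _ (𝓝 D.hLim) at h
  rw [Lp.tendsto_Lp_iff_tendsto_eLpNorm'] at h
  refine h.congr fun n => eLpNorm_congr_ae ?_
  have hall : ∀ᵐ x ∂vol11, ∀ m : ℤ, (D.memLp_block m).toLp _ x = D.block m (2 * x) :=
    ae_all_iff.2 fun m => (D.memLp_block m).coeFn_toLp
  filter_upwards [hall, Lp.coeFn_finsetSum (Finset.Ioc (-(n : ℤ)) n)
    fun m => (D.memLp_block m).toLp _] with x h1 h2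
  simp only [Function.comp_apply, Pi.sub_apply]
  rw [h2, Finset.sum_apply]
  simp only [h1]

end SpecData

end

/-! ### Positivity and coercivity of I + 𝓚. -/

section

variable {V : Type*} [NormedAddCommGroup V] [InnerProductSpace ℂ V] [FiniteDimensional ℂ V]
  [CompleteSpace V]

open ContinuousLinearMap (adjoint)

section PositiveForm

variable {H : Type*} [NormedAddCommGroup H] [InnerProductSpace ℂ H]

/-- Evaluate the nonnegative form at g - tTg with t = 1/(‖T‖ + 1). It shows both that a zero of the
form lies in the kernel and that a lower bound for ‖Tg‖ gives one for the form. -/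
theorem norm_sq_le_of_nonneg {T : H →L[ℂ] H} (hT : ∀ f g, ⟪T f, g⟫_ℂ = ⟪f, T g⟫_ℂ)
    (hpos : ∀ g, 0 ≤ RCLike.re ⟪g, T g⟫_ℂ) (g : H) :
    ‖T g‖ ^ 2 ≤ (‖T‖ + 1) * RCLike.re ⟪g, T g⟫_ℂ := by
  set C := ‖T‖ + 1 with hC
  have hC0 : 0 < C := by positivity
  set t : ℝ := C⁻¹ with ht
  have ht0 : 0 < t := by positivity
  have h := hpos (g - (t : ℂ) • T g)
  have e : RCLike.re ⟪g - (t : ℂ) • T g, T (g - (t : ℂ) • T g)⟫_ℂ =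
      RCLike.re ⟪g, T g⟫_ℂ - 2 * t * ‖T g‖ ^ 2 + t ^ 2 * RCLike.re ⟪T g, T (T g)⟫_ℂ := by
    rw [map_sub, map_smul, inner_sub_left, inner_sub_right, inner_sub_right, inner_smul_left,
      inner_smul_left, inner_smul_right, inner_smul_right, Complex.conj_ofReal, ← hT g (T g),
      inner_self_eq_norm_sq_to_K]
    simp only [RCLike.re_eq_complex_re, Complex.sub_re, Complex.re_ofReal_mul,
        Complex.coe_algebraMap]
    norm_cast
    ring
  have h2 : RCLike.re ⟪T g, T (T g)⟫_ℂ ≤ C * ‖T g‖ ^ 2 := by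
    refine (RCLike.re_le_norm _).trans ((norm_inner_le_norm _ _).trans ?_)
    have := T.le_opNorm (T g)
    nlinarith [norm_nonneg (T g)]
  rw [e] at h
  have h3 : t ^ 2 * RCLike.re ⟪T g, T (T g)⟫_ℂ ≤ t * ‖T g‖ ^ 2 := by
    calc _ ≤ t ^ 2 * (C * ‖T g‖ ^ 2) := by gcongr
      _ = (t * C) * (t * ‖T g‖ ^ 2) := by ring
      _ = _ := by rw [ht, inv_mul_cancel₀ hC0.ne', one_mul]
  have h4 : t * ‖T g‖ ^ 2 ≤ RCLike.re ⟪g, T g⟫_ℂ := by linarith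
  rwa [ht, inv_mul_le_iff₀ hC0] at h4

theorem apply_eq_zero_of_re_inner_eq_zero {T : H →L[ℂ] H} (hT : ∀ f g, ⟪T f, g⟫_ℂ = ⟪f, T g⟫_ℂ)
    (hpos : ∀ g, 0 ≤ RCLike.re ⟪g, T g⟫_ℂ) {g : H} (hg : RCLike.re ⟪g, T g⟫_ℂ = 0) : T g = 0 := by
  have := norm_sq_le_of_nonneg hT hpos g
  rw [hg, mul_zero] at this
  simpa using this.antisymm (by positivity)

end PositiveForm

theorem inner_apply_left_of_nonneg {T : V →L[ℂ] V} (hT : 0 ≤ T) (v w : V) :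
    ⟪T v, w⟫_ℂ = ⟪v, T w⟫_ℂ :=
  ((ContinuousLinearMap.nonneg_iff_isPositive T).1 hT).isSymmetric v w

theorem re_inner_nonneg {T : V →L[ℂ] V} (hT : 0 ≤ T) (v : V) : 0 ≤ RCLike.re ⟪v, T v⟫_ℂ :=
  ((ContinuousLinearMap.nonneg_iff_isPositive T).1 hT).re_inner_nonneg_right v

theorem toReal_eLpNorm_sq {W : Type*} [NormedAddCommGroup W] {μ : Measure ℝ} {f : ℝ → W}
    (hf : MemLp f 2 μ) : (eLpNorm f 2 μ).toReal ^ 2 = ∫ t, ‖f t‖ ^ 2 ∂μ := by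
  have h0 : 0 ≤ ∫ t, ‖f t‖ ^ 2 ∂μ := integral_nonneg fun _ => by positivity
  rw [hf.eLpNorm_eq_integral_rpow_norm two_ne_zero ENNReal.ofNat_ne_top]
  simp only [ENNReal.toReal_ofNat, Real.rpow_two]
  rw [ENNReal.toReal_ofReal (by positivity), ← Real.rpow_natCast, ← Real.rpow_mul h0]
  norm_num

/-- The operator `g ↦ ∫ e^{il(s - t)} T g(t) dt`. -/
def expOp (l : ℝ) (T : V →L[ℂ] V) : L2V V →L[ℂ] L2V V := expCol l ∘L T ∘L adjoint (expCol l)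

theorem integrable_exp_smul (l : ℝ) (g : L2V V) :
    Integrable (fun t : ℝ => Complex.exp (-(Complex.I * l * t)) • g t) vol11 := by
  refine Integrable.bdd_smul (C := 1) ((Lp.memLp g).integrable (by norm_num))
    (Continuous.aestronglyMeasurable (by fun_prop)) (ae_of_all _ fun t => ?_)
  rw [show -(Complex.I * l * t) = ((-(l * t) : ℝ) : ℂ) * Complex.I by push_cast; ring,
    Complex.norm_exp_ofReal_mul_I]

theorem coeFn_expOp (l : ℝ) (T : V →L[ℂ] V) (g : L2V V) : expOp l T g =ᵐ[vol11]
    fun s => ∫ t, (Complex.exp (Complex.I * l * ((s - t : ℝ) : ℂ)) • T) (g t) ∂vol11 := by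
  filter_upwards [coeFn_expCol l (T (adjoint (expCol l) g))] with s hs
  rw [expOp, ContinuousLinearMap.comp_apply, ContinuousLinearMap.comp_apply, hs,
      adjoint_expCol_apply,
    ← ContinuousLinearMap.integral_comp_comm _ (integrable_exp_smul l g), ← integral_smul]
  refine integral_congr_ae (ae_of_all _ fun t => ?_)
  beta_reduce
  rw [map_smul, smul_smul, ← Complex.exp_add, smul_apply]
  congr 2; push_cast; ring

theorem isCompactOperator_expOp (l : ℝ) (T : V →L[ℂ] V) : IsCompactOperator (expOp l T) :=
  (isCompactOperator_of_locallyCompactSpace_dom (adjoint (expCol l : V →L[ℂ] L2V V))).clm_comp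
    (expCol l ∘L T)

theorem inner_expOp (l : ℝ) (T : V →L[ℂ] V) (f g : L2V V) :
    ⟪f, expOp l T g⟫_ℂ = ⟪adjoint (expCol l) f, T (adjoint (expCol l) g)⟫_ℂ := by
  rw [ContinuousLinearMap.adjoint_inner_left]; rfl

namespace SpecData

variable (D : SpecData V)

/-- The integral operator with the kernel `block m (s - t)`. -/
def blockOp (m : ℤ) : L2V V →L[ℂ] L2V V :=
  ∑ j ∈ D.idx m, expOp (D.lam j) (D.al j) - expOp (Real.pi * m) 1

theorem coeFn_blockOp (m : ℤ) (g : L2V V) :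
    D.blockOp m g =ᵐ[vol11] fun s => ∫ t, D.block m (s - t) (g t) ∂vol11 := by
  have h1 : ∀ᵐ s ∂vol11, ∀ j : ℤ, expOp (D.lam j) (D.al j) g s =
      ∫ t, (Complex.exp (Complex.I * D.lam j * ((s - t : ℝ) : ℂ)) • D.al j) (g t) ∂vol11 :=
    ae_all_iff.2 fun j => coeFn_expOp _ _ _
  have hi : ∀ (s l : ℝ) (T : V →L[ℂ] V), Integrable (fun t : ℝ =>
      (Complex.exp (Complex.I * l * ((s - t : ℝ) : ℂ)) • T) (g t)) vol11 := fun s l T =>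
    integrable_clm_apply (memLp_of_continuous (by fun_prop)) (Lp.memLp g)
  have e : D.blockOp m g = ∑ j ∈ D.idx m, expOp (D.lam j) (D.al j) g - expOp (Real.pi * m) 1 g := by
    rw [blockOp, sub_apply, sum_apply]
  rw [e]
  filter_upwards [h1, coeFn_expOp (Real.pi * m) 1 g, Lp.coeFn_sub
    (∑ j ∈ D.idx m, expOp (D.lam j) (D.al j) g) (expOp (Real.pi * m) 1 g),
    Lp.coeFn_finsetSum (D.idx m) fun j => expOp (D.lam j) (D.al j) g] with s a1 a2 a3 a4
  rw [a3, Pi.sub_apply, a4, Finset.sum_apply, a2]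
  simp only [a1]
  rw [← integral_finsetSum _ fun j _ => hi _ _ _, ← integral_sub
    (integrable_finsetSum _ fun j _ => hi _ _ _) (hi _ _ _)]
  refine integral_congr_ae (ae_of_all _ fun t => ?_)
  beta_reduce
  rw [block, sub_apply, sum_apply]

theorem eq_zero_of_tendsto_sum {a : ℤ → ℝ} (h0 : ∀ j, 0 ≤ a j)
    (h : Tendsto (fun n : ℕ => ∑ m ∈ Finset.Ioc (-(n : ℤ)) n, ∑ j ∈ D.idx m, a j) atTop (𝓝 0))
    (j : ℤ) : a j = 0 := by
  have hmono : Monotone fun n : ℕ => ∑ m ∈ Finset.Ioc (-(n : ℤ)) n, ∑ j ∈ D.idx m, a j := by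
    intro b c hbc
    refine Finset.sum_le_sum_of_subset_of_nonneg ?_ fun m _ _ =>
      Finset.sum_nonneg fun j _ => h0 j
    exact Finset.Ioc_subset_Ioc (by omega) (by omega)
  obtain ⟨n, hn⟩ := D.exists_idx j
  refine le_antisymm (le_trans ?_ (hmono.ge_of_tendsto h (n.natAbs + 1))) (h0 j)
  have hmem : n ∈ Finset.Ioc (-((n.natAbs + 1 : ℕ) : ℤ)) (n.natAbs + 1 : ℕ) := by
    rw [Finset.mem_Ioc]; omega
  exact (Finset.single_le_sum (fun j _ => h0 j) hn).trans (Finset.single_le_sum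
    (f := fun m => ∑ j ∈ D.idx m, a j) (fun m _ => Finset.sum_nonneg fun j _ => h0 j) hmem)

/-- The kernel `κ` is the sum of the formal Fourier series of the data. -/
def Represents (κ : DiffKernel V) : Prop :=
  Tendsto (fun n : ℕ => eLpNorm (fun s => (1 / 2 : ℂ) • ∑ m ∈ Finset.Ioc (-(n : ℤ)) n, D.block m s -
    κ.k s) 2 (volume.restrict (Ioo (-2) 2))) atTop (𝓝 0)

variable {D} {κ : DiffKernel V}

/-- A difference kernel on (-1, 1) uses only arguments in (-2, 2), and Cauchy–Schwarz in each row
bounds the operator by the L₂ norm of the kernel there. Thus L₂ convergence of the series gives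
convergence in operator norm. -/
theorem norm_blockOp_sub_conv_le (κ : DiffKernel V) (n : ℕ) :
    ‖(1 / 2 : ℂ) • ∑ m ∈ Finset.Ioc (-(n : ℤ)) n, D.blockOp m - κ.conv‖ ≤
      2 * (eLpNorm (fun s => (1 / 2 : ℂ) • ∑ m ∈ Finset.Ioc (-(n : ℤ)) n, D.block m s -
        κ.k s) 2 (volume.restrict (Ioo (-2) 2))).toReal := by
  set d : ℝ → V →L[ℂ] V := fun s => (1 / 2 : ℂ) • ∑ m ∈ Finset.Ioc (-(n : ℤ)) n, D.block m s -
    κ.k s with hd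
  have hc : Continuous fun s => (1 / 2 : ℂ) • ∑ m ∈ Finset.Ioc (-(n : ℤ)) n, D.block m s :=
    (continuous_finsetSum (Finset.Ioc (-(n : ℤ)) n) fun m _ => D.continuous_block m).const_smul
      (1 / 2 : ℂ)
  have hd2 : MemLp d 2 (volume.restrict (Ioo (-2) 2)) := by
    refine MemLp.sub ?_ (κ.memLp.restrict _)
    obtain ⟨C, hC⟩ := (isCompact_Icc (a := (-2 : ℝ)) (b := 2)).exists_bound_of_continuousOn
      hc.continuousOn
    refine MemLp.of_bound hc.aestronglyMeasurable C ?_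
    filter_upwards [ae_restrict_mem measurableSet_Ioo] with t ht
    exact hC t (Ioo_subset_Icc_self ht)
  set δ := (eLpNorm d 2 (volume.restrict (Ioo (-2) 2))).toReal with hδ
  have hδ2 : δ ^ 2 = ∫ t in Ioo (-2) 2, ‖d t‖ ^ 2 := toReal_eLpNorm_sq hd2
  have hk : ∀ s, MemLp (fun t => κ.k (s - t)) 2 vol11 := by
    intro s
    have := memLp_comp_affine κ.memLp (a := -1) (by norm_num) s
    refine (this.restrict _).ae_eq (ae_of_all _ fun y => ?_)
    beta_reduce; congr 1; ring
  have hds : ∀ s, MemLp (fun t => d (s - t)) 2 vol11 := fun s =>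
    (memLp_of_continuous (hc.comp (by fun_prop : Continuous fun t : ℝ => s - t))).sub (hk s)
  refine ContinuousLinearMap.opNorm_le_bound _ (by positivity) fun g => ?_
  rw [mul_assoc]
  refine norm_Lp_vol11_le (by positivity) ?_
  have hb : ∀ᵐ s ∂vol11, ∀ m : ℤ, D.blockOp m g s = ∫ t, D.block m (s - t) (g t) ∂vol11 :=
    ae_all_iff.2 fun m => D.coeFn_blockOp m g
  have e : ((1 / 2 : ℂ) • ∑ m ∈ Finset.Ioc (-(n : ℤ)) n, D.blockOp m - κ.conv) g =
      (1 / 2 : ℂ) • ∑ m ∈ Finset.Ioc (-(n : ℤ)) n, D.blockOp m g - κ.conv g := by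
    rw [sub_apply, smul_apply, sum_apply]
  rw [e]
  filter_upwards [hb, κ.coeFn_conv g, Lp.coeFn_sub
    ((1 / 2 : ℂ) • ∑ m ∈ Finset.Ioc (-(n : ℤ)) n, D.blockOp m g) (κ.conv g),
    Lp.coeFn_smul (1 / 2 : ℂ) (∑ m ∈ Finset.Ioc (-(n : ℤ)) n, D.blockOp m g),
    Lp.coeFn_finsetSum (Finset.Ioc (-(n : ℤ)) n) fun m => D.blockOp m g, ae_vol11_mem]
    with s a1 a2 a3 a4 a5 a6
  have hbi : ∀ m, Integrable (fun t => D.block m (s - t) (g t)) vol11 := fun m =>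
    integrable_clm_apply (memLp_of_continuous ((D.continuous_block m).comp (by fun_prop)))
      (Lp.memLp g)
  have e2 : ((1 / 2 : ℂ) • ∑ m ∈ Finset.Ioc (-(n : ℤ)) n, D.blockOp m g - κ.conv g : L2V V) s =
      ∫ t, d (s - t) (g t) ∂vol11 := by
    rw [a3, Pi.sub_apply, a4, Pi.smul_apply, a5, Finset.sum_apply, a2, DiffKernel.adjoint_tau_apply]
    simp only [a1]
    have hbs : Integrable (fun t => (1 / 2 : ℂ) • ∑ m ∈ Finset.Ioc (-(n : ℤ)) n,
        D.block m (s - t) (g t)) vol11 :=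
      (integrable_finsetSum (Finset.Ioc (-(n : ℤ)) n) fun m _ => hbi m).smul (1 / 2 : ℂ)
    rw [← integral_finsetSum _ fun m _ => hbi m, ← integral_smul, ← integral_sub hbs
      (integrable_clm_apply (hk s) (Lp.memLp g))]
    refine integral_congr_ae (ae_of_all _ fun t => ?_)
    beta_reduce
    rw [hd]
    simp only [sub_apply, smul_apply, sum_apply]
  rw [e2]
  refine le_of_sq_le_sq ?_ (by positivity)
  refine (norm_integral_clm_apply_sq_le (hds s) (Lp.memLp g)).trans ?_
  rw [integral_norm_sq, mul_pow, hδ2]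
  gcongr
  rw [integral_vol11, ← integral_indicator measurableSet_Ioo,
    ← integral_sub_left_eq_self _ volume s]
  have hint : Integrable ((Ioo (-2 : ℝ) 2).indicator fun t => ‖d t‖ ^ 2) volume := by
    rw [integrable_indicator_iff measurableSet_Ioo]
    exact (memLp_two_iff_integrable_sq_norm hd2.1).1 hd2
  refine integral_mono_of_nonneg (ae_of_all _ fun t => ?_) hint (ae_of_all _ fun t => ?_)
  · exact indicator_nonneg (fun _ _ => by positivity) _
  · beta_reduce
    by_cases h : s - t ∈ Ioo (-1 : ℝ) 1
    · have h2 : t ∈ Ioo (-2 : ℝ) 2 := ⟨by linarith [h.2, a6.1], by linarith [h.1, a6.2]⟩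
      rw [indicator_of_mem h, indicator_of_mem h2, sub_sub_cancel]
    · rw [indicator_of_notMem h]
      exact indicator_nonneg (fun _ _ => by positivity) _

namespace Represents

variable (h : D.Represents κ)
include h

theorem tendsto_blockOp : Tendsto (fun n : ℕ => (1 / 2 : ℂ) • ∑ m ∈ Finset.Ioc (-(n : ℤ)) n,
    D.blockOp m) atTop (𝓝 κ.conv) := by
  rw [tendsto_iff_norm_sub_tendsto_zero]
  have h1 := ((ENNReal.tendsto_toReal ENNReal.zero_ne_top).comp h).const_mul 2
  rw [ENNReal.toReal_zero, mul_zero] at h1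
  exact squeeze_zero (fun _ => norm_nonneg _) (fun n => norm_blockOp_sub_conv_le κ n) h1

theorem isCompactOperator_conv : IsCompactOperator κ.conv := by
  refine isCompactOperator_of_tendsto h.tendsto_blockOp (Eventually.of_forall fun n => ?_)
  have hmem : ∀ l T, (expOp l T : L2V V →L[ℂ] L2V V) ∈
      compactOperator (RingHom.id ℂ) (L2V V) (L2V V) := fun l T => isCompactOperator_expOp l T
  have h2 : ((1 / 2 : ℂ) • ∑ m ∈ Finset.Ioc (-(n : ℤ)) n, D.blockOp m) ∈
      compactOperator (RingHom.id ℂ) (L2V V) (L2V V) := by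
    refine Submodule.smul_mem _ _ (Submodule.sum_mem _ fun m _ => ?_)
    exact Submodule.sub_mem _ (Submodule.sum_mem _ fun j _ => hmem _ _) (hmem _ _)
  exact h2

/-- The blocks converge to 2𝓚, and adding Parseval for the exponentials e_{πm} removes the
subtracted terms: 2(I + 𝓚) is the symmetric limit of Σ_j e_{λ_j} α_j e_{λ_j}^*. -/
theorem tendsto_form (f g : L2V V) : Tendsto (fun n : ℕ => ∑ m ∈ Finset.Ioc (-(n : ℤ)) n,
    ∑ j ∈ D.idx m, ⟪adjoint (expCol (D.lam j)) f, D.al j (adjoint (expCol (D.lam j)) g)⟫_ℂ) atTop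
    (𝓝 (2 * ⟪f, κ.big g⟫_ℂ)) := by
  have h1 : Tendsto (fun n : ℕ => 2 * ⟪f, ((1 / 2 : ℂ) • ∑ m ∈ Finset.Ioc (-(n : ℤ)) n,
      D.blockOp m) g⟫_ℂ) atTop (𝓝 (2 * ⟪f, κ.conv g⟫_ℂ)) :=
    ((tendsto_const_nhds (x := f)).inner ((ContinuousLinearMap.apply ℂ (L2V V) g).continuous.tendsto
      _ |>.comp h.tendsto_blockOp)).const_mul 2
  have h2 := (hasSum_inner_adjoint_expCol f g).comp (Finset.tendsto_Ioc_neg (R := ℤ))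
  have h3 := h1.add h2
  rw [← mul_add, ← inner_add_right, add_comm (κ.conv g)] at h3
  refine h3.congr fun n => ?_
  simp only [Function.comp_apply]
  rw [smul_apply, inner_smul_right, ← mul_assoc, sum_apply, inner_sum]
  norm_num
  rw [← Finset.sum_add_distrib]
  refine Finset.sum_congr rfl fun m _ => ?_
  rw [blockOp, sub_apply, sum_apply, inner_sub_right, inner_sum, inner_expOp]
  simp only [inner_expOp, one_apply_eq_self]
  abel

theorem re_inner_big_nonneg (g : L2V V) : 0 ≤ RCLike.re ⟪g, κ.big g⟫_ℂ := by
  have h1 := (RCLike.continuous_re.tendsto _).comp (h.tendsto_form g g)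
  have h2 : 0 ≤ RCLike.re (2 * ⟪g, κ.big g⟫_ℂ) := by
    refine ge_of_tendsto' h1 fun n => ?_
    rw [Function.comp_apply, map_sum]
    refine Finset.sum_nonneg fun m _ => ?_
    rw [map_sum]
    exact Finset.sum_nonneg fun j _ => re_inner_nonneg (D.pos j) _
  rw [show (2 : ℂ) * ⟪g, κ.big g⟫_ℂ = ((2 : ℝ) : ℂ) * ⟪g, κ.big g⟫_ℂ by norm_num] at h2
  rw [RCLike.re_eq_complex_re, Complex.re_ofReal_mul] at h2
  rw [RCLike.re_eq_complex_re]
  linarith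

/-- All terms of the form are nonnegative, so each of them vanishes; then α_j e_{λ_j}^* g = 0 for
all j, and (A₃) applies. -/
theorem eq_zero_of_big {g : L2V V} (hg : κ.big g = 0) : g = 0 := by
  refine D.complete g fun j => ?_
  have h1 := h.tendsto_form g g
  rw [hg, inner_zero_right, mul_zero] at h1
  obtain ⟨B, hB⟩ : ∃ B : ℤ → V, ∀ j, adjoint (expCol (D.lam j)) g = B j := ⟨_, fun _ => rfl⟩
  simp only [hB] at h1
  rw [hB]
  have h2 : Tendsto (fun n : ℕ => ∑ m ∈ Finset.Ioc (-(n : ℤ)) n, ∑ j ∈ D.idx m,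
      RCLike.re ⟪B j, D.al j (B j)⟫_ℂ) atTop (𝓝 0) := by
    have h3 := (RCLike.continuous_re (K := ℂ)).tendsto 0 |>.comp h1
    rw [map_zero] at h3
    refine h3.congr fun n => ?_
    rw [Function.comp_apply, map_sum]
    exact Finset.sum_congr rfl fun m _ => map_sum _ _ _
  have h0 := D.eq_zero_of_tendsto_sum (fun j => re_inner_nonneg (D.pos j) (B j)) h2 j
  exact apply_eq_zero_of_re_inner_eq_zero (inner_apply_left_of_nonneg (D.pos j))
    (re_inner_nonneg (D.pos j)) h0

/-- 𝓚 is a norm limit of finite rank operators, hence compact, and -1 is not an eigenvalue, so I + 𝓚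
is bounded below by the Fredholm alternative. Positivity turns this into a lower bound of the form.
-/
theorem coercive : κ.Coercive := by
  have hne : ¬ Module.End.HasEigenvalue (κ.conv : L2V V →ₗ[ℂ] L2V V) (-1) := by
    intro he
    obtain ⟨g, hg⟩ := he.exists_hasEigenvector
    refine hg.2 (h.eq_zero_of_big ?_)
    have h1 : κ.conv g = (-1 : ℂ) • g := hg.apply_eq_smul
    rw [DiffKernel.big_apply, h1, neg_one_smul, add_neg_cancel]
  obtain ⟨K, hK⟩ := h.isCompactOperator_conv.antilipschitz_of_not_hasEigenvalue
    (neg_ne_zero.2 one_ne_zero) hne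
  have hbound : ∀ g, ‖g‖ ≤ K * ‖κ.big g‖ := by
    intro g
    have h1 := ZeroHomClass.bound_of_antilipschitz _ hK g
    have h2 : (κ.conv - (-1 : ℂ) • (1 : L2V V →L[ℂ] L2V V)) g = κ.big g := by
      rw [sub_apply, smul_apply, one_apply_eq_self, neg_one_smul, sub_neg_eq_add, add_comm]
      rfl
    rwa [h2] at h1
  have hC := norm_sq_le_of_nonneg κ.inner_big_left h.re_inner_big_nonneg
  set C := ‖κ.big‖ + 1 with hCdef
  have hC1 : 1 ≤ C := by rw [hCdef]; linarith [norm_nonneg κ.big]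
  have hA : 1 ≤ ((K : ℝ) ^ 2 + 1) * C := by nlinarith [sq_nonneg (K : ℝ)]
  -- The summands 1 in K² + 1 and in C make the constant at most 1, as `Coercive` demands.
  refine ⟨(((K : ℝ) ^ 2 + 1) * C)⁻¹, by positivity, inv_le_one_of_one_le₀ hA, fun g => ?_⟩
  rw [inv_mul_le_iff₀ (by positivity)]
  calc ‖g‖ ^ 2 ≤ (K * ‖κ.big g‖) ^ 2 := by gcongr; exact hbound g
    _ = (K : ℝ) ^ 2 * ‖κ.big g‖ ^ 2 := by ring
    _ ≤ ((K : ℝ) ^ 2 + 1) * (C * RCLike.re ⟪g, κ.big g⟫_ℂ) := by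
        gcongr
        · linarith
        · exact hC g
    _ = _ := by ring

end Represents

end SpecData

end

/-! ### Interpolation and the dimension count from the rank condition. -/

section

variable {V : Type*} [NormedAddCommGroup V] [InnerProductSpace ℂ V] [FiniteDimensional ℂ V]
  [CompleteSpace V]

open ContinuousLinearMap (adjoint)

section SquareSummable

variable {E : Type*} [NormedAddCommGroup E] [NormedSpace ℂ E]

theorem memℓp_of_norm_le {w : ℤ → E →L[ℂ] V} {d : ℤ → ℝ} (hw : ∀ n, ‖w n‖ ≤ d n)
    (hd : Summable fun n => d n ^ 2) (f : E) : Memℓp (fun n => w n f) 2 := by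
  refine memℓp_gen ?_
  simp only [ENNReal.toReal_ofNat, Real.rpow_two]
  refine Summable.of_nonneg_of_le (fun _ => by positivity) (fun n => ?_) (hd.mul_right (‖f‖ ^ 2))
  rw [← mul_pow]
  gcongr
  exact (w n).le_of_opNorm_le (hw n) f

/-- The operator with square summable components. -/
def lpOp (w : ℤ → E →L[ℂ] V) (d : ℤ → ℝ) (hw : ∀ n, ‖w n‖ ≤ d n) (hd : Summable fun n => d n ^ 2) :
    E →L[ℂ] lp (fun _ : ℤ => V) 2 :=
  LinearMap.mkContinuous
    { toFun := fun f => ⟨fun n => w n f, memℓp_of_norm_le hw hd f⟩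
      map_add' := fun f g => by ext n; exact map_add _ _ _
      map_smul' := fun c f => by ext n; exact map_smul _ _ _ }
    (√(∑' n, d n ^ 2)) fun f => by
      refine le_of_sq_le_sq ?_ (by positivity)
      have h := lp.norm_rpow_eq_tsum (p := 2) (E := fun _ : ℤ => V) (by norm_num)
        ⟨fun n => w n f, memℓp_of_norm_le hw hd f⟩
      simp only [ENNReal.toReal_ofNat, Real.rpow_two] at h
      rw [LinearMap.coe_mk, AddHom.coe_mk, h, mul_pow,
        Real.sq_sqrt (tsum_nonneg fun n => by positivity), ← tsum_mul_right]
      have hs := memℓp_of_norm_le hw hd f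
      refine Summable.tsum_le_tsum (fun n => ?_) ?_ (hd.mul_right _)
      · rw [← mul_pow]
        gcongr
        exact (w n).le_of_opNorm_le (hw n) f
      · have := hs.summable (by norm_num)
        simpa only [ENNReal.toReal_ofNat, Real.rpow_two] using this

theorem lpOp_apply (w : ℤ → E →L[ℂ] V) (d : ℤ → ℝ) (hw : ∀ n, ‖w n‖ ≤ d n)
    (hd : Summable fun n => d n ^ 2) (f : E) (n : ℤ) : lpOp w d hw hd f n = w n f := rfl

theorem norm_lpOp_le (w : ℤ → E →L[ℂ] V) (d : ℤ → ℝ) (hw : ∀ n, ‖w n‖ ≤ d n)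
    (hd : Summable fun n => d n ^ 2) : ‖lpOp w d hw hd‖ ≤ √(∑' n, d n ^ 2) :=
  LinearMap.mkContinuous_norm_le _ (by positivity) _

/-- Functionals that are square close to coordinate functionals are interpolating. -/
theorem exists_interpolation_of_isometry [CompleteSpace E] (F : E ≃ₗᵢ[ℂ] lp (fun _ : ℤ => V) 2)
    {c : ℂ} (hcn : ‖c‖ ≤ 1) (hc0 : c ≠ 0) {v w : ℤ → E →L[ℂ] V} (hF : ∀ g n, F g n = c • v n g)
    {d : ℤ → ℝ} (hw : ∀ n, ‖w n - v n‖ ≤ d n) (hd : Summable fun n => d n ^ 2)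
    (hd1 : ∑' n, d n ^ 2 < 1) :
    ∃ G : lp (fun _ : ℤ => V) 2 →ₗ[ℂ] E, ∀ u n, w n (G u) = u n := by
  have hw' : ∀ n, ‖c • (w n - v n)‖ ≤ d n := fun n => by
    rw [norm_smul]
    calc _ ≤ 1 * d n := mul_le_mul hcn (hw n) (norm_nonneg _) zero_le_one
      _ = _ := one_mul _
  obtain ⟨Λ, hΛ⟩ : ∃ Λ, Λ = lpOp (fun n => c • (w n - v n)) d hw' hd := ⟨_, rfl⟩
  have hΛ1 : ‖Λ‖ < 1 := by
    rw [hΛ]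
    refine (norm_lpOp_le _ _ _ _).trans_lt ?_
    rw [Real.sqrt_lt' one_pos]; simpa using hd1
  obtain ⟨J', hJ'⟩ : ∃ J' : lp (fun _ : ℤ => V) 2 →L[ℂ] E, J' =
    (F.symm.toContinuousLinearEquiv : lp (fun _ : ℤ => V) 2 →L[ℂ] E) := ⟨_, rfl⟩
  have hJJ : ∀ v, F (J' v) = v := fun v => by rw [hJ']; exact F.apply_symm_apply v
  -- The scaled functionals c·w_n form the map F + Λ = F(1 + F⁻¹Λ), inverted by a Neumann series.
  have hT : ‖-(J' ∘L Λ)‖ < 1 := by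
    rw [norm_neg]
    refine (ContinuousLinearMap.opNorm_comp_le _ _).trans_lt ?_
    have : ‖J'‖ ≤ 1 := by
      rw [hJ']; exact F.symm.toLinearIsometry.norm_toContinuousLinearMap_le
    nlinarith [norm_nonneg Λ, norm_nonneg J']
  obtain ⟨S, hS⟩ := isUnit_one_sub_of_norm_lt_one hT
  refine ⟨(((S⁻¹ : (E →L[ℂ] E)ˣ) : E →L[ℂ] E) ∘L J' ∘L
    (c • ContinuousLinearMap.id ℂ _)).toLinearMap, fun u n => ?_⟩
  obtain ⟨f, hf⟩ : ∃ f, f = ((S⁻¹ : (E →L[ℂ] E)ˣ) : E →L[ℂ] E) (J' (c • u)) := ⟨_, rfl⟩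
  have h0 : w n f = u n → w n (((S⁻¹ : (E →L[ℂ] E)ˣ) : E →L[ℂ] E) (J' (c • u))) = u n := by
    rw [hf]; exact id
  refine h0 ?_
  have h1 : (S : E →L[ℂ] E) f = J' (c • u) := by
    rw [hf, ← mul_apply_eq_comp, ← Units.val_mul, mul_inv_cancel]; rfl
  rw [hS, sub_neg_eq_add, add_apply, one_apply_eq_self] at h1
  have h2 : F f + Λ f = c • u := by
    have h3 := congrArg F h1
    rw [map_add, hJJ] at h3
    have h4 : F ((J' ∘L Λ) f) = Λ f := hJJ _
    rw [← h3, h4]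
  have h5 : F f n + Λ f n = c • u n := by
    have := congrArg (fun v : lp (fun _ : ℤ => V) 2 => v n) h2
    exact this
  rw [hF, hΛ, lpOp_apply, smul_apply, ← smul_add, sub_apply, add_sub_cancel] at h5
  exact smul_right_injective V hc0 h5

end SquareSummable

/-- Linear functionals that are close in `ℓ₂` to the Fourier coefficients are interpolating. -/
theorem exists_interpolation {w : ℤ → L2V V →L[ℂ] V} {d : ℤ → ℝ}
    (hw : ∀ n, ‖w n - adjoint (expCol (Real.pi * n))‖ ≤ d n) (hd : Summable fun n => d n ^ 2)
    (hd1 : ∑' n, d n ^ 2 < 1) :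
    ∃ G : lp (fun _ : ℤ => V) 2 →ₗ[ℂ] L2V V, ∀ u n, w n (G u) = u n := by
  refine exists_interpolation_of_isometry (fourierIso (V := V)) (c := (((√2)⁻¹ : ℝ) : ℂ)) ?_ ?_
    (v := fun n => adjoint (expCol (Real.pi * n))) (fun g n => fourierIso_apply g n) hw hd hd1
  · rw [Complex.norm_real, Real.norm_eq_abs, abs_of_nonneg (by positivity)]
    exact inv_le_one_of_one_le₀ (Real.one_le_sqrt.2 (by norm_num))
  · simp

section Ranks

open Module

variable {ι : Type*}

/-- The addition map from the product of the ranges to V is surjective between spaces of equal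
dimension, so it is injective: the ranges form a direct sum. -/
theorem apply_eq_zero_of_sum_eq_zero {s : Finset ι} {T : ι → V →L[ℂ] V}
    (hsurj : Function.Surjective ((∑ i ∈ s, T i : V →L[ℂ] V) : V → V)) (hrank : ∑ i ∈ s, finrank ℂ
        (T i).range = finrank ℂ V)
    {x : ι → V} (hx : ∑ i ∈ s, T i (x i) = 0) : ∀ i ∈ s, T i (x i) = 0 := by
  set Ψ : (∀ i : s, (T i).range) →ₗ[ℂ] V :=
    ∑ i : s, (T i).range.subtype ∘ₗ LinearMap.proj i with hΨ
  have hΨa : ∀ y, Ψ y = ∑ i : s, (y i : V) := fun y => by rw [hΨ]; simp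
  have hs : Function.Surjective Ψ := by
    intro v
    obtain ⟨u, rfl⟩ := hsurj v
    refine ⟨fun i => ⟨T i u, u, rfl⟩, ?_⟩
    rw [hΨa, sum_apply]
    exact Finset.sum_coe_sort s fun i => T i u
  have hf : finrank ℂ (∀ i : s, (T i).range) = finrank ℂ V := by
    rw [finrank_pi_fintype, ← hrank]
    exact Finset.sum_coe_sort s fun i => finrank ℂ (T i).range
  have hi := (LinearMap.injective_iff_surjective_of_finrank_eq_finrank hf).2 hs
  have h0 : (fun i : s => (⟨T i (x i), x i, rfl⟩ : (T i).range)) = 0 := by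
    refine hi ?_
    rw [map_zero, hΨa, ← hx]
    exact Finset.sum_coe_sort s fun i => T i (x i)
  intro i hi
  have := congrFun h0 ⟨i, hi⟩
  exact congrArg Subtype.val this

theorem finrank_le_of_surjective_sum {s : Finset ι} {T : ι → V →L[ℂ] V}
    (hsurj : Function.Surjective ((∑ i ∈ s, T i : V →L[ℂ] V) : V → V)) :
    finrank ℂ V ≤ ∑ i ∈ s, finrank ℂ (T i).range := by
  set Ψ : (∀ i : s, (T i).range) →ₗ[ℂ] V :=
    ∑ i : s, (T i).range.subtype ∘ₗ LinearMap.proj i with hΨ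
  have hΨa : ∀ y, Ψ y = ∑ i : s, (y i : V) := fun y => by rw [hΨ]; simp
  have hs : Function.Surjective Ψ := by
    intro v
    obtain ⟨u, rfl⟩ := hsurj v
    refine ⟨fun i => ⟨T i u, u, rfl⟩, ?_⟩
    rw [hΨa, sum_apply]
    exact Finset.sum_coe_sort s fun i => T i u
  have h := LinearMap.finrank_le_finrank_of_surjective hs
  rw [finrank_pi_fintype] at h
  exact h.trans_eq (Finset.sum_coe_sort s fun i => finrank ℂ (T i).range)

end Ranks

namespace SpecData

open Module

variable (D : SpecData V)

theorem add_sq_le_two (x y : ℝ) : (x + y) ^ 2 ≤ 2 * x ^ 2 + 2 * y ^ 2 := by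
  nlinarith [sq_nonneg (x - y)]

theorem norm_sum_comp_sub_le {ι E : Type*} [NormedAddCommGroup E] [NormedSpace ℂ E] (s : Finset ι)
    (al : ι → V →L[ℂ] V) (b : ι → E →L[ℂ] V) (e : E →L[ℂ] V) {B : ℝ} (hB : ∀ j, ‖al j‖ ≤ B)
    {δ : ι → ℝ} (hδ : ∀ j, ‖b j - e‖ ≤ δ j) :
    ‖∑ j ∈ s, al j ∘L b j - e‖ ≤ B * ∑ j ∈ s, δ j + ‖e‖ * ‖1 - ∑ j ∈ s, al j‖ := by
  have h : ∑ j ∈ s, al j ∘L b j - e = ∑ j ∈ s, al j ∘L (b j - e) - (1 - ∑ j ∈ s, al j) ∘L e := by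
    ext g
    simp only [sub_apply, sum_apply, ContinuousLinearMap.comp_apply, one_apply_eq_self, map_sub,
      Finset.sum_sub_distrib]
    abel
  rw [h]
  refine (norm_sub_le _ _).trans (add_le_add ?_ ?_)
  · refine (norm_sum_le _ _).trans ?_
    rw [Finset.mul_sum]
    exact Finset.sum_le_sum fun j _ => (ContinuousLinearMap.opNorm_comp_le _ _).trans
      (mul_le_mul (hB j) (hδ j) (norm_nonneg _) ((norm_nonneg _).trans (hB j)))
  · rw [mul_comm]
    exact ContinuousLinearMap.opNorm_comp_le _ _

/-- The functionals of the blocks. -/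
def blockFun (n : ℤ) : L2V V →L[ℂ] V := ∑ j ∈ D.idx n, D.al j ∘L adjoint (expCol (D.lam j))

/-- Replacing λ_j by πn costs Σ|λ_j - πn|, and replacing the mass of the block by I costs ‖I - β_n‖;
both are square summable. One sequence c dominates the distance of the block functionals from the
Fourier coefficients and also ‖I - β_n‖. -/
theorem exists_norm_blockFun_sub_le : ∃ c : ℤ → ℝ, (Summable fun n => c n ^ 2) ∧
    (∀ n, 0 ≤ c n) ∧ (∀ n, ‖1 - D.beta n‖ ≤ c n) ∧
    ∀ n, ‖D.blockFun n - adjoint (expCol (Real.pi * n))‖ ≤ c n := by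
  obtain ⟨B, hB0, hB⟩ := D.exists_norm_le
  obtain ⟨x, hx⟩ : ∃ x : ℤ → ℝ, ∀ n, ∑ j ∈ D.idx n, |D.lam j - Real.pi * n| = x n :=
    ⟨_, fun _ => rfl⟩
  obtain ⟨y, hy⟩ : ∃ y : ℤ → ℝ, ∀ n, ‖1 - D.beta n‖ = y n := ⟨_, fun _ => rfl⟩
  have hx2 : Summable fun n => x n ^ 2 := D.summable_sq_sum.congr fun n => by rw [hx]
  have hy2 : Summable fun n => y n ^ 2 := D.summable_norm.congr fun n => by
    rw [← hy]; rfl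
  have hx0 : ∀ n, 0 ≤ x n := fun n => by rw [← hx]; positivity
  have hy0 : ∀ n, 0 ≤ y n := fun n => by rw [← hy]; positivity
  refine ⟨fun n => 2 * B * x n + 2 * y n, ?_, ?_, ?_, ?_⟩
  · exact Summable.of_nonneg_of_le (fun n => sq_nonneg (2 * B * x n + 2 * y n))
      (fun n => (add_sq_le_two (2 * B * x n) (2 * y n)).trans_eq
        (by ring : _ = 8 * B ^ 2 * x n ^ 2 + 8 * y n ^ 2))
      ((hx2.mul_left (8 * B ^ 2)).add (hy2.mul_left 8))
  · intro n
    have := hx0 n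
    have := hy0 n
    positivity
  · intro n
    have := mul_nonneg hB0 (hx0 n)
    rw [hy]
    linarith [hy0 n]
  · intro n
    refine (norm_sum_comp_sub_le (D.idx n) D.al _ _ hB
      (fun j => norm_adjoint_expCol_sub_le (D.lam j) (Real.pi * n))).trans ?_
    rw [← Finset.mul_sum, hx, ← mul_assoc, mul_comm B 2]
    refine add_le_add le_rfl (mul_le_mul (norm_adjoint_expCol_le _) ?_ (norm_nonneg _) zero_le_two)
    exact (hy n).le

theorem surjective_beta {n : ℤ} (h : ‖1 - D.beta n‖ < 1) :
    Function.Surjective ((∑ j ∈ D.idx n, D.al j : V →L[ℂ] V) : V → V) := by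
  have hu := isUnit_one_sub_of_norm_lt_one h
  rw [sub_sub_cancel] at hu
  obtain ⟨S, hS⟩ := hu
  intro v
  refine ⟨((S⁻¹ : (V →L[ℂ] V)ˣ) : V →L[ℂ] V) v, ?_⟩
  change D.beta n _ = v
  rw [← hS, ← mul_apply_eq_comp, ← Units.val_mul, mul_inv_cancel]
  rfl

/-- Subtracting (A₂) for N from (A₂) for N + 1 shows that the blocks N + 1 and -(N + 1) have total
rank 2r. Each has rank at least r because β_n is invertible, so each has exactly r. -/
theorem sum_finrank_eq {M : ℕ} (hM : ∀ N : ℕ, M ≤ N → ∑ n ∈ Finset.Icc (-(N : ℤ)) N, ∑ j ∈ D.idx n,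
      finrank ℂ (D.al j).range = (2 * N + 1) * finrank ℂ V)
    (hβ : ∀ n : ℤ, M < n.natAbs → ‖1 - D.beta n‖ < 1) {n : ℤ} (hn : M < n.natAbs) :
    ∑ j ∈ D.idx n, finrank ℂ (D.al j).range = finrank ℂ V := by
  set ρ : ℤ → ℕ := fun n => ∑ j ∈ D.idx n, finrank ℂ (D.al j).range with hρ
  obtain ⟨N, hN⟩ : ∃ N, n.natAbs = N + 1 := ⟨n.natAbs - 1, by omega⟩
  have h1 : ∑ n ∈ Finset.Icc (-(N : ℤ)) N, ρ n = (2 * N + 1) * finrank ℂ V := hM N (by omega)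
  have h2 : ∑ n ∈ Finset.Icc (-((N + 1 : ℕ) : ℤ)) (N + 1 : ℕ), ρ n =
      (2 * (N + 1 : ℕ) + 1) * finrank ℂ V := hM (N + 1) (by omega)
  have e : Finset.Icc (-((N + 1 : ℕ) : ℤ)) (N + 1 : ℕ) =
      insert ((N : ℤ) + 1) (insert (-((N : ℤ) + 1)) (Finset.Icc (-(N : ℤ)) N)) := by
    ext k; simp only [Finset.mem_Icc, Finset.mem_insert]; omega
  rw [e, Finset.sum_insert (by simp only [Finset.mem_Icc, Finset.mem_insert]; omega),
    Finset.sum_insert (by simp only [Finset.mem_Icc]; omega), h1] at h2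
  have h3 : finrank ℂ V ≤ ρ ((N : ℤ) + 1) :=
    finrank_le_of_surjective_sum (D.surjective_beta (hβ _ (by omega)))
  have h4 : finrank ℂ V ≤ ρ (-((N : ℤ) + 1)) :=
    finrank_le_of_surjective_sum (D.surjective_beta (hβ _ (by omega)))
  change ρ n = _
  have h5 : ρ ((N : ℤ) + 1) + ρ (-((N : ℤ) + 1)) = 2 * finrank ℂ V := by
    have h7 : (2 * (N + 1) + 1) * finrank ℂ V = (2 * N + 1) * finrank ℂ V + 2 * finrank ℂ V := by
      ring
    omega
  have h6 : n = (N : ℤ) + 1 ∨ n = -((N : ℤ) + 1) := by omega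
  rcases h6 with h6 | h6 <;> rw [h6] <;> omega

/-- There are sufficiently many functions that are orthogonal to the exponentials with a missing
frequency. -/
theorem exists_submodule (j₀ : ℤ) : ∃ P : Submodule ℂ (L2V V), FiniteDimensional ℂ P ∧
    (∀ f ∈ P, ∀ j, j ≠ j₀ → D.al j (adjoint (expCol (D.lam j)) f) = 0) ∧
    finrank ℂ (D.al j₀).range ≤ finrank ℂ P := by
  obtain ⟨c, hc, hc0, hcβ, hcl⟩ := D.exists_norm_blockFun_sub_le
  obtain ⟨N₀, hN₀⟩ := D.rank_sum
  obtain ⟨s, hs⟩ := summable_iff_vanishing_norm.1 hc (1 / 2) (by norm_num)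
  obtain ⟨n₀, hn₀⟩ := D.exists_idx j₀
  -- Beyond M the squares of c sum to at most 1/2, every β_n is invertible and (A₂) is available;
  -- the block of j₀ lies within M.
  set M : ℕ := N₀ + n₀.natAbs + ∑ n ∈ s, n.natAbs with hM
  have hsM : ∀ n ∈ s, n.natAbs ≤ M := fun n hn => by
    have := Finset.single_le_sum (f := fun n : ℤ => n.natAbs) (fun _ _ => Nat.zero_le _) hn
    omega
  have hsmall : ∀ t : Finset ℤ, (∀ n ∈ t, M < n.natAbs) → ∑ n ∈ t, c n ^ 2 < 1 / 2 := fun t ht => by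
    have := hs t (Finset.disjoint_left.2 fun n hn hns => by
      have := ht n hn
      have := hsM n hns
      omega)
    rwa [Real.norm_of_nonneg (Finset.sum_nonneg fun _ _ => by positivity)] at this
  have hβ : ∀ n : ℤ, M < n.natAbs → ‖1 - D.beta n‖ < 1 := fun n hn => by
    have h1 := hsmall {n} (by simpa using hn)
    rw [Finset.sum_singleton] at h1
    refine (hcβ n).trans_lt ?_
    nlinarith [hc0 n]
  -- Inside the window the Fourier coefficients stay as free parameters; outside they are replaced
  -- by the block functionals, which are to vanish.
  set w : ℤ → L2V V →L[ℂ] V := fun n => if M < n.natAbs then D.blockFun n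
    else adjoint (expCol (Real.pi * n)) with hw
  set d : ℤ → ℝ := fun n => if M < n.natAbs then c n else 0 with hd
  have hwd : ∀ n, ‖w n - adjoint (expCol (Real.pi * n))‖ ≤ d n := fun n => by
    simp only [hw, hd]
    by_cases h : M < n.natAbs
    · rw [if_pos h, if_pos h]; exact hcl n
    · rw [if_neg h, if_neg h, sub_self]; exact (norm_zero (E := L2V V →L[ℂ] V)).le
  have hdc : ∀ n, d n ^ 2 ≤ c n ^ 2 := fun n => by
    simp only [hd]
    by_cases h : M < n.natAbs
    · rw [if_pos h]
    · rw [if_neg h]; simpa using sq_nonneg (c n)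
  have hds : Summable fun n => d n ^ 2 :=
    Summable.of_nonneg_of_le (fun _ => by positivity) hdc hc
  have hd1 : ∑' n, d n ^ 2 < 1 := by
    refine lt_of_le_of_lt (hds.tsum_le_of_sum_le fun t => ?_) (by norm_num : (1 / 2 : ℝ) < 1)
    have e : ∑ n ∈ t, d n ^ 2 = ∑ n ∈ t.filter (fun n => M < n.natAbs), c n ^ 2 := by
      rw [Finset.sum_filter]
      refine Finset.sum_congr rfl fun n _ => ?_
      simp only [hd]; split_ifs <;> simp
    rw [e]
    exact (hsmall _ fun n hn => (Finset.mem_filter.1 hn).2).le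
  obtain ⟨G, hG⟩ := exists_interpolation hwd hds hd1
  set I := Finset.Icc (-(M : ℤ)) M with hI
  set ins : (I → V) →ₗ[ℂ] lp (fun _ : ℤ => V) 2 :=
    ∑ n : I, (lp.singleContinuousLinearMap ℂ (fun _ : ℤ => V) 2 (n : ℤ)).toLinearMap ∘ₗ
      LinearMap.proj n with hins
  have hins1 : ∀ x n, ins x n = ∑ m : I, (lp.single 2 (m : ℤ) (x m) : ℤ → V) n := fun x n => by
    rw [hins, LinearMap.sum_apply, lp.coeFn_sum, Finset.sum_apply]
    rfl
  have hin : ∀ x (n : I), ins x n = x n := fun x n => by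
    rw [hins1, Finset.sum_eq_single n]
    · exact lp.single_apply_self 2 _ _
    · intro m _ hm
      exact lp.single_apply_ne 2 _ _ (fun h => hm (Subtype.ext h.symm))
    · simp
  have hout : ∀ x n, n ∉ I → ins x n = 0 := fun x n hn => by
    rw [hins1]
    refine Finset.sum_eq_zero fun m _ => lp.single_apply_ne 2 _ _ ?_
    rintro rfl
    exact hn m.2
  -- A space of functions of dimension (2M + 1)r annihilated by all block functionals outside the
  -- window.
  set L : (I → V) →ₗ[ℂ] L2V V := G ∘ₗ ins with hL
  have hLi : Function.Injective L := fun x y hxy => by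
    funext n
    rw [← hin x n, ← hin y n, ← hG (ins x) n, ← hG (ins y) n]
    exact congrArg _ hxy
  set Jn : Finset ℤ := (I.biUnion D.idx).erase j₀ with hJn
  have hn₀I : n₀ ∈ I := by rw [hI, Finset.mem_Icc]; omega
  have hj₀ : j₀ ∈ I.biUnion D.idx := Finset.mem_biUnion.2 ⟨n₀, hn₀I, hn₀⟩
  -- The remaining conditions are those with index in the window, except j₀. By (A₂) their number is
  -- (2M + 1)r - rank α_{j₀}, so the kernel has dimension at least rank α_{j₀}.
  set K : (I → V) →ₗ[ℂ] (∀ j : Jn, (D.al j).range) :=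
    LinearMap.pi fun j : Jn => (D.al j).toLinearMap.rangeRestrict ∘ₗ
      (adjoint (expCol (V := V) (D.lam j))).toLinearMap ∘ₗ L with hK
  have hsum : ∑ j ∈ I.biUnion D.idx, finrank ℂ (D.al j).range = (2 * M + 1) * finrank ℂ V := by
    rw [Finset.sum_biUnion]
    · exact hN₀ M (by omega)
    · intro m _ n _ hmn
      exact Finset.disjoint_left.2 fun j hjm hjn => hmn (D.idx_unique hjm hjn)
  have hcod : finrank ℂ (∀ j : Jn, (D.al j).range) + finrank ℂ (D.al j₀).range =
      (2 * M + 1) * finrank ℂ V := by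
    rw [finrank_pi_fintype, ← hsum, ← Finset.sum_erase_add _ _ hj₀]
    congr 1
    exact Finset.sum_coe_sort Jn fun j => finrank ℂ (D.al j).range
  have hdom : finrank ℂ (I → V) = (2 * M + 1) * finrank ℂ V := by
    rw [finrank_pi_fintype, Finset.sum_const, Finset.card_univ, Fintype.card_coe, hI, Int.card_Icc,
      smul_eq_mul]
    congr 1
    omega
  have hker : finrank ℂ (D.al j₀).range ≤ finrank ℂ (LinearMap.ker K) := by
    have h1 := LinearMap.finrank_range_add_finrank_ker K
    have h2 : finrank ℂ (LinearMap.range K) ≤ finrank ℂ (∀ j : Jn, (D.al j).range) :=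
      Submodule.finrank_le _
    omega
  refine ⟨(LinearMap.ker K).map L, inferInstance, ?_, ?_⟩
  · rintro f ⟨x, hx, rfl⟩ j hj
    obtain ⟨n, hn⟩ := D.exists_idx j
    by_cases hnI : n ∈ I
    · have hjJ : j ∈ Jn := Finset.mem_erase.2 ⟨hj, Finset.mem_biUnion.2 ⟨n, hnI, hn⟩⟩
      have h0 : K x = 0 := hx
      exact congrArg Subtype.val (congrFun h0 ⟨j, hjJ⟩)
    · have hnM : M < n.natAbs := by
        rw [hI, Finset.mem_Icc] at hnI; omega
      have h0 : w n (L x) = 0 := (hG (ins x) n).trans (hout x n hnI)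
      have h1 : D.blockFun n (L x) = 0 := by
        rw [hw] at h0
        simpa only [if_pos hnM] using h0
      rw [blockFun, sum_apply] at h1
      -- Outside the window the ranges in a block form a direct sum, so a vanishing block functional
      -- means that every single term vanishes.
      exact apply_eq_zero_of_sum_eq_zero (D.surjective_beta (hβ n hnM))
        (D.sum_finrank_eq (fun N hN => hN₀ N (by omega)) hβ hnM)
        (x := fun j => adjoint (expCol (D.lam j)) (L x)) h1 j hn
  · rw [← (Submodule.equivMapOfInjective L hLi (LinearMap.ker K)).finrank_eq]
    exact hker

end SpecData

end

/-! ### Orthogonality of the eigenfunctions. -/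

section

variable {V : Type*} [NormedAddCommGroup V] [InnerProductSpace ℂ V] [FiniteDimensional ℂ V]
  [CompleteSpace V]

open ContinuousLinearMap (adjoint)

namespace SpecData

variable (D : SpecData V)

theorem eventually_sum_eq {a : ℤ → ℂ} {j₀ : ℤ} (ha : ∀ j, j ≠ j₀ → a j = 0) :
    ∀ᶠ n : ℕ in atTop, ∑ m ∈ Finset.Ioc (-(n : ℤ)) n, ∑ j ∈ D.idx m, a j = a j₀ := by
  obtain ⟨m₀, hm₀⟩ := D.exists_idx j₀
  filter_upwards [eventually_gt_atTop m₀.natAbs] with n hn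
  rw [Finset.sum_eq_single m₀, Finset.sum_eq_single j₀]
  · exact fun j _ hj => ha j hj
  · exact fun h => absurd hm₀ h
  · intro m _ hm
    refine Finset.sum_eq_zero fun j hj => ha j ?_
    rintro rfl
    exact hm (D.idx_unique hj hm₀)
  · intro h
    exact absurd (Finset.mem_Ioc.2 (by omega)) h

variable {D} {κ : DiffKernel V} (h : D.Represents κ)

variable (D κ) in
/-- The columns of the eigenfunctions. -/
def eigCol (hκ : κ.Coercive) (j : ℤ) : V →L[ℂ] L2V V := hκ.trafo κ ∘L expCol (D.lam j)

theorem adjoint_eigCol_apply (hκ : κ.Coercive) (j : ℤ) (g : L2V V) :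
    adjoint (D.eigCol κ hκ j) g = adjoint (expCol (D.lam j)) (adjoint (hκ.trafo κ) g) := by
  rw [eigCol, ContinuousLinearMap.adjoint_comp]; rfl

theorem coeFn_eigCol (hκ : κ.Coercive) (j : ℤ) (v : V) :
    D.eigCol κ hκ j v =ᵐ[vol11] fun y => κ.phi y (D.lam j) v :=
  hκ.trafo_expCol (D.lam j) v

namespace Represents

include h

/-- The factorization X(I + 𝓚)X^* = I turns the form into the inner product: the ψ_j satisfy
Parseval's relation before their orthogonality is known. -/
theorem tendsto_form_eigCol (f g : L2V V) : Tendsto (fun n : ℕ => ∑ m ∈ Finset.Ioc (-(n : ℤ)) n,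
    ∑ j ∈ D.idx m, ⟪adjoint (D.eigCol κ h.coercive j) f,
      D.al j (adjoint (D.eigCol κ h.coercive j) g)⟫_ℂ) atTop (𝓝 (2 * ⟪f, g⟫_ℂ)) := by
  have h1 := h.tendsto_form (adjoint (h.coercive.trafo κ) f) (adjoint (h.coercive.trafo κ) g)
  rw [h.coercive.inner_big_adjoint] at h1
  simpa only [adjoint_eigCol_apply] using h1

theorem eq_zero_of_adjoint_eigCol {f : L2V V}
    (hf : ∀ j, D.al j (adjoint (D.eigCol κ h.coercive j) f) = 0) : f = 0 := by
  have h1 := h.tendsto_form_eigCol f f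
  simp only [hf, inner_zero_right, Finset.sum_const_zero] at h1
  have h2 := tendsto_nhds_unique h1 tendsto_const_nhds
  simpa using h2

/-- In Parseval's relation for such an f only the term j₀ remains. -/
theorem two_smul_eq {f : L2V V} {j₀ : ℤ}
    (hf : ∀ j, j ≠ j₀ → D.al j (adjoint (D.eigCol κ h.coercive j) f) = 0) :
    (2 : ℂ) • f =
      D.eigCol κ h.coercive j₀ (D.al j₀ (adjoint (D.eigCol κ h.coercive j₀) f)) := by
  refine ext_inner_left ℂ fun g => ?_
  have h1 := h.tendsto_form_eigCol g f
  have h2 := D.eventually_sum_eq (j₀ := j₀) (a := fun j => ⟪adjoint (D.eigCol κ h.coercive j) g,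
      D.al j (adjoint (D.eigCol κ h.coercive j) f)⟫_ℂ) fun j hj => by
    rw [hf j hj, inner_zero_right]
  have h3 := tendsto_nhds_unique (h1.congr' h2) tendsto_const_nhds
  rw [inner_smul_right, h3, ContinuousLinearMap.adjoint_inner_left]

/-- The functions from `exists_submodule`, transported by X(I + 𝓚), have vanishing coordinates for
every index other than j, hence lie in the range of ψ_j α_j by `two_smul_eq`. That range has
dimension at most rank α_j, so the two spaces coincide and ψ_j α_j v inherits the vanishing. -/
theorem al_adjoint_eigCol {j k : ℤ} (hjk : k ≠ j) (v : V) :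
    D.al k (adjoint (D.eigCol κ h.coercive k) (D.eigCol κ h.coercive j (D.al j v))) = 0 := by
  obtain ⟨P, hPfin, hP, hPr⟩ := D.exists_submodule j
  set X := h.coercive.trafo κ with hX
  set S : L2V V →ₗ[ℂ] L2V V := (X ∘L κ.big).toLinearMap with hS
  have hSi : Function.Injective S := by
    refine (injective_iff_map_eq_zero S).2 fun g hg => ?_
    exact h.coercive.big_injective (h.coercive.trafo_injective hg)
  have hS0 : ∀ f ∈ P.map S, ∀ i, i ≠ j → D.al i (adjoint (D.eigCol κ h.coercive i) f) = 0 := by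
    rintro f ⟨g, hg, rfl⟩ i hi
    rw [adjoint_eigCol_apply]
    have e : adjoint X (S g) = g := h.coercive.adjoint_trafo_surjective g
    rw [e]
    exact hP g hg i hi
  set Q : Submodule ℂ (L2V V) :=
    (LinearMap.range (D.al j).toLinearMap).map (D.eigCol κ h.coercive j).toLinearMap with hQ
  have hle : P.map S ≤ Q := by
    intro f hf
    have h2 := h.two_smul_eq (hS0 f hf)
    refine ⟨(1 / 2 : ℂ) • D.al j (adjoint (D.eigCol κ h.coercive j) f), ?_, ?_⟩
    · exact Submodule.smul_mem _ _ ⟨_, rfl⟩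
    · change D.eigCol κ h.coercive j _ = f
      rw [map_smul, ← h2, smul_smul]
      norm_num
  have hrank : Module.finrank ℂ Q ≤ Module.finrank ℂ (P.map S) := by
    rw [← (Submodule.equivMapOfInjective S hSi P).finrank_eq]
    exact (Submodule.finrank_map_le _ _).trans hPr
  have hEq := Submodule.eq_of_le_of_finrank_le hle hrank
  refine hS0 _ ?_ k hjk
  rw [hEq]
  exact ⟨D.al j v, ⟨v, rfl⟩, rfl⟩

theorem inner_eigCol {j k : ℤ} (hjk : k ≠ j) (v w : V) :
    ⟪D.eigCol κ h.coercive j (D.al j v), D.eigCol κ h.coercive k (D.al k w)⟫_ℂ = 0 := by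
  rw [← ContinuousLinearMap.adjoint_inner_left, ← inner_apply_left_of_nonneg (D.pos k),
    h.al_adjoint_eigCol hjk, inner_zero_left]

end Represents

end SpecData

/-! ### The Dirac system, Green's formula and the boundary condition at the right end. -/

/-- Pairs `(y₁, y₂)` that solve the Dirac system with the potential `p` on `[0, 1]`. -/
structure IsDiracSol (p : ℝ → V →L[ℂ] V) (z : ℂ) (y₁ y₂ : ℝ → V) : Prop where
  cont₁ : ContinuousOn y₁ (Icc 0 1)
  cont₂ : ContinuousOn y₂ (Icc 0 1)
  eq₁ : ∀ x ∈ Icc (0 : ℝ) 1,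
    y₁ x = y₁ 0 + ∫ s in (0 : ℝ)..x, ((Complex.I * z) • y₁ s + p s (y₂ s))
  eq₂ : ∀ x ∈ Icc (0 : ℝ) 1,
    y₂ x = y₂ 0 + ∫ s in (0 : ℝ)..x, (-(Complex.I * z) • y₂ s + adjoint (p s) (y₁ s))

theorem memLp_vol01_of_continuousOn {W : Type*} [NormedAddCommGroup W] {y : ℝ → W}
    (hy : ContinuousOn y (Icc 0 1)) : MemLp y 2 vol01 := by
  have h : MemLp y 2 (volume.restrict (Icc (0 : ℝ) 1)) := by
    obtain ⟨C, hC⟩ := isCompact_Icc.exists_bound_of_continuousOn hy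
    exact MemLp.of_bound (hy.aestronglyMeasurable measurableSet_Icc) C
      ((ae_restrict_iff' measurableSet_Icc).2 (Eventually.of_forall hC))
  exact h.mono_measure (Measure.restrict_mono Ioo_subset_Icc_self le_rfl)

theorem vol01_eq_Ioc : vol01 = volume.restrict (Ioc (0 : ℝ) 1) := restrict_Ioo_eq_restrict_Ioc

theorem memLp_adjoint {μ : Measure ℝ} {p : ℝ → V →L[ℂ] V} (hp : MemLp p 2 μ) :
    MemLp (fun s => adjoint (p s)) 2 μ := by
  refine hp.of_le ((adjoint : (V →L[ℂ] V) ≃ₗᵢ⋆[ℂ] _).continuous.comp_aestronglyMeasurable hp.1) ?_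
  exact Eventually.of_forall fun s => (LinearIsometryEquiv.norm_map _ _).le

theorem integrable_vol01_clm {p : ℝ → V →L[ℂ] V} (hp : MemLp p 2 vol01) {y : ℝ → V}
    (hy : ContinuousOn y (Icc 0 1)) : IntegrableOn (fun s => p s (y s)) (Ioc 0 1) := by
  have := integrable_clm_apply hp (memLp_vol01_of_continuousOn hy)
  rwa [vol01_eq_Ioc] at this

theorem integrable_vol01_smul (c : ℂ) {y : ℝ → V}
    (hy : ContinuousOn y (Icc 0 1)) : IntegrableOn (fun s => c • y s) (Ioc 0 1) :=
  ((hy.integrableOn_Icc).mono_set Ioc_subset_Icc_self).smul c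

variable (V) in
/-- The inner product as a real bilinear map. -/
def innerBilin : V →L[ℝ] V →L[ℝ] ℂ := (isBoundedBilinearMap_inner (𝕜 := ℂ) (E :=
    V)).toContinuousLinearMap

theorem innerBilin_apply (v w : V) : innerBilin V v w = ⟪v, w⟫_ℂ := rfl

theorem integrable_bilin_continuousOn {U W Z : Type*} [NormedAddCommGroup U] [NormedSpace ℝ U]
    [NormedAddCommGroup W] [NormedSpace ℝ W] [NormedAddCommGroup Z] [NormedSpace ℝ Z]
    (B : U →L[ℝ] W →L[ℝ] Z) {f : ℝ → U} {G : ℝ → W} (hf : IntegrableOn f (Ioc 0 1))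
    (hG : ContinuousOn G (Icc 0 1)) : IntegrableOn (fun t => B (f t) (G t)) (Ioc 0 1) := by
  obtain ⟨C, hC⟩ := isCompact_Icc.exists_bound_of_continuousOn hG
  refine (hf.norm.const_mul (‖B‖ * C)).mono' (B.aestronglyMeasurable_comp₂ hf.1
    ((hG.mono Ioc_subset_Icc_self).aestronglyMeasurable measurableSet_Ioc)) ?_
  filter_upwards [ae_restrict_mem measurableSet_Ioc] with t ht
  refine (B.le_opNorm₂ _ _).trans ?_
  have := hC t (Ioc_subset_Icc_self ht)
  calc _ ≤ ‖B‖ * ‖f t‖ * C := by gcongr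
    _ = _ := by ring

/-- Green's formula for the Dirac system. -/
theorem IsDiracSol.green {p : ℝ → V →L[ℂ] V} (hp : MemLp p 2 vol01) {z w : ℂ}
    {y₁ y₂ u₁ u₂ : ℝ → V} (hy : IsDiracSol p z y₁ y₂) (hu : IsDiracSol p w u₁ u₂) :
    (⟪y₁ 1, u₁ 1⟫_ℂ - ⟪y₂ 1, u₂ 1⟫_ℂ) - (⟪y₁ 0, u₁ 0⟫_ℂ - ⟪y₂ 0, u₂ 0⟫_ℂ) =
      Complex.I * (w - (starRingEnd ℂ) z) *
        ∫ s in (0 : ℝ)..1, (⟪y₁ s, u₁ s⟫_ℂ + ⟪y₂ s, u₂ s⟫_ℂ) := by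
  have h01 : (1 : ℝ) ∈ Icc (0 : ℝ) 1 := by simp
  have hp' := memLp_adjoint hp
  have iy1 := (integrable_vol01_smul (Complex.I * z) hy.cont₁).add
      (integrable_vol01_clm hp hy.cont₂)
  have iy2 := (integrable_vol01_smul (-(Complex.I * z)) hy.cont₂).add
    (integrable_vol01_clm hp' hy.cont₁)
  have iu1 := (integrable_vol01_smul (Complex.I * w) hu.cont₁).add
      (integrable_vol01_clm hp hu.cont₂)
  have iu2 := (integrable_vol01_smul (-(Complex.I * w)) hu.cont₂).add
    (integrable_vol01_clm hp' hu.cont₁)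
  have e1 := bilin_primitive_eq (innerBilin V) zero_le_one iy1 iu1 hy.eq₁ hu.eq₁
  have e2 := bilin_primitive_eq (innerBilin V) zero_le_one iy2 iu2 hy.eq₂ hu.eq₂
  have j1 := (integrable_bilin_continuousOn (innerBilin V) iy1 hu.cont₁).add
    (integrable_bilin_continuousOn (innerBilin V).flip iu1 hy.cont₁)
  have j2 := (integrable_bilin_continuousOn (innerBilin V) iy2 hu.cont₂).add
    (integrable_bilin_continuousOn (innerBilin V).flip iu2 hy.cont₂)
  have k1 := (intervalIntegrable_iff_integrableOn_Ioc_of_le zero_le_one).2 j1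
  have k2 := (intervalIntegrable_iff_integrableOn_Ioc_of_le zero_le_one).2 j2
  have e3 := intervalIntegral.integral_sub k1 k2
  have e4 : (⟪y₁ 1, u₁ 1⟫_ℂ - ⟪y₂ 1, u₂ 1⟫_ℂ) - (⟪y₁ 0, u₁ 0⟫_ℂ - ⟪y₂ 0, u₂ 0⟫_ℂ) =
      ⟪y₁ 1, u₁ 1⟫_ℂ - ⟪y₁ 0, u₁ 0⟫_ℂ - (⟪y₂ 1, u₂ 1⟫_ℂ - ⟪y₂ 0, u₂ 0⟫_ℂ) := by ring
  rw [e4]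
  simp only [innerBilin_apply] at e1 e2
  rw [e1, e2, add_sub_cancel_left, add_sub_cancel_left]
  refine e3.symm.trans ?_
  rw [← intervalIntegral.integral_const_mul]
  refine intervalIntegral.integral_congr fun s _ => ?_
  simp only [Pi.add_apply, ContinuousLinearMap.flip_apply, innerBilin_apply, inner_add_left,
    inner_add_right, inner_smul_left, inner_smul_right, ContinuousLinearMap.adjoint_inner_left,
    ContinuousLinearMap.adjoint_inner_right, map_mul, map_neg, Complex.conj_I]
  ring

namespace DiffKernel.Coercive

variable {κ : DiffKernel V} (hκ : κ.Coercive)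

include hκ

theorem memLp_pot_vol01 : MemLp (κ.pot 1) 2 vol01 :=
  (hκ.memLp_pot (Or.inl rfl)).mono_measure Measure.restrict_le_self

theorem isDiracSol_phi (l : ℝ) (v : V) :
    IsDiracSol (κ.pot 1) l (fun x => κ.phi x l v) (fun x => κ.phi (-x) l v) := by
  have hc := hκ.continuous_phi l
  refine ⟨(hc.clm_apply continuous_const).continuousOn,
    ((hc.comp continuous_neg).clm_apply continuous_const).continuousOn, fun x hx => ?_,
        fun x hx => ?_⟩
  · have := hκ.phi_eq_integral (Or.inl rfl) hx l v
    simpa [κ.phi_zero] using this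
  · have := hκ.phi_eq_integral (Or.inr rfl) hx l v
    simpa [κ.phi_zero, hκ.adjoint_pot] using this

end DiffKernel.Coercive

theorem integral_vol11_eq_add {W : Type*} [NormedAddCommGroup W] [NormedSpace ℝ W] {f : ℝ → W}
    (hf : Integrable f vol11) : ∫ t, f t ∂vol11 = ∫ t in (0 : ℝ)..1, (f t + f (-t)) := by
  have hi : IntervalIntegrable f volume (-1) 1 := by
    rw [intervalIntegrable_iff_integrableOn_Ioc_of_le (by norm_num), IntegrableOn,
      ← restrict_Ioo_eq_restrict_Ioc]
    exact hf
  have h0 : IntervalIntegrable f volume (-1) 0 :=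
    hi.mono_set (by
      rw [uIcc_of_le (by norm_num), uIcc_of_le (by norm_num)]
      exact Icc_subset_Icc le_rfl zero_le_one)
  have h1 : IntervalIntegrable f volume 0 1 :=
    hi.mono_set (by
      rw [uIcc_of_le (by norm_num), uIcc_of_le (by norm_num)]
      exact Icc_subset_Icc (by norm_num) le_rfl)
  have h2 : IntervalIntegrable (fun t => f (-t)) volume 0 1 := by
    have := (IntervalIntegrable.iff_comp_neg (f := f) (a := -1) (b := 0)).1 h0
    simpa using this.symm
  have e : ∫ t, f t ∂vol11 = ∫ t in (-1 : ℝ)..1, f t := by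
    rw [intervalIntegral.integral_of_le (by norm_num), ← restrict_Ioo_eq_restrict_Ioc]
    rfl
  rw [e, ← intervalIntegral.integral_add_adjacent_intervals h0 h1,
    intervalIntegral.integral_add h1 h2, add_comm]
  congr 1
  rw [intervalIntegral.integral_comp_neg]
  simp

namespace SpecData

variable {D : SpecData V} {κ : DiffKernel V}

theorem inner_eigCol_eq (hκ : κ.Coercive) (j k : ℤ) (v w : V) :
    ⟪D.eigCol κ hκ j v, D.eigCol κ hκ k w⟫_ℂ = ∫ s in (0 : ℝ)..1,
      (⟪κ.phi s (D.lam j) v, κ.phi s (D.lam k) w⟫_ℂ +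
        ⟪κ.phi (-s) (D.lam j) v, κ.phi (-s) (D.lam k) w⟫_ℂ) := by
  have e := L2.inner_def (𝕜 := ℂ) (D.eigCol κ hκ j v) (D.eigCol κ hκ k w)
  have hc : Continuous fun s => ⟪κ.phi s (D.lam j) v, κ.phi s (D.lam k) w⟫_ℂ :=
    ((hκ.continuous_phi _).clm_apply continuous_const).inner
      ((hκ.continuous_phi _).clm_apply continuous_const)
  rw [e, ← integral_vol11_eq_add (f := fun s => ⟪κ.phi s (D.lam j) v, κ.phi s (D.lam k) w⟫_ℂ)]
  · refine integral_congr_ae ?_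
    filter_upwards [coeFn_eigCol hκ j v, coeFn_eigCol hκ k w] with s h1 h2
    rw [h1, h2]
  · exact (memLp_of_continuous hc).integrable one_le_two

namespace Represents

variable (h : D.Represents κ)

include h

/-- In Green's formula the contribution of x = 0 cancels since φ(0, λ) = I. The right side vanishes
by orthogonality if the indices differ and through its factor λ_k - λ_j if they agree. -/
theorem inner_phi_one (j k : ℤ) (v w : V) :
    ⟪κ.phi 1 (D.lam j) (D.al j v), κ.phi 1 (D.lam k) (D.al k w)⟫_ℂ =
      ⟪κ.phi (-1) (D.lam j) (D.al j v), κ.phi (-1) (D.lam k) (D.al k w)⟫_ℂ := by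
  have hκ := h.coercive
  have h1 := (hκ.isDiracSol_phi (D.lam j) (D.al j v)).green hκ.memLp_pot_vol01
    (hκ.isDiracSol_phi (D.lam k) (D.al k w))
  rw [← inner_eigCol_eq hκ] at h1
  have h2 : Complex.I * ((D.lam k : ℂ) - (starRingEnd ℂ) (D.lam j)) *
      ⟪D.eigCol κ hκ j (D.al j v), D.eigCol κ hκ k (D.al k w)⟫_ℂ = 0 := by
    by_cases hjk : k = j
    · rw [hjk, Complex.conj_ofReal, sub_self, mul_zero, zero_mul]
    · rw [h.inner_eigCol hjk, mul_zero]
  rw [h2] at h1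
  simp only [neg_zero, sub_self, sub_zero] at h1
  exact sub_eq_zero.1 h1

end Represents

variable (D)

theorem tendsto_blockFun (g : L2V V) : Tendsto (fun n : ℕ => D.blockFun n g) atTop (𝓝 0) := by
  obtain ⟨c, hc, hc0, -, hcl⟩ := D.exists_norm_blockFun_sub_le
  have hN : Tendsto (fun n : ℕ => (n : ℤ)) atTop cofinite :=
    (Nat.cast_injective (R := ℤ)).tendsto_cofinite.mono_left Nat.cofinite_eq_atTop.ge
  have h1 : Tendsto (fun n : ℕ => c n) atTop (𝓝 0) := by
    have := (hc.tendsto_cofinite_zero.comp hN).sqrt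
    simpa [Function.comp_def, Real.sqrt_sq (hc0 _)] using this
  have h2 : Tendsto (fun n : ℕ => adjoint (expCol (Real.pi * (n : ℤ))) g) atTop (𝓝 0) := by
    have := ((hasSum_inner_adjoint_expCol g g).summable.tendsto_cofinite_zero.comp hN)
    rw [tendsto_zero_iff_norm_tendsto_zero] at this ⊢
    have h3 := this.sqrt
    refine (h3.congr fun n => ?_).trans (by simp)
    rw [Function.comp_apply, inner_self_eq_norm_sq_to_K]
    simp [Real.sqrt_sq]
  have h3 : Tendsto (fun n : ℕ => D.blockFun n g - adjoint (expCol (Real.pi * (n : ℤ))) g) atTop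
      (𝓝 0) := by
    refine squeeze_zero_norm (a := fun n : ℕ => c n * ‖g‖) (fun n => ?_) ?_
    · exact ContinuousLinearMap.le_of_opNorm_le _ (hcl n) g
    · simpa using h1.mul_const ‖g‖
  simpa using h3.add h2

theorem tendsto_natCast_cofinite : Tendsto (fun n : ℕ => (n : ℤ)) atTop cofinite :=
  (Nat.cast_injective (R := ℤ)).tendsto_cofinite.mono_left Nat.cofinite_eq_atTop.ge

theorem tendsto_zero_of_summable_sq {x : ℤ → ℝ} (h0 : ∀ n, 0 ≤ x n)
    (hx : Summable fun n => x n ^ 2) : Tendsto (fun n : ℕ => x n) atTop (𝓝 0) := by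
  have := (hx.tendsto_cofinite_zero.comp tendsto_natCast_cofinite).sqrt
  simpa [Function.comp_def, Real.sqrt_sq (h0 _)] using this

theorem tendsto_sum_exp {ε : ℝ} (hε : ε = 1 ∨ ε = -1) (u : V) : Tendsto (fun n : ℕ =>
    ∑ k ∈ D.idx n, D.al k (Complex.exp (-(Complex.I * D.lam k * ε)) • u) -
      Complex.exp (-(Complex.I * (Real.pi * (n : ℤ) : ℝ) * ε)) • u) atTop (𝓝 0) := by
  obtain ⟨B, hB0, hB⟩ := D.exists_norm_le
  have habs : |ε| = 1 := by rcases hε with rfl | rfl <;> norm_num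
  have h1 := tendsto_zero_of_summable_sq (fun n => by positivity) D.summable_sq_sum
  have h2 := tendsto_zero_of_summable_sq (x := fun n => ‖1 - D.beta n‖) (fun n => norm_nonneg _)
    D.summable_norm
  have h3 := ((h1.const_mul B).add h2).mul_const ‖u‖
  refine squeeze_zero_norm (fun n => ?_) (h3.trans (by simp))
  have h4 := norm_sum_comp_sub_le (D.idx n) D.al
    (fun k => Complex.exp (-(Complex.I * D.lam k * ε)) • (1 : V →L[ℂ] V))
    (Complex.exp (-(Complex.I * (Real.pi * (n : ℤ) : ℝ) * ε)) • (1 : V →L[ℂ] V)) hB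
    (δ := fun k => |D.lam k - Real.pi * (n : ℤ)|) (fun k => by
      rw [← sub_smul, norm_smul]
      refine (mul_le_mul (norm_exp_sub_exp_le _ _ _) ContinuousLinearMap.norm_id_le (norm_nonneg _)
        (by positivity)).trans_eq ?_
      rw [habs, mul_one, mul_one])
  have h5 : ‖Complex.exp (-(Complex.I * (Real.pi * (n : ℤ) : ℝ) * ε)) • (1 : V →L[ℂ] V)‖ ≤ 1 := by
    rw [norm_smul, Complex.norm_exp]
    have h6 : ‖(1 : V →L[ℂ] V)‖ ≤ 1 := ContinuousLinearMap.norm_id_le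
    simpa using h6
  have h6 := ContinuousLinearMap.le_of_opNorm_le _
    (h4.trans (add_le_add le_rfl (mul_le_mul_of_nonneg_right h5 (norm_nonneg _)))) u
  simp only [sub_apply, sum_apply, ContinuousLinearMap.comp_apply, smul_apply, one_apply_eq_self,
    one_mul] at h6
  exact h6

theorem adjoint_phi_apply (κ : DiffKernel V) (y l : ℝ) (u : V) : adjoint (κ.phi y l) u =
    Complex.exp (-(Complex.I * l * y)) • u + adjoint (expCol l) (adjoint (κ.sigma y) u) := by
  refine ext_inner_left ℂ fun v => ?_
  rw [ContinuousLinearMap.adjoint_inner_right, κ.phi_apply, inner_add_left, inner_add_right,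
    inner_smul_left, inner_smul_right, ContinuousLinearMap.adjoint_inner_right,
    ContinuousLinearMap.adjoint_inner_right, ← Complex.exp_conj]
  simp

/-- Over Δ_n the scalar part is close to e^{∓iπn}, which is the same number for both signs, with
total mass close to I. The part containing σ is a block functional at a fixed function and tends to
zero as in the Riemann–Lebesgue lemma. -/
theorem tendsto_sum_adjoint_phi (κ : DiffKernel V) {ε : ℝ} (hε : ε = 1 ∨ ε = -1) (u : V) :
    Tendsto (fun n : ℕ => ∑ k ∈ D.idx n, D.al k (adjoint (κ.phi ε (D.lam k)) u) -
      Complex.exp (Complex.I * (Real.pi * (n : ℤ) : ℝ)) • u) atTop (𝓝 0) := by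
  have h1 := (D.tendsto_sum_exp hε u).add (D.tendsto_blockFun (adjoint (κ.sigma ε) u))
  rw [add_zero] at h1
  refine h1.congr fun n => ?_
  have e : Complex.exp (-(Complex.I * (Real.pi * (n : ℤ) : ℝ) * ε)) =
      Complex.exp (Complex.I * (Real.pi * (n : ℤ) : ℝ)) := by
    rcases hε with rfl | rfl
    · rw [Complex.exp_eq_exp_iff_exists_int]
      exact ⟨-n, by push_cast; ring⟩
    · congr 1; push_cast; ring
  simp only [adjoint_phi_apply, map_add, Finset.sum_add_distrib, blockFun, sum_apply,
    ContinuousLinearMap.comp_apply]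
  rw [e]
  abel

/-- The boundary condition at the right end. -/
theorem Represents.phi_one {D : SpecData V} {κ : DiffKernel V} (h : D.Represents κ) (j : ℤ)
    (v : V) :
    κ.phi 1 (D.lam j) (D.al j v) = κ.phi (-1) (D.lam j) (D.al j v) := by
  set a := κ.phi 1 (D.lam j) (D.al j v) with ha
  set b := κ.phi (-1) (D.lam j) (D.al j v) with hb
  -- The Gram identity `inner_phi_one` says exactly that the block sums for a at x = 1 and for b at
  -- x = -1 agree; their asymptotics then give e^{iπn}(a - b) → 0.
  have hS : ∀ n, ∑ k ∈ D.idx n, D.al k (adjoint (κ.phi 1 (D.lam k)) a) =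
      ∑ k ∈ D.idx n, D.al k (adjoint (κ.phi (-1) (D.lam k)) b) := fun n => by
    refine Finset.sum_congr rfl fun k _ => ext_inner_right ℂ fun w => ?_
    rw [inner_apply_left_of_nonneg (D.pos k), inner_apply_left_of_nonneg (D.pos k),
      ContinuousLinearMap.adjoint_inner_left, ContinuousLinearMap.adjoint_inner_left]
    exact h.inner_phi_one j k v w
  have h1 := (D.tendsto_sum_adjoint_phi κ (Or.inr rfl) b).sub
    (D.tendsto_sum_adjoint_phi κ (Or.inl rfl) a)
  have h2 : Tendsto (fun _ : ℕ => ‖a - b‖) atTop (𝓝 0) := by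
    have h3 := h1.norm
    rw [sub_zero, norm_zero] at h3
    refine h3.congr fun n => ?_
    rw [hS, sub_sub_sub_cancel_left, ← smul_sub, norm_smul, Complex.norm_exp]
    simp
  have h3 := tendsto_nhds_unique h2 tendsto_const_nhds
  exact sub_eq_zero.1 (norm_eq_zero.1 h3.symm)

end SpecData

end

/-! ### Linear systems with square integrable coefficients; absence of further eigenvalues. -/

section

section LinearODE

variable {E : Type*} [NormedAddCommGroup E] [NormedSpace ℝ E] [CompleteSpace E]

theorem memLp_exp_mul (c : ℝ) : MemLp (fun s : ℝ => Real.exp (c * s)) 2 vol01 :=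
  memLp_vol01_of_continuousOn (by fun_prop)

theorem integrable_ode {A : ℝ → E →L[ℝ] E} (hA : MemLp A 2 vol01) (c : ℝ) {v : ℝ → E}
    (hv : Continuous v) : IntegrableOn (fun s => A s (Real.exp (c * s) • v s)) (Ioc 0 1) := by
  have h1 : IntegrableOn A (Ioc 0 1) := by
    rw [IntegrableOn, ← restrict_Ioo_eq_restrict_Ioc]
    exact hA.integrable one_le_two
  exact integrable_bilin_continuousOn (ContinuousLinearMap.id ℝ (E →L[ℝ] E)) h1
    (G := fun s => Real.exp (c * s) • v s) (by fun_prop)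

theorem norm_integral_ode_le {A : ℝ → E →L[ℝ] E} (hA : MemLp A 2 vol01) {c : ℝ} (hc : 0 < c)
    {v : ℝ → E} {C : ℝ} (hC : ∀ s, ‖v s‖ ≤ C) {x : ℝ} (hx : x ∈ Icc (0 : ℝ) 1) :
    ‖∫ s in (0 : ℝ)..x, A s (Real.exp (c * s) • v s)‖ ≤
      √((∫ s, ‖A s‖ ^ 2 ∂vol01) / (2 * c)) * Real.exp (c * x) * C := by
  have hC0 : 0 ≤ C := (norm_nonneg _).trans (hC 0)
  have hμ : volume.restrict (Ioc 0 x) ≤ vol01 := by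
    rw [vol01_eq_Ioc]
    exact Measure.restrict_mono (Ioc_subset_Ioc_right hx.2) le_rfl
  have hAx : MemLp (fun s => ‖A s‖) 2 (volume.restrict (Ioc 0 x)) := (hA.mono_measure hμ).norm
  have hex : MemLp (fun s => Real.exp (c * s)) 2 (volume.restrict (Ioc 0 x)) :=
    (memLp_exp_mul c).mono_measure hμ
  have h1 : ‖∫ s in (0 : ℝ)..x, A s (Real.exp (c * s) • v s)‖ ≤
      ∫ s in Ioc 0 x, (‖A s‖ * Real.exp (c * s)) * C := by
    rw [intervalIntegral.integral_of_le hx.1]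
    refine norm_integral_le_of_norm_le ((hAx.integrable_mul hex).mul_const C) ?_
    refine Eventually.of_forall fun s => ((A s).le_opNorm _).trans ?_
    rw [norm_smul, Real.norm_of_nonneg (Real.exp_pos _).le, mul_assoc]
    gcongr
    exact hC s
  have h2 := sq_integral_mul_le (fun s => norm_nonneg (A s)) (fun s => (Real.exp_pos (c * s)).le)
    hAx hex
  have h3 : ∫ s in Ioc 0 x, ‖A s‖ ^ 2 ≤ ∫ s, ‖A s‖ ^ 2 ∂vol01 :=
    integral_mono_measure hμ (Eventually.of_forall fun s => sq_nonneg _)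
      ((memLp_two_iff_integrable_sq_norm hA.1).1 hA)
  have h4 : ∫ s in Ioc 0 x, Real.exp (c * s) ^ 2 ≤ Real.exp (c * x) ^ 2 / (2 * c) := by
    have e : ∀ s : ℝ, Real.exp (c * s) ^ 2 = Real.exp ((2 * c) * s) := fun s => by
      rw [← Real.exp_nat_mul]; congr 1; push_cast; ring
    simp_rw [e]
    rw [← intervalIntegral.integral_of_le hx.1,
      intervalIntegral.integral_comp_mul_left (fun s => Real.exp s) (by positivity), integral_exp,
      mul_zero, Real.exp_zero, smul_eq_mul, inv_mul_eq_div]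
    gcongr
    linarith
  refine h1.trans ?_
  rw [integral_mul_const]
  refine mul_le_mul_of_nonneg_right ?_ hC0
  refine le_of_sq_le_sq ?_ (by positivity)
  refine h2.trans ?_
  rw [mul_pow, Real.sq_sqrt (div_nonneg (integral_nonneg fun s => sq_nonneg _) (by positivity))]
  refine (mul_le_mul h3 h4 (integral_nonneg fun s => sq_nonneg _)
    (integral_nonneg fun s => sq_nonneg _)).trans_eq ?_
  ring

/-- Linear systems with square integrable coefficients are solvable. -/
theorem exists_linear_ode {A : ℝ → E →L[ℝ] E} (hA : MemLp A 2 vol01) (u₀ : E) :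
    ∃ u : ℝ → E, Continuous u ∧ ∀ x ∈ Icc (0 : ℝ) 1, u x = u₀ + ∫ s in (0 : ℝ)..x, A s (u s) := by
  set N := ∫ s, ‖A s‖ ^ 2 ∂vol01 with hN
  have hN0 : 0 ≤ N := integral_nonneg fun s => sq_nonneg _
  -- The unknown is e^{-cx} u(x). In the sup norm its integral operator has norm at most √(N/(2c))
  -- by Cauchy–Schwarz, and this is less than 1 for c = N + 1.
  set c := N + 1 with hc
  have hc0 : 0 < c := by positivity
  set K := √(N / (2 * c)) with hK
  have hK1 : K < 1 := by
    rw [hK, Real.sqrt_lt' one_pos, div_lt_iff₀ (by positivity)]; linarith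
  set ext : C(Icc (0 : ℝ) 1, E) → ℝ → E := fun v => IccExtend zero_le_one v with hext
  have hextc : ∀ v, Continuous (ext v) := fun v => v.continuous.Icc_extend'
  set Φ : C(Icc (0 : ℝ) 1, E) → C(Icc (0 : ℝ) 1, E) := fun v =>
    ⟨fun x => Real.exp (-(c * x)) • (u₀ + ∫ s in (0 : ℝ)..x, A s (Real.exp (c * s) • ext v s)), by
      have h := continuousOn_primitive_Icc (integrable_ode hA c (hextc v))
      have h' := continuousOn_iff_continuous_domRestrict.1 h
      exact (by fun_prop : Continuous fun x : Icc (0 : ℝ) 1 => Real.exp (-(c * x))).smul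
        (continuous_const.add h')⟩ with hΦ
  have hΦa : ∀ v x, Φ v x = Real.exp (-(c * x)) •
      (u₀ + ∫ s in (0 : ℝ)..x, A s (Real.exp (c * s) • ext v s)) := fun _ _ => rfl
  have hlip : LipschitzWith ⟨K, Real.sqrt_nonneg _⟩ Φ := by
    refine LipschitzWith.of_dist_le_mul fun v w => ?_
    rw [dist_eq_norm, dist_eq_norm]
    refine (ContinuousMap.norm_le _ (mul_nonneg (Real.sqrt_nonneg _) (norm_nonneg _))).2 fun x => ?_
    have e : (Φ v - Φ w) x = Real.exp (-(c * x)) •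
        ∫ s in (0 : ℝ)..x, A s (Real.exp (c * s) • ext (v - w) s) := by
      have i : ∀ v, IntervalIntegrable (fun s => A s (Real.exp (c * s) • ext v s)) volume 0 x :=
        fun v => (intervalIntegrable_iff_integrableOn_Ioc_of_le x.2.1).2
          ((integrable_ode hA c (hextc v)).mono_set (Ioc_subset_Ioc_right x.2.2))
      rw [ContinuousMap.sub_apply, hΦa, hΦa, ← smul_sub, add_sub_add_left_eq_sub,
          ← intervalIntegral.integral_sub (i v) (i w)]
      congr 1
      refine intervalIntegral.integral_congr fun s _ => ?_
      rw [← map_sub, ← smul_sub]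
      rfl
    rw [e, norm_smul, Real.norm_of_nonneg (Real.exp_pos _).le]
    refine (mul_le_mul_of_nonneg_left (norm_integral_ode_le hA hc0 (C := ‖v - w‖)
      (fun s => (v - w).norm_coe_le_norm _) x.2) (Real.exp_pos _).le).trans_eq ?_
    rw [mul_comm (√_), mul_assoc, ← mul_assoc, ← Real.exp_add, neg_add_cancel, Real.exp_zero,
        one_mul]
  have hcon : ContractingWith ⟨K, Real.sqrt_nonneg _⟩ Φ := ⟨hK1, hlip⟩
  obtain ⟨v, hv⟩ : ∃ v, Φ v = v := ⟨_, hcon.fixedPoint_isFixedPt⟩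
  refine ⟨fun x => Real.exp (c * x) • ext v x, by have := hextc v; fun_prop, fun x hx => ?_⟩
  have h1 : ext v x = Φ v ⟨x, hx⟩ := by
    rw [hv, hext]; exact IccExtend_of_mem _ _ hx
  change Real.exp (c * x) • ext v x = _
  rw [h1, hΦa, smul_smul, ← Real.exp_add, add_neg_cancel, Real.exp_zero, one_smul]

end LinearODE

variable {V : Type*} [NormedAddCommGroup V] [InnerProductSpace ℂ V] [FiniteDimensional ℂ V]
  [CompleteSpace V]

open ContinuousLinearMap (adjoint)

/-- The function on `(-1, 1)` that corresponds to a pair of functions on `(0, 1)`. -/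
def foldFun (y₁ y₂ : ℝ → V) : ℝ → V := (Ioi (0 : ℝ)).piecewise y₁ fun t => y₂ (-t)

theorem foldFun_of_pos (y₁ y₂ : ℝ → V) {t : ℝ} (ht : 0 < t) : foldFun y₁ y₂ t = y₁ t :=
  piecewise_eq_of_mem _ _ _ ht

theorem foldFun_of_nonpos (y₁ y₂ : ℝ → V) {t : ℝ} (ht : t ≤ 0) : foldFun y₁ y₂ t = y₂ (-t) :=
  piecewise_eq_of_notMem _ _ _ (not_lt.2 ht)

theorem memLp_restrict_of_subset_Icc {S : Set ℝ} {y : ℝ → V} {a b : ℝ}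
    (hSi : S ⊆ Icc a b) (hy : ContinuousOn y (Icc a b)) : MemLp y 2 (volume.restrict S) := by
  have h : MemLp y 2 (volume.restrict (Icc a b)) := by
    obtain ⟨C, hC⟩ := isCompact_Icc.exists_bound_of_continuousOn hy
    exact MemLp.of_bound (hy.aestronglyMeasurable measurableSet_Icc) C
      ((ae_restrict_iff' measurableSet_Icc).2 (Eventually.of_forall hC))
  exact h.mono_measure (Measure.restrict_mono hSi le_rfl)

theorem memLp_foldFun {y₁ y₂ : ℝ → V} (h₁ : ContinuousOn y₁ (Icc 0 1))
    (h₂ : ContinuousOn y₂ (Icc 0 1)) : MemLp (foldFun y₁ y₂) 2 vol11 := by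
  refine MemLp.piecewise measurableSet_Ioi ?_ ?_
  · rw [vol11, Measure.restrict_restrict measurableSet_Ioi]
    refine memLp_restrict_of_subset_Icc ?_ h₁
    exact fun t ht => ⟨le_of_lt ht.1, ht.2.2.le⟩
  · rw [vol11, Measure.restrict_restrict measurableSet_Ioi.compl]
    refine memLp_restrict_of_subset_Icc (a := -1) (b := 0) ?_ ?_
    · exact fun t ht => ⟨ht.2.1.le, not_lt.1 ht.1⟩
    · exact h₂.comp continuous_neg.continuousOn fun t ht => ⟨by linarith [ht.2], by linarith [ht.1]⟩

/-- The class in `L₂((-1, 1), V)` of the folded pair. -/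
def foldL2 (y₁ y₂ : ℝ → V) : L2V V := res (foldFun y₁ y₂)

theorem inner_foldL2 {y₁ y₂ u₁ u₂ : ℝ → V} (h₁ : ContinuousOn y₁ (Icc 0 1))
    (h₂ : ContinuousOn y₂ (Icc 0 1)) (k₁ : ContinuousOn u₁ (Icc 0 1))
    (k₂ : ContinuousOn u₂ (Icc 0 1)) : ⟪foldL2 y₁ y₂, foldL2 u₁ u₂⟫_ℂ =
      ∫ s in (0 : ℝ)..1, (⟪y₁ s, u₁ s⟫_ℂ + ⟪y₂ s, u₂ s⟫_ℂ) := by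
  have hy := memLp_foldFun h₁ h₂
  have hu := memLp_foldFun k₁ k₂
  have i : Integrable (fun t => ⟪foldFun y₁ y₂ t, foldFun u₁ u₂ t⟫_ℂ) vol11 := by
    have := L2.integrable_inner (𝕜 := ℂ) (foldL2 y₁ y₂) (foldL2 u₁ u₂)
    refine this.congr ?_
    filter_upwards [coeFn_res hy, coeFn_res hu] with t e1 e2
    rw [foldL2, foldL2, e1, e2]
  have e : ⟪foldL2 y₁ y₂, foldL2 u₁ u₂⟫_ℂ = ∫ t, ⟪foldFun y₁ y₂ t, foldFun u₁ u₂ t⟫_ℂ ∂vol11 := by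
    refine (L2.inner_def (𝕜 := ℂ) _ _).trans (integral_congr_ae ?_)
    filter_upwards [coeFn_res hy, coeFn_res hu] with t e1 e2
    rw [foldL2, foldL2, e1, e2]
  rw [e, integral_vol11_eq_add i]
  refine intervalIntegral.integral_congr_ae (Eventually.of_forall fun t ht => ?_)
  rw [uIoc_of_le zero_le_one] at ht
  rw [foldFun_of_pos _ _ ht.1, foldFun_of_pos _ _ ht.1, foldFun_of_nonpos _ _ (by linarith [ht.1]),
    foldFun_of_nonpos _ _ (by linarith [ht.1]), neg_neg]

theorem eqOn_zero_of_foldL2 {y₁ y₂ : ℝ → V} (h₁ : ContinuousOn y₁ (Icc 0 1))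
    (h₂ : ContinuousOn y₂ (Icc 0 1)) (h : foldL2 y₁ y₂ = 0) :
    ∀ x ∈ Icc (0 : ℝ) 1, y₁ x = 0 ∧ y₂ x = 0 := by
  have h0 : foldFun y₁ y₂ =ᵐ[vol11] 0 := by
    have h3 := coeFn_res (memLp_foldFun h₁ h₂)
    change foldL2 y₁ y₂ =ᵐ[vol11] _ at h3
    rw [h] at h3
    exact h3.symm.trans (Lp.coeFn_zero _ _ _)
  have h4 : ∀ᵐ t : ℝ, t ∈ Ioo (-1 : ℝ) 1 → foldFun y₁ y₂ t = 0 := ae_vol11_iff.1 h0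
  have h5 : ∀ᵐ t : ℝ, -t ∈ Ioo (-1 : ℝ) 1 → foldFun y₁ y₂ (-t) = 0 :=
    (Measure.measurePreserving_neg volume).quasiMeasurePreserving.ae h4
  have hne : ∀ᵐ t : ℝ, t ≠ 0 ∧ t ≠ 1 := by
    have a0 : ∀ᵐ t : ℝ, t ≠ 0 := by simp [ae_iff]
    have a1 : ∀ᵐ t : ℝ, t ≠ 1 := by simp [ae_iff]
    filter_upwards [a0, a1] with t b0 b1 using ⟨b0, b1⟩
  have e1 : y₁ =ᵐ[volume.restrict (Icc 0 1)] fun _ => 0 := by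
    refine (ae_restrict_iff' measurableSet_Icc).2 ?_
    filter_upwards [h4, hne] with t a b ht
    have t0 : 0 < t := lt_of_le_of_ne ht.1 b.1.symm
    rw [← foldFun_of_pos y₁ y₂ t0]
    exact a ⟨by linarith, lt_of_le_of_ne ht.2 b.2⟩
  have e2 : y₂ =ᵐ[volume.restrict (Icc 0 1)] fun _ => 0 := by
    refine (ae_restrict_iff' measurableSet_Icc).2 ?_
    filter_upwards [h5, hne] with t a b ht
    have t0 : 0 < t := lt_of_le_of_ne ht.1 b.1.symm
    have t1 : t < 1 := lt_of_le_of_ne ht.2 b.2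
    have := a ⟨by linarith, by linarith⟩
    rwa [foldFun_of_nonpos _ _ (by linarith), neg_neg] at this
  intro x hx
  exact ⟨Measure.eqOn_Icc_of_ae_eq volume zero_ne_one e1 h₁ continuousOn_const hx,
    Measure.eqOn_Icc_of_ae_eq volume zero_ne_one e2 h₂ continuousOn_const hx⟩

theorem IsDiracSol.green_foldL2 {p : ℝ → V →L[ℂ] V} (hp : MemLp p 2 vol01) {z w : ℂ}
    {y₁ y₂ u₁ u₂ : ℝ → V} (hy : IsDiracSol p z y₁ y₂) (hu : IsDiracSol p w u₁ u₂)
    (hy1 : y₁ 1 = y₂ 1) (hu1 : u₁ 1 = u₂ 1) :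
    ⟪y₂ 0, u₂ 0⟫_ℂ - ⟪y₁ 0, u₁ 0⟫_ℂ =
      Complex.I * (w - (starRingEnd ℂ) z) * ⟪foldL2 y₁ y₂, foldL2 u₁ u₂⟫_ℂ := by
  rw [inner_foldL2 hy.cont₁ hy.cont₂ hu.cont₁ hu.cont₂, ← hy.green hp hu, hy1, hu1]
  ring

namespace SpecData

variable {D : SpecData V} {κ : DiffKernel V}

theorem eigCol_eq_foldL2 (hκ : κ.Coercive) (j : ℤ) (v : V) : D.eigCol κ hκ j v =
    foldL2 (fun x => κ.phi x (D.lam j) v) (fun x => κ.phi (-x) (D.lam j) v) := by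
  have h := hκ.isDiracSol_phi (D.lam j) v
  refine Lp.ext ((coeFn_eigCol hκ j v).trans ((coeFn_res (memLp_foldFun h.cont₁ h.cont₂)).trans
    (Eventually.of_forall fun t => ?_)).symm)
  rcases lt_or_ge 0 t with ht | ht
  · exact foldFun_of_pos _ _ ht
  · exact (foldFun_of_nonpos _ _ ht).trans (by rw [neg_neg])

namespace Represents

variable (h : D.Represents κ)

include h

/-- Green's formula against an eigenfunction: both satisfy the condition at 1, so the coordinates of
the solution are determined by its jump y₂(0) - y₁(0). With zero jump and z off the λ_j all
coordinates vanish; with a prescribed jump this computes the Weyl solution. -/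
theorem smul_al_adjoint_eigCol {z : ℂ} {y₁ y₂ : ℝ → V} (hy : IsDiracSol (κ.pot 1) z y₁ y₂)
    (hy1 : y₁ 1 = y₂ 1) (j : ℤ) :
    (Complex.I * (z - D.lam j)) • D.al j (adjoint (D.eigCol κ h.coercive j) (foldL2 y₁ y₂)) =
      D.al j (y₂ 0 - y₁ 0) := by
  refine ext_inner_left ℂ fun v => ?_
  have h1 := (h.coercive.isDiracSol_phi (D.lam j) (D.al j v)).green_foldL2
    h.coercive.memLp_pot_vol01 hy (h.phi_one j v) hy1
  rw [← eigCol_eq_foldL2 h.coercive, Complex.conj_ofReal] at h1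
  simp only [neg_zero, κ.phi_zero] at h1
  rw [inner_smul_right, ← inner_apply_left_of_nonneg (D.pos j),
    ContinuousLinearMap.adjoint_inner_right, ← h1, ← inner_sub_right,
    inner_apply_left_of_nonneg (D.pos j)]

theorem eq_zero_of_isDiracSol {z : ℂ} (hz : ∀ j, z ≠ D.lam j) {y₁ y₂ : ℝ → V}
    (hy : IsDiracSol (κ.pot 1) z y₁ y₂) (hy0 : y₁ 0 = y₂ 0) (hy1 : y₁ 1 = y₂ 1) :
    ∀ x ∈ Icc (0 : ℝ) 1, y₁ x = 0 ∧ y₂ x = 0 := by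
  refine eqOn_zero_of_foldL2 hy.cont₁ hy.cont₂ (h.eq_zero_of_adjoint_eigCol fun j => ?_)
  have h1 := h.smul_al_adjoint_eigCol hy hy1 j
  rw [hy0, sub_self, map_zero] at h1
  exact (smul_eq_zero.1 h1).resolve_left
    (mul_ne_zero Complex.I_ne_zero (sub_ne_zero.2 (hz j)))

end Represents

end SpecData

end

/-! ### Mittag-Leffler expansion of the Weyl function. -/

section

variable {V : Type*} [NormedAddCommGroup V] [InnerProductSpace ℂ V] [FiniteDimensional ℂ V]
  [CompleteSpace V]

open ContinuousLinearMap (adjoint)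

namespace SpecData

variable (D : SpecData V)

theorem abs_le_abs_lam_sub {j m : ℤ} (hj : j ∈ D.idx m) {c : ℝ} (hc : 2 + |c| ≤ |(m : ℝ)|) :
    |(m : ℝ)| ≤ |D.lam j - c| := by
  have h1 := (D.mem_idx j m).1 hj
  rw [Delta, mem_Ioc] at h1
  have h2 : |Real.pi * m - D.lam j| ≤ Real.pi / 2 := by rw [abs_le]; constructor <;> linarith
  have h3 : |Real.pi * m| = Real.pi * |(m : ℝ)| := by rw [abs_mul, abs_of_pos Real.pi_pos]
  have h4 : Real.pi * m = (Real.pi * m - D.lam j) + (D.lam j - c) + c := by ring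
  have h5 : |Real.pi * m| ≤ |Real.pi * m - D.lam j| + |D.lam j - c| + |c| := by
    conv_lhs => rw [h4]
    exact (abs_add_le _ _).trans (add_le_add (abs_add_le _ _) le_rfl)
  have := Real.pi_gt_three
  have := Real.pi_lt_four
  have h6 : 3 * |(m : ℝ)| ≤ Real.pi * |(m : ℝ)| := by gcongr
  linarith [abs_nonneg c]

theorem eventually_abs_le (c : ℝ) : ∀ᶠ m : ℤ in cofinite, c ≤ |(m : ℝ)| := by
  have h : {m : ℤ | ¬ c ≤ |(m : ℝ)|} ⊆ Icc (-⌈c⌉) ⌈c⌉ := by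
    intro m hm
    have h1 : |(m : ℝ)| < c := not_le.1 hm
    have h2 := (abs_lt.1 h1)
    have h3 := Int.le_ceil c
    constructor
    · have : (-⌈c⌉ : ℝ) < m := by linarith
      exact_mod_cast this.le
    · have : (m : ℝ) < ⌈c⌉ := by linarith
      exact_mod_cast this.le
  exact (finite_Icc _ _).subset h

theorem exists_gap (k : ℤ) : ∃ ρ : ℝ, 0 < ρ ∧ ∀ j, j ≠ k → 2 * ρ ≤ |D.lam j - D.lam k| := by
  have hfin : {m : ℤ | ¬ 2 + |D.lam k| ≤ |(m : ℝ)|}.Finite := eventually_abs_le _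
  set s := hfin.toFinset.biUnion D.idx with hs
  have h1 : ∀ᶠ ρ : ℝ in 𝓝[>] 0, ∀ j ∈ s.erase k, 2 * ρ ≤ |D.lam j - D.lam k| := by
    refine (Filter.eventually_all_finset _).2 fun j hj => ?_
    have hpos : 0 < |D.lam j - D.lam k| / 2 :=
      half_pos (abs_pos.2 (sub_ne_zero.2 fun e => (Finset.mem_erase.1 hj).1 (D.inj e)))
    filter_upwards [Ioo_mem_nhdsGT hpos] with ρ hρ
    linarith [hρ.2]
  obtain ⟨ρ, hρ1, hρ2, hρ3⟩ := (h1.and (Ioo_mem_nhdsGT (one_pos : (0 : ℝ) < 1))).exists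
  refine ⟨ρ, hρ2, fun j hj => ?_⟩
  obtain ⟨m, hm⟩ := D.exists_idx j
  by_cases h2 : 2 + |D.lam k| ≤ |(m : ℝ)|
  · have := D.abs_le_abs_lam_sub hm h2
    linarith [abs_nonneg (D.lam k)]
  · exact hρ1 j (Finset.mem_erase.2 ⟨hj, Finset.mem_biUnion.2 ⟨m, hfin.mem_toFinset.2 h2, hm⟩⟩)

/-- The terms of the Mittag-Leffler series. -/
def cauchyTerm (a b : V) (z : ℂ) (j : ℤ) : ℂ :=
  ⟪a, D.al j b⟫_ℂ / ((z - D.lam j) * (-Complex.I - D.lam j))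

theorem neg_I_sub_ne_zero (l : ℝ) : -Complex.I - (l : ℂ) ≠ 0 := fun h => by
  simpa using congrArg Complex.im h

theorem abs_le_norm_neg_I_sub (l : ℝ) : |l| ≤ ‖-Complex.I - (l : ℂ)‖ := by
  have := Complex.abs_re_le_norm (-Complex.I - (l : ℂ))
  simpa using this

theorem norm_cauchyTerm_le {B : ℝ} (hB : ∀ j, ‖D.al j‖ ≤ B) (a b : V) {z : ℂ} {j k : ℤ} {ρ : ℝ}
    (hρ : 2 * ρ ≤ |D.lam j - D.lam k|) (h0 : 0 < ρ) (hz : z ∈ Metric.ball (D.lam k : ℂ) ρ) :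
    ‖D.cauchyTerm a b z j‖ ≤
      ‖a‖ * (B * ‖b‖) / (|D.lam j - D.lam k| / 2 * ‖-Complex.I - (D.lam j : ℂ)‖) := by
  have h1 : |D.lam j - D.lam k| / 2 ≤ ‖z - D.lam j‖ := by
    have h2 : ‖(D.lam k : ℂ) - D.lam j‖ = |D.lam j - D.lam k| := by
      rw [← Complex.ofReal_sub, Complex.norm_real, Real.norm_eq_abs, abs_sub_comm]
    have h3 := norm_sub_le_norm_sub_add_norm_sub (D.lam k : ℂ) z (D.lam j)
    rw [h2] at h3
    rw [Metric.mem_ball, dist_comm, dist_eq_norm] at hz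
    linarith
  have h4 : 0 < |D.lam j - D.lam k| / 2 := by linarith
  have h5 : 0 < ‖-Complex.I - (D.lam j : ℂ)‖ := norm_pos_iff.2 (neg_I_sub_ne_zero _)
  rw [cauchyTerm, norm_div, norm_mul]
  have h6 : ‖⟪a, D.al j b⟫_ℂ‖ ≤ ‖a‖ * (B * ‖b‖) := (norm_inner_le_norm _ _).trans
    (mul_le_mul_of_nonneg_left ((D.al j).le_of_opNorm_le (hB j) b) (norm_nonneg _))
  have h7 : 0 ≤ ‖a‖ * (B * ‖b‖) := (norm_nonneg _).trans h6
  gcongr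

/-- The second factor -i - λ_j makes the terms of the m-th block O(m⁻²), with boundedly many terms
in a block, so the sum without the k-th term converges uniformly to a holomorphic function. -/
theorem exists_cauchy_sum (a b : V) {k : ℤ} {ρ : ℝ} (h0 : 0 < ρ)
    (hρ : ∀ j, j ≠ k → 2 * ρ ≤ |D.lam j - D.lam k|) : ∃ T : ℂ → ℂ,
    DifferentiableOn ℂ T (Metric.ball (D.lam k : ℂ) ρ) ∧ ∀ z ∈ Metric.ball (D.lam k : ℂ) ρ,
      Tendsto (fun n : ℕ => ∑ m ∈ Finset.Ioc (-(n : ℤ)) n, ∑ j ∈ D.idx m,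
          D.cauchyTerm a b z j) atTop
        (𝓝 (D.cauchyTerm a b z k + T z)) := by
  obtain ⟨B, hB0, hB⟩ := D.exists_norm_le
  obtain ⟨C, hC⟩ := D.card_le
  set F : ℤ → ℂ → ℂ := fun m z => ∑ j ∈ (D.idx m).erase k, D.cauchyTerm a b z j with hF
  set g : ℤ → ℝ := fun j =>
    ‖a‖ * (B * ‖b‖) / (|D.lam j - D.lam k| / 2 * ‖-Complex.I - (D.lam j : ℂ)‖) with hg
  have hg0 : ∀ j, 0 ≤ g j := fun j => by positivity
  set u : ℤ → ℝ := fun m => ∑ j ∈ (D.idx m).erase k, g j with hu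
  have hu0 : ∀ m, 0 ≤ u m := fun m => Finset.sum_nonneg fun j _ => hg0 j
  have hus : Summable u := by
    have hsum : Summable fun m : ℤ => (C * (2 * (‖a‖ * (B * ‖b‖)))) * (1 / (m : ℝ) ^ 2) :=
      (Real.summable_one_div_int_pow.2 one_lt_two).mul_left _
    refine Summable.of_norm_bounded_eventually hsum ?_
    filter_upwards [eventually_abs_le (2 + |D.lam k|)] with m hm
    rw [Real.norm_of_nonneg (hu0 m)]
    have hm0 : 0 < |(m : ℝ)| := by linarith [abs_nonneg (D.lam k)]
    have h1 : ∀ j ∈ (D.idx m).erase k, g j ≤ 2 * (‖a‖ * (B * ‖b‖)) * (1 / (m : ℝ) ^ 2) := by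
      intro j hj
      have hj' := Finset.mem_of_mem_erase hj
      have h2 := D.abs_le_abs_lam_sub hj' hm
      have h3 : |(m : ℝ)| ≤ |D.lam j - 0| :=
        D.abs_le_abs_lam_sub hj' (by rw [abs_zero]; linarith [abs_nonneg (D.lam k)])
      rw [sub_zero] at h3
      have h4 := h3.trans (abs_le_norm_neg_I_sub (D.lam j))
      have h5 : |(m : ℝ)| / 2 * |(m : ℝ)| ≤
          |D.lam j - D.lam k| / 2 * ‖-Complex.I - (D.lam j : ℂ)‖ := by gcongr
      have h6 : g j ≤ ‖a‖ * (B * ‖b‖) / (|(m : ℝ)| / 2 * |(m : ℝ)|) :=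
        div_le_div_of_nonneg_left (by positivity) (by positivity) h5
      refine h6.trans_eq ?_
      rw [← sq_abs (m : ℝ)]
      field_simp
    refine (Finset.sum_le_card_nsmul _ _ _ h1).trans ?_
    rw [nsmul_eq_mul]
    have h7 : (((D.idx m).erase k).card : ℝ) ≤ C :=
      by exact_mod_cast ((Finset.card_le_card (Finset.erase_subset _ _)).trans (hC m))
    calc _ ≤ (C : ℝ) * (2 * (‖a‖ * (B * ‖b‖)) * (1 / (m : ℝ) ^ 2)) :=
          mul_le_mul_of_nonneg_right h7 (by positivity)
      _ = _ := by ring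
  have hne : ∀ z ∈ Metric.ball (D.lam k : ℂ) ρ, ∀ j, j ≠ k → z - D.lam j ≠ 0 := by
    intro z hz j hj e
    rw [sub_eq_zero.1 e, Metric.mem_ball, dist_eq_norm, ← Complex.ofReal_sub, Complex.norm_real,
      Real.norm_eq_abs] at hz
    linarith [hρ j hj]
  have hFu : ∀ m, ∀ z ∈ Metric.ball (D.lam k : ℂ) ρ, ‖F m z‖ ≤ u m := fun m z hz =>
    (norm_sum_le _ _).trans (Finset.sum_le_sum fun j hj =>
      D.norm_cauchyTerm_le hB a b (hρ j (Finset.ne_of_mem_erase hj)) h0 hz)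
  refine ⟨fun z => ∑' m, F m z, ?_, fun z hz => ?_⟩
  · refine Complex.differentiableOn_tsum_of_summable_norm hus (fun m => ?_) Metric.isOpen_ball hFu
    refine DifferentiableOn.fun_sum fun j hj => ?_
    intro z hz
    refine DifferentiableAt.differentiableWithinAt ?_
    simp only [cauchyTerm]
    refine DifferentiableAt.div (by fun_prop) (by fun_prop) ?_
    exact mul_ne_zero (hne z hz j (Finset.ne_of_mem_erase hj)) (neg_I_sub_ne_zero _)
  · have hs : HasSum (fun m => F m z) (∑' m, F m z) :=
      (Summable.of_norm_bounded hus fun m => hFu m z hz).hasSum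
    have hIoc : Tendsto (fun n : ℕ => Finset.Ioc (-(n : ℤ)) n) atTop atTop := by
      refine tendsto_atTop_finset_of_monotone (fun a b hab => ?_) fun x => ⟨x.natAbs + 1, ?_⟩
      · refine Finset.Ioc_subset_Ioc ?_ ?_ <;> omega
      · rw [Finset.mem_Ioc]; omega
    have h1 := hs.comp hIoc
    have h2 := D.eventually_sum_eq (j₀ := k) (a := fun j => if j =
        k then D.cauchyTerm a b z k else 0)
      fun j hj => if_neg hj
    have h3 : Tendsto (fun n : ℕ => ∑ m ∈ Finset.Ioc (-(n : ℤ)) n, ∑ j ∈ D.idx m,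
        if j = k then D.cauchyTerm a b z k else 0) atTop (𝓝 (D.cauchyTerm a b z k)) := by
      refine tendsto_const_nhds.congr' ?_
      filter_upwards [h2] with n hn
      rw [hn, if_pos rfl]
    refine (h3.add h1).congr fun n => ?_
    rw [Function.comp_apply, ← Finset.sum_add_distrib]
    refine Finset.sum_congr rfl fun m _ => ?_
    rw [hF]
    beta_reduce
    by_cases hk : k ∈ D.idx m
    · rw [← Finset.add_sum_erase _ _ hk, if_pos rfl, Finset.sum_eq_zero, add_zero,
        Finset.add_sum_erase _ _ hk]
      intro j hj
      rw [if_neg (Finset.ne_of_mem_erase hj)]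
    · rw [Finset.erase_eq_of_notMem hk, Finset.sum_eq_zero, zero_add]
      intro j hj
      rw [if_neg]
      rintro rfl
      exact hk hj

variable {D} {κ : DiffKernel V}

/-- `m` is the Weyl function of the Dirac system. -/
def IsWeyl (D : SpecData V) (κ : DiffKernel V) (m : ℂ → V →L[ℂ] V) : Prop :=
  ∀ z : ℂ, (∀ j, z ≠ D.lam j) → ∀ b : V, ∃ y₁ y₂ : ℝ → V, IsDiracSol (κ.pot 1) z y₁ y₂ ∧
    y₁ 1 = y₂ 1 ∧ y₁ 0 = b - Complex.I • m z b ∧ y₂ 0 = -b - Complex.I • m z b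

/-- The inner product of the Weyl solutions at i and at z is computed twice: by Green's formula from
the boundary values at 0, and by Parseval with the coordinates from `smul_al_adjoint_eigCol`. The
reference point i enters conjugated, whence the factors z + i and -i - λ_j. -/
theorem Represents.weyl_eq (h : D.Represents κ) {m : ℂ → V →L[ℂ] V} (hm : D.IsWeyl κ m) {z : ℂ}
    (hz : ∀ j, z ≠ D.lam j) (a b : V) {T : ℂ} (hT : Tendsto (fun n : ℕ =>
      ∑ m ∈ Finset.Ioc (-(n : ℤ)) n, ∑ j ∈ D.idx m, D.cauchyTerm a b z j) atTop (𝓝 T)) :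
    ⟪a, m z b⟫_ℂ = ⟪m Complex.I a, b⟫_ℂ + (z + Complex.I) * T := by
  have hI : ∀ j, Complex.I ≠ D.lam j := fun j e => by
    simpa using congrArg Complex.im e
  obtain ⟨y₁, y₂, hy, hy1, hya, hyb⟩ := hm Complex.I hI a
  obtain ⟨u₁, u₂, hu, hu1, hua, hub⟩ := hm z hz b
  have hal : ∀ {z : ℂ} (hz : ∀ j, z ≠ D.lam j) {y₁ y₂ : ℝ → V} {a : V} (hy : IsDiracSol
      (κ.pot 1) z y₁ y₂)
      (hy1 : y₁ 1 = y₂ 1) (hya : y₁ 0 = a - Complex.I • m z a)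
      (hyb : y₂ 0 = -a - Complex.I • m z a) (j : ℤ),
      D.al j (adjoint (D.eigCol κ h.coercive j) (foldL2 y₁ y₂)) =
        (2 * Complex.I / (z - D.lam j)) • D.al j a := by
    intro z hz y₁ y₂ a hy hy1 hya hyb j
    have h1 := h.smul_al_adjoint_eigCol hy hy1 j
    have h2 : y₂ 0 - y₁ 0 = (-2 : ℂ) • a := by rw [hya, hyb]; module
    have h3 : z - D.lam j ≠ 0 := sub_ne_zero.2 (hz j)
    rw [h2, map_smul] at h1
    have h4 : D.al j (adjoint (D.eigCol κ h.coercive j) (foldL2 y₁ y₂)) =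
        (Complex.I * (z - D.lam j))⁻¹ • (Complex.I * (z - D.lam j)) •
          D.al j (adjoint (D.eigCol κ h.coercive j) (foldL2 y₁ y₂)) := by
      rw [smul_smul, inv_mul_cancel₀ (mul_ne_zero Complex.I_ne_zero h3), one_smul]
    rw [h4, h1, smul_smul]
    congr 1
    rw [mul_inv, Complex.inv_I]
    field_simp
  have hgreen := hy.green_foldL2 h.coercive.memLp_pot_vol01 hu hy1 hu1
  have hform := h.tendsto_form_eigCol (foldL2 y₁ y₂) (foldL2 u₁ u₂)
  have e : ∀ j, ⟪adjoint (D.eigCol κ h.coercive j) (foldL2 y₁ y₂),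
      D.al j (adjoint (D.eigCol κ h.coercive j) (foldL2 u₁ u₂))⟫_ℂ =
      4 * D.cauchyTerm a b z j := fun j => by
    rw [hal hz hu hu1 hua hub, inner_smul_right, ← inner_apply_left_of_nonneg (D.pos j),
      hal hI hy hy1 hya hyb, inner_smul_left, inner_apply_left_of_nonneg (D.pos j), cauchyTerm]
    have h3 : z - D.lam j ≠ 0 := sub_ne_zero.2 (hz j)
    have h4 := neg_I_sub_ne_zero (D.lam j)
    simp only [map_div₀, map_mul, map_sub, Complex.conj_I, Complex.conj_ofReal, map_ofNat]
    field_simp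
    rw [show Complex.I ^ 2 = -1 from Complex.I_sq]
    ring
  simp only [e, ← Finset.mul_sum] at hform
  have h5 := tendsto_nhds_unique hform (hT.const_mul 4)
  rw [hya, hyb, hua, hub] at hgreen
  simp only [inner_sub_left, inner_sub_right, inner_neg_left, inner_neg_right, inner_smul_left,
    inner_smul_right, Complex.conj_I] at hgreen
  have h6 : ⟪foldL2 y₁ y₂, foldL2 u₁ u₂⟫_ℂ = 2 * T := by linear_combination h5 / 2
  rw [h6] at hgreen
  have h7 : (2 * Complex.I) * (⟪a, m z b⟫_ℂ) =
      (2 * Complex.I) * (⟪m Complex.I a, b⟫_ℂ + (z + Complex.I) * T) := by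
    linear_combination hgreen
  exact mul_left_cancel₀ (by simp) h7

/-- The polar part of the Weyl function at an eigenvalue. -/
theorem Represents.weyl_polar (h : D.Represents κ) {m : ℂ → V →L[ℂ] V} (hm : D.IsWeyl κ m) (k : ℤ) :
    ∃ ρ : ℝ, 0 < ρ ∧ ∀ a b : V, ∃ G : ℂ → ℂ, DifferentiableOn ℂ G (Metric.ball (D.lam k : ℂ) ρ) ∧
      ∀ z ∈ Metric.ball (D.lam k : ℂ) ρ \ {(D.lam k : ℂ)},
        ⟪a, m z b⟫_ℂ = -((z - D.lam k)⁻¹ * ⟪a, D.al k b⟫_ℂ) + G z := by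
  obtain ⟨ρ, hρ0, hρ⟩ := D.exists_gap k
  refine ⟨ρ, hρ0, fun a b => ?_⟩
  obtain ⟨T, hT, hTt⟩ := D.exists_cauchy_sum a b hρ0 hρ
  refine ⟨fun z => ⟪m Complex.I a, b⟫_ℂ + ⟪a, D.al k b⟫_ℂ / (-Complex.I - D.lam k) +
    (z + Complex.I) * T z, ?_, fun z hz => ?_⟩
  · exact (differentiableOn_const _).add ((by fun_prop : DifferentiableOn ℂ
        (fun z => z + Complex.I) _).mul hT)
  · have hz' : ∀ j, z ≠ D.lam j := by
      intro j e
      by_cases hj : j = k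
      · exact hz.2 (by rw [e, hj]; rfl)
      · have := hz.1
        rw [e, Metric.mem_ball, dist_eq_norm, ← Complex.ofReal_sub, Complex.norm_real,
          Real.norm_eq_abs] at this
        linarith [hρ j hj]
    rw [h.weyl_eq hm hz' a b (hTt z hz.1), cauchyTerm]
    have h3 : z - D.lam k ≠ 0 := sub_ne_zero.2 (hz' k)
    have h4 := neg_I_sub_ne_zero (D.lam k)
    field_simp
    ring

end SpecData

end

/-! ### From the function H to a hermitian difference kernel. -/

section

variable {V : Type*} [NormedAddCommGroup V] [InnerProductSpace ℂ V] [FiniteDimensional ℂ V]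
  [CompleteSpace V]

open ContinuousLinearMap (adjoint)

theorem eLpNorm_comp_two_mul {W : Type*} [NormedAddCommGroup W] (F : ℝ → W) :
    eLpNorm F 2 (volume.restrict (Ioo (-2) 2)) =
      (2 : ℝ≥0∞) ^ (1 / (2 : ℝ≥0∞)).toReal * eLpNorm (fun x => F (2 * x)) 2 vol11 := by
  have hemb : MeasurableEmbedding (fun x : ℝ => 2 * x) :=
    (Homeomorph.mulLeft₀ (2 : ℝ) two_ne_zero).measurableEmbedding
  have hv : volume.restrict (Ioo (-2 : ℝ) 2) = (2 : ℝ≥0∞) • vol11.map (fun x : ℝ => 2 * x) := by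
    have h1 := Real.smul_map_volume_mul_left (a := 2) two_ne_zero
    have h2 : (fun x : ℝ => 2 * x) ⁻¹' Ioo (-2 : ℝ) 2 = Ioo (-1) 1 := by
      ext x; simp only [mem_preimage, mem_Ioo]; constructor <;> rintro ⟨a,
          b⟩ <;> constructor <;> linarith
    conv_lhs => rw [← h1]
    rw [Measure.restrict_smul, hemb.restrict_map, h2]
    congr 1
    rw [abs_of_pos two_pos]
    simp
  rw [hv, eLpNorm_smul_measure_of_ne_top (by simp), hemb.eLpNorm_map_measure, smul_eq_mul]
  rfl

theorem eLpNorm_comp_neg_vol11 {W : Type*} [NormedAddCommGroup W] (F : ℝ → W) :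
    eLpNorm (fun x => F (-x)) 2 vol11 = eLpNorm F 2 vol11 := by
  have hemb : MeasurableEmbedding (fun x : ℝ => -x) := (Homeomorph.neg ℝ).measurableEmbedding
  have hv : vol11.map (fun x : ℝ => -x) = vol11 := by
    have h2 : (fun x : ℝ => -x) ⁻¹' Ioo (-1 : ℝ) 1 = Ioo (-1) 1 := by
      ext x; simp only [mem_preimage, mem_Ioo]; constructor <;> rintro ⟨a,
          b⟩ <;> constructor <;> linarith
    have h3 : volume.map (fun x : ℝ => -x) = volume := Measure.map_neg_eq_self volume
    rw [vol11]
    conv_rhs => rw [← h3, hemb.restrict_map, h2]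
  conv_rhs => rw [← hv]
  rw [hemb.eLpNorm_map_measure]
  rfl

theorem ae_vol11_neg {P : ℝ → Prop} (h : ∀ᵐ x ∂vol11, P x) : ∀ᵐ x ∂vol11, P (-x) := by
  rw [ae_vol11_iff] at h ⊢
  have := (Measure.measurePreserving_neg (volume : Measure ℝ)).quasiMeasurePreserving.ae h
  filter_upwards [this] with x hx h1
  exact hx ⟨by linarith [h1.2], by linarith [h1.1]⟩

namespace SpecData

variable (D : SpecData V)

theorem adjoint_block (m : ℤ) (s : ℝ) : adjoint (D.block m s) = D.block m (-s) := by
  rw [block, block, map_sub, map_sum]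
  congr 1
  · refine Finset.sum_congr rfl fun j _ => ?_
    have h1 : adjoint (D.al j) = D.al j := by
      refine ContinuousLinearMap.ext fun v => ext_inner_right ℂ fun w => ?_
      rw [ContinuousLinearMap.adjoint_inner_left, inner_apply_left_of_nonneg (D.pos j)]
    rw [map_smulₛₗ, h1, ← Complex.exp_conj]
    congr 2
    simp
  · rw [map_smulₛₗ, ← Complex.exp_conj]
    have h1 : adjoint (1 : V →L[ℂ] V) = 1 := by
      rw [← ContinuousLinearMap.star_eq_adjoint, star_one]
    rw [h1]
    congr 2
    simp

variable {D} {h : ℝ → V →L[ℂ] V} (hm : MemLp h 2 vol11) (ht : Tendsto (fun n : ℕ => eLpNorm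
    (fun x => ∑ m ∈ Finset.Ioc (-(n : ℤ)) n, D.block m (2 * x) - h x) 2 vol11) atTop (𝓝 0))

include hm ht

/-- Each symmetric partial sum has the symmetry exactly, because the α_j are self-adjoint;
reflection and adjunction preserve the L₂ norm, so the limit has it too. -/
theorem adjoint_ae : ∀ᵐ x ∂vol11, adjoint (h x) = h (-x) := by
  set S : ℕ → ℝ → V →L[ℂ] V := fun n x => ∑ m ∈ Finset.Ioc (-(n : ℤ)) n, D.block m (2 * x) with hS
  have hSc : ∀ n, Continuous (S n) := fun n => by
    refine continuous_finsetSum _ fun m _ => (D.continuous_block m).comp (by fun_prop)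
  have hSa : ∀ n x, adjoint (S n x) = S n (-x) := fun n x => by
    simp only [hS, map_sum, adjoint_block, mul_neg]
  have hma := memLp_adjoint hm
  have hmn : AEStronglyMeasurable (fun x => h (-x)) vol11 := by
    refine hm.1.comp_quasiMeasurePreserving ⟨measurable_neg, ?_⟩
    refine Measure.AbsolutelyContinuous.mk fun s hs h0 => ?_
    rw [Measure.map_apply measurable_neg hs]
    have : ∀ᵐ x ∂vol11, x ∉ s := measure_eq_zero_iff_ae_notMem.1 h0
    exact measure_eq_zero_iff_ae_notMem.2 (ae_vol11_neg this)
  have hle : ∀ n, eLpNorm (fun x => adjoint (h x) - h (-x)) 2 vol11 ≤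
      eLpNorm (fun x => S n x - h x) 2 vol11 + eLpNorm (fun x => S n x - h x) 2 vol11 := fun n => by
    have e : (fun x => adjoint (h x) - h (-x)) =
        (fun x => S n (-x) - h (-x)) - fun x => adjoint (S n x - h x) := by
      funext x; rw [Pi.sub_apply, map_sub, hSa]; abel
    rw [e]
    have m1 : AEStronglyMeasurable (fun x => S n (-x) - h (-x)) vol11 :=
      ((hSc n).comp continuous_neg).aestronglyMeasurable.sub hmn
    have m2 : AEStronglyMeasurable (fun x => adjoint (S n x - h x)) vol11 :=
      (adjoint : (V →L[ℂ] V) ≃ₗᵢ⋆[ℂ] _).continuous.comp_aestronglyMeasurable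
        ((hSc n).aestronglyMeasurable.sub hm.1)
    refine (eLpNorm_sub_le m1 m2 one_le_two).trans (add_le_add ?_ ?_)
    · exact (eLpNorm_comp_neg_vol11 fun x => S n x - h x).le
    · exact (eLpNorm_congr_norm_ae (Eventually.of_forall fun x =>
        LinearIsometryEquiv.norm_map _ _)).le
  have h0 : eLpNorm (fun x => adjoint (h x) - h (-x)) 2 vol11 = 0 := by
    have h1 := ht.add ht
    rw [add_zero] at h1
    exact le_antisymm (ge_of_tendsto' h1 hle) zero_le
  have h2 := (eLpNorm_eq_zero_iff (f := fun x => adjoint (h x) - h (-x)) (hma.1.sub hmn)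
    two_ne_zero).1 h0
  filter_upwards [h2] with x hx
  exact sub_eq_zero.1 hx

theorem exists_represents : ∃ κ : DiffKernel V, D.Represents κ ∧
    ∀ᵐ x ∂vol11, h x = (2 : ℂ) • κ.k (2 * x) := by
  set h1 := hm.1.mk h with hh1
  have h1m : StronglyMeasurable h1 := hm.1.stronglyMeasurable_mk
  have h1e : h =ᵐ[vol11] h1 := hm.1.ae_eq_mk
  set g : ℝ → V →L[ℂ] V := (Ioo (-1 : ℝ) 1).indicator h1 with hg
  have hgm : StronglyMeasurable g := h1m.indicator measurableSet_Ioo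
  have hgL : MemLp g 2 volume := (memLp_indicator_iff_restrict measurableSet_Ioo).2
      ((memLp_congr_ae h1e).1 hm)
  -- This is ½ H(s/2) symmetrized: averaging with the reflected adjoint makes k(-s) = k(s)^* hold
  -- everywhere, as `DiffKernel` requires, and changes nothing almost everywhere on (-2, 2).
  set k : ℝ → V →L[ℂ] V := fun s =>
    (1 / 4 : ℂ) • (g (1 / 2 * s + 0) + adjoint (g (-(1 / 2) * s + 0))) with hk
  have hadj : Continuous fun T : V →L[ℂ] V => adjoint T :=
    (adjoint : (V →L[ℂ] V) ≃ₗᵢ⋆[ℂ] _).continuous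
  have hkm : StronglyMeasurable k :=
    ((hgm.comp_measurable (by fun_prop : Measurable fun s : ℝ => 1 / 2 * s + 0)).add
      (hadj.comp_stronglyMeasurable (hgm.comp_measurable
        (by fun_prop : Measurable fun s : ℝ => -(1 / 2) * s + 0)))).const_smul (1 / 4 : ℂ)
  have hkL : MemLp k 2 volume :=
    ((memLp_comp_affine hgL (by norm_num) 0).add
      (memLp_adjoint (memLp_comp_affine hgL (by norm_num) 0))).const_smul (1 / 4 : ℂ)
  have hks : ∀ s, k (-s) = adjoint (k s) := fun s => by
    simp only [hk, map_smulₛₗ, map_add, ContinuousLinearMap.adjoint_adjoint]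
    rw [add_comm]
    have e : (starRingEnd ℂ) (1 / 4 : ℂ) = 1 / 4 := by
      rw [map_div₀, map_one, map_ofNat]
    rw [e]
    congr 3 <;> ring_nf
  have hke : ∀ᵐ x ∂vol11, h x = (2 : ℂ) • k (2 * x) := by
    filter_upwards [adjoint_ae hm ht, h1e, ae_vol11_neg h1e, ae_vol11_mem] with x a b c d
    have e1 : g (1 / 2 * (2 * x) + 0) = h x := by
      rw [show (1 / 2 * (2 * x) + 0 : ℝ) = x by ring, hg, indicator_of_mem d, b]
    have e2 : g (-(1 / 2) * (2 * x) + 0) = h (-x) := by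
      rw [show (-(1 / 2) * (2 * x) + 0 : ℝ) = -x by ring, hg,
        indicator_of_mem (by constructor <;> linarith [d.1, d.2]), c]
    simp only [hk, e1, e2, ← a, ContinuousLinearMap.adjoint_adjoint]
    module
  refine ⟨⟨k, hkm, hkL, hks⟩, ?_, hke⟩
  have h2 : ∀ n : ℕ, eLpNorm (fun s => (1 / 2 : ℂ) • ∑ m ∈ Finset.Ioc (-(n : ℤ)) n, D.block m s -
      k s) 2 (volume.restrict (Ioo (-2) 2)) ≤ (2 : ℝ≥0∞) ^ (1 / (2 : ℝ≥0∞)).toReal *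
        eLpNorm (fun x => ∑ m ∈ Finset.Ioc (-(n : ℤ)) n, D.block m (2 * x) - h x) 2 vol11 :=
            fun n => by
    rw [eLpNorm_comp_two_mul]
    refine mul_le_mul_right (eLpNorm_mono_ae ?_) _
    filter_upwards [hke] with x hx
    have e : (1 / 2 : ℂ) • ∑ m ∈ Finset.Ioc (-(n : ℤ)) n, D.block m (2 * x) - k (2 * x) =
        (1 / 2 : ℂ) • (∑ m ∈ Finset.Ioc (-(n : ℤ)) n, D.block m (2 * x) - h x) := by
      rw [hx]; module
    rw [e, norm_smul]
    have : ‖(1 / 2 : ℂ)‖ ≤ 1 := by norm_num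
    exact mul_le_of_le_one_left (norm_nonneg _) this
  refine tendsto_of_tendsto_of_tendsto_of_le_of_le tendsto_const_nhds ?_ (fun _ => zero_le) h2
  have := ENNReal.Tendsto.const_mul ht (a := (2 : ℝ≥0∞) ^ (1 / (2 : ℝ≥0∞)).toReal)
    (Or.inr (ENNReal.rpow_ne_top_of_nonneg (by positivity) (by simp)))
  simpa using this

end SpecData

end

/-! ### The accelerant condition and the Krein equation. -/

section

variable {V : Type*} [NormedAddCommGroup V] [InnerProductSpace ℂ V] [FiniteDimensional ℂ V]
  [CompleteSpace V]

open ContinuousLinearMap (adjoint)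

theorem ae_comp_affine {P : ℝ → Prop} (h : ∀ᵐ x : ℝ, P x) {a : ℝ} (ha : a ≠ 0) (b : ℝ) :
    ∀ᵐ x : ℝ, P (a * x + b) := (quasiMeasurePreserving_affine ha b).ae h

theorem integral_comp_two_mul_sub {W : Type*} [NormedAddCommGroup W] [NormedSpace ℝ W]
    (Φ : ℝ → W) (b : ℝ) :
    ∫ t in (-b)..b, Φ t = (2 : ℝ) • ∫ t in (0 : ℝ)..b, Φ (2 * t - b) := by
  rw [intervalIntegral.integral_comp_mul_sub Φ two_ne_zero b, smul_smul]
  norm_num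
  congr 1
  ring

namespace DiffKernel

variable {κ : DiffKernel V}

/-- A representative of the accelerant that belongs to the kernel. -/
def acc (κ : DiffKernel V) (s : ℝ) : V →L[ℂ] V := (2 : ℂ) • κ.k (2 * s)

theorem memLp_acc (κ : DiffKernel V) : MemLp κ.acc 2 volume := by
  have h := (memLp_comp_affine κ.memLp two_ne_zero 0).const_smul (2 : ℂ)
  simp only [add_zero] at h
  exact h

theorem adjoint_acc (κ : DiffKernel V) (s : ℝ) : adjoint (κ.acc s) = κ.acc (-s) := by
  rw [acc, acc, mul_neg, κ.symm, map_smulₛₗ]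
  congr 1
  exact map_ofNat _ 2

/-- The equation with a difference kernel on `(0, b)` has only the trivial solution. -/
theorem Coercive.eq_zero_of_acc (hκ : κ.Coercive) {b : ℝ} (hb : b ∈ Icc (0 : ℝ) 1) {f : ℝ → V}
    (hf : MemLp f 2 vol01)
    (h : ∀ᵐ x ∂volume.restrict (Ioo 0 b), f x + ∫ t in (0 : ℝ)..b, κ.acc (x - t) (f t) = 0) :
    ∀ᵐ x ∂volume.restrict (Ioo 0 b), f x = 0 := by
  set f' := (Ioo (0 : ℝ) 1).indicator f with hf'
  have hfL : MemLp f' 2 volume := (memLp_indicator_iff_restrict measurableSet_Ioo).2 hf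
  -- The substitution s = 2t - b carries (0, b) to (-b, b). The factor 2 in H(x) = 2k(2x) is its
  -- Jacobian, so the equation becomes `trunc b g = 0`.
  set F : ℝ → V := (Ioo (-b) b).indicator fun s => f' (1 / 2 * s + b / 2) with hF
  have hFL : MemLp F 2 volume := (memLp_comp_affine hfL (by norm_num) _).indicator measurableSet_Ioo
  have hF11 : MemLp F 2 vol11 := hFL.restrict _
  set g : L2V V := res F with hg
  have hgF : g =ᵐ[vol11] F := coeFn_res hF11
  have hcg : cut V b g = g := by
    refine Lp.ext ((coeFn_cut b g).trans ?_)
    filter_upwards [hgF] with s hs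
    by_cases h1 : s ∈ Ioo (-b) b
    · rw [indicator_of_mem h1]
    · rw [indicator_of_notMem h1, hs, hF, indicator_of_notMem h1]
  have hFt : ∀ t ∈ Ioo 0 b, F (2 * t - b) = f t := fun t ht => by
    rw [hF, indicator_of_mem (by constructor <;> linarith [ht.1, ht.2]),
      show 1 / 2 * (2 * t - b) + b / 2 = t by ring, hf',
      indicator_of_mem (show t ∈ Ioo (0 : ℝ) 1 from ⟨ht.1, ht.2.trans_le hb.2⟩)]
  have hconv : ∀ s, adjoint (κ.tau s) g =
      ∫ t in (0 : ℝ)..b, κ.acc (1 / 2 * s + b / 2 - t) (f t) := fun s => by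
    rw [adjoint_tau_apply]
    have e1 : ∫ t, κ.k (s - t) (g t) ∂vol11 = ∫ t, κ.k (s - t) (F t) ∂vol11 := by
      refine integral_congr_ae ?_
      filter_upwards [hgF] with t ht
      rw [ht]
    rw [e1, integral_vol11_of_support hb.1 hb.2, integral_comp_two_mul_sub,
      ← intervalIntegral.integral_smul]
    · refine intervalIntegral.integral_congr_Ioo_of_le hb.1 fun t ht => ?_
      rw [hFt t ht, acc, show 2 * (1 / 2 * s + b / 2 - t) = s - (2 * t - b) by ring]
      exact (Complex.coe_smul 2 _).symm
    · intro t ht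
      rw [hF, indicator_of_notMem ht, map_zero]
  have ht0 : κ.trunc b g = 0 := by
    rw [trunc_apply, hcg]
    refine Lp.ext (((Lp.coeFn_add _ _).trans ?_).trans (Lp.coeFn_zero _ _ _).symm)
    have h1 := (ae_restrict_iff' measurableSet_Ioo).1 h
    have h2 := ae_comp_affine h1 (a := 1 / 2) (by norm_num) (b / 2)
    have h3 : ∀ᵐ s ∂vol11, 1 / 2 * s + b / 2 ∈ Ioo 0 b → f (1 / 2 * s + b / 2) +
      ∫ t in (0 : ℝ)..b, κ.acc (1 / 2 * s + b / 2 - t) (f t) = 0 := ae_restrict_of_ae h2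
    filter_upwards [hgF, coeFn_cut b (κ.conv g), κ.coeFn_conv g, h3] with s e1 e2 e3 e4
    rw [Pi.add_apply, e1, e2, Pi.zero_apply]
    by_cases hs : s ∈ Ioo (-b) b
    · have hs' : 1 / 2 * s + b / 2 ∈ Ioo 0 b := by constructor <;> linarith [hs.1, hs.2]
      have := hFt _ hs'
      rw [show 2 * (1 / 2 * s + b / 2) - b = s by ring] at this
      rw [indicator_of_mem hs, e3, hconv, this]
      exact e4 hs'
    · rw [indicator_of_notMem hs, hF, indicator_of_notMem hs, add_zero]
  have hg0 : g = 0 := by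
    have h0 : (κ.tinv b * κ.trunc b) g = g := by rw [hκ.tinv_mul_trunc b, one_apply_eq_self]
    rw [← h0, mul_apply_eq_comp, ht0, map_zero]
  have hF0 : ∀ᵐ s ∂vol11, F s = 0 := by
    have h0 := hgF
    rw [hg0] at h0
    exact h0.symm.trans (Lp.coeFn_zero _ _ _)
  have h5 := ae_comp_affine (ae_vol11_iff.1 hF0) (a := 2) two_ne_zero (-b)
  refine (ae_restrict_iff' measurableSet_Ioo).2 ?_
  filter_upwards [h5] with t h6 ht
  rw [← hFt t ht]
  exact h6 ⟨by linarith [ht.1, hb.2], by linarith [ht.2, hb.2]⟩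

/-- From `sigma_big`: σ_y h = -τ_y^* h - σ_y 𝓚 h, which exhibits G(y, t) - k(y - t) as the kernel of
σ_y. Hence `pot` is twice its trace on the antidiagonal. -/
theorem Coercive.sigma_eq_integral (hκ : κ.Coercive) {y : ℝ} {h : L2V V} (hh : cut V |y| h = h) :
    κ.sigma y h = ∫ t, (κ.green y t - κ.k (y - t)) (h t) ∂vol11 := by
  have e2 : κ.sigma y h + κ.sigma y (κ.conv h) = -adjoint (κ.tau y) h := by
    rw [← map_add, ← big_apply, hκ.sigma_big hh]
  have hi := κ.integrable_tau_apply 0 h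
  simp only [sub_zero] at hi
  have e3 : κ.sigma y (κ.conv h) = ∫ t, κ.sigma y (κ.tau t (h t)) ∂vol11 := by
    rw [conv_eq_integral, ContinuousLinearMap.integral_comp_comm _ hi]
  have i1 : Integrable (fun t => κ.k (y - t) (h t)) vol11 := by
    refine (integrable_adjoint_apply (κ.memLp_col y) (Lp.memLp h)).congr (ae_of_all _ fun t => ?_)
    beta_reduce
    rw [← κ.symm, neg_sub]
  have i2 : Integrable (fun t => κ.green y t (h t)) vol11 := by
    refine ((κ.sigma y).integrable_comp hi).neg.congr (ae_of_all _ fun t => ?_)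
    rfl
  have e4 : ∫ t, κ.green y t (h t) ∂vol11 = -∫ t, κ.sigma y (κ.tau t (h t)) ∂vol11 := by
    rw [← integral_neg]
    rfl
  simp only [sub_apply]
  rw [integral_sub i2 i1, e4, ← e3, ← adjoint_tau_apply]
  rw [← eq_sub_iff_add_eq] at e2
  rw [e2]
  abel

/-- The resolvent identity on the interval `(-x, x)`. -/
theorem Coercive.green_eq_integral (hκ : κ.Coercive) {x : ℝ} (hx : x ∈ Icc (0 : ℝ) 1) (t : ℝ) :
    κ.green x t + ∫ u in (-x)..x, (κ.green x u - κ.k (x - u)) * κ.k (u - t) = 0 := by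
  have habs : |x| = x := abs_of_nonneg hx.1
  have hgm : MemLp (fun u => κ.green x u - κ.k (x - u)) 2 (volume.restrict (Ioc (-x) x)) := by
    have h1 : MemLp (fun u => κ.green x u) 2 (volume.restrict (Ioc (-x) x)) := by
      have hc : Continuous fun u => κ.green x u :=
        hκ.continuous_green.comp (f := fun u : ℝ => (x, u)) (by fun_prop)
      obtain ⟨C, hC⟩ := isCompact_Icc.exists_bound_of_continuousOn (s := Icc (-x) x) hc.continuousOn
      exact MemLp.of_bound hc.aestronglyMeasurable C ((ae_restrict_iff' measurableSet_Ioc).2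
        (Eventually.of_forall fun u hu => hC u (Ioc_subset_Icc_self hu)))
    have h2 := memLp_comp_affine κ.memLp (a := -1) (by norm_num) x
    refine h1.sub ((memLp_congr_ae (ae_of_all _ fun u => ?_)).1 (h2.restrict _))
    ring_nf
  have hkm : MemLp (fun u => κ.k (u - t)) 2 (volume.restrict (Ioc (-x) x)) :=
    (memLp_comp_sub_right κ.memLp t).restrict _
  have hint : IntervalIntegrable (fun u => (κ.green x u - κ.k (x - u)) * κ.k (u - t)) volume
      (-x) x := by
    rw [intervalIntegrable_iff_integrableOn_Ioc_of_le (by linarith [hx.1])]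
    exact integrable_clm_mul hgm hkm
  refine ContinuousLinearMap.ext fun v => ?_
  rw [add_apply, ContinuousLinearMap.intervalIntegral_apply hint, zero_apply]
  have e1 : κ.green x t v = -κ.sigma x (cut V x (κ.tau t v)) := by
    rw [hκ.sigma_cut_of_le habs.le, green]; rfl
  rw [e1, hκ.sigma_eq_integral (by rw [habs, cut_cut]), neg_add_eq_zero]
  have e2 : ∫ u, (κ.green x u - κ.k (x - u)) (cut V x (κ.tau t v) u) ∂vol11 =
      ∫ u, (κ.green x u - κ.k (x - u)) ((Ioo (-x) x).indicator (fun u => κ.k (u - t) v) u) ∂vol11 :=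
          by
    refine integral_congr_ae ?_
    filter_upwards [coeFn_cut x (κ.tau t v), κ.coeFn_tau t v] with u h1 h2
    rw [h1]
    by_cases hu : u ∈ Ioo (-x) x
    · rw [indicator_of_mem hu, indicator_of_mem hu, h2]
    · rw [indicator_of_notMem hu, indicator_of_notMem hu]
  rw [e2, integral_vol11_of_support hx.1 hx.2]
  · refine intervalIntegral.integral_congr_Ioo_of_le (by linarith [hx.1]) fun u hu => ?_
    rw [indicator_of_mem hu]
    rfl
  · intro u hu
    rw [indicator_of_notMem hu, map_zero]

/-- The solution of the Krein equation. -/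
def krein (κ : DiffKernel V) (x t : ℝ) : V →L[ℂ] V :=
  if t ≤ x then (2 : ℂ) • κ.green x (2 * t - x) - κ.acc (x - t) else 0

/-- The resolvent identity on (-x, x) in the variables 2t - x and 2s - x. -/
theorem Coercive.krein_eq (hκ : κ.Coercive) {x t : ℝ} (hx : x ∈ Icc (0 : ℝ) 1) (ht : t ≤ x) :
    κ.krein x t + κ.acc (x - t) + ∫ s in (0 : ℝ)..x, κ.krein x s * κ.acc (s - t) = 0 := by
  have h := hκ.green_eq_integral hx (2 * t - x)
  rw [integral_comp_two_mul_sub] at h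
  have e : ∫ s in (0 : ℝ)..x, κ.krein x s * κ.acc (s - t) = (2 : ℂ) • (2 : ℝ) •
      ∫ s in (0 : ℝ)..x, (κ.green x (2 * s - x) - κ.k (x - (2 * s - x))) *
        κ.k (2 * s - x - (2 * t - x)) := by
    rw [← intervalIntegral.integral_smul, ← intervalIntegral.integral_smul]
    refine intervalIntegral.integral_congr_Ioo_of_le hx.1 fun s hs => ?_
    rw [krein, if_pos hs.2.le, acc, acc, ← smul_sub, show 2 * (x - s) = x - (2 * s - x) by ring,
      show 2 * (s - t) = 2 * s - x - (2 * t - x) by ring, smul_mul_smul_comm, mul_smul]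
    congr 1
  rw [e, krein, if_pos ht, sub_add_cancel, ← smul_add, h, smul_zero]

theorem krein_zero {x : ℝ} (hx : x ∈ Ioo (0 : ℝ) 1) : κ.krein x 0 = κ.pot 1 x := by
  rw [krein, if_pos hx.1.le, pot, indicator_of_mem hx, acc, smul_sub]
  congr 3 <;> ring_nf

end DiffKernel

end

/-! ### Continuity of the sections of the Krein solution. -/

section

/-- Kernels on the unit square whose sections are square integrable and depend continuously on the
remaining variable. -/
def IsContKernel {W : Type*} [NormedAddCommGroup W] (K : ℝ → ℝ → W) : Prop :=
  AEStronglyMeasurable (fun p : ℝ × ℝ => K p.1 p.2)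
      (volume.restrict (Icc (0 : ℝ) 1 ×ˢ Icc (0 : ℝ) 1)) ∧
  (∀ x ∈ Icc (0 : ℝ) 1, MemLp (fun t => K x t) 2 vol01) ∧
  (∀ t ∈ Icc (0 : ℝ) 1, MemLp (fun x => K x t) 2 vol01) ∧
  (∀ x₀ ∈ Icc (0 : ℝ) 1,
    Tendsto (fun x => eLpNorm (fun t => K x t - K x₀ t) 2 vol01) (𝓝[Icc 0 1] x₀) (𝓝 0)) ∧
  (∀ t₀ ∈ Icc (0 : ℝ) 1,
    Tendsto (fun t => eLpNorm (fun x => K x t - K x t₀) 2 vol01) (𝓝[Icc 0 1] t₀) (𝓝 0))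

theorem tendsto_eLpNorm_of_bounded {W : Type*} [NormedAddCommGroup W] {F : ℝ → ℝ → W} {S : Set ℝ}
    {x₀ : ℝ} (hx₀ : x₀ ∈ S) {C : ℝ} (hC : ∀ x ∈ S, ∀ᵐ t ∂vol01, ‖F x t‖ ≤ C)
    (hm : ∀ x ∈ S, AEStronglyMeasurable (F x) vol01)
    (ht : ∀ᵐ t ∂vol01, Tendsto (fun x => F x t) (𝓝[S] x₀) (𝓝 (F x₀ t))) :
    Tendsto (fun x => eLpNorm (fun t => F x t - F x₀ t) 2 vol01) (𝓝[S] x₀) (𝓝 0) := by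
  have hL : ∀ x ∈ S, MemLp (fun t => F x t - F x₀ t) 2 vol01 := fun x hx =>
    (MemLp.of_bound (hm x hx) C (hC x hx)).sub (MemLp.of_bound (hm x₀ hx₀) C (hC x₀ hx₀))
  have h1 : Tendsto (fun x => ∫ t, ‖F x t - F x₀ t‖ ^ 2 ∂vol01) (𝓝[S] x₀) (𝓝 (∫ t,
      (0 : ℝ) ∂vol01)) := by
    refine tendsto_integral_filter_of_dominated_convergence (fun _ => (C + C) ^ 2) ?_ ?_
      (integrable_const _) ?_
    · filter_upwards [self_mem_nhdsWithin] with x hx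
      exact (hL x hx).1.norm.pow 2
    · filter_upwards [self_mem_nhdsWithin] with x hx
      filter_upwards [hC x hx, hC x₀ hx₀] with t h1 h2
      rw [Real.norm_of_nonneg (sq_nonneg _)]
      exact pow_le_pow_left₀ (norm_nonneg _) ((norm_sub_le _ _).trans (add_le_add h1 h2)) 2
    · filter_upwards [ht] with t h
      have := (h.sub_const (F x₀ t)).norm.pow 2
      simpa using this
  rw [integral_zero] at h1
  have h2 := h1.sqrt
  rw [Real.sqrt_zero] at h2
  have h3 : Tendsto (fun x => ENNReal.ofReal √(∫ t, ‖F x t - F x₀ t‖ ^ 2 ∂vol01)) (𝓝[S] x₀) (𝓝 0) :=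
      by
    simpa using ENNReal.tendsto_ofReal h2
  refine h3.congr' ?_
  filter_upwards [self_mem_nhdsWithin] with x hx
  rw [← toReal_eLpNorm_sq (hL x hx), Real.sqrt_sq ENNReal.toReal_nonneg,
    ENNReal.ofReal_toReal (hL x hx).2.ne]

theorem tendsto_eLpNorm_vol01_translate {W : Type*} [NormedAddCommGroup W] {F : ℝ → W}
    (hF : MemLp F 2 volume) (t₀ : ℝ) (S : Set ℝ) :
    Tendsto (fun t => eLpNorm (fun s => F (s - t) - F (s - t₀)) 2 vol01) (𝓝[S] t₀) (𝓝 0) :=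
  tendsto_of_tendsto_of_tendsto_of_le_of_le tendsto_const_nhds
    ((tendsto_eLpNorm_translate hF t₀).mono_left nhdsWithin_le_nhds) (fun _ => zero_le)
    fun _ => eLpNorm_mono_measure _ Measure.restrict_le_self

theorem tendsto_eLpNorm_sub_sub {W : Type*} [NormedAddCommGroup W] {l : Filter ℝ} {F G : ℝ → ℝ → W}
    {x₀ : ℝ} (hF : ∀ᶠ x in l, AEStronglyMeasurable (fun t => F x t - F x₀ t) vol01)
    (hG : ∀ᶠ x in l, AEStronglyMeasurable (fun t => G x t - G x₀ t) vol01)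
    (hFt : Tendsto (fun x => eLpNorm (fun t => F x t - F x₀ t) 2 vol01) l (𝓝 0))
    (hGt : Tendsto (fun x => eLpNorm (fun t => G x t - G x₀ t) 2 vol01) l (𝓝 0)) :
    Tendsto (fun x => eLpNorm (fun t => (F x t - G x t) - (F x₀ t - G x₀ t)) 2 vol01) l (𝓝 0) := by
  have h := hFt.add hGt
  rw [add_zero] at h
  refine tendsto_of_tendsto_of_tendsto_of_le_of_le' tendsto_const_nhds h
    (Eventually.of_forall fun _ => zero_le) ?_
  filter_upwards [hF, hG] with x h1 h2
  have e : (fun t => (F x t - G x t) - (F x₀ t - G x₀ t)) =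
      (fun t => F x t - F x₀ t) - fun t => G x t - G x₀ t := by
    funext t; rw [Pi.sub_apply]; abel
  rw [e]
  exact eLpNorm_sub_le h1 h2 one_le_two

variable {V : Type*} [NormedAddCommGroup V] [InnerProductSpace ℂ V] [FiniteDimensional ℂ V]
  [CompleteSpace V]

open ContinuousLinearMap (adjoint)

namespace DiffKernel

variable {κ : DiffKernel V}

theorem stronglyMeasurable_acc (κ : DiffKernel V) : StronglyMeasurable κ.acc :=
  (κ.meas.comp_measurable (by fun_prop : Measurable fun s : ℝ => 2 * s)).const_smul (2 : ℂ)

/-- The regular part of the solution of the Krein equation. -/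
def kreinReg (κ : DiffKernel V) (x t : ℝ) : V →L[ℂ] V :=
  if t ≤ x then (2 : ℂ) • κ.green x (2 * t - x) else 0

/-- The singular part of the solution of the Krein equation. -/
def kreinSing (κ : DiffKernel V) : ℝ → V →L[ℂ] V := (Ici (0 : ℝ)).indicator κ.acc

theorem krein_eq_sub (κ : DiffKernel V) (x t : ℝ) :
    κ.krein x t = κ.kreinReg x t - κ.kreinSing (x - t) := by
  rw [krein, kreinReg, kreinSing]
  by_cases h : t ≤ x
  · rw [if_pos h, if_pos h, indicator_of_mem (by simpa using h)]
  · rw [if_neg h, if_neg h, indicator_of_notMem (by simpa using h), sub_zero]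

theorem memLp_kreinSing (κ : DiffKernel V) : MemLp κ.kreinSing 2 volume :=
  κ.memLp_acc.indicator measurableSet_Ici

namespace Coercive

variable (hκ : κ.Coercive)

include hκ

theorem stronglyMeasurable_kreinReg : StronglyMeasurable fun p : ℝ × ℝ => κ.kreinReg p.1 p.2 := by
  refine StronglyMeasurable.ite (measurableSet_le measurable_snd measurable_fst) ?_
    stronglyMeasurable_const
  have hc : Continuous fun p : ℝ × ℝ => κ.green p.1 (2 * p.2 - p.1) :=
    hκ.continuous_green.comp (f := fun p : ℝ × ℝ => (p.1, 2 * p.2 - p.1)) (by fun_prop)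
  exact (hc.const_smul (2 : ℂ)).stronglyMeasurable

theorem exists_bound_kreinReg : ∃ C, ∀ x ∈ Icc (0 : ℝ) 1, ∀ t ∈ Icc (0 : ℝ) 1,
    ‖κ.kreinReg x t‖ ≤ C := by
  have hc : Continuous fun p : ℝ × ℝ => (2 : ℂ) • κ.green p.1 (2 * p.2 - p.1) :=
    (hκ.continuous_green.comp (f := fun p : ℝ × ℝ => (p.1, 2 * p.2 - p.1)) (by fun_prop)).const_smul
        (2 : ℂ)
  obtain ⟨C, hC⟩ := (isCompact_Icc (a := (0 : ℝ)) (b := 1)).prod (isCompact_Icc (a := (0 : ℝ)) (b :=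
      1))
    |>.exists_bound_of_continuousOn hc.continuousOn
  refine ⟨C, fun x hx t ht => ?_⟩
  have h1 := hC (x, t) ⟨hx, ht⟩
  rw [kreinReg]
  split_ifs
  · exact h1
  · rw [norm_zero]; exact (norm_nonneg _).trans h1

/-- The regular part may jump only across the diagonal, a null set in every section. -/
theorem tendsto_kreinReg {x₀ t₀ : ℝ} (h : x₀ ≠ t₀) :
    Tendsto (fun p : ℝ × ℝ => κ.kreinReg p.1 p.2) (𝓝 (x₀, t₀)) (𝓝 (κ.kreinReg x₀ t₀)) := by
  have hc : Continuous fun p : ℝ × ℝ => (2 : ℂ) • κ.green p.1 (2 * p.2 - p.1) :=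
    (hκ.continuous_green.comp (f := fun p : ℝ × ℝ => (p.1, 2 * p.2 - p.1)) (by fun_prop)).const_smul
        (2 : ℂ)
  rcases lt_or_gt_of_ne h with h1 | h1
  · have e : ∀ᶠ p : ℝ × ℝ in 𝓝 (x₀, t₀), p.1 < p.2 :=
      (isOpen_lt continuous_fst continuous_snd).mem_nhds h1
    rw [show κ.kreinReg x₀ t₀ = 0 from if_neg (not_le.2 h1)]
    refine tendsto_const_nhds.congr' ?_
    filter_upwards [e] with p hp
    exact (if_neg (not_le.2 hp)).symm
  · have e : ∀ᶠ p : ℝ × ℝ in 𝓝 (x₀, t₀), p.2 < p.1 :=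
      (isOpen_lt continuous_snd continuous_fst).mem_nhds h1
    rw [show κ.kreinReg x₀ t₀ = (2 : ℂ) • κ.green x₀ (2 * t₀ - x₀) from if_pos h1.le]
    refine (hc.tendsto (x₀, t₀)).congr' ?_
    filter_upwards [e] with p hp
    exact (if_pos hp.le).symm

/-- The regular part is bounded and continuous off the diagonal, so dominated convergence applies.
The singular part is a function of x - t in L₂(ℝ), so continuity of translations applies. -/
theorem isContKernel_krein : IsContKernel κ.krein := by
  have hR := hκ.stronglyMeasurable_kreinReg
  have hRx : ∀ x, StronglyMeasurable fun t => κ.kreinReg x t := fun x =>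
    hR.comp_measurable (g := fun t : ℝ => (x, t)) (by fun_prop)
  have hRt : ∀ t, StronglyMeasurable fun x => κ.kreinReg x t := fun t =>
    hR.comp_measurable (g := fun x : ℝ => (x, t)) (by fun_prop)
  have hS : StronglyMeasurable κ.kreinSing := κ.stronglyMeasurable_acc.indicator measurableSet_Ici
  obtain ⟨C, hC⟩ := hκ.exists_bound_kreinReg
  have h01 : ∀ᵐ t ∂vol01, t ∈ Ioo (0 : ℝ) 1 := ae_restrict_mem measurableSet_Ioo
  have hne : ∀ a : ℝ, ∀ᵐ t ∂vol01, t ≠ a := fun a => ae_restrict_of_ae (by simp [ae_iff])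
  have hSx : ∀ x, MemLp (fun t => κ.kreinSing (x - t)) 2 vol01 := fun x => by
    have := memLp_comp_affine κ.memLp_kreinSing (a := -1) (by norm_num) x
    have h2 := this.restrict (Ioo (0 : ℝ) 1)
    refine (memLp_congr_ae (ae_of_all _ fun t => ?_)).1 h2
    ring_nf
  have hSt : ∀ t, MemLp (fun x => κ.kreinSing (x - t)) 2 vol01 := fun t =>
    (memLp_comp_sub_right κ.memLp_kreinSing t).restrict _
  have hRxL : ∀ x ∈ Icc (0 : ℝ) 1, MemLp (fun t => κ.kreinReg x t) 2 vol01 := fun x hx => by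
    refine MemLp.of_bound (hRx x).aestronglyMeasurable C ?_
    filter_upwards [h01] with t ht using hC x hx t (Ioo_subset_Icc_self ht)
  have hRtL : ∀ t ∈ Icc (0 : ℝ) 1, MemLp (fun x => κ.kreinReg x t) 2 vol01 := fun t ht => by
    refine MemLp.of_bound (hRt t).aestronglyMeasurable C ?_
    filter_upwards [h01] with x hx using hC x (Ioo_subset_Icc_self hx) t ht
  simp only [IsContKernel, krein_eq_sub]
  refine ⟨?_, fun x hx => (hRxL x hx).sub (hSx x), fun t ht => (hRtL t ht).sub (hSt t),
      fun x₀ hx₀ => ?_,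
    fun t₀ ht₀ => ?_⟩
  · exact (hR.sub (hS.comp_measurable (by fun_prop : Measurable fun p : ℝ × ℝ => p.1 - p.2))).aestronglyMeasurable
  · refine tendsto_eLpNorm_sub_sub (F := fun x t => κ.kreinReg x t)
      (G := fun x t => κ.kreinSing (x - t)) ?_ ?_ ?_ ?_
    · exact Eventually.of_forall fun x => ((hRx x).sub (hRx x₀)).aestronglyMeasurable
    · exact Eventually.of_forall fun x => (hSx x).1.sub (hSx x₀).1
    · refine tendsto_eLpNorm_of_bounded hx₀ (C := C) (fun x hx => ?_)
        (fun x _ => (hRx x).aestronglyMeasurable) ?_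
      · filter_upwards [h01] with t ht using hC x hx t (Ioo_subset_Icc_self ht)
      · filter_upwards [hne x₀] with t ht
        have h1 : Tendsto (fun x : ℝ => (x, t)) (𝓝[Icc 0 1] x₀) (𝓝 (x₀, t)) :=
          (Continuous.tendsto (by fun_prop) x₀).mono_left nhdsWithin_le_nhds
        exact (hκ.tendsto_kreinReg ht.symm).comp h1
    · have hn : MemLp (fun s => κ.kreinSing (-s)) 2 volume := by
        have := memLp_comp_affine κ.memLp_kreinSing (a := -1) (by norm_num) 0
        simpa using this
      have := tendsto_eLpNorm_vol01_translate hn x₀ (Icc 0 1)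
      simpa only [neg_sub] using this
  · refine tendsto_eLpNorm_sub_sub (F := fun t x => κ.kreinReg x t)
      (G := fun t x => κ.kreinSing (x - t)) ?_ ?_ ?_ ?_
    · exact Eventually.of_forall fun t => ((hRt t).sub (hRt t₀)).aestronglyMeasurable
    · exact Eventually.of_forall fun t => (hSt t).1.sub (hSt t₀).1
    · refine tendsto_eLpNorm_of_bounded (F := fun t x => κ.kreinReg x t) ht₀ (C := C)
          (fun t ht => ?_)
        (fun t _ => (hRt t).aestronglyMeasurable) ?_
      · filter_upwards [h01] with x hx using hC x (Ioo_subset_Icc_self hx) t ht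
      · filter_upwards [hne t₀] with x hx
        have h1 : Tendsto (fun t : ℝ => (x, t)) (𝓝[Icc 0 1] t₀) (𝓝 (x, t₀)) :=
          (Continuous.tendsto (by fun_prop) t₀).mono_left nhdsWithin_le_nhds
        exact (hκ.tendsto_kreinReg hx).comp h1
    · exact tendsto_eLpNorm_vol01_translate κ.memLp_kreinSing t₀ (Icc 0 1)

end Coercive

end DiffKernel

end

/-! ### Uniqueness of the trace of the Krein solution. -/

section

variable {V : Type*} [NormedAddCommGroup V] [InnerProductSpace ℂ V] [FiniteDimensional ℂ V]
  [CompleteSpace V]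

open ContinuousLinearMap (adjoint)

/-- The real linear map `T ↦ T† v`. -/
def adjointApply (v : V) : (V →L[ℂ] V) →L[ℝ] V :=
  LinearMap.mkContinuous
    { toFun := fun T => adjoint T v
      map_add' := fun S T => by rw [map_add, add_apply]
      map_smul' := fun c T => by
        rw [← Complex.coe_smul, map_smulₛₗ, Complex.conj_ofReal, smul_apply, Complex.coe_smul]
        rfl } ‖v‖ fun T => by
      refine ((adjoint T).le_opNorm v).trans_eq ?_
      rw [LinearIsometryEquiv.norm_map, mul_comm]

theorem adjointApply_apply (v : V) (T : V →L[ℂ] V) : adjointApply v T = adjoint T v := rfl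

theorem eq_zero_of_adjoint_basis {T : V →L[ℂ] V}
    (h : ∀ i, adjoint T (stdOrthonormalBasis ℂ V i) = 0) : T = 0 := by
  have h1 := norm_le_sum_norm_apply (adjoint T)
  simp only [h, norm_zero, Finset.sum_const_zero] at h1
  have h2 : adjoint T = 0 := norm_le_zero_iff.1 h1
  exact (LinearIsometryEquiv.map_eq_zero_iff _).1 h2

theorem measurableSet_OmegaPlus : MeasurableSet OmegaPlus :=
  (measurableSet_le measurable_const measurable_snd).inter
    ((measurableSet_le measurable_snd measurable_fst).inter
      (measurableSet_le measurable_fst measurable_const))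

theorem measurableSet_OmegaMinus : MeasurableSet OmegaMinus :=
  (measurableSet_le measurable_const measurable_fst).inter
    ((measurableSet_lt measurable_fst measurable_snd).inter
      (measurableSet_le measurable_snd measurable_const))

/-- A kernel that vanishes almost everywhere has vanishing traces. -/
theorem IsContKernel.trace_eq_zero {W : Type*} [NormedAddCommGroup W] {K : ℝ → ℝ → W}
    (hK : IsContKernel K) (h : ∀ᵐ x ∂vol01, ∀ᵐ t ∂vol01, K x t = 0) :
    (fun x => K x 0) =ᵐ[vol01] 0 := by
  obtain ⟨hm, -, hmt, -, hct⟩ := hK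
  have hm' : AEStronglyMeasurable (fun p : ℝ × ℝ => K p.1 p.2) (vol01.prod vol01) := by
    refine hm.mono_measure ?_
    rw [vol01, Measure.prod_restrict, Measure.volume_eq_prod]
    exact Measure.restrict_mono (Set.prod_mono Ioo_subset_Icc_self Ioo_subset_Icc_self) le_rfl
  obtain ⟨K', hK', hKK⟩ := hm'
  have h1 := Measure.ae_ae_of_ae_prod hKK
  have h2 : ∀ᵐ x ∂vol01, ∀ᵐ t ∂vol01, K' (x, t) = 0 := by
    filter_upwards [h, h1] with x a b
    filter_upwards [a, b] with t c d
    rw [← d]; exact c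
  -- A measurable modification is needed to pass from vanishing along almost every row to vanishing
  -- along almost every column.
  have hms : MeasurableSet {p : ℝ × ℝ | K' p = 0} := hK'.measurableSet_eq_fun stronglyMeasurable_const
  have h3 : ∀ᵐ p ∂vol01.prod vol01, K' p = 0 := (Measure.ae_prod_iff_ae_ae hms).2 h2
  have h4 : ∀ᵐ p ∂vol01.prod vol01, K p.1 p.2 = 0 := by
    filter_upwards [h3, hKK] with p a b using b.trans a
  have h5 : ∀ᵐ t ∂vol01, ∀ᵐ x ∂vol01, K x t = 0 := by
    have := Measure.ae_ae_of_ae_prod (Measure.measurePreserving_swap.quasiMeasurePreserving.ae h4)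
    exact this
  have h0 : (0 : ℝ) ∈ Icc (0 : ℝ) 1 := by simp
  have h6 : eLpNorm (fun x => K x 0) 2 vol01 = 0 := by
    by_contra hne
    have hpos : 0 < eLpNorm (fun x => K x 0) 2 vol01 := pos_iff_ne_zero.2 hne
    -- Near 0 the columns are closer to the trace than its norm, yet almost every column is zero, a
    -- contradiction.
    have h7 := (hct 0 h0).eventually (gt_mem_nhds hpos)
    rw [eventually_nhdsWithin_iff, Metric.eventually_nhds_iff] at h7
    obtain ⟨δ, hδ, h8⟩ := h7
    have hδ1 : 0 < min δ 1 := lt_min hδ one_pos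
    have hne : (volume.restrict (Ioo 0 (min δ 1))) ≠ 0 := by
      rw [Ne, Measure.restrict_eq_zero, Real.volume_Ioo]
      simpa using hδ1
    have : (ae (volume.restrict (Ioo 0 (min δ 1)))).NeBot := ae_neBot.2 hne
    have h9 : ∀ᵐ t ∂volume.restrict (Ioo 0 (min δ 1)), ∀ᵐ x ∂vol01, K x t = 0 :=
      ae_mono (Measure.restrict_mono (Ioo_subset_Ioo_right (min_le_right _ _)) le_rfl) h5
    obtain ⟨t, ht, ht2⟩ := (h9.and (ae_restrict_mem measurableSet_Ioo)).exists
    have h10 := @h8 t (by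
      rw [Real.dist_eq, sub_zero, abs_of_pos ht2.1]
      exact ht2.2.trans_le (min_le_left _ _)) ⟨ht2.1.le, ht2.2.le.trans (min_le_right _ _)⟩
    refine (h10.trans_eq ?_).false
    refine eLpNorm_congr_norm_ae ?_
    filter_upwards [ht] with x hx
    rw [hx, zero_sub, norm_neg]
  exact (eLpNorm_eq_zero_iff (hmt 0 h0).1 two_ne_zero).1 h6

namespace DiffKernel

variable {κ : DiffKernel V}

theorem ae_eq_acc_sub {H : ℝ → V →L[ℂ] V} (hH : ∀ᵐ x ∂vol11, H x = κ.acc x) {x t : ℝ}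
    (hx1 : x ≤ 1) (ht : t ∈ Icc 0 x) :
    ∀ᵐ s : ℝ, s ∈ Ioo 0 x → H (s - t) = κ.acc (s - t) := by
  have := ae_comp_affine (ae_vol11_iff.1 hH) (a := 1) one_ne_zero (-t)
  filter_upwards [this] with s hs hsx
  rw [one_mul, ← sub_eq_add_neg] at hs
  exact hs ⟨by linarith [hsx.1, ht.2], by linarith [hsx.2, ht.1]⟩

theorem integral_acc_congr {H : ℝ → V →L[ℂ] V} (hH : ∀ᵐ x ∂vol11, H x = κ.acc x) {x t : ℝ}
    (hx1 : x ≤ 1) (ht : t ∈ Icc 0 x) (R : ℝ → V →L[ℂ] V) :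
    ∫ s in (0 : ℝ)..x, R s * H (s - t) = ∫ s in (0 : ℝ)..x, R s * κ.acc (s - t) := by
  have hx0 : 0 ≤ x := ht.1.trans ht.2
  rw [intervalIntegral.integral_of_le hx0, intervalIntegral.integral_of_le hx0,
    ← restrict_Ioo_eq_restrict_Ioc]
  refine integral_congr_ae ((ae_restrict_iff' measurableSet_Ioo).2 ?_)
  filter_upwards [ae_eq_acc_sub hH hx1 ht] with s hs hsx
  rw [hs hsx]

/-- Taking adjoints moves R to the right of the kernel: R(t)^* v solves the homogeneous accelerant
equation on (0, x). -/
theorem Coercive.krein_row_eq_zero (hκ : κ.Coercive) {x : ℝ} (hx : x ∈ Icc (0 : ℝ) 1)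
    {R : ℝ → V →L[ℂ] V} (hR : MemLp R 2 vol01) (h : ∀ᵐ t ∂volume.restrict (Ioo 0 x),
      R t + ∫ s in (0 : ℝ)..x, R s * κ.acc (s - t) = 0) :
    ∀ᵐ t ∂volume.restrict (Ioo 0 x), R t = 0 := by
  have hv : ∀ v : V, ∀ᵐ t ∂volume.restrict (Ioo 0 x), adjoint (R t) v = 0 := fun v => by
    have hf : MemLp (fun t => adjoint (R t) v) 2 vol01 := (adjointApply v).comp_memLp' hR
    refine hκ.eq_zero_of_acc hx hf ?_
    filter_upwards [h] with t ht
    have hRx : MemLp R 2 (volume.restrict (Ioc 0 x)) := by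
      refine hR.mono_measure ?_
      rw [vol01_eq_Ioc]
      exact Measure.restrict_mono (Ioc_subset_Ioc_right hx.2) le_rfl
    have hint : IntervalIntegrable (fun s => R s * κ.acc (s - t)) volume 0 x := by
      rw [intervalIntegrable_iff_integrableOn_Ioc_of_le hx.1]
      exact integrable_clm_mul hRx ((memLp_comp_sub_right κ.memLp_acc t).restrict _)
    have h1 := congrArg (adjointApply v) ht
    rw [map_add, map_zero, ← ContinuousLinearMap.intervalIntegral_comp_comm _ hint] at h1
    rw [← h1]
    congr 1
    refine intervalIntegral.integral_congr fun s _ => ?_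
    simp only [adjointApply_apply]
    rw [← ContinuousLinearMap.star_eq_adjoint (R s * _), star_mul,
      ContinuousLinearMap.star_eq_adjoint, ContinuousLinearMap.star_eq_adjoint, κ.adjoint_acc,
          neg_sub,
      mul_apply_eq_comp]
  have hall : ∀ᵐ t ∂volume.restrict (Ioo 0 x), ∀ i, adjoint (R t) (stdOrthonormalBasis ℂ V i) = 0 :=
    ae_all_iff.2 fun i => hv _
  filter_upwards [hall] with t ht using eq_zero_of_adjoint_basis ht

/-- Uniqueness of the trace of the solution of the Krein equation. -/
theorem Coercive.krein_trace_eq_zero (hκ : κ.Coercive) {H : ℝ → V →L[ℂ] V}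
    (hH : ∀ᵐ x ∂vol11, H x = κ.acc x) {K : ℝ → ℝ → V →L[ℂ] V} (hK : IsContKernel K)
    (h0 : ∀ᵐ p ∂volume.restrict OmegaMinus, K p.1 p.2 = 0)
    (h1 : ∀ᵐ p ∂volume.restrict OmegaPlus,
      K p.1 p.2 + ∫ s in (0 : ℝ)..p.1, K p.1 s * H (s - p.2) = 0) :
    (fun x => K x 0) =ᵐ[vol01] 0 := by
  refine hK.trace_eq_zero ?_
  rw [ae_restrict_iff' measurableSet_OmegaMinus, Measure.volume_eq_prod] at h0
  rw [ae_restrict_iff' measurableSet_OmegaPlus, Measure.volume_eq_prod] at h1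
  have a0 := Measure.ae_ae_of_ae_prod h0
  have a1 := Measure.ae_ae_of_ae_prod h1
  refine (ae_restrict_iff' measurableSet_Ioo).2 ?_
  filter_upwards [a0, a1] with x b0 b1 hx
  have hx' := Ioo_subset_Icc_self hx
  have hrow := hκ.krein_row_eq_zero hx' (hK.2.1 x hx') (by
    refine (ae_restrict_iff' measurableSet_Ioo).2 ?_
    filter_upwards [b1] with t ht htx
    rw [← integral_acc_congr hH hx.2.le (Ioo_subset_Icc_self htx)]
    exact ht ⟨htx.1.le, htx.2.le, hx.2.le⟩)
  have hne : ∀ᵐ t : ℝ, t ≠ x := by simp [ae_iff]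
  refine (ae_restrict_iff' measurableSet_Ioo).2 ?_
  filter_upwards [(ae_restrict_iff' measurableSet_Ioo).1 hrow, b0, hne] with t c0 c1 c2 ht
  rcases lt_or_gt_of_ne c2 with h | h
  · exact c0 ⟨ht.1, h⟩
  · exact c1 ⟨hx.1.le, h, ht.2.le⟩

end DiffKernel

end

/-! ### Matrices as operators on Euclidean space. -/

section

open ContinuousLinearMap (adjoint)

/-- The Euclidean space on which the matrices act. -/
abbrev EV (r : ℕ) : Type := EuclideanSpace ℂ (Fin r)

variable {r : ℕ}

/-- The isometric identification of matrices with operators. -/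
def op : Mat r ≃ₗᵢ[ℂ] (EV r →L[ℂ] EV r) :=
  { (Matrix.toEuclideanCLM (n := Fin r) (𝕜 := ℂ)).toAlgEquiv.toLinearEquiv with
    norm_map' := fun A => Matrix.l2_opNorm_toEuclideanCLM A }

theorem ofLp_op (A : Mat r) (x : EV r) : WithLp.ofLp (op A x) = A *ᵥ WithLp.ofLp x := rfl

theorem op_one : op (1 : Mat r) = 1 := map_one (Matrix.toEuclideanCLM (n := Fin r) (𝕜 := ℂ))

theorem op_mul (A B : Mat r) : op (A * B) = op A * op B :=
  map_mul (Matrix.toEuclideanCLM (n := Fin r) (𝕜 := ℂ)) A B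

theorem adjoint_op (A : Mat r) : adjoint (op A) = op Aᴴ :=
  (map_star (Matrix.toEuclideanCLM (n := Fin r) (𝕜 := ℂ)) A).symm

theorem op_nonneg {A : Mat r} (hA : A.PosSemidef) : 0 ≤ op A := by
  rw [ContinuousLinearMap.nonneg_iff_isPositive, ← ContinuousLinearMap.isPositive_toLinearMap_iff]
  exact Matrix.isPositive_toEuclideanLin_iff.2 hA

theorem finrank_range_op (A : Mat r) : Module.finrank ℂ (op A).range = A.rank := by
  rw [Matrix.rank_eq_finrank_range_toLin A (PiLp.basisFun 2 ℂ (Fin r)) (PiLp.basisFun 2 ℂ (Fin r)),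
    ← Matrix.toLpLin_eq_toLin]
  rfl

theorem inner_op_single (A : Mat r) (i j : Fin r) :
    ⟪(EuclideanSpace.single i (1 : ℂ) : EV r), op A (EuclideanSpace.single j 1)⟫_ℂ = A i j := by
  rw [EuclideanSpace.inner_single_left]
  simp [ofLp_op]

namespace Collection

variable (a : Collection r)

theorem finite_idx (h1 : a.A1) (n : ℤ) : (a.idx n).Finite := by
  obtain ⟨⟨C, hC⟩, -, -⟩ := h1
  exact finite_of_encard_le_coe (hC n)

/-- The spectral data as operators. -/
def specData (h1 : a.A1) (h2 : a.A2) (h3 : a.A3) : SpecData (EV r) where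
  lam := a.lam
  al := fun j => op (a.alpha j)
  idx := fun n => (a.finite_idx h1 n).toFinset
  inj := a.strictMono_lam.injective
  mem_idx := fun j n => by rw [Set.Finite.mem_toFinset]; rfl
  pos := fun j => op_nonneg (a.alpha_posSemidef j)
  card_le := by
    obtain ⟨C, hC⟩ := h1.1
    refine ⟨C, fun n => ?_⟩
    have := hC n
    rw [(a.finite_idx h1 n).encard_eq_coe_toFinset_card] at this
    exact_mod_cast this
  summable_sq := by
    refine h1.2.1.congr fun n => ?_
    rw [finsum_mem_eq_finite_toFinset_sum _ (a.finite_idx h1 n)]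
  summable_norm := by
    refine h1.2.2.congr fun n => ?_
    rw [finsum_mem_eq_finite_toFinset_sum _ (a.finite_idx h1 n), ← op_one, ← map_sum, ← map_sub,
      LinearIsometryEquiv.norm_map]
  rank_sum := by
    obtain ⟨N₀, hN₀⟩ := h2
    refine ⟨N₀, fun N hN => ?_⟩
    rw [finrank_euclideanSpace_fin, ← hN₀ N hN]
    refine Finset.sum_congr rfl fun n _ => ?_
    rw [finsum_mem_eq_finite_toFinset_sum _ (a.finite_idx h1 n)]
    exact Finset.sum_congr rfl fun j _ => finrank_range_op _
  complete := fun g hg => by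
    refine Dense.eq_zero_of_inner_left (𝕜 := ℂ) h3 fun v hv => ?_
    have hle : Submodule.span ℂ {f : Lp (EuclideanSpace ℂ (Fin r)) 2 vol11 |
        ∃ (j : ℤ) (c : Fin r → ℂ), f =ᵐ[vol11] fun t : ℝ =>
          Complex.exp (Complex.I * a.lam j * t) • WithLp.toLp 2 (a.alpha j *ᵥ c)} ≤
        (Submodule.span ℂ {g})ᗮ := by
      refine Submodule.span_le.2 ?_
      rintro f ⟨j, c, hf⟩
      have e : f = expCol (a.lam j) (op (a.alpha j) (WithLp.toLp 2 c)) :=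
        Lp.ext (hf.trans (coeFn_expCol _ _).symm)
      refine (Submodule.mem_orthogonal_singleton_iff_inner_right).2 ?_
      rw [e, ← ContinuousLinearMap.adjoint_inner_left,
        ← inner_apply_left_of_nonneg (op_nonneg (a.alpha_posSemidef j)), hg j, inner_zero_left]
    exact (Submodule.mem_orthogonal_singleton_iff_inner_right).1 (hle hv)

variable {a}

/-- The limits of integration are the right endpoints of Δ_{-n} and Δ_n, so the half-open window is
the union of the Δ_m with -n < m ≤ n. This is why all partial sums run over `Finset.Ioc (-n) n`. -/
theorem op_truncH (h1 : a.A1) (h2 : a.A2) (h3 : a.A3) (n : ℕ) (x : ℝ) : op (a.truncH n x) =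
    ∑ m ∈ Finset.Ioc (-(n : ℤ)) n, (a.specData h1 h2 h3).block m (2 * x) := by
  set S : Set ℝ := Ioc (-(Real.pi * ((n : ℝ) - 1 / 2))) (Real.pi * ((n : ℝ) + 1 / 2)) with hS
  have hpi := Real.pi_pos
  have hmem : ∀ (m : ℤ) (l : ℝ), l ∈ Delta m → (l ∈ S ↔ m ∈ Finset.Ioc (-(n : ℤ)) n) := by
    intro m l hl
    rw [Delta, mem_Ioc] at hl
    rw [hS, mem_Ioc, Finset.mem_Ioc]
    constructor
    · rintro ⟨p1, p2⟩
      constructor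
      · by_contra hc
        have hc' : (m : ℝ) ≤ -n := by exact_mod_cast not_lt.1 hc
        nlinarith
      · by_contra hc
        have hc' : (n : ℝ) + 1 ≤ m := by exact_mod_cast not_le.1 hc
        nlinarith
    · rintro ⟨p1, p2⟩
      have p1' : -(n : ℝ) + 1 ≤ m := by exact_mod_cast p1
      have p2' : (m : ℝ) ≤ n := by exact_mod_cast p2
      constructor <;> nlinarith
  set D := a.specData h1 h2 h3 with hD
  have e1 : atomicIntegral a.lam a.alpha S (fun l => Complex.exp (2 * Complex.I * l * x)) =
      ∑ m ∈ Finset.Ioc (-(n : ℤ)) n, ∑ j ∈ D.idx m, Complex.exp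
          (2 * Complex.I * a.lam j * x) • a.alpha j := by
    rw [← Finset.sum_biUnion]
    · rw [atomicIntegral, ← finsum_mem_coe_finset]
      refine finsum_congr fun j => ?_
      have : a.lam j ∈ S ↔ j ∈ ((Finset.Ioc (-(n : ℤ)) n).biUnion D.idx : Set ℤ) := by
        obtain ⟨m, hm⟩ := D.exists_idx j
        refine (hmem m (a.lam j) ((D.mem_idx j m).1 hm)).trans ?_
        rw [Finset.mem_coe, Finset.mem_biUnion]
        constructor
        · exact fun h => ⟨m, h, hm⟩
        · rintro ⟨m', hm', hj⟩
          rwa [D.idx_unique hm hj]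
      simp only [this]
    · intro m _ m' _ hmm
      exact Finset.disjoint_left.2 fun j hj hj' => hmm (D.idx_unique hj hj')
  have e2 : atomicIntegral (fun m : ℤ => Real.pi * m) (fun _ => (1 : Mat r)) S
      (fun l => Complex.exp (2 * Complex.I * l * x)) =
      ∑ m ∈ Finset.Ioc (-(n : ℤ)) n, Complex.exp (2 * Complex.I * (Real.pi * m : ℝ) * x) •
          (1 : Mat r) := by
    rw [atomicIntegral, ← finsum_mem_coe_finset]
    refine finsum_congr fun m => ?_
    have : Real.pi * m ∈ S ↔ m ∈ (Finset.Ioc (-(n : ℤ)) n : Set ℤ) := by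
      rw [hmem m _ (by rw [Delta, mem_Ioc]; constructor <;> linarith), Finset.mem_coe]
    simp only [this]
  rw [truncH, e1, e2, map_sub, map_sum, map_sum, ← Finset.sum_sub_distrib]
  refine Finset.sum_congr rfl fun m _ => ?_
  rw [SpecData.block, map_sum, map_smul, op_one]
  congr 1
  · refine Finset.sum_congr rfl fun j _ => ?_
    rw [map_smul]
    change _ = Complex.exp (Complex.I * a.lam j * _) • op (a.alpha j)
    congr 2
    push_cast; ring
  · congr 2
    push_cast; ring

theorem eLpNorm_op_comp (μ : Measure ℝ) (F : ℝ → Mat r) :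
    eLpNorm (fun x => op (F x)) 2 μ = eLpNorm F 2 μ :=
  eLpNorm_congr_norm_ae (Eventually.of_forall fun _ => LinearIsometryEquiv.norm_map _ _)

theorem memLp_op_iff {μ : Measure ℝ} {F : ℝ → Mat r} :
    MemLp (fun x => op (F x)) 2 μ ↔ MemLp F 2 μ := by
  constructor
  · rintro ⟨h1, h2⟩
    refine ⟨?_, by rwa [eLpNorm_op_comp] at h2⟩
    have := (op (r := r)).symm.continuous.comp_aestronglyMeasurable h1
    simpa using this
  · rintro ⟨h1, h2⟩
    exact ⟨(op (r := r)).continuous.comp_aestronglyMeasurable h1, by rwa [eLpNorm_op_comp]⟩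

theorem isHmu_iff (h1 : a.A1) (h2 : a.A2) (h3 : a.A3) (H : ℝ → Mat r) : a.IsHmu H ↔
    MemLp (fun x => op (H x)) 2 vol11 ∧ Tendsto (fun n : ℕ => eLpNorm (fun x =>
      ∑ m ∈ Finset.Ioc (-(n : ℤ)) n, (a.specData h1 h2 h3).block m (2 * x) - op (H x)) 2 vol11)
        atTop (𝓝 0) := by
  rw [IsHmu, memLp_op_iff]
  simp only [← op_truncH h1 h2 h3, ← map_sub, eLpNorm_op_comp]

theorem exists_isHmu (h1 : a.A1) (h2 : a.A2) (h3 : a.A3) : ∃ H, a.IsHmu H := by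
  refine ⟨fun x => op.symm ((a.specData h1 h2 h3).hLim x), (isHmu_iff h1 h2 h3 _).2 ?_⟩
  simp only [LinearIsometryEquiv.apply_symm_apply]
  exact ⟨Lp.memLp _, (a.specData h1 h2 h3).tendsto_block⟩

end Collection

end

/-! ### Accelerant and Krein equation for matrix functions. -/

section

open ContinuousLinearMap (adjoint)

variable {r : ℕ}

theorem integral_op {μ : Measure ℝ} (F : ℝ → Mat r) : ∫ x, op (F x) ∂μ = op (∫ x, F x ∂μ) :=
  (op (r := r)).toContinuousLinearEquiv.integral_comp_comm F

theorem intervalIntegral_op (a b : ℝ) (F : ℝ → Mat r) :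
    ∫ x in a..b, op (F x) = op (∫ x in a..b, F x) := by
  rw [intervalIntegral, intervalIntegral, integral_op, integral_op, map_sub]

variable (r) in
/-- The identification of vectors with elements of the Euclidean space. -/
def vec : (Fin r → ℂ) ≃L[ℂ] EV r := (PiLp.continuousLinearEquiv 2 ℂ (fun _ : Fin r => ℂ)).symm

theorem vec_apply (x : Fin r → ℂ) : vec r x = WithLp.toLp 2 x := rfl

theorem op_vec (A : Mat r) (x : Fin r → ℂ) : op A (vec r x) = vec r (A *ᵥ x) := rfl

theorem intervalIntegral_vec (a b : ℝ) (F : ℝ → Fin r → ℂ) :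
    ∫ x in a..b, vec r (F x) = vec r (∫ x in a..b, F x) := by
  rw [intervalIntegral, intervalIntegral, (vec r).integral_comp_comm, (vec r).integral_comp_comm,
    map_sub]

theorem isG2_iff {K : ℝ → ℝ → Mat r} : IsG2 K ↔ IsContKernel fun x t => op (K x t) := by
  have hm : AEStronglyMeasurable (fun p : ℝ × ℝ => K p.1 p.2)
      (volume.restrict (Icc (0 : ℝ) 1 ×ˢ Icc (0 : ℝ) 1)) ↔
      AEStronglyMeasurable (fun p : ℝ × ℝ => op (K p.1 p.2))
      (volume.restrict (Icc (0 : ℝ) 1 ×ˢ Icc (0 : ℝ) 1)) := by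
    constructor
    · exact fun h => (op (r := r)).continuous.comp_aestronglyMeasurable h
    · intro h
      have := (op (r := r)).symm.continuous.comp_aestronglyMeasurable h
      simpa using this
  rw [IsG2, IsContKernel, hm]
  simp only [Collection.memLp_op_iff, ← map_sub, Collection.eLpNorm_op_comp]

theorem IsContKernel.sub {W : Type*} [NormedAddCommGroup W] {K L : ℝ → ℝ → W} (hK : IsContKernel K)
    (hL : IsContKernel L) : IsContKernel fun x t => K x t - L x t := by
  obtain ⟨k1, k2, k3, k4, k5⟩ := hK
  obtain ⟨l1, l2, l3, l4, l5⟩ := hL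
  refine ⟨k1.sub l1, fun x hx => (k2 x hx).sub (l2 x hx), fun x hx => (k3 x hx).sub (l3 x hx),
    fun x hx => ?_, fun t ht => ?_⟩
  · refine tendsto_eLpNorm_sub_sub ?_ ?_ (k4 x hx) (l4 x hx)
    · filter_upwards [self_mem_nhdsWithin] with y hy using ((k2 y hy).sub (k2 x hx)).1
    · filter_upwards [self_mem_nhdsWithin] with y hy using ((l2 y hy).sub (l2 x hx)).1
  · refine tendsto_eLpNorm_sub_sub (F := fun t x => K x t) (G := fun t x => L x t) ?_ ?_ (k5 t ht)
        (l5 t ht)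
    · filter_upwards [self_mem_nhdsWithin] with y hy using ((k3 y hy).sub (k3 t ht)).1
    · filter_upwards [self_mem_nhdsWithin] with y hy using ((l3 y hy).sub (l3 t ht)).1

section Accelerant

variable {κ : DiffKernel (EV r)} (hκ : κ.Coercive) {H : ℝ → Mat r}
  (hH : ∀ᵐ x ∂vol11, op (H x) = κ.acc x)

include hκ hH

theorem isAccelerant_of_acc (hHL : MemLp H 2 vol11) : IsAccelerant H := by
  refine ⟨hHL, fun b hb f hf hfe => ?_⟩
  have hf' : MemLp (fun x => vec r (f x)) 2 vol01 :=
    ((vec r : (Fin r → ℂ) ≃L[ℂ] EV r) : (Fin r → ℂ) →L[ℂ] EV r).comp_memLp' hf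
  have h0 : ∀ᵐ x ∂volume.restrict (Ioo 0 b), vec r (f x) = 0 := by
    refine hκ.eq_zero_of_acc hb hf' ?_
    have hfe' := ae_restrict_of_ae_restrict_of_subset (Ioo_subset_Ioo_right hb.2) hfe
    filter_upwards [hfe', ae_restrict_mem measurableSet_Ioo] with x hx hxb
    have h1 := congrArg (vec r) hx
    rw [map_add, map_zero, ← intervalIntegral_vec] at h1
    rw [← h1]
    congr 1
    rw [intervalIntegral.integral_of_le hb.1, intervalIntegral.integral_of_le hb.1,
      ← restrict_Ioo_eq_restrict_Ioc]
    refine integral_congr_ae ((ae_restrict_iff' measurableSet_Ioo).2 ?_)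
    have h2 := ae_comp_affine (ae_vol11_iff.1 hH) (a := -1) (by norm_num) x
    filter_upwards [h2] with t ht htb
    rw [show -1 * t + x = x - t by ring] at ht
    rw [← op_vec, ht ⟨by linarith [hxb.1, htb.2, hb.2], by linarith [hxb.2, htb.1, hb.2]⟩]
  -- Once f vanishes on (0, b) the integral is zero for every x, and the equation itself gives f = 0
  -- on the rest of (0, 1).
  have hz : ∀ x, ∫ t in (0 : ℝ)..b, H (x - t) *ᵥ f t = 0 := fun x => by
    rw [intervalIntegral.integral_of_le hb.1, ← restrict_Ioo_eq_restrict_Ioc]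
    refine integral_eq_zero_of_ae ?_
    filter_upwards [h0] with t ht
    rw [(vec r).map_eq_zero_iff.1 ht, Matrix.mulVec_zero]
    rfl
  filter_upwards [hfe] with x hx
  rwa [hz, add_zero] at hx

theorem exists_isKreinSolution : ∃ R, IsKreinSolution H R ∧ ∀ x t, op (R x t) = κ.krein x t := by
  have e : ∀ x t, op (op.symm (κ.krein x t) : Mat r) = κ.krein x t := fun x t =>
    op.apply_symm_apply _
  refine ⟨fun x t => op.symm (κ.krein x t), ⟨?_, ?_, ?_⟩, e⟩
  · rw [isG2_iff]
    simp only [e]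
    exact hκ.isContKernel_krein
  · refine (ae_restrict_iff' measurableSet_OmegaMinus).2 (ae_of_all _ fun p hp => ?_)
    have h0 : κ.krein p.1 p.2 = 0 := if_neg (not_le.2 hp.2.1)
    change op.symm (κ.krein p.1 p.2) = 0
    rw [h0, map_zero]
  · refine (ae_restrict_iff' measurableSet_OmegaPlus).2 ?_
    -- H is prescribed only on the open interval, while x - t reaches 1 at the corner of Ω⁺; the
    -- null set x - t = 1 is discarded.
    have h1 : ∀ᵐ s : ℝ, s ≠ 1 ∧ (s ∈ Ioo (-1 : ℝ) 1 → op (H s) = κ.acc s) := by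
      have a1 : ∀ᵐ s : ℝ, s ≠ 1 := by simp [ae_iff]
      filter_upwards [a1, ae_vol11_iff.1 hH] with s b1 b2 using ⟨b1, b2⟩
    have h2 := (quasiMeasurePreserving_sub (volume : Measure ℝ) (volume : Measure ℝ)).ae h1
    rw [← Measure.volume_eq_prod] at h2
    filter_upwards [h2] with p hp hpO
    have hx : p.1 ∈ Icc (0 : ℝ) 1 := ⟨hpO.1.trans hpO.2.1, hpO.2.2⟩
    refine op.injective ?_
    rw [map_add, map_add, map_zero, ← intervalIntegral_op]
    simp only [op_mul, e]
    have h3 := hp.2 ⟨by linarith [hpO.2.1], lt_of_le_of_ne (by linarith [hpO.1, hpO.2.2]) hp.1⟩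
    rw [h3, DiffKernel.integral_acc_congr (H := fun s => op (H s)) hH hpO.2.2 ⟨hpO.1, hpO.2.1⟩]
    exact hκ.krein_eq hx hpO.2.1

theorem IsKreinSolution.trace_unique {R R' : ℝ → ℝ → Mat r} (hR : IsKreinSolution H R)
    (hR' : IsKreinSolution H R') : (fun x => R x 0) =ᵐ[vol01] fun x => R' x 0 := by
  have hK := (isG2_iff.1 hR.1).sub (isG2_iff.1 hR'.1)
  have hint : ∀ {R : ℝ → ℝ → Mat r} (_ : IsG2 R) {x t : ℝ} (_ : x ≤ 1) (_ : t ∈ Icc 0 x),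
      IntervalIntegrable (fun s => op (R x s) * op (H (s - t))) volume 0 x := by
    intro R hR x t hx1 ht
    have hx : x ∈ Icc (0 : ℝ) 1 := ⟨ht.1.trans ht.2, hx1⟩
    have hRx : MemLp (fun s => op (R x s)) 2 (volume.restrict (Ioc 0 x)) := by
      refine ((isG2_iff.1 hR).2.1 x hx).mono_measure ?_
      rw [vol01_eq_Ioc]
      exact Measure.restrict_mono (Ioc_subset_Ioc_right hx1) le_rfl
    rw [intervalIntegrable_iff_integrableOn_Ioc_of_le hx.1]
    refine integrable_clm_mul hRx ((memLp_congr_ae ?_).2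
      ((memLp_comp_sub_right κ.memLp_acc t).restrict _))
    rw [← restrict_Ioo_eq_restrict_Ioc]
    exact (ae_restrict_iff' measurableSet_Ioo).2 (DiffKernel.ae_eq_acc_sub (H := fun s => op
        (H s)) hH hx1 ht)
  have h0 := hκ.krein_trace_eq_zero hH hK (by
    filter_upwards [hR.2.1, hR'.2.1] with p a b
    rw [a, b, sub_self]) (by
    filter_upwards [hR.2.2, hR'.2.2, ae_restrict_mem measurableSet_OmegaPlus] with p a b hp
    have a' := congrArg op a
    have b' := congrArg op b
    rw [map_add, map_add, map_zero, ← intervalIntegral_op] at a' b'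
    simp only [op_mul] at a' b'
    simp only [sub_mul]
    rw [intervalIntegral.integral_sub (hint hR.1 hp.2.2 ⟨hp.1, hp.2.1⟩)
      (hint hR'.1 hp.2.2 ⟨hp.1, hp.2.1⟩)]
    have e : ∀ A B C D E : EV r →L[ℂ] EV r, A + E + C = 0 → B + E + D = 0 → A - B + (C - D) = 0 :=
        by
      intro A B C D E h1 h2
      have : A - B + (C - D) = (A + E + C) - (B + E + D) := by abel
      rw [this, h1, h2, sub_zero]
    exact e _ _ _ _ _ a' b')
  filter_upwards [h0] with x hx
  exact op.injective (sub_eq_zero.1 hx)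

theorem exists_isTheta : ∃ q, IsTheta H q := by
  obtain ⟨R, hR, -⟩ := exists_isKreinSolution hκ hH
  exact ⟨_, R, hR, ae_eq_rfl⟩

theorem isTheta_unique {q q' : ℝ → Mat r} (h : IsTheta H q) (h' : IsTheta H q') :
    q =ᵐ[vol01] q' := by
  obtain ⟨R, hR, hq⟩ := h
  obtain ⟨R', hR', hq'⟩ := h'
  filter_upwards [hR.trace_unique hκ hH hR', hq, hq'] with x a b c
  rw [b, c, a]

theorem op_isTheta {q : ℝ → Mat r} (h : IsTheta H q) :
    ∀ᵐ x ∂vol01, op (q x) = Complex.I • κ.pot 1 x := by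
  obtain ⟨R, hR, hRe⟩ := exists_isKreinSolution hκ hH
  have h01 : ∀ᵐ t ∂vol01, t ∈ Ioo (0 : ℝ) 1 := ae_restrict_mem measurableSet_Ioo
  filter_upwards [isTheta_unique hκ hH h ⟨R, hR, ae_eq_rfl⟩, h01] with x hx hx1
  rw [hx, map_smul, hRe, DiffKernel.krein_zero hx1]

end Accelerant

end

/-! ### The Dirac system in components. -/

section

open ContinuousLinearMap (adjoint)

variable {r : ℕ}

theorem memLp_bilin_continuousOn {U W Z : Type*} [NormedAddCommGroup U] [NormedSpace ℝ U]
    [NormedAddCommGroup W] [NormedSpace ℝ W] [NormedAddCommGroup Z] [NormedSpace ℝ Z]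
    (B : U →L[ℝ] W →L[ℝ] Z) {f : ℝ → U} {G : ℝ → W} (hf : MemLp f 2 vol01)
    (hG : ContinuousOn G (Icc 0 1)) : MemLp (fun t => B (f t) (G t)) 2 vol01 := by
  obtain ⟨C, hC⟩ := isCompact_Icc.exists_bound_of_continuousOn hG
  refine hf.of_le_mul (c := ‖B‖ * C) (B.aestronglyMeasurable_comp₂ hf.1
    ((hG.mono Ioo_subset_Icc_self).aestronglyMeasurable measurableSet_Ioo)) ?_
  refine (ae_restrict_iff' measurableSet_Ioo).2 (ae_of_all _ fun t ht => ?_)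
  refine (B.le_opNorm₂ _ _).trans ?_
  have := hC t (Ioo_subset_Icc_self ht)
  calc _ ≤ ‖B‖ * ‖f t‖ * C := by gcongr
    _ = _ := by ring

variable (r) in
/-- The first component of a vector of length `2r`. -/
def pr₁ : (Fin r ⊕ Fin r → ℂ) →L[ℂ] EV r :=
  (vec r : (Fin r → ℂ) →L[ℂ] EV r).comp (ContinuousLinearMap.pi fun i =>
    ContinuousLinearMap.proj (R := ℂ) (φ := fun _ : Fin r ⊕ Fin r => ℂ) (Sum.inl i))

variable (r) in
/-- The second component of a vector of length `2r`. -/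
def pr₂ : (Fin r ⊕ Fin r → ℂ) →L[ℂ] EV r :=
  (vec r : (Fin r → ℂ) →L[ℂ] EV r).comp (ContinuousLinearMap.pi fun i =>
    ContinuousLinearMap.proj (R := ℂ) (φ := fun _ : Fin r ⊕ Fin r => ℂ) (Sum.inr i))

variable (r) in
/-- The vector of length `2r` with given components. -/
def join : EV r × EV r →L[ℂ] (Fin r ⊕ Fin r → ℂ) :=
  ContinuousLinearMap.pi (Sum.elim
    (fun i => (EuclideanSpace.proj (𝕜 := ℂ) i).comp (ContinuousLinearMap.fst ℂ (EV r) (EV r)))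
    (fun i => (EuclideanSpace.proj (𝕜 := ℂ) i).comp (ContinuousLinearMap.snd ℂ (EV r) (EV r))))

theorem pr₁_apply (w : Fin r ⊕ Fin r → ℂ) : pr₁ r w = vec r (w ∘ Sum.inl) := rfl

theorem pr₂_apply (w : Fin r ⊕ Fin r → ℂ) : pr₂ r w = vec r (w ∘ Sum.inr) := rfl

theorem pr₁_join (v : EV r × EV r) : pr₁ r (join r v) = v.1 := by
  ext i; rfl

theorem pr₂_join (v : EV r × EV r) : pr₂ r (join r v) = v.2 := by
  ext i; rfl

theorem pr_ext {w w' : Fin r ⊕ Fin r → ℂ} (h1 : pr₁ r w = pr₁ r w') (h2 : pr₂ r w = pr₂ r w') :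
    w = w' := by
  rw [pr₁_apply, pr₁_apply] at h1
  rw [pr₂_apply, pr₂_apply] at h2
  have h1 := (vec r).injective h1
  have h2 := (vec r).injective h2
  ext (i | i)
  · exact congrFun h1 i
  · exact congrFun h2 i

theorem pr₁_theta (w : Fin r ⊕ Fin r → ℂ) : pr₁ r (theta r *ᵥ w) = -(Complex.I • pr₁ r w) := by
  rw [pr₁_apply, pr₁_apply, ← map_smul, ← map_neg]
  congr 1
  ext i
  simp [theta, Matrix.fromBlocks_mulVec, Matrix.neg_mulVec, Matrix.smul_mulVec]

theorem pr₂_theta (w : Fin r ⊕ Fin r → ℂ) : pr₂ r (theta r *ᵥ w) = Complex.I • pr₂ r w := by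
  rw [pr₂_apply, pr₂_apply, ← map_smul]
  congr 1
  ext i
  simp [theta, Matrix.fromBlocks_mulVec, Matrix.neg_mulVec, Matrix.smul_mulVec]

theorem pr₁_bq (q : ℝ → Mat r) (x : ℝ) (w : Fin r ⊕ Fin r → ℂ) :
    pr₁ r (bq q x *ᵥ w) = op (q x) (pr₂ r w) := by
  rw [pr₁_apply, pr₂_apply, op_vec]
  congr 1
  ext i
  simp [bq, Matrix.fromBlocks_mulVec]

theorem pr₂_bq (q : ℝ → Mat r) (x : ℝ) (w : Fin r ⊕ Fin r → ℂ) :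
    pr₂ r (bq q x *ᵥ w) = adjoint (op (q x)) (pr₁ r w) := by
  rw [pr₁_apply, pr₂_apply, adjoint_op, op_vec]
  congr 1
  ext i
  simp [bq, Matrix.fromBlocks_mulVec]

theorem IsW12.integrableOn {E : Type*} [NormedAddCommGroup E] [NormedSpace ℝ E] {y y' : ℝ → E}
    (h : IsW12 y y') : IntegrableOn y' (Ioc 0 1) := by
  have := h.1.integrable one_le_two
  rwa [vol01_eq_Ioc] at this

theorem IsW12.intervalIntegrable {E : Type*} [NormedAddCommGroup E] [NormedSpace ℝ E]
    {y y' : ℝ → E} (h : IsW12 y y') {x : ℝ} (hx : x ∈ Icc (0 : ℝ) 1) :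
    IntervalIntegrable y' volume 0 x :=
  (intervalIntegrable_iff_integrableOn_Ioc_of_le hx.1).2
    (h.integrableOn.mono_set (Ioc_subset_Ioc_right hx.2))

theorem IsW12.continuousOn {E : Type*} [NormedAddCommGroup E] [NormedSpace ℝ E] {y y' : ℝ → E}
    (h : IsW12 y y') : ContinuousOn y (Icc 0 1) := by
  have h1 : IntegrableOn y' (Icc 0 1) := by
    rw [integrableOn_Icc_iff_integrableOn_Ioc]; exact h.integrableOn
  have h2 := intervalIntegral.continuousOn_primitive_interval (a := (0 : ℝ)) (b := 1) (μ := volume)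
    (f := y') (by rwa [uIcc_of_le zero_le_one])
  rw [uIcc_of_le zero_le_one] at h2
  exact (continuousOn_const.add h2).congr h.2

theorem IsW12.map {E F : Type*} [NormedAddCommGroup E] [NormedSpace ℝ E] [CompleteSpace E]
    [NormedAddCommGroup F] [NormedSpace ℝ F] [CompleteSpace F] {y y' : ℝ → E} (h : IsW12 y y')
    (T : E →L[ℝ] F) : IsW12 (fun x => T (y x)) (fun x => T (y' x)) := by
  refine ⟨T.comp_memLp' h.1, fun x hx => ?_⟩
  rw [T.intervalIntegral_comp_comm (h.intervalIntegrable hx), ← map_add, ← h.2 x hx]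

theorem IsW12.add {E : Type*} [NormedAddCommGroup E] [NormedSpace ℝ E] {y y' u u' : ℝ → E}
    (h : IsW12 y y') (k : IsW12 u u') : IsW12 (fun x => y x + u x) (fun x => y' x + u' x) := by
  refine ⟨h.1.add k.1, fun x hx => ?_⟩
  beta_reduce
  rw [intervalIntegral.integral_add (h.intervalIntegrable hx) (k.intervalIntegrable hx), h.2 x hx,
    k.2 x hx]
  abel

theorem IsW12.eq_add_integral {E : Type*} [NormedAddCommGroup E] [NormedSpace ℝ E] {y y' g : ℝ → E}
    (h : IsW12 y y') (hg : ∀ᵐ x ∂vol01, y' x = g x) {x : ℝ} (hx : x ∈ Icc (0 : ℝ) 1) :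
    y x = y 0 + ∫ t in (0 : ℝ)..x, g t := by
  rw [h.2 x hx, intervalIntegral.integral_congr_ae_restrict]
  rw [uIoc_of_le hx.1]
  rw [vol01_eq_Ioc] at hg
  exact ae_mono (Measure.restrict_mono (Ioc_subset_Ioc_right hx.2) le_rfl) hg

/-- Multiplication by i: with q = ip the first row of ϑy' + 𝐪y = zy reads y₁' = izy₁ + py₂. -/
theorem pr₁_eq_iff {q : ℝ → Mat r} {x : ℝ} {P : EV r →L[ℂ] EV r} (hq : op (q x) = Complex.I • P)
    {z : ℂ} {w w' : Fin r ⊕ Fin r → ℂ} :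
    pr₁ r (theta r *ᵥ w') + pr₁ r (bq q x *ᵥ w) = z • pr₁ r w ↔
      pr₁ r w' = (Complex.I * z) • pr₁ r w + P (pr₂ r w) := by
  rw [pr₁_theta, pr₁_bq, hq, smul_apply]
  constructor <;> intro h
  · have h3 := congrArg (fun v => Complex.I • v) h
    simp only [smul_add, smul_neg, smul_smul, Complex.I_mul_I, neg_smul, one_smul, neg_neg] at h3
    rw [← h3]
    abel
  · rw [h]
    simp only [smul_add, smul_smul, ← mul_assoc, Complex.I_mul_I, neg_smul, neg_mul, one_mul]
    abel

theorem pr₂_eq_iff {q : ℝ → Mat r} {x : ℝ} {P : EV r →L[ℂ] EV r} (hq : op (q x) = Complex.I • P)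
    {z : ℂ} {w w' : Fin r ⊕ Fin r → ℂ} :
    pr₂ r (theta r *ᵥ w') + pr₂ r (bq q x *ᵥ w) = z • pr₂ r w ↔
      pr₂ r w' = -(Complex.I * z) • pr₂ r w + adjoint P (pr₁ r w) := by
  have ha : adjoint (op (q x)) = -(Complex.I • adjoint P) := by
    rw [hq, LinearIsometryEquiv.map_smulₛₗ, Complex.conj_I, neg_smul]
  rw [pr₂_theta, pr₂_bq, ha, neg_apply, smul_apply]
  constructor <;> intro h
  · have h3 := congrArg (fun v => Complex.I • v) h
    simp only [smul_add, smul_neg, smul_smul, Complex.I_mul_I, neg_smul, one_smul, neg_neg] at h3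
    rw [neg_smul, ← h3]
    abel
  · rw [h]
    simp only [smul_add, smul_neg, smul_smul, ← mul_assoc, Complex.I_mul_I, neg_smul,
      neg_mul, one_mul, neg_neg]
    abel

section

variable {q : ℝ → Mat r} {p : ℝ → EV r →L[ℂ] EV r}
  (hq : ∀ᵐ x ∂vol01, op (q x) = Complex.I • p x)

include hq

theorem isDiracSol_of_isW12 {z : ℂ} {y y' : ℝ → (Fin r ⊕ Fin r → ℂ)} (hy : IsW12 y y')
    (he : ∀ᵐ x ∂vol01, theta r *ᵥ y' x + bq q x *ᵥ y x = z • y x) :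
    IsDiracSol p z (fun x => pr₁ r (y x)) (fun x => pr₂ r (y x)) := by
  have h1 := hy.map ((pr₁ r).restrictScalars ℝ)
  have h2 := hy.map ((pr₂ r).restrictScalars ℝ)
  refine ⟨h1.continuousOn, h2.continuousOn, fun x hx => h1.eq_add_integral ?_ hx,
    fun x hx => h2.eq_add_integral ?_ hx⟩
  · filter_upwards [hq, he] with x hqx hex
    exact (pr₁_eq_iff hqx).1 (by simpa using congrArg (pr₁ r) hex)
  · filter_upwards [hq, he] with x hqx hex
    exact (pr₂_eq_iff hqx).1 (by simpa using congrArg (pr₂ r) hex)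

/-- Solutions of the first order system, as functions with values in vectors of length `2r`. -/
theorem IsDiracSol.exists_isW12 (hp : MemLp p 2 vol01) {z : ℂ} {y₁ y₂ : ℝ → EV r}
    (h : IsDiracSol p z y₁ y₂) : ∃ y', IsW12 (fun x => join r (y₁ x, y₂ x)) y' ∧
      ∀ᵐ x ∂vol01, theta r *ᵥ y' x + bq q x *ᵥ join r (y₁ x, y₂ x) = z • join r (y₁ x, y₂ x) := by
  let g₁ : ℝ → EV r := fun s => (Complex.I * z) • y₁ s + p s (y₂ s)
  let g₂ : ℝ → EV r := fun s => -(Complex.I * z) • y₂ s + adjoint (p s) (y₁ s)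
  have ev : ∀ P : ℝ → EV r →L[ℂ] EV r, MemLp P 2 vol01 → ∀ y : ℝ → EV r, ContinuousOn y (Icc 0 1) →
      MemLp (fun s => P s (y s)) 2 vol01 := fun P hP y hy =>
    memLp_bilin_continuousOn ((ContinuousLinearMap.apply ℂ (EV r)).flip.bilinearRestrictScalars ℝ)
      hP hy
  have hg₁ : MemLp g₁ 2 vol01 :=
    ((memLp_vol01_of_continuousOn h.cont₁).const_smul (Complex.I * z)).add (ev _ hp _ h.cont₂)
  have hg₂ : MemLp g₂ 2 vol01 :=
    ((memLp_vol01_of_continuousOn h.cont₂).const_smul (-(Complex.I * z))).add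
      (ev _ (memLp_adjoint hp) _ h.cont₁)
  have w₁ : IsW12 y₁ g₁ := ⟨hg₁, h.eq₁⟩
  have w₂ : IsW12 y₂ g₂ := ⟨hg₂, h.eq₂⟩
  have j₁ := w₁.map (((join r).comp (ContinuousLinearMap.inl ℂ (EV r) (EV r))).restrictScalars ℝ)
  have j₂ := w₂.map (((join r).comp (ContinuousLinearMap.inr ℂ (EV r) (EV r))).restrictScalars ℝ)
  have hj : ∀ a b : EV r, join r (a, b) = join r (a, 0) + join r (0, b) := fun a b => by
    rw [← map_add, Prod.mk_add_mk, add_zero, zero_add]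
  have j := j₁.add j₂
  refine ⟨fun x => join r (g₁ x, g₂ x), ?_, ?_⟩
  · have e₁ : (fun x => join r (y₁ x, y₂ x)) = fun x => join r (y₁ x, 0) + join r (0, y₂ x) :=
      funext fun x => hj _ _
    have e₂ : (fun x => join r (g₁ x, g₂ x)) = fun x => join r (g₁ x, 0) + join r (0, g₂ x) :=
      funext fun x => hj _ _
    rw [e₁, e₂]
    exact j
  · filter_upwards [hq] with x hqx
    refine pr_ext ?_ ?_
    · rw [map_add, map_smul, pr₁_eq_iff hqx, pr₁_join, pr₁_join, pr₂_join]
    · rw [map_add, map_smul, pr₂_eq_iff hqx, pr₁_join, pr₂_join, pr₂_join]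

end

end

/-! ### Fundamental solution, eigenvalues and the Weyl–Titchmarsh function. -/

section

open ContinuousLinearMap (adjoint)

variable {r : ℕ}

theorem theta_mul_theta : theta r * theta r = -1 := by
  simp [theta, Matrix.fromBlocks_multiply, Matrix.fromBlocks_one, smul_smul]

theorem memLp_bq {q : ℝ → Mat r} (hq : MemLp q 2 vol01) : MemLp (bq q) 2 vol01 := by
  let T : Mat r →ₗ[ℝ] Mat2 r :=
    { toFun := fun A => Matrix.fromBlocks 0 A Aᴴ 0
      map_add' := fun A B => by simp [Matrix.fromBlocks_add]
      map_smul' := fun c A => by simp [Matrix.fromBlocks_smul] }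
  exact (LinearMap.toContinuousLinearMap T).comp_memLp' hq

theorem exists_isFundamentalSolution {q : ℝ → Mat r} (hq : MemLp q 2 vol01) (z : ℂ) :
    ∃ u, IsFundamentalSolution q z u := by
  -- Since ϑ² = -1, the equation is u' = -ϑ(z - 𝐪)u.
  let B : ℝ → Mat2 r := fun s => -(theta r * (z • (1 : Mat2 r) - bq q s))
  have hB : MemLp B 2 vol01 := by
    have h1 : MemLp (fun s => z • (1 : Mat2 r) - bq q s) 2 vol01 :=
      (memLp_vol01_of_continuousOn continuousOn_const).sub (memLp_bq hq)
    exact ((ContinuousLinearMap.mul ℂ (Mat2 r) (theta r)).comp_memLp' h1).neg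
  have hA : MemLp (fun s => ContinuousLinearMap.mul ℝ (Mat2 r) (B s)) 2 vol01 :=
    (ContinuousLinearMap.mul ℝ (Mat2 r)).comp_memLp' hB
  obtain ⟨u, hu, hue⟩ := exists_linear_ode hA 1
  have hu0 : u 0 = 1 := by simpa using hue 0 (by simp)
  refine ⟨u, fun s => B s * u s, ⟨?_, fun x hx => ?_⟩, hu0, ae_of_all _ fun x => ?_⟩
  · exact memLp_bilin_continuousOn (ContinuousLinearMap.mul ℝ (Mat2 r)) hB hu.continuousOn
  · rw [hue x hx, hu0]
    rfl
  · simp only [B]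
    rw [← mul_assoc, mul_neg, ← mul_assoc, theta_mul_theta]
    simp [sub_mul]

theorem IsFundamentalSolution.isDiracSol {q : ℝ → Mat r} {p : ℝ → EV r →L[ℂ] EV r}
    (hq : ∀ᵐ x ∂vol01, op (q x) = Complex.I • p x) {z : ℂ} {u : ℝ → Mat2 r}
    (hu : IsFundamentalSolution q z u) (w : Fin r ⊕ Fin r → ℂ) :
    IsDiracSol p z (fun x => pr₁ r (u x *ᵥ w)) (fun x => pr₂ r (u x *ᵥ w)) := by
  obtain ⟨u', hu', -, he⟩ := hu
  let T : Mat2 r →ₗ[ℂ] (Fin r ⊕ Fin r → ℂ) :=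
    { toFun := fun A => A *ᵥ w
      map_add' := fun A B => Matrix.add_mulVec _ _ _
      map_smul' := fun c A => Matrix.smul_mulVec _ _ _ }
  refine isDiracSol_of_isW12 hq (hu'.map ((LinearMap.toContinuousLinearMap T).restrictScalars ℝ)) ?_
  filter_upwards [he] with x hx
  change theta r *ᵥ (u' x *ᵥ w) + bq q x *ᵥ (u x *ᵥ w) = z • (u x *ᵥ w)
  rw [Matrix.mulVec_mulVec, Matrix.mulVec_mulVec, ← Matrix.add_mulVec, hx, Matrix.smul_mulVec]

theorem vec_bdry_mulVec (w : Fin r ⊕ Fin r → ℂ) :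
    vec r (bdry r *ᵥ w) = ((1 / Real.sqrt 2 : ℝ) : ℂ) • (pr₁ r w - pr₂ r w) := by
  rw [pr₁_apply, pr₂_apply, ← map_sub, ← map_smul]
  congr 1
  rw [bdry, Matrix.smul_mulVec, Matrix.fromCols_mulVec, Matrix.one_mulVec, Matrix.neg_mulVec,
    Matrix.one_mulVec, sub_eq_add_neg]

theorem bdryH_mulVec (c : Fin r → ℂ) : (bdry r)ᴴ *ᵥ c =
    join r (((1 / Real.sqrt 2 : ℝ) : ℂ) • vec r c, -(((1 / Real.sqrt 2 : ℝ) : ℂ) • vec r c)) := by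
  have h : (bdry r)ᴴ = ((1 / Real.sqrt 2 : ℝ) : ℂ) • Matrix.fromRows 1 (-1) := by
    rw [bdry, Matrix.conjTranspose_smul, Matrix.conjTranspose_fromCols_eq_fromRows_conjTranspose]
    simp
  rw [h, Matrix.smul_mulVec, Matrix.fromRows_mulVec]
  ext (i | i)
  · simp [join, vec_apply]
  · simp [join, vec_apply, Matrix.neg_mulVec]

section

variable {D : SpecData (EV r)} {κ : DiffKernel (EV r)} (h : D.Represents κ) {q : ℝ → Mat r}
  (hq : ∀ᵐ x ∂vol01, op (q x) = Complex.I • κ.pot 1 x)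

include hq

theorem memLp_of_op_eq_pot (hκ : κ.Coercive) : MemLp q 2 vol01 :=
  Collection.memLp_op_iff.1 ((hκ.memLp_pot_vol01.const_smul Complex.I).ae_eq
    (by filter_upwards [hq] with x hx using hx.symm))

include h

/-- Off the λ_j the only solution of the boundary value problem is zero. Conversely φ(·, λ_j) α_j v
is an eigenfunction whenever α_j v ≠ 0, since its value at 0 is α_j v. -/
theorem setOf_isDiracEigenvalue (h0 : ∀ j, D.al j ≠ 0) :
    {z : ℂ | IsDiracEigenvalue q z} = range fun j => (D.lam j : ℂ) := by
  ext z
  constructor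
  · rintro ⟨y, hy0, y', hy, b0, b1, he⟩
    by_contra hz
    have hs := isDiracSol_of_isW12 hq hy (by filter_upwards [he] with x hx using hx.symm)
    have hz' : ∀ j, z ≠ D.lam j := fun j e => hz ⟨j, e.symm⟩
    have hb : ∀ x, (∀ i : Fin r, y x (Sum.inl i) = y x (Sum.inr i)) → pr₁ r (y x) = pr₂ r (y x) :=
      fun x hx => by rw [pr₁_apply, pr₂_apply]; congr 1; ext i; exact hx i
    have hv := h.eq_zero_of_isDiracSol hz' hs (hb 0 b0) (hb 1 b1)
    refine hy0 ?_
    have h01 : ∀ᵐ t ∂vol01, t ∈ Ioo (0 : ℝ) 1 := ae_restrict_mem measurableSet_Ioo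
    filter_upwards [h01] with x hx
    have := hv x (Ioo_subset_Icc_self hx)
    exact pr_ext (this.1.trans (map_zero _).symm) (this.2.trans (map_zero _).symm)
  · rintro ⟨j, rfl⟩
    obtain ⟨v, hv⟩ : ∃ v, D.al j v ≠ 0 := by
      by_contra hc
      push Not at hc
      exact h0 j (ContinuousLinearMap.ext hc)
    have hs := h.coercive.isDiracSol_phi (D.lam j) (D.al j v)
    obtain ⟨y', hy, he⟩ := hs.exists_isW12 hq h.coercive.memLp_pot_vol01
    refine ⟨_, fun hc => hv ?_, y', hy, fun i => ?_, fun i => ?_, ?_⟩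
    · have h1 := Measure.eqOn_Icc_of_ae_eq volume zero_ne_one
        (by rwa [← restrict_Ioo_eq_restrict_Icc]) hy.continuousOn continuousOn_const
      have h2 := congrArg (pr₁ r) (h1 (left_mem_Icc.2 zero_le_one))
      rw [pr₁_join] at h2
      exact (DiffKernel.phi_zero κ _ _).symm.trans (h2.trans (map_zero _))
    · simp [join, DiffKernel.phi_zero]
    · simp [join, h.phi_one]
    · filter_upwards [he] with x hx using hx.symm

/-- A vector c in the kernel of s(z) makes u ϑ a^* c a solution satisfying both boundary conditions,
which vanishes when z is not one of the λ_j. -/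
theorem isUnit_boundary {z : ℂ} (hz : ∀ j, z ≠ D.lam j) {u : ℝ → Mat2 r}
    (hu : IsFundamentalSolution q z u) :
    IsUnit (bdry r * (u 1 * (theta r * (bdry r)ᴴ))).det := by
  rw [isUnit_iff_ne_zero]
  intro hd
  obtain ⟨c, hc, hc0⟩ := Matrix.exists_mulVec_eq_zero_iff.2 hd
  refine hc ?_
  set w := theta r *ᵥ ((bdry r)ᴴ *ᵥ c) with hw
  have hu0 : u 0 *ᵥ w = w := by rw [hu.choose_spec.2.1, Matrix.one_mulVec]
  have h1 := congrArg (vec r) hc0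
  rw [← Matrix.mulVec_mulVec, ← Matrix.mulVec_mulVec, ← Matrix.mulVec_mulVec, vec_bdry_mulVec,
    map_zero, smul_eq_zero_iff_right (by simp), sub_eq_zero] at h1
  have p1 : pr₁ r w = pr₂ r w := by
    rw [hw, pr₁_theta, pr₂_theta, bdryH_mulVec, pr₁_join, pr₂_join, smul_neg]
  have := h.eq_zero_of_isDiracSol hz (hu.isDiracSol hq w) (by simpa only [hu0] using p1) h1 0
    (by simp)
  rw [hu0] at this
  have h2 := this.2
  rw [hw, pr₂_theta, bdryH_mulVec, pr₂_join, smul_eq_zero_iff_right (by simp), neg_eq_zero,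
    smul_eq_zero_iff_right (by simp)] at h2
  exact (vec r).map_eq_zero_iff.1 h2

/-- The Weyl solutions are expressed by the Weyl-Titchmarsh function. -/
theorem isWeyl_of_isWeylTitchmarsh {m : ℂ → Mat r} (hm : IsWeylTitchmarsh q m) :
    D.IsWeyl κ fun z => op (m z) := by
  obtain ⟨u, hu, hmu⟩ := hm
  intro z hz b
  obtain ⟨b, rfl⟩ := (vec r).surjective b
  -- With this initial value a·u(1)w = √2 (c(z) + s(z)m(z)) b = 0, and √2 cancels the normalization
  -- of a.
  set w := ((Real.sqrt 2 : ℝ) : ℂ) • ((bdry r)ᴴ *ᵥ b + theta r *ᵥ ((bdry r)ᴴ *ᵥ (m z *ᵥ b))) with hw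
  have hu0 : u z 0 *ᵥ w = w := by rw [(hu z).choose_spec.2.1, Matrix.one_mulVec]
  have h2 : ((Real.sqrt 2 : ℝ) : ℂ) * ((1 / Real.sqrt 2 : ℝ) : ℂ) = 1 := by
    rw [← Complex.ofReal_mul, mul_one_div, div_self (by simp), Complex.ofReal_one]
  have hS := isUnit_boundary h hq hz (hu z)
  have hk : bdry r *ᵥ (u z 1 *ᵥ w) = 0 := by
    rw [hw, Matrix.mulVec_smul, Matrix.mulVec_smul, Matrix.mulVec_add, Matrix.mulVec_add]
    simp only [Matrix.mulVec_mulVec]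
    rw [← Matrix.add_mulVec, hmu z]
    simp only [Matrix.mul_neg]
    have e : bdry r * (u z 1 * (theta r * ((bdry r)ᴴ * ((bdry r * (u z 1 * (theta r *
        (bdry r)ᴴ)))⁻¹ *
        (bdry r * (u z 1 * (bdry r)ᴴ)))))) = bdry r * (u z 1 * (bdry r)ᴴ) := by
      have := Matrix.mul_nonsing_inv_cancel_left (bdry r * (u z 1 * (theta r * (bdry r)ᴴ)))
        (bdry r * (u z 1 * (bdry r)ᴴ)) hS
      simpa only [Matrix.mul_assoc] using this
    rw [e, add_neg_cancel, Matrix.zero_mulVec, smul_zero]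
  refine ⟨_, _, (hu z).isDiracSol hq w, ?_, ?_, ?_⟩
  · have h1 := congrArg (vec r) hk
    rwa [vec_bdry_mulVec, map_zero, smul_eq_zero_iff_right (by simp), sub_eq_zero] at h1
  · rw [hu0, hw, map_smul, map_add, pr₁_theta, bdryH_mulVec, bdryH_mulVec, pr₁_join, pr₁_join,
      op_vec, smul_add, smul_neg, smul_smul, h2, one_smul, smul_comm Complex.I, smul_smul, h2,
      one_smul, sub_eq_add_neg]
  · rw [hu0, hw, map_smul, map_add, pr₂_theta, bdryH_mulVec, bdryH_mulVec, pr₂_join, pr₂_join,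
      op_vec, smul_add, smul_neg, smul_smul, h2, one_smul, smul_neg, smul_neg,
      smul_comm Complex.I, smul_smul, h2, one_smul, sub_eq_add_neg]

end

end

/-! ### Residues and the spectral data. -/

section

open ContinuousLinearMap (adjoint)

variable {r : ℕ}

theorem hasResidueAt_of_eqOn {m G : ℂ → Mat r} {c : ℂ} {A : Mat r} {ρ : ℝ} (hρ : 0 < ρ)
    (hG : DifferentiableOn ℂ G (Metric.ball c ρ))
    (h : ∀ z ∈ Metric.ball c ρ \ {c}, m z = (z - c)⁻¹ • A + G z) : HasResidueAt m c A := by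
  refine ⟨ρ, hρ, ?_, fun ε hε => ?_⟩
  · refine DifferentiableOn.congr (f := fun z => (z - c)⁻¹ • A + G z) ?_ h
    refine DifferentiableOn.add (DifferentiableOn.smul_const ?_ _) (hG.mono sdiff_subset)
    exact DifferentiableOn.inv (by fun_prop) fun z hz => sub_ne_zero.2 hz.2
  · have hne : ∀ z ∈ Metric.sphere c ε, z - c ≠ 0 := fun z hz e => by
      rw [mem_sphere_iff_norm, e, norm_zero] at hz
      exact hε.1.ne hz
    have hsub : Metric.closedBall c ε ⊆ Metric.ball c ρ := Metric.closedBall_subset_ball hε.2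
    have h1 : ∮ z in C(c, ε), m z = ∮ z in C(c, ε), ((z - c)⁻¹ • A + G z) :=
      circleIntegral.integral_congr hε.1.le fun z hz =>
        h z ⟨hsub (Metric.sphere_subset_closedBall hz), fun e => hne z hz (sub_eq_zero.2 e)⟩
    have i1 : CircleIntegrable (fun z => (z - c)⁻¹ • A) c ε :=
      ContinuousOn.circleIntegrable hε.1.le (ContinuousOn.smul
        (ContinuousOn.inv₀ (by fun_prop) hne) continuousOn_const)
    have i2 : CircleIntegrable G c ε := ContinuousOn.circleIntegrable hε.1.le
      (hG.continuousOn.mono (Metric.sphere_subset_closedBall.trans hsub))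
    have h2 : ∮ z in C(c, ε), G z = 0 :=
      Complex.circleIntegral_eq_zero_of_differentiable_on_off_countable hε.1.le countable_empty
        (hG.continuousOn.mono hsub) fun z hz => hG.differentiableAt
          (Metric.isOpen_ball.mem_nhds (hsub (Metric.ball_subset_closedBall hz.1)))
    rw [h1, circleIntegral.integral_add i1 i2, h2, add_zero, circleIntegral.integral_smul_const,
      circleIntegral.integral_sub_center_inv _ hε.1.ne']

theorem SpecData.Represents.hasResidueAt {D : SpecData (EV r)} {κ : DiffKernel (EV r)}
    (h : D.Represents κ)
    {m : ℂ → Mat r} (hm : D.IsWeyl κ fun z => op (m z)) {k : ℤ} {A : Mat r} (hA : D.al k = op A) :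
    HasResidueAt m (D.lam k) (-A) := by
  obtain ⟨ρ, hρ, hG⟩ := h.weyl_polar hm k
  have hG' : ∀ i j : Fin r, ∃ G : ℂ → ℂ, DifferentiableOn ℂ G (Metric.ball (D.lam k : ℂ) ρ) ∧
      ∀ z ∈ Metric.ball (D.lam k : ℂ) ρ \ {(D.lam k : ℂ)},
        m z i j = -((z - D.lam k)⁻¹ * A i j) + G z := fun i j => by
    obtain ⟨G, h1, h2⟩ := hG (EuclideanSpace.single i 1) (EuclideanSpace.single j 1)
    refine ⟨G, h1, fun z hz => ?_⟩
    have := h2 z hz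
    rwa [hA, inner_op_single, inner_op_single] at this
  choose G h1 h2 using hG'
  refine hasResidueAt_of_eqOn (G := fun z => ∑ i, ∑ j, G i j z • Matrix.single i j (1 : ℂ)) hρ
    (DifferentiableOn.fun_sum fun i _ => DifferentiableOn.fun_sum fun j _ => (h1 i j).smul_const _)
    fun z hz => ?_
  ext i j
  rw [h2 i j z hz, Matrix.add_apply, Matrix.smul_apply, Matrix.neg_apply, smul_neg, smul_eq_mul]
  congr 1
  have := congrFun (congrFun (Matrix.matrix_eq_sum_single (Matrix.of fun i j => G i j z)) i) j
  simpa [Matrix.smul_single] using this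

theorem Collection.isSpectralData (a : Collection r) (h1 : a.A1) (h2 : a.A2) (h3 : a.A3)
    {κ : DiffKernel (EV r)} (h : (a.specData h1 h2 h3).Represents κ) {q : ℝ → Mat r}
    (hq : ∀ᵐ x ∂vol01, op (q x) = Complex.I • κ.pot 1 x) : IsSpectralData q a := by
  refine ⟨setOf_isDiracEigenvalue h hq fun j e => a.alpha_ne_zero j
    (op.injective (e.trans (map_zero op).symm)), ?_⟩
  choose u hu using fun z => exists_isFundamentalSolution (memLp_of_op_eq_pot hq h.coercive) z
  have hm : IsWeylTitchmarsh q fun z => -((bdry r * (u z 1 * (theta r * (bdry r)ᴴ)))⁻¹ *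
      (bdry r * (u z 1 * (bdry r)ᴴ))) := ⟨u, hu, fun z => rfl⟩
  exact ⟨_, hm, fun j => h.hasResidueAt (k := j) (isWeyl_of_isWeylTitchmarsh h hq hm) rfl⟩

end

end Dirac

end

theorem theorem9 {r : ℕ} (a : Dirac.Collection r) (h1 : a.A1) (h2 : a.A2) (h3 : a.A3) :
    (∃ H : ℝ → Dirac.Mat r, a.IsHmu H) ∧
    ∀ H : ℝ → Dirac.Mat r, a.IsHmu H →
      Dirac.IsSymmAccelerant H ∧
      (∃ q : ℝ → Dirac.Mat r, Dirac.IsTheta H q) ∧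
      (∀ q q' : ℝ → Dirac.Mat r,
        Dirac.IsTheta H q → Dirac.IsTheta H q' → q =ᵐ[Dirac.vol01] q') ∧
      ∀ q : ℝ → Dirac.Mat r, Dirac.IsTheta H q →
        Dirac.IsPotential q ∧ Dirac.IsSpectralData q a := by
  refine ⟨Dirac.Collection.exists_isHmu h1 h2 h3, fun H hH => ?_⟩
  obtain ⟨hm, ht⟩ := (Dirac.Collection.isHmu_iff h1 h2 h3 H).1 hH
  obtain ⟨κ, hr, hacc⟩ := (a.specData h1 h2 h3).exists_represents hm ht
  have hκ := hr.coercive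
  have hacc' : ∀ᵐ x ∂Dirac.vol11, Dirac.op (H x) = κ.acc x := hacc
  refine ⟨⟨Dirac.isAccelerant_of_acc hκ hacc' hH.1, ?_⟩, Dirac.exists_isTheta hκ hacc',
    fun q q' hq hq' => Dirac.isTheta_unique hκ hacc' hq hq', fun q hq => ?_⟩
  · filter_upwards [(a.specData h1 h2 h3).adjoint_ae hm ht] with x hx
    rw [Dirac.adjoint_op] at hx
    exact Dirac.op.injective hx
  · have hqe := Dirac.op_isTheta hκ hacc' hq
    exact ⟨Dirac.memLp_of_op_eq_pot hqe hκ, a.isSpectralData h1 h2 h3 hr hqe⟩
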